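/- Let $k$ be a function field of one variable with exact field of constants $\mathbb F_q$, $q$ odd, with places $v$, completions $k_v\supset\mathcal O_v$ and adele ring $\mathbb A$. For a function field $K$ over a finite field put $\mathfrak C_K=h_K/(q_K-1)$, where $h_K$ is the order of the group of divisor classes of degree zero and $q_K$ the order of the field of constants of $K$ (so $q_k=q$). Let $V$ be the space of binary quadratic forms $F_x(z_1,z_2)=x_0z_1^2+x_1z_1z_2+x_2z_2^2$, on which $G=GL(1)\times GL(2)$ acts by $F_{g\cdot x}(z_1,z_2)=tF_x(az_1+cz_2,bz_1+dz_2)$ for $g=\left(t,\begin{pmatrix}a&b\\c&d\end{pmatrix}\right)$. Let $\varrho:G\to GL(V)$ be this representation, $T=\{(t^2,t^{-1}I_2)\}\cong GL(1)$ its kernel and $H=\operatorname{Im}\varrho$; let $G_x,H_x$ be the stabilizers of $x$ and $G_x^\circ,H_x^\circ$ their identity components. Let $x\in V_k''$, i.e. $x\in V_k$, $x_1^2-4x_0x_2\ne0$ and the splitting field $k(x)$ of $F_x$ over $k$ has degree $2$ over $k$. For each place $v$ the action on the linear factors of $F_x$ gives an isomorphism of $(G_x^\circ)_{k_v}$ with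 $k_v^\times\times k_v^\times$ if $F_x$ splits over $k_v$, and with $k_v(x)^\times$ otherwise. Let $dg''_{x,v}$ be the Haar measure on $(G_x^\circ)_{k_v}$ that gives volume $1$ to the subgroup corresponding to $\mathcal O_v^\times\times\mathcal O_v^\times$, respectively $\mathcal O_{k_v(x)}^\times$; let $d^\times t_v$ be the Haar measure on $T_{k_v}\cong k_v^\times$ with $\int_{\mathcal O_v^\times}d^\times t_v=1$; let $dh''_{x,v}$ be the measure on $(H_x^\circ)_{k_v}\cong(G_x^\circ)_{k_v}/T_{k_v}$ with $dg''_{x,v}=dh''_{x,v}\,d^\times t_v$; and let $dh''_x=\prod_v dh''_{x,v}$ on $(H_x^\circ)_{\mathbb A}$. Give $X=(H_x^\circ)_{\mathbb A}/(H_x^\circ)_k$ the measure, again written $dh''_x$, for which $\int_{(H_x^\circ)_{\mathbb A}}f(h)\,dh''_x=\int_X\sum_{\gamma\in(H_x^\circ)_k}f(h\gamma)\,dh''_x$. Then $$\int_{(H_x^\circ)_{\mathbb A}/(H_x^\circ)_k}dh''_x=\begin{cases}2\,\mathfrak C_{k(x)}/\mathfrak C_k&\text{if }k(x)\text{ has field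 of constants }\mathbb F_q,\\ \mathfrak C_{k(x)}/\mathfrak C_k&\text{if }k(x)=k\otimes_{\mathbb F_q}\mathbb F_{q^2}.\end{cases}$$ -/

import Mathlib

open MeasureTheory Filter
open scoped RestrictedProduct ENNReal Matrix

namespace BinQuad

noncomputable section

/-! ### Binary quadratic forms and the prehomogeneous representation -/

section Forms

variable (R : Type*) [CommRing R]

/-- The `R`-points of the space of binary quadratic forms; `x = (x₀, x₁, x₂)` is the form
`x₀ z₁² + x₁ z₁ z₂ + x₂ z₂²`. -/
abbrev V := Fin 3 → R

/-- The `R`-points of `G = GL(1) × GL(2)`. -/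
abbrev G := Rˣ × GL (Fin 2) R

variable {R}

/-- The value `F_x(z₁, z₂)`. -/
def V.form (x : V R) (z₁ z₂ : R) : R := x 0 * z₁ ^ 2 + x 1 * z₁ * z₂ + x 2 * z₂ ^ 2

/-- The discriminant `P(x)`. -/
def V.disc (x : V R) : R := x 1 ^ 2 - 4 * x 0 * x 2

/-- Base change of forms. -/
def V.map {S : Type*} [CommRing S] (f : R →+* S) (x : V R) : V S := fun i => f (x i)

/-- The matrix of the change of variables `F_x(z₁, z₂) ↦ F_x(a z₁ + c z₂, b z₁ + d z₂)`
for `m = (a b; c d)`. -/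
def symSq (m : Matrix (Fin 2) (Fin 2) R) : Matrix (Fin 3) (Fin 3) R :=
  !![m 0 0 ^ 2, m 0 0 * m 0 1, m 0 1 ^ 2;
     2 * m 0 0 * m 1 0, m 0 0 * m 1 1 + m 0 1 * m 1 0, 2 * m 0 1 * m 1 1;
     m 1 0 ^ 2, m 1 0 * m 1 1, m 1 1 ^ 2]

theorem symSq_one : symSq (1 : Matrix (Fin 2) (Fin 2) R) = 1 := by
  ext i j
  fin_cases i <;> fin_cases j <;> simp [symSq]

theorem symSq_mul (m n : Matrix (Fin 2) (Fin 2) R) : symSq (m * n) = symSq m * symSq n := by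
  ext i j
  fin_cases i <;> fin_cases j <;>
    simp [symSq, Matrix.mul_apply, Fin.sum_univ_succ] <;> ring

/-- The representation of `G` on `V`, on `R`-points. -/
def rho : G R →* GL (Fin 3) R :=
  Units.map
      { toFun := fun p : R × Matrix (Fin 2) (Fin 2) R => p.1 • symSq p.2
        map_one' := by simp [symSq_one]
        map_mul' := fun p q => by
          rw [Prod.fst_mul, Prod.snd_mul, symSq_mul, smul_mul_smul_comm] } |>.comp
    (MulEquiv.prodUnits.symm : G R ≃* (R × Matrix (Fin 2) (Fin 2) R)ˣ).toMonoidHom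

theorem coe_rho (g : G R) :
    (rho g : Matrix (Fin 3) (Fin 3) R) = (g.1 : R) • symSq (g.2 : Matrix (Fin 2) (Fin 2) R) :=
  rfl

/-- `F_{g x}(z₁, z₂) = t F_x(a z₁ + c z₂, b z₁ + d z₂)` for `g = (t, (a b; c d))`. -/
theorem form_rho (g : G R) (x : V R) (z₁ z₂ : R) :
    V.form ((rho g : Matrix (Fin 3) (Fin 3) R) *ᵥ x) z₁ z₂ =
      (g.1 : R) * V.form x ((g.2 : Matrix (Fin 2) (Fin 2) R) 0 0 * z₁ + g.2.1 1 0 * z₂)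
        (g.2.1 0 1 * z₁ + g.2.1 1 1 * z₂) := by
  simp [coe_rho, V.form, symSq, Matrix.mulVec, dotProduct, Fin.sum_univ_succ]
  ring

/-- The stabilizer of `x` in `GL(V)`. -/
def stabGL (x : V R) : Subgroup (GL (Fin 3) R) where
  carrier := {h | (h : Matrix (Fin 3) (Fin 3) R) *ᵥ x = x}
  one_mem' := by simp
  mul_mem' := fun {a b} ha hb => by
    change _ *ᵥ x = x at ha hb ⊢
    rw [Units.val_mul, ← Matrix.mulVec_mulVec, hb, ha]
  inv_mem' := fun {a} ha => by
    change _ *ᵥ x = x at ha ⊢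
    conv_lhs => rw [← ha]
    rw [Matrix.mulVec_mulVec, ← Units.val_mul, inv_mul_cancel, Units.val_one, Matrix.one_mulVec]

/-- The stabilizer `G_x` on `R`-points. -/
def stabG (x : V R) : Subgroup (G R) := (stabGL x).comap rho

/-- The stabilizer of `x` in the image of `ϱ` on `R`-points. Used only for algebraically closed
fields `R`, where this is the stabilizer `H_x` in the algebraic group `H = Im ϱ`. -/
def stabH (x : V R) : Subgroup (GL (Fin 3) R) := rho.range ⊓ stabGL x

/-- The embedding `t ↦ (t², t⁻¹)` of `GL(1)` onto the kernel `T_ϱ` of `ϱ`. -/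
def torus (t : Rˣ) : G R := (t ^ 2, Units.map (Matrix.scalar (Fin 2)).toMonoidHom t⁻¹)

/-- Base change `G_R → G_S`. -/
def G.map {S : Type*} [CommRing S] (f : R →+* S) : G R →* G S :=
  MonoidHom.prodMap (Units.map f.toMonoidHom) (Matrix.GeneralLinearGroup.map f)

end Forms

/-! ### Identity components -/

section Component

/-- The Zariski topology on a group `𝒢` of points over a field `F`, where `c : 𝒢 → F^σ` are
coordinates identifying `𝒢` with a locally closed subset of affine space. -/
@[reducible] def zariski {F σ 𝒢 : Type*} [Field F] (c : 𝒢 → σ → F) : TopologicalSpace 𝒢 :=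
  TopologicalSpace.induced
    (fun g => (MvPolynomial.pointToPoint (c g) : PrimeSpectrum (MvPolynomial σ F))) inferInstance

theorem continuous_zariski {F σ 𝒢 : Type*} [Field F] (c : 𝒢 → σ → F) (φ : 𝒢 → 𝒢)
    (q : σ → MvPolynomial σ F) (h : ∀ g i, c (φ g) i = MvPolynomial.eval (c g) (q i)) :
    @Continuous _ _ (zariski c) (zariski c) φ := by
  let _ := zariski c
  refine continuous_induced_rng.2 ?_
  have : (fun g => (MvPolynomial.pointToPoint (c g) : PrimeSpectrum (MvPolynomial σ F))) ∘ φ =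
      PrimeSpectrum.comap (MvPolynomial.bind₁ q).toRingHom ∘
      (fun g => (MvPolynomial.pointToPoint (c g) : PrimeSpectrum (MvPolynomial σ F))) := by
    funext g
    apply PrimeSpectrum.ext
    ext p
    have hc : c (φ g) = fun i => MvPolynomial.eval (c g) (q i) := funext (h g)
    have he : MvPolynomial.aeval (c (φ g)) p =
        MvPolynomial.aeval (c g) (MvPolynomial.bind₁ q p) := by
      rw [MvPolynomial.aeval_bind₁, hc]
      rfl
    have he' : MvPolynomial.eval (c (φ g)) p =
        MvPolynomial.eval (c g) (MvPolynomial.bind₁ q p) := he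
    simp [MvPolynomial.pointToPoint, he']
  rw [this]
  exact (PrimeSpectrum.continuous_comap _).comp continuous_induced_dom

theorem mul_mem_component {𝒢 : Type*} [Group 𝒢] (τ : TopologicalSpace 𝒢)
    (hτ : ∀ a : 𝒢, @Continuous _ _ τ τ (fun g => a * g)) (S : Subgroup 𝒢) (a : 𝒢) (ha : a ∈ S)
    (h : ∃ b ∈ connectedComponentIn (S : Set 𝒢) 1, a * b ∈ connectedComponentIn (S : Set 𝒢) 1)
    (b : 𝒢) (hb : b ∈ connectedComponentIn (S : Set 𝒢) 1) :
    a * b ∈ connectedComponentIn (S : Set 𝒢) 1 := by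
  obtain ⟨b₀, hb₀, hab₀⟩ := h
  have hpre : IsPreconnected ((fun g => a * g) '' connectedComponentIn (S : Set 𝒢) 1) :=
    isPreconnected_connectedComponentIn.image _ (hτ a).continuousOn
  have hsub : ((fun g => a * g) '' connectedComponentIn (S : Set 𝒢) 1) ⊆ (S : Set 𝒢) := by
    rintro _ ⟨c, hc, rfl⟩
    exact S.mul_mem ha (connectedComponentIn_subset _ _ hc)
  have := hpre.subset_connectedComponentIn ⟨b₀, hb₀, rfl⟩ hsub
  rw [← connectedComponentIn_eq hab₀] at this
  exact this ⟨b, hb, rfl⟩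

/-- The connected component of `1` in a subgroup `S` of `𝒢`, for a topology on `𝒢` for which the
left translations are continuous. -/
def component {𝒢 : Type*} [Group 𝒢] (τ : TopologicalSpace 𝒢)
    (hτ : ∀ a : 𝒢, @Continuous _ _ τ τ (fun g => a * g)) (S : Subgroup 𝒢) : Subgroup 𝒢 where
  carrier := connectedComponentIn (S : Set 𝒢) 1
  one_mem' := mem_connectedComponentIn S.one_mem
  mul_mem' := fun {a b} ha hb =>
    mul_mem_component τ hτ S a (connectedComponentIn_subset _ _ ha)
      ⟨1, mem_connectedComponentIn S.one_mem, by simpa using ha⟩ b hb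
  inv_mem' := fun {a} ha => by
    have h1 : (1 : 𝒢) ∈ connectedComponentIn (S : Set 𝒢) 1 := mem_connectedComponentIn S.one_mem
    have := mul_mem_component τ hτ S a⁻¹ (S.inv_mem (connectedComponentIn_subset _ _ ha))
      ⟨a, ha, by simpa using h1⟩ 1 h1
    simpa using this

variable {F : Type*} [Field F]

/-- The nine matrix entries as coordinates on `GL(3)`. -/
def coordGL (h : GL (Fin 3) F) : Fin 3 × Fin 3 → F := fun p => h.1 p.1 p.2

/-- The scalar and the four matrix entries as coordinates on `GL(1) × GL(2)`. -/
def coordG (g : G F) : Option (Fin 2 × Fin 2) → F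
  | none => g.1
  | some p => g.2.1 p.1 p.2

theorem continuous_left_GL (a : GL (Fin 3) F) :
    @Continuous _ _ (zariski coordGL) (zariski coordGL) (fun g => a * g) :=
  continuous_zariski _ _
    (fun p => ∑ j, MvPolynomial.C (a.1 p.1 j) * MvPolynomial.X (j, p.2)) fun g i => by
      simp [coordGL, Matrix.mul_apply]

theorem continuous_left_G (a : G F) :
    @Continuous _ _ (zariski coordG) (zariski coordG) (fun g => a * g) :=
  continuous_zariski _ _
    (fun o => match o with
      | none => MvPolynomial.C (a.1 : F) * MvPolynomial.X none
      | some p => ∑ j, MvPolynomial.C (a.2.1 p.1 j) * MvPolynomial.X (some (j, p.2)))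
    fun g i => by
      cases i <;> simp [coordG, Matrix.mul_apply]

variable {K : Type*} [Field K]

/-- `(G_x°)_K`: the `K`-rational points of the identity component of the stabilizer `G_x`. -/
def stabG0 (x : V K) : Subgroup (G K) :=
  (component (zariski coordG) continuous_left_G
    (stabG (x.map (algebraMap K (AlgebraicClosure K))))).comap
      (G.map (algebraMap K (AlgebraicClosure K)))

/-- `(H_x°)_K`: the `K`-rational points of the identity component of the stabilizer `H_x` of `x`
in the algebraic group `H = Im ϱ ⊆ GL(V)`. -/
def stabH0 (x : V K) : Subgroup (GL (Fin 3) K) :=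
  (component (zariski coordGL) continuous_left_GL
    (stabH (x.map (algebraMap K (AlgebraicClosure K))))).comap
      (Matrix.GeneralLinearGroup.map (algebraMap K (AlgebraicClosure K)))

end Component

/-! ### Splitting fields -/

/-- The dehomogenized form `F_x(X, 1)`. -/
def V.poly {K : Type*} [Field K] (x : V K) : Polynomial K :=
  Polynomial.C (x 0) * Polynomial.X ^ 2 + Polynomial.C (x 1) * Polynomial.X + Polynomial.C (x 2)

/-- The splitting field `K(x)` of the form `F_x` over `K`. -/
abbrev V.field {K : Type*} [Field K] (x : V K) : Type _ := x.poly.SplittingField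

/-- The set of non-singular forms whose splitting field is quadratic. -/
def V'' (K : Type*) [Field K] : Set (V K) :=
  {x | x.disc ≠ 0 ∧ Module.finrank K x.field = 2}

/-! ### Places, completions, adeles, divisors -/

section Places

variable (K : Type*) [Field K]

/-- The places of a function field of one variable over a finite field: its non-trivial valuation
rings. (Elements of a finite constant field lie in every valuation ring.) -/
def Place := {A : ValuationSubring K // A ≠ ⊤}

variable {K}

/-- The completion `K_v`. -/
def Place.Compl (v : Place K) : Type _ := v.1.valuation.Completion

instance (v : Place K) : Field v.Compl := inferInstanceAs (Field v.1.valuation.Completion)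

instance (v : Place K) : Valued v.Compl v.1.ValueGroup :=
  inferInstanceAs (Valued v.1.valuation.Completion v.1.ValueGroup)

/-- The ring of integers `𝒪_v` of `K_v`. -/
abbrev Place.integers (v : Place K) : Subring v.Compl :=
  (Valued.v : Valuation v.Compl v.1.ValueGroup).integer

/-- The embedding `K → K_v`. -/
def Place.emb (v : Place K) : K →+* v.Compl :=
  (UniformSpace.Completion.coeRingHom (α := WithVal v.1.valuation) :
    WithVal v.1.valuation →+* v.1.valuation.Completion).comp
    (WithVal.equiv v.1.valuation).symm.toRingHom

variable (K)

/-- The ring of adeles of `K`, with its restricted product topology. -/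
abbrev Adele : Type _ := Πʳ v : Place K, [v.Compl, v.integers]

/-- The divisor group. -/
abbrev Divisor := Place K →₀ ℤ

variable {K}

/-- `q_v`, the cardinality of the residue field. -/
def Place.card (v : Place K) : ℕ := Nat.card (IsLocalRing.ResidueField v.1)

variable (Fq : Type*) [Field Fq] (K) [Algebra Fq K]

/-- The order of the field of constants of `K`, the algebraic closure of `Fq` in `K`. -/
def constCard : ℕ := Nat.card (algebraicClosure Fq K)

/-- The degree of a divisor over the field of constants; the degree `d` of a place is given
by `q_v = q ^ d`. -/
def degree : Divisor K →+ ℤ :=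
  Finsupp.liftAddHom fun v => AddMonoidHom.mulRight (Nat.log (constCard K Fq) v.card : ℤ)

/-- The principal divisors: `D = div f` iff `v(f) = v(ϖ_v) ^ D(v)` for every place `v` and every
uniformizer `ϖ_v` at `v`. -/
def principal : AddSubgroup (Divisor K) where
  carrier := {D | ∃ f : Kˣ, ∀ (v : Place K) (ϖ : v.1), Irreducible ϖ →
    v.1.valuation (f : K) = v.1.valuation (ϖ : K) ^ D v}
  zero_mem' := ⟨1, fun v ϖ _ => by simp⟩
  add_mem' := by
    rintro D E ⟨f, hf⟩ ⟨g, hg⟩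
    refine ⟨f * g, fun v ϖ h => ?_⟩
    have h0 : v.1.valuation (ϖ : K) ≠ 0 := by
      rw [Valuation.ne_zero_iff]
      exact fun h' => h.ne_zero (Subtype.ext h')
    rw [Units.val_mul, map_mul, hf v ϖ h, hg v ϖ h, Finsupp.add_apply, zpow_add₀ h0]
  neg_mem' := by
    rintro D ⟨f, hf⟩
    refine ⟨f⁻¹, fun v ϖ h => ?_⟩
    rw [Units.val_inv_eq_inv_val, map_inv₀, hf v ϖ h, Finsupp.neg_apply, zpow_neg]

/-- The order `h_K` of the degree zero divisor class group. -/
def classNumber : ℕ :=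
  Nat.card ((degree K Fq).ker ⧸ (principal K).addSubgroupOf (degree K Fq).ker)

/-- The constant `ℭ_K = h_K / (q_K - 1)`. -/
def constC : ℝ := classNumber K Fq / (constCard K Fq - 1)

end Places

/-! ### Measures -/

section Measures

/-- The unique measure with the property `Q` (and `0` if there is no such measure). -/
def theMeasure {α : Type*} [MeasurableSpace α] (Q : Measure α → Prop) : Measure α := by
  classical exact if h : ∃! μ, Q μ then h.choose else 0

variable {K : Type*} [Field K]

/-- `K_v^×` with its Borel structure. -/
instance instMeasurableUnits (v : Place K) : MeasurableSpace v.Complˣ := borel _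

/-- `G_{K_v}` with its Borel structure. -/
instance instMeasurableG (v : Place K) : MeasurableSpace (G v.Compl) := borel _

/-- `GL(V)_{K_v}` with its Borel structure. -/
instance instMeasurableGL (v : Place K) : MeasurableSpace (GL (Fin 3) v.Compl) := borel _

/-- `GL(V)_𝔸` with its Borel structure. -/
instance instMeasurableAdelicGL : MeasurableSpace (GL (Fin 3) (Adele K)) := borel _

/-- `d^×t_v`: the Haar measure on `K_v^×` for which `𝒪_v^×` has volume one. -/
def unitMeasure (v : Place K) : Measure v.Complˣ :=
  theMeasure fun μ => μ.IsHaarMeasure ∧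
    μ {u | (u : v.Compl) ∈ v.integers ∧ ((u⁻¹ : v.Complˣ) : v.Compl) ∈ v.integers} = 1

variable (x : V K)

/-- `x` as a form over `K_v`. -/
abbrev V.at (v : Place K) : V v.Compl := x.map v.emb

/-- The preimage in `(G_x°)_{K_v}` of `𝒪_v^× × 𝒪_v^×` (if `F_x` splits over `K_v`), respectively
of the units of the ring of integers of `K_v(x)` (otherwise), under the isomorphisms
`(G_x°)_{K_v} ≅ K_v^× × K_v^×`, respectively `(G_x°)_{K_v} ≅ K_v(x)^×`. Here `g = (t, m)` is sent
to the scalars by which `m` acts on the linear factors `l₁ z₁ + l₂ z₂` of `F_x` over `K_v(x)`. -/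
def unitsG (v : Place K) : Set (stabG0 (x.at v)) :=
  {g | ∀ l l' : Fin 2 → (x.at v).field,
    (∀ i, algebraMap v.Compl (x.at v).field (x.at v i) =
      ![l 0 * l' 0, l 0 * l' 1 + l 1 * l' 0, l 1 * l' 1] i) →
    ∃ lam : ((x.at v).field)ˣ,
      ((g : G v.Compl).2.1.map (algebraMap v.Compl (x.at v).field)) *ᵥ l =
        (lam : (x.at v).field) • l ∧
      IsIntegral v.integers (lam : (x.at v).field) ∧
      IsIntegral v.integers ((lam⁻¹ : ((x.at v).field)ˣ) : (x.at v).field)}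

/-- `dg''_{x,v}`: the Haar measure on `(G_x°)_{K_v}` transported from the Haar measure on
`K_v^× × K_v^×`, respectively on `K_v(x)^×`, for which the group of integral units has volume
one. -/
def measureG (v : Place K) : Measure (stabG0 (x.at v)) :=
  theMeasure fun μ => μ.IsHaarMeasure ∧ μ (unitsG x v) = 1

/-- `dh''_{x,v}`: the measure on `(H_x°)_{K_v} ≅ (G_x°)_{K_v} / (T_ϱ)_{K_v}` such that
`dg''_{x,v} = dh''_{x,v} d^×t_v`. -/
def measureH (v : Place K) : Measure (stabH0 (x.at v)) :=
  theMeasure fun η => ∀ (f : G v.Compl → ℝ≥0∞) (φ : GL (Fin 3) v.Compl → ℝ≥0∞),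
    Measurable f → Measurable φ →
    (∀ g ∈ stabG0 (x.at v), φ (rho g) = ∫⁻ t, f (g * torus t) ∂unitMeasure v) →
    ∫⁻ g, f g ∂measureG x v = ∫⁻ h, φ h ∂η

/-- The component at `v` of an adelic matrix. -/
def evalGL (v : Place K) : GL (Fin 3) (Adele K) →* GL (Fin 3) v.Compl :=
  Matrix.GeneralLinearGroup.map (RestrictedProduct.evalRingHom (fun v : Place K => v.Compl) v)

/-- `(H_x°)_𝔸`. -/
def adelicH0 : Subgroup (GL (Fin 3) (Adele K)) :=
  ⨅ v : Place K, (stabH0 (x.at v)).comap (evalGL v)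

/-- The component at `v` of an element of `(H_x°)_𝔸`. -/
def adelicH0.eval (v : Place K) (h : adelicH0 x) : stabH0 (x.at v) :=
  ⟨evalGL v h, (Subgroup.mem_iInf.1 h.2 v)⟩

/-- `(H_x°)_K`, diagonally embedded in `(H_x°)_𝔸`. -/
def rationalH0 : Subgroup (adelicH0 x) where
  carrier := {h | ∃ γ ∈ stabH0 x, ∀ v : Place K,
    evalGL v (h : GL (Fin 3) (Adele K)) = Matrix.GeneralLinearGroup.map v.emb γ}
  one_mem' := ⟨1, one_mem _, fun v => by simp⟩
  mul_mem' := by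
    rintro a b ⟨γ, hγ, h⟩ ⟨δ, hδ, h'⟩
    exact ⟨γ * δ, mul_mem hγ hδ, fun v => by simp [h v, h' v]⟩
  inv_mem' := by
    rintro a ⟨γ, hγ, h⟩
    exact ⟨γ⁻¹, inv_mem hγ, fun v => by rw [map_inv, Subgroup.coe_inv, map_inv, h v]⟩

/-- The elements of `(H_x°)_{K_v}` that lie in `GL(V)_{𝒪_v}`. -/
def integralH (v : Place K) : Set (stabH0 (x.at v)) :=
  {h | ∀ i j, (h : GL (Fin 3) v.Compl).1 i j ∈ v.integers ∧
    (h⁻¹ : GL (Fin 3) v.Compl).1 i j ∈ v.integers}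

/-- `dh''_x = ∏_v dh''_{x,v}` on `(H_x°)_𝔸`, the restricted product of the `(H_x°)_{K_v}` with
respect to their integral points: the measure of a box `∏_v B_v` with `B_v` the set of integral
points for almost all `v` is the product of the measures of the `B_v`. -/
def measureAdelic : Measure (adelicH0 x) :=
  theMeasure fun μ => ∀ B : (v : Place K) → Set (stabH0 (x.at v)),
    (∀ v, MeasurableSet (B v)) → (∀ᶠ v in cofinite, B v = integralH x v) →
    μ {h | ∀ v, adelicH0.eval x v h ∈ B v} = ∏ᶠ v, measureH x v (B v)

/-- The measure on `X = (H_x°)_𝔸 / (H_x°)_K` such that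
`∫_{(H_x°)_𝔸} f(h) dh = ∫_X ∑_{γ ∈ (H_x°)_K} f(h γ) dh`. -/
def measureQuotient : Measure (adelicH0 x ⧸ rationalH0 x) :=
  theMeasure fun ν => ∀ (f : adelicH0 x → ℝ≥0∞) (φ : adelicH0 x ⧸ rationalH0 x → ℝ≥0∞),
    Measurable f → (∀ h : adelicH0 x, φ h = ∑' γ : rationalH0 x, f (h * γ)) →
    ∫⁻ h, f h ∂measureAdelic x = ∫⁻ y, φ y ∂ν

/-- The volume of `(H_x°)_𝔸 / (H_x°)_K` with respect to `dh''_x`. -/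
def volume : ℝ≥0∞ := measureQuotient x Set.univ

end Measures

end

end BinQuad

namespace BinQuad

noncomputable section

/-! ### Zariski connectedness -/

section ZariskiTopology

variable {F σ 𝒢 : Type*} [Field F] (c : 𝒢 → σ → F)

/-! Put $L=k(x)$. The group $G_x^\circ$ is the multiplicative group of $L$, viewed as a torus over
$k$: its points over a field $F$ are the invertible matrices $a+bJ$, where $J^2$ is the discriminant
(`mem_stabG0_iff`). Every rational point of $H_x^\circ$ lifts to one of $G_x^\circ$
(`mem_stabH0_iff`), so $(H_x^\circ)_k=L^\times/k^\times$. Let $U$ be the compact open subgroup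
`boxGroup x ∅` of $(H_x^\circ)_{\mathbb A}$, formed by the images of the integral units at all
places. It has volume one, and unfolding gives the volume of the quotient as
$\#\bigl((H_x^\circ)_{\mathbb A}/U(H_x^\circ)_k\bigr)$ divided by $\#\bigl(U\cap(H_x^\circ)_k\bigr)$
(`volume_eq`).

Both numbers concern divisors. Let $C$ be the group of conorms of divisors of $k$, $P$ the principal
divisors of $L$ and $D_0$ the divisors of $L$ of degree zero. An element of $L^\times$ acts as a
unit at $v$ exactly when its divisor above $v$ comes from $k$ (`loc_mem_unitsH_iff`). Hence the
numerator is $[\mathrm{Div}\,L:C+P]$ (`card_adelic_quotient`), and the denominator counts the $z\in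
L^\times$ with divisor in $C$, modulo $k^\times$. Index identities express both through $h_L$,
$h_k$, $q_L-1$, $q_k-1$ and one unknown index, which cancels; the volume is
$[\mathrm{Div}\,L:C+D_0]\,\mathfrak C_L/\mathfrak C_k$ (`volume_eq_index_mul`).

The remaining index is that of the degrees of conorms in $\mathbb Z$. The conorm squares the
absolute norm, and both fields have divisors of degree one (`degree_surjective`), so the index is
two if the constants do not grow and one otherwise (`index_degree_range`).

The facts on function fields are derived from valuation rings. The fundamental inequality
(`card_quotients_le`) makes places discrete with finite residue fields and bounds the zeros of an
element; a count of $L(m(t)_\infty)$ turns the bound into an equality, whence the product formula,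
Riemann's inequality and the finiteness of the class group. Degree one is reached without zeta
functions: if $n>1$ divided all degrees, every place would acquire two places of equal norm in the
constant extension of degree $n$, which would then have too many effective divisors
(`not_forall_split`). On the side of measures, each measure is given by a characteristic property,
so existence and uniqueness come before any computation (`existsUnique_measureH`,
`IsProductMeasure.unique`, `existsUnique_isUnfolding`). -/

theorem mem_pointToPoint_iff (y : σ → F) (p : MvPolynomial σ F) :
    p ∈ (MvPolynomial.pointToPoint y : PrimeSpectrum (MvPolynomial σ F)).asIdeal ↔
      MvPolynomial.eval y p = 0 := by
  simp [MvPolynomial.pointToPoint]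

theorem isClosed_zariski_eq (p : MvPolynomial σ F) (r : F) :
    @IsClosed _ (zariski c) {g | MvPolynomial.eval (c g) p = r} := by
  let _ := zariski c
  have h : IsClosed ((fun g => (MvPolynomial.pointToPoint (c g) :
      PrimeSpectrum (MvPolynomial σ F))) ⁻¹' PrimeSpectrum.zeroLocus {p - MvPolynomial.C r}) :=
    (PrimeSpectrum.isClosed_zeroLocus _).preimage continuous_induced_dom
  convert h using 1
  ext g
  simp [PrimeSpectrum.mem_zeroLocus, mem_pointToPoint_iff, sub_eq_zero]

theorem exists_eval_ne_zero_of_isOpen {u : Set 𝒢} (hu : @IsOpen _ (zariski c) u) {g : 𝒢}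
    (hg : g ∈ u) : ∃ p : MvPolynomial σ F, MvPolynomial.eval (c g) p ≠ 0 ∧
      ∀ g', MvPolynomial.eval (c g') p ≠ 0 → g' ∈ u := by
  let _ := zariski c
  obtain ⟨O, hO, rfl⟩ := isOpen_induced_iff.1 hu
  obtain ⟨_, ⟨p, rfl⟩, hp, hpO⟩ :=
    PrimeSpectrum.isTopologicalBasis_basic_opens.exists_subset_of_mem_open hg hO
  refine ⟨p, fun h => hp ((mem_pointToPoint_iff _ _).2 h), fun g' hg' => hpO ?_⟩
  exact fun h => hg' ((mem_pointToPoint_iff _ _).1 h)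

/-- Substituting fractions with a common denominator into a polynomial. -/
theorem exists_clear_denominators (u : σ → Polynomial F) (D : Polynomial F)
    (p : MvPolynomial σ F) : ∃ (N : ℕ) (P : Polynomial F), ∀ s, D.eval s ≠ 0 →
      P.eval s = D.eval s ^ N * MvPolynomial.eval (fun i => (u i).eval s / D.eval s) p := by
  induction p using MvPolynomial.induction_on with
  | C a => exact ⟨0, Polynomial.C a, fun s _ => by simp⟩
  | add p q hp hq =>
    obtain ⟨N, P, hP⟩ := hp
    obtain ⟨M, Q, hQ⟩ := hq
    refine ⟨N + M, D ^ M * P + D ^ N * Q, fun s hs => ?_⟩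
    simp [hP s hs, hQ s hs]
    ring
  | mul_X p i hp =>
    obtain ⟨N, P, hP⟩ := hp
    refine ⟨N + 1, P * u i, fun s hs => ?_⟩
    simp [hP s hs]
    field_simp
    ring

/-- The image of a rational curve is connected. -/
theorem isPreconnected_rational_curve [Infinite F] (u : σ → Polynomial F) (D : Polynomial F)
    (hD : D ≠ 0) (γ : F → 𝒢)
    (hγ : ∀ s, D.eval s ≠ 0 → ∀ i, c (γ s) i = (u i).eval s / D.eval s) :
    @IsPreconnected _ (zariski c) (γ '' {s | D.eval s ≠ 0}) := by
  let _ := zariski c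
  -- Nonempty open subsets of the image contain the nonvanishing loci of polynomials in the
  -- parameter. Over an infinite field the product of two such polynomials and `D` has a nonzero
  -- value, so the image is even irreducible.
  apply IsPreirreducible.isPreconnected
  rintro U V hU hV ⟨_, ⟨s₁, hs₁, rfl⟩, h₁⟩ ⟨_, ⟨s₂, hs₂, rfl⟩, h₂⟩
  obtain ⟨p, hp, hpU⟩ := exists_eval_ne_zero_of_isOpen c hU h₁
  obtain ⟨q, hq, hqV⟩ := exists_eval_ne_zero_of_isOpen c hV h₂
  obtain ⟨N, P, hP⟩ := exists_clear_denominators u D p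
  obtain ⟨M, Q, hQ⟩ := exists_clear_denominators u D q
  have hc : ∀ s, D.eval s ≠ 0 → c (γ s) = fun i => (u i).eval s / D.eval s :=
    fun s hs => funext (hγ s hs)
  have hP0 : P ≠ 0 := by
    rintro rfl
    have := hP s₁ hs₁
    rw [← hc s₁ hs₁, Polynomial.eval_zero] at this
    exact mul_ne_zero (pow_ne_zero _ hs₁) hp this.symm
  have hQ0 : Q ≠ 0 := by
    rintro rfl
    have := hQ s₂ hs₂
    rw [← hc s₂ hs₂, Polynomial.eval_zero] at this
    exact mul_ne_zero (pow_ne_zero _ hs₂) hq this.symm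
  obtain ⟨s, hs⟩ : ∃ s, (P * Q * D).eval s ≠ 0 := by
    by_contra! h
    exact mul_ne_zero (mul_ne_zero hP0 hQ0) hD (Polynomial.funext fun s => by simpa using h s)
  simp only [Polynomial.eval_mul, mul_ne_zero_iff] at hs
  obtain ⟨⟨hsP, hsQ⟩, hsD⟩ := hs
  refine ⟨γ s, ⟨s, hsD, rfl⟩, hpU _ ?_, hqV _ ?_⟩
  · rw [hP s hsD, ← hc s hsD] at hsP
    exact right_ne_zero_of_mul hsP
  · rw [hQ s hsD, ← hc s hsD] at hsQ
    exact right_ne_zero_of_mul hsQ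

variable [Group 𝒢]

/-- The identity component is cut out by a polynomial function with values `±1`, provided that the
resulting set is connected. -/
theorem mem_component_iff (hτ : ∀ a : 𝒢, @Continuous _ _ (zariski c) (zariski c) (fun g => a * g))
    (S : Subgroup 𝒢) (h2 : (2 : F) ≠ 0) (p : MvPolynomial σ F)
    (h1 : MvPolynomial.eval (c 1) p = 1)
    (hp : ∀ g ∈ S, MvPolynomial.eval (c g) p = 1 ∨ MvPolynomial.eval (c g) p = -1)
    (hC : ∀ g ∈ S, MvPolynomial.eval (c g) p = 1 → ∃ Z : Set 𝒢,
      @IsPreconnected _ (zariski c) Z ∧ 1 ∈ Z ∧ g ∈ Z ∧ Z ⊆ S) (g : 𝒢) :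
    g ∈ component (zariski c) hτ S ↔ g ∈ S ∧ MvPolynomial.eval (c g) p = 1 := by
  let _ := zariski c
  constructor
  · intro hg
    have hgS : g ∈ S := connectedComponentIn_subset _ _ hg
    refine ⟨hgS, (hp g hgS).resolve_right fun hg1 => ?_⟩
    -- The fibres over `1` and `-1` are closed and cover the component. If both were met,
    -- connectedness would give a common point and `1 = -1`.
    have hpre : IsPreconnected (connectedComponentIn (S : Set 𝒢) 1) :=
      isPreconnected_connectedComponentIn
    rw [isPreconnected_closed_iff] at hpre
    obtain ⟨y, -, hy1, hy2⟩ := hpre _ _ (isClosed_zariski_eq c p 1) (isClosed_zariski_eq c p (-1))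
      (fun y hy => hp y (connectedComponentIn_subset _ _ hy))
      ⟨1, mem_connectedComponentIn S.one_mem, h1⟩ ⟨g, hg, hg1⟩
    apply h2
    rw [Set.mem_ofPred_eq] at hy1 hy2
    linear_combination hy2 - hy1
  · rintro ⟨hgS, hg1⟩
    obtain ⟨Z, hZ, h1Z, hgZ, hZS⟩ := hC g hgS hg1
    exact hZ.subset_connectedComponentIn h1Z hZS hgZ

end ZariskiTopology

/-! ### The torus of a form -/

section Torus

variable {R : Type*} [CommRing R] (x : V R)

/-- The matrix `a + b J`, where `J` is the traceless matrix with `J² = disc x` whose eigenvectors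
are the linear factors of `F_x`. -/
def V.elt (a b : R) : Matrix (Fin 2) (Fin 2) R :=
  !![a - b * x 1, 2 * b * x 0; -(2 * b * x 2), a + b * x 1]

theorem V.det_elt (a b : R) : (x.elt a b).det = a ^ 2 - x.disc * b ^ 2 := by
  simp [V.elt, V.disc, Matrix.det_fin_two]
  ring

theorem V.elt_mul (a b a' b' : R) :
    x.elt a b * x.elt a' b' = x.elt (a * a' + x.disc * b * b') (a * b' + a' * b) := by
  ext i j
  fin_cases i <;> fin_cases j <;>
    simp [V.elt, V.disc, Matrix.mul_apply, Fin.sum_univ_succ] <;> ring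

theorem V.elt_one : x.elt 1 0 = 1 := by
  ext i j
  fin_cases i <;> fin_cases j <;> simp [V.elt]

theorem V.elt_smul (t a b : R) : x.elt (t * a) (t * b) = t • x.elt a b := by
  ext i j
  fin_cases i <;> fin_cases j <;> simp [V.elt] <;> ring

theorem V.elt_map {S : Type*} [CommRing S] (f : R →+* S) (a b : R) :
    (x.elt a b).map f = (x.map f).elt (f a) (f b) := by
  ext i j
  fin_cases i <;> fin_cases j <;> simp [V.elt, V.map, map_ofNat f]

theorem V.disc_map {S : Type*} [CommRing S] (f : R →+* S) : (x.map f).disc = f x.disc := by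
  simp [V.disc, V.map, map_ofNat f]

theorem mem_stabG_iff (g : G R) : g ∈ stabG x ↔
    (g.1 : R) * (g.2.1 0 0 ^ 2 * x 0 + g.2.1 0 0 * g.2.1 0 1 * x 1 + g.2.1 0 1 ^ 2 * x 2) = x 0 ∧
    (g.1 : R) * (2 * g.2.1 0 0 * g.2.1 1 0 * x 0 +
      (g.2.1 0 0 * g.2.1 1 1 + g.2.1 0 1 * g.2.1 1 0) * x 1 +
      2 * g.2.1 0 1 * g.2.1 1 1 * x 2) = x 1 ∧
    (g.1 : R) * (g.2.1 1 0 ^ 2 * x 0 + g.2.1 1 0 * g.2.1 1 1 * x 1 + g.2.1 1 1 ^ 2 * x 2) =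
      x 2 := by
  have : g ∈ stabG x ↔ ((g.1 : R) • symSq g.2.1) *ᵥ x = x := Iff.rfl
  rw [this, funext_iff, Fin.forall_fin_succ, Fin.forall_fin_succ, Fin.forall_fin_succ]
  simp [symSq, Matrix.mulVec, dotProduct, Fin.sum_univ_succ, mul_add, add_assoc, mul_assoc]

variable {x} in
-- The discriminant is a relative invariant with character $(t\det m)^2$. For nonzero discriminant
-- over a field this forces $t\det m=\pm1$ on the stabilizer, and the sign will separate its two
-- components.
theorem sq_of_mem_stabG {g : G R} (hg : g ∈ stabG x) :
    ((g.1 : R) * g.2.1.det) ^ 2 * x.disc = x.disc := by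
  obtain ⟨h0, h1, h2⟩ := (mem_stabG_iff x g).1 hg
  have : x.disc = (((g.1 : R) * (2 * g.2.1 0 0 * g.2.1 1 0 * x 0 +
      (g.2.1 0 0 * g.2.1 1 1 + g.2.1 0 1 * g.2.1 1 0) * x 1 +
      2 * g.2.1 0 1 * g.2.1 1 1 * x 2))) ^ 2 - 4 * ((g.1 : R) * (g.2.1 0 0 ^ 2 * x 0 +
      g.2.1 0 0 * g.2.1 0 1 * x 1 + g.2.1 0 1 ^ 2 * x 2)) * ((g.1 : R) * (g.2.1 1 0 ^ 2 * x 0 +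
      g.2.1 1 0 * g.2.1 1 1 * x 1 + g.2.1 1 1 ^ 2 * x 2)) := by rw [h0, h1, h2]; rfl
  conv_rhs => rw [this]
  rw [Matrix.det_fin_two, V.disc]
  ring

theorem mem_stabG_of_elt {g : G R} {a b : R} (h : g.2.1 = x.elt a b)
    (ht : (g.1 : R) * g.2.1.det = 1) : g ∈ stabG x := by
  rw [mem_stabG_iff]
  rw [h, V.det_elt, V.disc] at ht
  simp only [h, V.elt, Matrix.of_apply, Matrix.cons_val', Matrix.cons_val_zero,
    Matrix.cons_val_one, Matrix.cons_val_fin_one]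
  refine ⟨?_, ?_, ?_⟩
  · linear_combination x 0 * ht
  · linear_combination x 1 * ht
  · linear_combination x 2 * ht

end Torus

section TorusField

variable {F : Type*} [Field F] {x : V F}

/-- Since $t$ is the inverse of $\det m$, eliminating with the entries of $m$ turns the quadratic
stabilizer equations into linear ones. These (`e1`, `e2`, `e3`) say that $(b,\,d-a,\,-c)$ is
proportional to $(x_0,x_1,x_2)$. -/
theorem exists_elt_of_mem_stabG (h2 : (2 : F) ≠ 0) (hx : x.disc ≠ 0) {g : G F}
    (hg : g ∈ stabG x) (ht : (g.1 : F) * g.2.1.det = 1) : ∃ a b, g.2.1 = x.elt a b := by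
  obtain ⟨h0, h1, h2'⟩ := (mem_stabG_iff x g).1 hg
  rw [Matrix.det_fin_two] at ht
  set a := g.2.1 0 0 with ha
  set b := g.2.1 0 1 with hb
  set c := g.2.1 1 0 with hc
  set d := g.2.1 1 1 with hd
  set t := (g.1 : F)
  have e1 : x 0 * (d - a) = b * x 1 := by
    apply mul_left_cancel₀ h2
    linear_combination -(2 * d) * h0 + b * h1 + (2 * x 0 * a + x 1 * b) * ht
  have e2 : x 2 * (a - d) = c * x 1 := by
    apply mul_left_cancel₀ h2
    linear_combination c * h1 - 2 * a * h2' + (x 1 * c + 2 * x 2 * d) * ht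
  have e3 : b * x 2 + c * x 0 = 0 := by
    apply mul_left_cancel₀ h2
    linear_combination d * h1 - 2 * b * h2' - (2 * x 0 * c + x 1 * d) * ht
  -- The proportionality factor is $2\beta$. It is read off by pairing with $x$ under the polar form
  -- of the discriminant, for which $x$ paired with itself gives `x.disc`.
  refine ⟨(a + d) / 2, (x 1 * (d - a) - 2 * b * x 2 + 2 * c * x 0) / (2 * x.disc), ?_⟩
  set β := (x 1 * (d - a) - 2 * b * x 2 + 2 * c * x 0) / (2 * x.disc) with hβ
  have hβ' : x 1 * (d - a) - 2 * b * x 2 + 2 * c * x 0 = β * (2 * x.disc) := by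
    rw [hβ, div_mul_cancel₀ _ (mul_ne_zero h2 hx)]
  clear_value β
  have k1 : b = 2 * β * x 0 := by
    apply mul_left_cancel₀ hx
    have h : x.disc = x 1 ^ 2 - 4 * x 0 * x 2 := rfl
    apply mul_left_cancel₀ h2
    linear_combination 2 * b * h + 2 * x 0 * hβ' - 2 * x 1 * e1 - 4 * x 0 * e3
  have k2 : c = -(2 * β * x 2) := by
    apply mul_left_cancel₀ hx
    have h : x.disc = x 1 ^ 2 - 4 * x 0 * x 2 := rfl
    apply mul_left_cancel₀ h2
    linear_combination 2 * c * h - 2 * x 2 * hβ' - 2 * x 1 * e2 - 4 * x 2 * e3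
  have k3 : d - a = 2 * β * x 1 := by
    apply mul_left_cancel₀ hx
    have h : x.disc = x 1 ^ 2 - 4 * x 0 * x 2 := rfl
    linear_combination (d - a) * h + x 1 * hβ' - 4 * x 2 * e1 - 2 * x 1 * e3
  ext i j
  fin_cases i <;> fin_cases j
  · simp only [V.elt, Fin.zero_eta, Matrix.of_apply, Matrix.cons_val', Matrix.cons_val_zero,
      Matrix.cons_val_fin_one, ← ha]
    field_simp
    linear_combination -k3
  · simpa [V.elt] using k1
  · simpa [V.elt] using k2
  · simp only [V.elt, Fin.mk_one, Matrix.of_apply, Matrix.cons_val', Matrix.cons_val_one,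
      Matrix.cons_val_fin_one, ← hd]
    field_simp
    linear_combination k3

variable (x) in
/-- The element of `(G_x°)_F` with matrix `a + b J`. -/
def V.eltG (a b : F) (h : a ^ 2 - x.disc * b ^ 2 ≠ 0) : G F :=
  ((Units.mk0 _ h)⁻¹, Matrix.GeneralLinearGroup.mkOfDetNeZero (x.elt a b) (by rwa [V.det_elt]))

theorem V.eltG_snd (a b : F) (h : a ^ 2 - x.disc * b ^ 2 ≠ 0) :
    (x.eltG a b h).2.1 = x.elt a b := rfl

theorem V.eltG_fst (a b : F) (h : a ^ 2 - x.disc * b ^ 2 ≠ 0) :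
    ((x.eltG a b h).1 : F) = (a ^ 2 - x.disc * b ^ 2)⁻¹ := by
  simp [V.eltG]

theorem V.eltG_one (h : (1 : F) ^ 2 - x.disc * 0 ^ 2 ≠ 0) : x.eltG 1 0 h = 1 := by
  refine Prod.ext (Units.ext ?_) (Units.ext ?_)
  · simp [V.eltG_fst]
  · exact x.elt_one

theorem V.eltG_mem_stabG (a b : F) (h : a ^ 2 - x.disc * b ^ 2 ≠ 0) : x.eltG a b h ∈ stabG x := by
  refine mem_stabG_of_elt x (V.eltG_snd a b h) ?_
  rw [V.eltG_fst, V.eltG_snd, V.det_elt, inv_mul_cancel₀ h]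

theorem exists_eltG_iff (h2 : (2 : F) ≠ 0) (hx : x.disc ≠ 0) (g : G F) :
    (g ∈ stabG x ∧ (g.1 : F) * g.2.1.det = 1) ↔ ∃ a b h, g = x.eltG a b h := by
  constructor
  · rintro ⟨hg, ht⟩
    obtain ⟨a, b, hab⟩ := exists_elt_of_mem_stabG h2 hx hg ht
    rw [hab, V.det_elt] at ht
    refine ⟨a, b, right_ne_zero_of_mul_eq_one ht, Prod.ext (Units.ext ?_) (Units.ext hab)⟩
    rw [V.eltG_fst]
    exact eq_inv_of_mul_eq_one_left ht
  · rintro ⟨a, b, h, rfl⟩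
    refine ⟨V.eltG_mem_stabG a b h, ?_⟩
    rw [V.eltG_fst, V.eltG_snd, V.det_elt, inv_mul_cancel₀ h]

theorem V.eltG_map {L : Type*} [Field L] (f : F →+* L) (a b : F)
    (h : a ^ 2 - x.disc * b ^ 2 ≠ 0) (h' : f a ^ 2 - (x.map f).disc * f b ^ 2 ≠ 0) :
    G.map f (x.eltG a b h) = (x.map f).eltG (f a) (f b) h' := by
  refine Prod.ext (Units.ext ?_) (Units.ext ?_)
  · rw [V.eltG_fst, V.disc_map]
    simp [G.map, V.eltG_fst]
  · rw [V.eltG_snd, ← V.elt_map]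
    rfl

theorem det_symSq (m : Matrix (Fin 2) (Fin 2) F) : (symSq m).det = m.det ^ 3 := by
  simp [symSq, Matrix.det_fin_three, Matrix.det_fin_two]
  ring

theorem det_rho (g : G F) : (rho g).1.det = ((g.1 : F) * g.2.1.det) ^ 3 := by
  rw [coe_rho, Matrix.det_smul, det_symSq]
  simp [mul_pow]

/-- The line joining `1` to `a + b J`. -/
def V.line (x : V F) (a b s : F) : G F :=
  open Classical in if h : (1 + s * (a - 1)) ^ 2 - x.disc * (b * s) ^ 2 ≠ 0 then
    x.eltG (1 + s * (a - 1)) (b * s) h else 1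

variable (x) in
/-- The determinant along `V.line`. -/
def V.lineDet (a b : F) : Polynomial F :=
  (1 + Polynomial.X * Polynomial.C (a - 1)) ^ 2 -
    Polynomial.C x.disc * (Polynomial.C b * Polynomial.X) ^ 2

theorem V.eval_lineDet (a b s : F) :
    (x.lineDet a b).eval s = (1 + s * (a - 1)) ^ 2 - x.disc * (b * s) ^ 2 := by
  simp [V.lineDet]

theorem V.lineDet_ne_zero (a b : F) : x.lineDet a b ≠ 0 := by
  intro h
  have := V.eval_lineDet (x := x) a b 0
  simp [h] at this

variable (x) in
/-- The coordinates of the matrices along `V.line`. -/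
def V.lineElt (a b : F) : Matrix (Fin 2) (Fin 2) (Polynomial F) :=
  V.elt (fun i => Polynomial.C (x i)) (1 + Polynomial.X * Polynomial.C (a - 1))
    (Polynomial.C b * Polynomial.X)

theorem V.eval_lineElt (a b s : F) :
    (x.lineElt a b).map (Polynomial.eval s) = x.elt (1 + s * (a - 1)) (b * s) := by
  have := V.elt_map (fun i => Polynomial.C (x i)) (Polynomial.evalRingHom s)
    (1 + Polynomial.X * Polynomial.C (a - 1)) (Polynomial.C b * Polynomial.X)
  have h : V.map (Polynomial.evalRingHom s) (fun i => Polynomial.C (x i)) = x := by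
    ext i
    simp [V.map]
  rw [h] at this
  simpa [V.lineElt] using this

theorem V.line_eq {a b s : F} (hs : (x.lineDet a b).eval s ≠ 0) :
    x.line a b s = x.eltG (1 + s * (a - 1)) (b * s) (by rwa [← V.eval_lineDet]) := by
  rw [V.eval_lineDet] at hs
  rw [V.line, dif_pos hs]

theorem V.line_zero (a b : F) : x.line a b 0 = 1 := by
  have h : (x.lineDet a b).eval 0 ≠ 0 := by rw [V.eval_lineDet]; simp
  rw [V.line_eq h]
  simp only [zero_mul, mul_zero, add_zero]
  exact V.eltG_one (by simp)

theorem V.line_one {a b : F} (h : a ^ 2 - x.disc * b ^ 2 ≠ 0) : x.line a b 1 = x.eltG a b h := by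
  have h : (x.lineDet a b).eval 1 ≠ 0 := by rw [V.eval_lineDet]; simpa using h
  rw [V.line_eq h]
  simp

theorem symSq_map {L : Type*} [CommRing L] {R : Type*} [CommRing R] (f : R →+* L)
    (m : Matrix (Fin 2) (Fin 2) R) : (symSq m).map f = symSq (m.map f) := by
  ext i j
  fin_cases i <;> fin_cases j <;> simp [symSq, map_ofNat f]

/-- The function $t\det m$ takes only the values $\pm1$ on the stabilizer. Where it is $1$ the
matrix has the form $a+bJ$, and the line from $1$ to $a+bJ$, without its points of norm zero, is a
connected set inside the stabilizer. -/
theorem mem_component_G_iff [Infinite F] (h2 : (2 : F) ≠ 0) (hx : x.disc ≠ 0) (g : G F) :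
    g ∈ component (zariski coordG) continuous_left_G (stabG x) ↔ ∃ a b h, g = x.eltG a b h := by
  let p : MvPolynomial (Option (Fin 2 × Fin 2)) F := MvPolynomial.X none *
    (MvPolynomial.X (some (0, 0)) * MvPolynomial.X (some (1, 1)) -
      MvPolynomial.X (some (0, 1)) * MvPolynomial.X (some (1, 0)))
  have hp : ∀ g : G F, MvPolynomial.eval (coordG g) p = (g.1 : F) * g.2.1.det := by
    intro g
    simp [p, coordG, Matrix.det_fin_two]
  rw [mem_component_iff coordG continuous_left_G (stabG x) h2 p, hp, exists_eltG_iff h2 hx]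
  · simp [hp]
  · intro g hg
    rw [hp]
    refine sq_eq_one_iff.1 ?_
    exact mul_right_cancel₀ hx ((sq_of_mem_stabG hg).trans (one_mul _).symm)
  · intro g hg h
    rw [hp] at h
    obtain ⟨a, b, hab, rfl⟩ := (exists_eltG_iff h2 hx g).1 ⟨hg, h⟩
    refine ⟨x.line a b '' {s | (x.lineDet a b).eval s ≠ 0}, ?_, ⟨0, ?_, V.line_zero a b⟩,
      ⟨1, ?_, V.line_one hab⟩, ?_⟩
    · refine isPreconnected_rational_curve coordG
        (fun o => match o with
          | none => 1
          | some q => x.lineDet a b * x.lineElt a b q.1 q.2) (x.lineDet a b)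
        (V.lineDet_ne_zero a b) _ fun s hs i => ?_
      rw [V.line_eq hs]
      match i with
      | none => simp [coordG, V.eltG_fst, V.eval_lineDet]
      | some q =>
        simp only [coordG, V.eltG_snd, ← V.eval_lineElt, Polynomial.eval_mul, Matrix.map_apply]
        rw [mul_div_cancel_left₀ _ hs]
    · rw [Set.mem_ofPred_eq, V.eval_lineDet]; simp
    · rw [Set.mem_ofPred_eq, V.eval_lineDet]; simpa using hab
    · rintro _ ⟨s, hs, rfl⟩
      rw [V.line_eq hs]
      exact V.eltG_mem_stabG _ _ _

/-- The separating function is now the determinant on $GL(3)$. By `det_rho` it is the cube of $t\det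
m$, hence again $\pm1$ with the same sign, and the connecting curves are the images of the lines
used for $G_x$. -/
theorem mem_component_H_iff [Infinite F] (h2 : (2 : F) ≠ 0) (hx : x.disc ≠ 0) (g : GL (Fin 3) F) :
    g ∈ component (zariski coordGL) continuous_left_GL (stabH x) ↔
      ∃ a b h, g = rho (x.eltG a b h) := by
  let p : MvPolynomial (Fin 3 × Fin 3) F :=
    (Matrix.of fun i j => MvPolynomial.X (i, j) : Matrix (Fin 3) (Fin 3) _).det
  have hp : ∀ g : GL (Fin 3) F, MvPolynomial.eval (coordGL g) p = g.1.det := by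
    intro g
    rw [RingHom.map_det]
    congr 1
    ext i j
    simp [coordGL]
  have key : ∀ g : GL (Fin 3) F, g ∈ stabH x → ∃ g' ∈ stabG x, rho g' = g ∧
      ((g'.1 : F) * g'.2.1.det = 1 ∨ (g'.1 : F) * g'.2.1.det = -1) := by
    rintro _ ⟨⟨g', rfl⟩, hg'⟩
    exact ⟨g', hg', rfl, sq_eq_one_iff.1       (mul_right_cancel₀ hx ((sq_of_mem_stabG hg').trans (one_mul _).symm))⟩
  have key2 : ∀ g : GL (Fin 3) F, (g ∈ stabH x ∧ g.1.det = 1) ↔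
      ∃ a b h, g = rho (x.eltG a b h) := by
    intro g
    constructor
    · rintro ⟨hg, hdet⟩
      obtain ⟨g', hg', rfl, h⟩ := key g hg
      rw [det_rho] at hdet
      rcases h with h | h
      · obtain ⟨a, b, hab, rfl⟩ := (exists_eltG_iff h2 hx g').1 ⟨hg', h⟩
        exact ⟨a, b, hab, rfl⟩
      · rw [h] at hdet
        exact (h2 (by linear_combination -hdet)).elim
    · rintro ⟨a, b, h, rfl⟩
      refine ⟨⟨⟨_, rfl⟩, V.eltG_mem_stabG a b h⟩, ?_⟩
      rw [det_rho, ((exists_eltG_iff h2 hx _).2 ⟨a, b, h, rfl⟩).2, one_pow]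
  rw [mem_component_iff coordGL continuous_left_GL (stabH x) h2 p, hp, key2]
  · simp [hp]
  · intro g hg
    obtain ⟨g', -, rfl, h⟩ := key g hg
    rw [hp, det_rho]
    rcases h with h | h <;> rw [h] <;> norm_num
  · intro g hg h
    rw [hp] at h
    obtain ⟨a, b, hab, rfl⟩ := (key2 g).1 ⟨hg, h⟩
    refine ⟨(fun s => rho (x.line a b s)) '' {s | (x.lineDet a b).eval s ≠ 0}, ?_,
      ⟨0, ?_, by simp [V.line_zero]⟩, ⟨1, ?_, by simp [V.line_one hab]⟩, ?_⟩
    · refine isPreconnected_rational_curve coordGL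
        (fun q => symSq (x.lineElt a b) q.1 q.2) (x.lineDet a b)
        (V.lineDet_ne_zero a b) _ fun s hs i => ?_
      have := symSq_map (Polynomial.evalRingHom s) (x.lineElt a b)
      simp only [Polynomial.coe_evalRingHom, V.eval_lineElt] at this
      simp only [V.line_eq hs, coordGL, coe_rho, V.eltG_fst, V.eltG_snd, ← this, V.eval_lineDet,
        Matrix.smul_apply, Matrix.map_apply, smul_eq_mul]
      rw [div_eq_inv_mul]
    · rw [Set.mem_ofPred_eq, V.eval_lineDet]; simp
    · rw [Set.mem_ofPred_eq, V.eval_lineDet]; simpa using hab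
    · rintro _ ⟨s, hs, rfl⟩
      simp only [V.line_eq hs]
      exact ⟨⟨_, rfl⟩, V.eltG_mem_stabG _ _ _⟩

end TorusField

end

end BinQuad

namespace BinQuad

noncomputable section

/-! ### Rational points of the identity components -/

section RationalPoints

theorem rho_map {R S : Type*} [CommRing R] [CommRing S] (f : R →+* S) (g : G R) :
    Matrix.GeneralLinearGroup.map f (rho g) = rho (G.map f g) := by
  refine Units.ext ?_
  change (rho g).1.map f = (rho (G.map f g)).1
  rw [coe_rho, coe_rho]
  ext i j
  have := congr_fun₂ (symSq_map f g.2.1) i j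
  simp only [Matrix.map_apply, Matrix.smul_apply, smul_eq_mul, map_mul] at this ⊢
  rw [this]
  rfl

theorem exists_torus_of_rho_eq_one {R : Type*} [CommRing R] {g : G R}
    (hg : rho g = 1) : ∃ t, g = torus t := by
  have h := congr_arg Units.val hg
  rw [coe_rho, Units.val_one] at h
  have h00 := congr_fun₂ h 0 0
  have h01 := congr_fun₂ h 0 1
  have h11 := congr_fun₂ h 1 1
  have h21 := congr_fun₂ h 2 1
  have h22 := congr_fun₂ h 2 2
  simp [symSq] at h00 h01 h11 h21 h22
  set a := g.2.1 0 0 with ha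
  set b := g.2.1 0 1 with hb
  set c := g.2.1 1 0 with hc
  set d := g.2.1 1 1 with hd
  set t := (g.1 : R) with ht
  have hb0 : b = 0 := by linear_combination -b * h00 + t * a * h01
  have hc0 : c = 0 := by linear_combination -c * h22 + t * d * h21
  rw [hb0] at h11
  have had : d = a := by linear_combination a * h11 - d * h00
  refine ⟨⟨t * a, a, by linear_combination h00, by linear_combination h00⟩,
    Prod.ext (Units.ext ?_) (Units.ext ?_)⟩
  · simp only [torus, Units.val_pow_eq_pow_val]
    linear_combination -t * h00
  · ext i j
    fin_cases i <;> fin_cases j <;> simp [torus, ← ha, ← hb, ← hc, ← hd, hb0, hc0, had]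

theorem rho_torus {R : Type*} [CommRing R] (t : Rˣ) : rho (torus t) = 1 := by
  refine Units.ext ?_
  rw [coe_rho]
  ext i j
  have h : (t : R) ^ 2 * (↑t⁻¹) ^ 2 = 1 := by rw [← mul_pow, Units.mul_inv, one_pow]
  fin_cases i <;> fin_cases j <;> simp [torus, symSq, ← pow_two, h]

theorem torus_mul {R : Type*} [CommRing R] (s t : Rˣ) : torus (s * t) = torus s * torus t := by
  refine Prod.ext (mul_pow _ _ _) ?_
  simp [torus, mul_comm]

variable {F : Type*} [Field F] {x : V F}

/-- Over the algebraic closure the component consists of the stabilizing elements with $t\det m=1$.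
These are equations with coefficients in $F$, so for a rational point they can be tested over $F$.
-/
theorem mem_stabG0_iff (h2 : (2 : F) ≠ 0) (hx : x.disc ≠ 0) (g : G F) :
    g ∈ stabG0 x ↔ ∃ a b h, g = x.eltG a b h := by
  let f := algebraMap F (AlgebraicClosure F)
  have hf : Function.Injective f := f.injective
  have h2' : (2 : AlgebraicClosure F) ≠ 0 := by
    rw [← map_ofNat f]
    exact (map_ne_zero f).2 h2
  have hx' : (x.map f).disc ≠ 0 := by
    rw [V.disc_map]
    exact (map_ne_zero f).2 hx
  rw [← exists_eltG_iff h2 hx]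
  change G.map f g ∈ component (zariski coordG) continuous_left_G (stabG (x.map f)) ↔ _
  rw [mem_component_G_iff h2' hx', ← exists_eltG_iff h2' hx']
  refine and_congr ?_ ?_
  · have e : ∀ i j, (G.map f g).2.1 i j = f (g.2.1 i j) := fun i j => rfl
    have e' : ((G.map f g).1 : AlgebraicClosure F) = f g.1 := rfl
    rw [mem_stabG_iff, mem_stabG_iff]
    simp only [e, e', V.map]
    refine and_congr ?_ (and_congr ?_ ?_) <;> rw [← hf.eq_iff] <;> simp [map_ofNat f]
  · have e : (G.map f g).2.1.det = f g.2.1.det := (RingHom.map_det f _).symm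
    have e' : ((G.map f g).1 : AlgebraicClosure F) = f g.1 := rfl
    rw [e, e', ← map_mul, ← hf.eq_iff (b := (1 : F)), map_one]

theorem V.eltG_mul (a b a' b' : F) (h : a ^ 2 - x.disc * b ^ 2 ≠ 0)
    (h' : a' ^ 2 - x.disc * b' ^ 2 ≠ 0)
    (h'' : (a * a' + x.disc * b * b') ^ 2 - x.disc * (a * b' + a' * b) ^ 2 ≠ 0) :
    x.eltG a b h * x.eltG a' b' h' = x.eltG (a * a' + x.disc * b * b') (a * b' + a' * b) h'' := by
  refine Prod.ext (Units.ext ?_) (Units.ext ?_)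
  · rw [Prod.fst_mul, Units.val_mul, V.eltG_fst, V.eltG_fst, V.eltG_fst, ← mul_inv]
    congr 1
    ring
  · exact x.elt_mul a b a' b'

theorem V.norm_mul (a b a' b' : F) :
    (a * a' + x.disc * b * b') ^ 2 - x.disc * (a * b' + a' * b) ^ 2 =
      (a ^ 2 - x.disc * b ^ 2) * (a' ^ 2 - x.disc * b' ^ 2) := by
  ring

theorem V.eltG_comm (a b a' b' : F) (h : a ^ 2 - x.disc * b ^ 2 ≠ 0)
    (h' : a' ^ 2 - x.disc * b' ^ 2 ≠ 0) :
    x.eltG a b h * x.eltG a' b' h' = x.eltG a' b' h' * x.eltG a b h := by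
  have h1 : (a * a' + x.disc * b * b') ^ 2 - x.disc * (a * b' + a' * b) ^ 2 ≠ 0 := by
    rw [V.norm_mul]; exact mul_ne_zero h h'
  have h2 : (a' * a + x.disc * b' * b) ^ 2 - x.disc * (a' * b + a * b') ^ 2 ≠ 0 := by
    rw [V.norm_mul]; exact mul_ne_zero h' h
  rw [V.eltG_mul a b a' b' h h' h1, V.eltG_mul a' b' a b h' h h2]
  congr 1 <;> ring

theorem V.eltG_mul_torus (a b : F) (t : Fˣ) (h : a ^ 2 - x.disc * b ^ 2 ≠ 0)
    (h' : ((t⁻¹ : Fˣ) * a) ^ 2 - x.disc * ((t⁻¹ : Fˣ) * b) ^ 2 ≠ 0) :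
    x.eltG a b h * torus t = x.eltG ((t⁻¹ : Fˣ) * a) ((t⁻¹ : Fˣ) * b) h' := by
  refine Prod.ext (Units.ext ?_) (Units.ext ?_)
  · rw [Prod.fst_mul, Units.val_mul, V.eltG_fst, V.eltG_fst]
    have : ((t⁻¹ : Fˣ) * a) ^ 2 - x.disc * ((t⁻¹ : Fˣ) * b) ^ 2 =
        ((t : F) ^ 2)⁻¹ * (a ^ 2 - x.disc * b ^ 2) := by
      rw [Units.val_inv_eq_inv_val]
      ring
    rw [this, mul_inv, inv_inv, mul_comm]
    rfl
  · rw [V.eltG_snd, V.elt_smul, Prod.snd_mul, Units.val_mul, V.eltG_snd]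
    ext i j
    simp [torus, mul_comm]

theorem V.rho_eltG_smul (a b t : F) (h : a ^ 2 - x.disc * b ^ 2 ≠ 0)
    (h' : (t * a) ^ 2 - x.disc * (t * b) ^ 2 ≠ 0) :
    rho (x.eltG (t * a) (t * b) h') = rho (x.eltG a b h) := by
  have ht : t ≠ 0 := by
    rintro rfl
    simp at h'
  have := V.eltG_mul_torus a b (Units.mk0 t ht)⁻¹ h (by simpa using h')
  simp only [inv_inv, Units.val_mk0] at this
  rw [← this, map_mul, rho_torus, mul_one]

theorem rho_eltG_apply (a b : F) (h : a ^ 2 - x.disc * b ^ 2 ≠ 0) (i j : Fin 3) :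
    (a ^ 2 - x.disc * b ^ 2) * (rho (x.eltG a b h)).1 i j = symSq (x.elt a b) i j := by
  rw [coe_rho, V.eltG_fst, V.eltG_snd, Matrix.smul_apply, smul_eq_mul, mul_inv_cancel_left₀ h]

/-- For $u=a+b\sqrt{P(x)}$ with conjugate $\bar u$ the eigenvalues on binary forms are $1$, $u/\bar
u$ and $\bar u/u$, so the trace minus $3$ is $(u-\bar u)^2/(u\bar u)$. Thus the norm of a normalized
lift, and the size of $b$, can be read off from the image in $H_x$. -/
theorem trace_rho_eltG (a b : F) (h : a ^ 2 - x.disc * b ^ 2 ≠ 0) :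
    (a ^ 2 - x.disc * b ^ 2) * ((rho (x.eltG a b h)).1.trace - 3) = 4 * x.disc * b ^ 2 := by
  rw [Matrix.trace, mul_sub, Finset.mul_sum]
  simp only [Matrix.diag_apply, rho_eltG_apply]
  simp [Fin.sum_univ_succ, symSq, V.elt, V.disc]
  ring

theorem rho_eltG_zero (a : F) (h : a ^ 2 - x.disc * 0 ^ 2 ≠ 0) : rho (x.eltG a 0 h) = 1 := by
  have h1 : (1 : F) ^ 2 - x.disc * 0 ^ 2 ≠ 0 := by simp
  have h' : (a * 1) ^ 2 - x.disc * (a * 0) ^ 2 ≠ 0 := by simpa using h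
  have := V.rho_eltG_smul 1 0 a h1 h'
  rw [V.eltG_one, map_one] at this
  simpa using this

/-- Rational points of `H_x°` lift to rational points of `G_x°`. -/
theorem mem_stabH0_iff (h2 : (2 : F) ≠ 0) (hx : x.disc ≠ 0) (g : GL (Fin 3) F) :
    g ∈ stabH0 x ↔ g = 1 ∨ ∃ c h, g = rho (x.eltG c 1 h) := by
  let f := algebraMap F (AlgebraicClosure F)
  have hf : Function.Injective f := f.injective
  have h2' : (2 : AlgebraicClosure F) ≠ 0 := by
    rw [← map_ofNat f]
    exact (map_ne_zero f).2 h2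
  have h4 : (4 : F) ≠ 0 := by
    have : (4 : F) = 2 * 2 := by norm_num
    rw [this]
    exact mul_ne_zero h2 h2
  have hx' : (x.map f).disc ≠ 0 := by
    rw [V.disc_map]
    exact (map_ne_zero f).2 hx
  have hinj : Function.Injective (Matrix.GeneralLinearGroup.map (n := Fin 3) f) := by
    intro a b hab
    refine Units.ext (Matrix.ext fun i j => hf ?_)
    have h := congr_arg (fun u : GL (Fin 3) (AlgebraicClosure F) => u.1 i j) hab
    exact h
  change Matrix.GeneralLinearGroup.map f g ∈
    component (zariski coordGL) continuous_left_GL (stabH (x.map f)) ↔ _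
  rw [mem_component_H_iff h2' hx']
  constructor
  · rintro ⟨α, β, h, hg⟩
    by_cases hβ : β = 0
    · subst hβ
      rw [rho_eltG_zero] at hg
      exact Or.inl (hinj (hg.trans (map_one _).symm))
    right
    -- A point with $\beta\ne0$ is normalized modulo the torus to $c+J$. What remains is to show
    -- that $c$ lies in $F$.
    have hc : (α / β) ^ 2 - (x.map f).disc * 1 ^ 2 ≠ 0 := by
      intro h0
      apply h
      have : α ^ 2 - (x.map f).disc * β ^ 2 = β ^ 2 * ((α / β) ^ 2 - (x.map f).disc * 1 ^ 2) := by
        field_simp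
      rw [this, h0, mul_zero]
    have hg' : Matrix.GeneralLinearGroup.map f g = rho ((x.map f).eltG (α / β) 1 hc) := by
      have e1 : β * (α / β) = α := by field_simp
      have h' : (β * (α / β)) ^ 2 - (x.map f).disc * (β * 1) ^ 2 ≠ 0 := by
        rw [e1, mul_one]; exact h
      rw [← V.rho_eltG_smul (α / β) 1 β hc h', hg]
      congr 2 <;> simp [e1]
    set c := α / β
    have hent : ∀ i j, (c ^ 2 - (x.map f).disc * 1 ^ 2) * f (g.1 i j) =
        symSq ((x.map f).elt c 1) i j := by
      intro i j
      have : f (g.1 i j) = (Matrix.GeneralLinearGroup.map f g).1 i j := rfl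
      rw [this, hg', rho_eltG_apply]
    have htr : (c ^ 2 - (x.map f).disc * 1 ^ 2) * f (g.1.trace - 3) = f (4 * x.disc) := by
      have := trace_rho_eltG c 1 hc
      rw [← hg'] at this
      have e : (Matrix.GeneralLinearGroup.map f g).1.trace = f g.1.trace :=
        (AddMonoidHom.map_trace f g.1).symm
      rw [e] at this
      rw [map_sub, map_mul, map_ofNat, map_ofNat, ← V.disc_map, this]
      ring
    have hT : g.1.trace - 3 ≠ 0 := by
      intro h0
      rw [h0, map_zero, mul_zero] at htr
      exact mul_ne_zero h4 hx (hf (htr.symm.trans (map_zero f).symm))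
    -- The norm of $c+J$ is rational, because the trace identity expresses it through the trace of
    -- `g`.
    set N := 4 * x.disc / (g.1.trace - 3) with hN
    have hn : c ^ 2 - (x.map f).disc * 1 ^ 2 = f N := by
      rw [hN, map_div₀, eq_div_iff ((map_ne_zero f).2 hT), htr]
    rw [hn] at hent
    -- Once the norm is rational, $c$ solves a linear equation over $F$: the entry `0 1` gives
    -- $2x_0(c-x_1)$, and the difference of the corner entries gives $4cx_1$, which serves when
    -- $x_1\ne0$.
    obtain ⟨c₀, hc₀⟩ : ∃ c₀, c = f c₀ := by
      by_cases hx1 : x 1 = 0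
      · have hx0 : x 0 ≠ 0 := by
          intro hx0
          apply hx
          simp [V.disc, hx1, hx0]
        refine ⟨N * g.1 0 1 / (2 * x 0) + x 1, ?_⟩
        have h01 := hent 0 1
        simp [symSq, V.elt, V.map] at h01
        rw [map_add, map_div₀, map_mul, h01, map_mul, map_ofNat]
        have : f (x 0) ≠ 0 := (map_ne_zero f).2 hx0
        field_simp
        ring
      · refine ⟨N * (g.1 2 2 - g.1 0 0) / (4 * x 1), ?_⟩
        have h00 := hent 0 0
        have h22 := hent 2 2
        simp [symSq, V.elt, V.map] at h00 h22
        rw [map_div₀, map_mul, map_sub, mul_sub, h00, h22, map_mul, map_ofNat]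
        have h1 : f (x 1) ≠ 0 := (map_ne_zero f).2 hx1
        have h4' : (4 : AlgebraicClosure F) ≠ 0 := by
          rw [← map_ofNat f]; exact (map_ne_zero f).2 h4
        field_simp
        ring
    have hc₀' : c₀ ^ 2 - x.disc * 1 ^ 2 ≠ 0 := by
      intro h0
      apply hc
      rw [hc₀, V.disc_map, ← map_one f, ← map_pow, ← map_pow, ← map_mul, ← map_sub, h0, map_zero]
    refine ⟨c₀, hc₀', hinj ?_⟩
    rw [rho_map, hg', V.eltG_map f c₀ 1 hc₀' (by rwa [map_one, ← hc₀])]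
    congr 2
  · rintro (rfl | ⟨c, h, rfl⟩)
    · refine ⟨1, 0, by simp, ?_⟩
      rw [rho_eltG_zero, map_one]
    · refine ⟨f c, f 1, ?_, ?_⟩
      · rw [V.disc_map, ← map_pow, ← map_pow, ← map_mul, ← map_sub]
        exact (map_ne_zero f).2 h
      · rw [rho_map, V.eltG_map]

theorem mem_stabH0_iff' (h2 : (2 : F) ≠ 0) (hx : x.disc ≠ 0) (g : GL (Fin 3) F) :
    g ∈ stabH0 x ↔ ∃ g' ∈ stabG0 x, g = rho g' := by
  rw [mem_stabH0_iff h2 hx]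
  constructor
  · rintro (rfl | ⟨c, h, rfl⟩)
    · exact ⟨1, one_mem _, (map_one _).symm⟩
    · exact ⟨_, (mem_stabG0_iff h2 hx _).2 ⟨c, 1, h, rfl⟩, rfl⟩
  · rintro ⟨g', hg', rfl⟩
    obtain ⟨a, b, h, rfl⟩ := (mem_stabG0_iff h2 hx g').1 hg'
    by_cases hb : b = 0
    · subst hb
      exact Or.inl (rho_eltG_zero a h)
    · have hc : (a / b) ^ 2 - x.disc * 1 ^ 2 ≠ 0 := by
        intro h0
        apply h
        have : a ^ 2 - x.disc * b ^ 2 = b ^ 2 * ((a / b) ^ 2 - x.disc * 1 ^ 2) := by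
          field_simp
        rw [this, h0, mul_zero]
      have e1 : b * (a / b) = a := by field_simp
      refine Or.inr ⟨a / b, hc, ?_⟩
      rw [← V.rho_eltG_smul (a / b) 1 b hc (by rwa [e1, mul_one])]
      congr 2 <;> simp [e1]

theorem stabG0_comm (h2 : (2 : F) ≠ 0) (hx : x.disc ≠ 0) {g g' : G F} (hg : g ∈ stabG0 x)
    (hg' : g' ∈ stabG0 x) : g * g' = g' * g := by
  obtain ⟨a, b, h, rfl⟩ := (mem_stabG0_iff h2 hx g).1 hg
  obtain ⟨a', b', h', rfl⟩ := (mem_stabG0_iff h2 hx g').1 hg'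
  exact V.eltG_comm a b a' b' h h'

theorem stabH0_comm (h2 : (2 : F) ≠ 0) (hx : x.disc ≠ 0) {g g' : GL (Fin 3) F}
    (hg : g ∈ stabH0 x) (hg' : g' ∈ stabH0 x) : g * g' = g' * g := by
  obtain ⟨a, ha, rfl⟩ := (mem_stabH0_iff' h2 hx g).1 hg
  obtain ⟨b, hb, rfl⟩ := (mem_stabH0_iff' h2 hx g').1 hg'
  rw [← map_mul, ← map_mul, stabG0_comm h2 hx ha hb]

theorem torus_mem_stabG0 (h2 : (2 : F) ≠ 0) (hx : x.disc ≠ 0) (t : Fˣ) : torus t ∈ stabG0 x := by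
  rw [mem_stabG0_iff h2 hx]
  have h1 : (1 : F) ^ 2 - x.disc * 0 ^ 2 ≠ 0 := by simp
  refine ⟨(t⁻¹ : Fˣ) * 1, (t⁻¹ : Fˣ) * 0, by simp, ?_⟩
  rw [← V.eltG_mul_torus 1 0 t h1 (by simp), V.eltG_one, one_mul]

end RationalPoints

end

end BinQuad

namespace BinQuad

noncomputable section

/-! ### Function fields of one variable -/

section PlaceBasics

variable {K : Type*} [Field K]

theorem valuation_eq_one_of_pow_eq_one (A : ValuationSubring K) {a : K} {m : ℕ} (hm : 0 < m)
    (h : a ^ m = 1) : A.valuation a = 1 := by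
  have := congr_arg A.valuation h
  rw [map_pow, map_one] at this
  exact (pow_eq_one_iff.1 this).resolve_right hm.ne'

theorem maximalIdeal_place_ne_bot (w : Place K) : IsLocalRing.maximalIdeal w.1 ≠ ⊥ := by
  intro h
  refine w.2 (eq_top_iff.2 fun y _ => ?_)
  by_contra hy
  have h0 : y ≠ 0 := fun h => hy (h ▸ w.1.zero_mem)
  have hlt : w.1.valuation y⁻¹ < 1 := by
    rw [map_inv₀]
    refine inv_lt_one_of_one_lt₀ ?_
    rw [← w.1.valuation_le_one_iff] at hy
    exact not_le.1 hy
  have : (⟨y⁻¹, w.1.mem_of_valuation_le_one _ hlt.le⟩ : w.1) ∈ IsLocalRing.maximalIdeal w.1 :=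
    (w.1.valuation_lt_one_iff _).2 hlt
  rw [h, Ideal.mem_bot] at this
  exact inv_ne_zero h0 (congr_arg Subtype.val this)

end PlaceBasics

section FunctionFields

open IntermediateField
open scoped IntermediateField.algebraAdjoinAdjoin

/-- `K` is a function field of one variable over `Fq`. -/
class IsFunctionFieldOver (Fq K : Type*) [Field Fq] [Field K] [Algebra Fq K] : Prop where
  exists_transcendental : ∃ t : K, Transcendental Fq t ∧ FiniteDimensional Fq⟮t⟯ K

variable (Fq : Type*) {K : Type*} [Field Fq] [Field K] [Algebra Fq K]

/-- The transcendence degree is one, so $s$ alone is a transcendence basis. The field $K$ is then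
algebraic over $\mathbb F_q(s)$ and generated by $t$ together with a basis over $\mathbb F_q(t)$. -/
theorem finiteDimensional_of_transcendental [h : IsFunctionFieldOver Fq K] {s : K}
    (hs : Transcendental Fq s) : FiniteDimensional Fq⟮s⟯ K := by
  obtain ⟨t, ht, hfin⟩ := h.exists_transcendental
  have alg : Algebra.IsAlgebraic (Algebra.adjoin Fq {t}) K := by
    refine ⟨fun y => ?_⟩
    have := Algebra.IsAlgebraic.isAlgebraic (R := Fq⟮t⟯) y
    exact (IntermediateField.isAlgebraic_adjoin_iff).1 this
  have htr : Algebra.trdeg Fq K ≤ 1 := by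
    have := Algebra.IsAlgebraic.trdeg_le_cardinalMk Fq ({t} : Set K)
    simpa using this
  have hind : AlgebraicIndependent Fq (fun _ : Unit => s) :=
    algebraicIndependent_unique_type_iff.2 hs
  have hbas : IsTranscendenceBasis Fq (fun _ : Unit => s) :=
    hind.isTranscendenceBasis_of_lift_trdeg_le_of_finite (by simpa using htr)
  have halg : Algebra.IsAlgebraic Fq⟮s⟯ K := by
    have := hbas.isAlgebraic_field
    rwa [Set.range_const] at this
  let b := Module.finBasis Fq⟮t⟯ K
  have hfin' : FiniteDimensional Fq⟮s⟯ (IntermediateField.adjoin Fq⟮s⟯ (insert t (Set.range b))) := by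
    have : Finite (insert t (Set.range b) : Set K) := Set.toFinite _
    exact IntermediateField.finiteDimensional_adjoin fun y _ =>
      (Algebra.IsAlgebraic.isAlgebraic y).isIntegral
  have htop : IntermediateField.adjoin Fq⟮s⟯ (insert t (Set.range b)) = ⊤ := by
    rw [eq_top_iff]
    intro y _
    set L := IntermediateField.adjoin Fq⟮s⟯ (insert t (Set.range b))
    have htL : t ∈ L := IntermediateField.subset_adjoin _ _ (Set.mem_insert _ _)
    have hle : Fq⟮t⟯ ≤ L.restrictScalars Fq := by
      rw [IntermediateField.adjoin_simple_le_iff]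
      exact htL
    rw [← b.sum_repr y]
    refine sum_mem fun i _ => ?_
    rw [Algebra.smul_def]
    exact mul_mem (hle (b.repr y i).2)
      (IntermediateField.subset_adjoin _ _ (Set.mem_insert_of_mem _ ⟨i, rfl⟩))
  rw [htop] at hfin'
  exact Module.Finite.equiv (IntermediateField.topEquiv (F := Fq⟮s⟯) (E := K)).toLinearEquiv

/-- A nontrivial linear relation can be divided by a power of a non-unit `ϖ`. -/
theorem exists_primitive_relation {R ι : Type*} [CommRing R] [IsDomain R] [WfDvdMonoid R]
    {ϖ : R} (hϖ : ¬ IsUnit ϖ) (φ : R →+* K) (hφ : φ ϖ ≠ 0) [Fintype ι] (f : ι → K) (r : ι → R)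
    (hr : ∃ i, r i ≠ 0) (h : ∑ i, φ (r i) * f i = 0) :
    ∃ r' : ι → R, (∃ i, ¬ ϖ ∣ r' i) ∧ ∑ i, φ (r' i) * f i = 0 := by
  classical
  obtain ⟨i, hi⟩ := hr
  -- The least such `m` is the exponent of the largest power of `ϖ` dividing all coefficients, and
  -- this power is cancelled.
  have hex : ∃ m, ∃ j, ¬ ϖ ^ (m + 1) ∣ r j := by
    obtain ⟨m, hm⟩ := FiniteMultiplicity.of_not_isUnit hϖ hi
    exact ⟨m, i, hm⟩
  obtain ⟨j, hj⟩ := Nat.find_spec hex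
  have hall : ∀ l, ϖ ^ Nat.find hex ∣ r l := by
    intro l
    rcases Nat.eq_zero_or_pos (Nat.find hex) with h0 | h0
    · rw [h0, pow_zero]; exact one_dvd _
    · have := Nat.find_min hex (Nat.sub_lt h0 one_pos)
      push Not at this
      have := this l
      rwa [Nat.sub_add_cancel (show 1 ≤ _ from h0)] at this
  choose r' hr' using hall
  refine ⟨r', ⟨j, fun hd => hj ?_⟩, ?_⟩
  · rw [hr' j, pow_succ]
    exact mul_dvd_mul_left _ hd
  · have : φ ϖ ^ Nat.find hex * ∑ l, φ (r' l) * f l = 0 := by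
      rw [Finset.mul_sum, ← h]
      refine Finset.sum_congr rfl fun l _ => ?_
      rw [hr' l, map_mul, map_pow, mul_assoc]
    exact (mul_eq_zero.1 this).resolve_left (pow_ne_zero _ hφ)

/-- Any `n + 1` elements of `K` satisfy a linear relation with coefficients in `R` that are not
all divisible by `ϖ`. -/
def HasRelations {R : Type*} [CommRing R] (φ : R →+* K) (ϖ : R) (n : ℕ) : Prop :=
  ∀ f : Fin (n + 1) → K, ∃ r : Fin (n + 1) → R, (∃ i, ¬ ϖ ∣ r i) ∧ ∑ i, φ (r i) * f i = 0

/-- Elements dependent over $\mathbb F_q(s)$ are dependent over $\mathbb F_q[s]$ after clearing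
denominators. This feeds the fundamental inequality at the point $s=0$. -/
theorem hasRelations_of_transcendental [IsFunctionFieldOver Fq K] {s : K}
    (hs : Transcendental Fq s) :
    HasRelations (Polynomial.aeval s : Polynomial Fq →ₐ[Fq] K).toRingHom Polynomial.X
      (Module.finrank Fq⟮s⟯ K) := by
  intro f
  have := finiteDimensional_of_transcendental Fq hs
  have hdep : ¬ LinearIndependent (Algebra.adjoin Fq {s}) f := by
    rw [LinearIndependent.iff_fractionRing (Algebra.adjoin Fq {s}) Fq⟮s⟯]
    intro h
    have := h.fintype_card_le_finrank
    simp at this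
  rw [Fintype.not_linearIndependent_iff] at hdep
  obtain ⟨g, hg, i, hi⟩ := hdep
  have hrange : ∀ a : Algebra.adjoin Fq {s}, ∃ p : Polynomial Fq, Polynomial.aeval s p = (a : K) := by
    rintro ⟨a, ha⟩
    rw [Algebra.adjoin_singleton_eq_range_aeval] at ha
    exact ha
  choose P hP using hrange
  refine exists_primitive_relation Polynomial.not_isUnit_X _ ?_ f (fun j => P (g j)) ⟨i, ?_⟩ ?_
  · change Polynomial.aeval s Polynomial.X ≠ 0
    rw [Polynomial.aeval_X]
    rintro rfl
    exact hs (isAlgebraic_zero)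
  · intro h0
    apply hi
    have := hP (g i)
    rw [h0, map_zero] at this
    exact Subtype.ext this.symm
  · rw [← hg]
    refine Finset.sum_congr rfl fun j _ => ?_
    change Polynomial.aeval s (P (g j)) * f j = _
    rw [hP]
    rfl

/-- If `n + 1` elements are always dependent, a vector space has at most `q ^ n` elements. -/
theorem card_le_of_dependent {κ M : Type*} [Field κ] [Finite κ] [AddCommGroup M] [Module κ M]
    {n : ℕ} (h : ∀ f : Fin (n + 1) → M, ¬ LinearIndependent κ f) :
    Finite M ∧ Nat.card M ≤ Nat.card κ ^ n := by
  have hr : Module.rank κ M ≤ n := by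
    refine rank_le fun s hs => ?_
    by_contra! hlt
    obtain ⟨t, hts, htc⟩ := Finset.exists_subset_card_eq (show n + 1 ≤ s.card from hlt)
    have ht : LinearIndependent κ (fun i : t => (i : M)) :=
      hs.comp (fun i : t => (⟨i, hts i.2⟩ : s)) fun a b hab =>
        Subtype.ext (congr_arg (fun z : s => (z : M)) hab)
    exact h _ (ht.comp (t.equivFinOfCardEq htc).symm (Equiv.injective _))
  have hfin : Module.Finite κ M := Module.rank_lt_aleph0_iff.1 (hr.trans_lt (Cardinal.natCast_lt_aleph0))
  refine ⟨Module.finite_of_finite κ, ?_⟩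
  rw [Module.natCard_eq_pow_finrank (K := κ)]
  refine Nat.pow_le_pow_right Nat.card_pos ?_
  rw [← Module.finrank_eq_rank] at hr
  exact_mod_cast hr

/-- The fundamental inequality `∑ e f ≤ n`, in multiplicative form. -/
theorem card_quotients_le {R : Type*} [CommRing R] (φ : R →+* K) (ϖ : R)
    (hmax : (Ideal.span {ϖ}).IsMaximal) [Finite (R ⧸ Ideal.span {ϖ})] {n : ℕ}
    (hrel : HasRelations φ ϖ n) {ι : Type*} (A : ι → ValuationSubring K)
    (hA : ∀ i r, φ r ∈ A i)
    (happ : ∀ a : (i : ι) → A i, ∃ b : K, ∀ i, ∃ c : A i, b = a i + c * φ ϖ) :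
    Finite ((i : ι) → A i ⧸ Ideal.span {(⟨φ ϖ, hA i ϖ⟩ : A i)}) ∧
      Nat.card ((i : ι) → A i ⧸ Ideal.span {(⟨φ ϖ, hA i ϖ⟩ : A i)}) ≤
        Nat.card (R ⧸ Ideal.span {ϖ}) ^ n := by
  let ψ₀ : R →+* ((i : ι) → A i ⧸ Ideal.span {(⟨φ ϖ, hA i ϖ⟩ : A i)}) :=
    RingHom.pi fun i => (Ideal.Quotient.mk _).comp (φ.codRestrict (A i) (hA i))
  have hψ₀ : ∀ a ∈ Ideal.span {ϖ}, ψ₀ a = 0 := by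
    intro a ha
    obtain ⟨b, rfl⟩ := Ideal.mem_span_singleton.1 ha
    have : ψ₀ ϖ = 0 := by
      funext i
      exact Ideal.Quotient.eq_zero_iff_mem.2 (Ideal.mem_span_singleton_self _)
    rw [map_mul, this, zero_mul]
  let ψ := Ideal.Quotient.lift (Ideal.span {ϖ}) ψ₀ hψ₀
  let _ : Field (R ⧸ Ideal.span {ϖ}) := Ideal.Quotient.field _
  let _ : Module (R ⧸ Ideal.span {ϖ}) ((i : ι) → A i ⧸ Ideal.span {(⟨φ ϖ, hA i ϖ⟩ : A i)}) :=
    ψ.toModule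
  -- Each `f j` is lifted to an element `b j` of $K$ that approximates all its components at once. A
  -- primitive relation among the `b j` reduces to a nontrivial relation over the residue field of
  -- `ϖ`.
  refine card_le_of_dependent fun f => ?_
  have hlift : ∀ j i, ∃ a : A i, Ideal.Quotient.mk _ a = f j i :=
    fun j i => Ideal.Quotient.mk_surjective _
  choose a ha using hlift
  choose b c hc using fun j => happ (a j)
  obtain ⟨r, ⟨j, hj⟩, hr⟩ := hrel b
  rw [Fintype.not_linearIndependent_iff]
  refine ⟨fun j => Ideal.Quotient.mk _ (r j), ?_, j, fun h0 => ?_⟩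
  · funext i
    have hsum : (∑ j, φ.codRestrict (A i) (hA i) (r j) * a j i) =
        (⟨φ ϖ, hA i ϖ⟩ : A i) * -∑ j, φ.codRestrict (A i) (hA i) (r j) * c j i := by
      apply Subtype.ext
      push_cast
      rw [← sub_eq_zero, ← hr]
      simp only [hc _ i, mul_add, Finset.sum_add_distrib, mul_neg, sub_neg_eq_add, Finset.mul_sum]
      congr 1
      refine Finset.sum_congr rfl fun j _ => ?_
      change _ * (φ (r j) * _) = φ (r j) * _
      ring
    rw [Finset.sum_apply]
    have : ∀ j, ((Ideal.Quotient.mk (Ideal.span {ϖ}) (r j)) • f j) i =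
        Ideal.Quotient.mk _ (φ.codRestrict (A i) (hA i) (r j) * a j i) := by
      intro j
      rw [map_mul, ha]
      rfl
    rw [Finset.sum_congr rfl fun j _ => this j, ← map_sum, hsum]
    exact Ideal.Quotient.eq_zero_iff_mem.2 (Ideal.mem_span_singleton.2 (dvd_mul_right _ _))
  · exact hj (Ideal.mem_span_singleton.1 (Ideal.Quotient.eq_zero_iff_mem.1 h0))

/-! ### Places are discrete with finite residue fields -/

theorem isMaximal_span_X : (Ideal.span {(Polynomial.X : Polynomial Fq)}).IsMaximal :=
  PrincipalIdealRing.isMaximal_of_irreducible Polynomial.irreducible_X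

theorem card_quotient_X : Nat.card (Polynomial Fq ⧸ Ideal.span {(Polynomial.X : Polynomial Fq)}) =
    Nat.card Fq := by
  have e := Polynomial.quotientSpanXSubCAlgEquiv (0 : Fq)
  rw [map_zero, sub_zero] at e
  exact Nat.card_congr e.toEquiv

variable [Finite Fq]

theorem exists_pow_eq_one_of_isAlgebraic {a : K} (ha : IsAlgebraic Fq a) (h0 : a ≠ 0) :
    ∃ m > 0, a ^ m = 1 := by
  have := IntermediateField.adjoin.finiteDimensional ha.isIntegral
  have : Finite Fq⟮a⟯ := Module.finite_of_finite Fq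
  let u : Fq⟮a⟯ˣ := Units.mk0 (AdjoinSimple.gen Fq a) (by
    intro h
    apply h0
    have := congr_arg (algebraMap Fq⟮a⟯ K) h
    simpa using this)
  obtain ⟨m, hm, h⟩ := (isOfFinOrder_of_finite u).exists_pow_eq_one
  refine ⟨m, hm, ?_⟩
  have := congr_arg (fun u : Fq⟮a⟯ˣ => algebraMap Fq⟮a⟯ K u) h
  simpa [u] using this

theorem valuation_eq_one_of_isAlgebraic (A : ValuationSubring K) {a : K} (ha : IsAlgebraic Fq a)
    (h0 : a ≠ 0) : A.valuation a = 1 := by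
  obtain ⟨m, hm, h⟩ := exists_pow_eq_one_of_isAlgebraic Fq ha h0
  exact valuation_eq_one_of_pow_eq_one A hm h

theorem mem_of_isAlgebraic (A : ValuationSubring K) {a : K} (ha : IsAlgebraic Fq a) : a ∈ A := by
  rcases eq_or_ne a 0 with rfl | h0
  · exact A.zero_mem
  · exact A.mem_of_valuation_le_one _ (valuation_eq_one_of_isAlgebraic Fq A ha h0).le

theorem aeval_mem (A : ValuationSubring K) {s : K} (hs : s ∈ A) (p : Polynomial Fq) :
    Polynomial.aeval s p ∈ A := by
  rw [Polynomial.aeval_eq_sum_range]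
  refine sum_mem fun i _ => ?_
  rw [Algebra.smul_def]
  exact mul_mem (mem_of_isAlgebraic Fq A (isAlgebraic_algebraMap _)) (pow_mem hs _)

/-- Each place lies below a transcendental `s` in its maximal ideal. -/
theorem exists_transcendental_mem_nonunits (w : Place K) :
    ∃ s : K, Transcendental Fq s ∧ w.1.valuation s < 1 := by
  obtain ⟨t, ht⟩ : ∃ t, t ∉ w.1 := by
    by_contra! h
    exact w.2 (eq_top_iff.2 fun y _ => h y)
  have h0 : t ≠ 0 := fun h => ht (h ▸ w.1.zero_mem)
  refine ⟨t⁻¹, fun h => ?_, ?_⟩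
  · have := valuation_eq_one_of_isAlgebraic Fq w.1 h (inv_ne_zero h0)
    rw [map_inv₀, inv_eq_one] at this
    exact ht (w.1.mem_of_valuation_le_one _ this.le)
  · rw [map_inv₀]
    refine inv_lt_one_of_one_lt₀ ?_
    rw [← w.1.valuation_le_one_iff] at ht
    exact not_le.1 ht

instance finite_quotient_X : Finite (Polynomial Fq ⧸ Ideal.span {(Polynomial.X : Polynomial Fq)}) :=
  Nat.finite_of_card_ne_zero (by rw [card_quotient_X]; exact Nat.card_pos.ne')

/-- With a single valuation ring the approximation hypothesis of `card_quotients_le` is void, so the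
inequality is available before weak approximation is known. -/
theorem finite_quotient_of_transcendental [IsFunctionFieldOver Fq K] (A : ValuationSubring K) (s : A)
    (hs : Transcendental Fq (s : K)) : Finite (A ⧸ Ideal.span {s}) := by
  have := (card_quotients_le (K := K)
    (Polynomial.aeval (s : K) : Polynomial Fq →ₐ[Fq] K).toRingHom Polynomial.X
    (isMaximal_span_X Fq) (hasRelations_of_transcendental Fq hs) (fun _ : Unit => A)
    (fun _ p => aeval_mem Fq A s.2 p) (fun a => ⟨a (), fun _ => ⟨0, by simp⟩⟩)).1
  have hs' : ∀ h, (⟨(Polynomial.aeval (s : K) : Polynomial Fq →ₐ[Fq] K).toRingHom Polynomial.X, h⟩ : A)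
      = s := fun h => Subtype.ext (Polynomial.aeval_X _)
  simp only [hs'] at this
  exact Finite.of_equiv _ (Equiv.funUnique Unit (A ⧸ Ideal.span {s}))

/-- Nonzero elements divide a power of `s`. -/
theorem exists_dvd_pow [IsFunctionFieldOver Fq K] (w : Place K) {s : K} (hs : Transcendental Fq s)
    (hs1 : w.1.valuation s < 1) {y : K} (hy : y ≠ 0) :
    ∃ j : ℕ, w.1.valuation (s ^ j) ≤ w.1.valuation y := by
  rcases le_or_gt 1 (w.1.valuation y) with h1 | h1
  · exact ⟨0, by simpa using h1⟩
  have := finiteDimensional_of_transcendental Fq hs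
  have halg : IsAlgebraic (Algebra.adjoin Fq {s}) y :=
    IntermediateField.isAlgebraic_adjoin_iff.1 (Algebra.IsAlgebraic.isAlgebraic (R := Fq⟮s⟯) y)
  obtain ⟨p, hp0, hp⟩ := halg.exists_nonzero_coeff_and_aeval_eq_zero (mem_nonZeroDivisors_of_ne_zero hy)
  have hsA : s ∈ w.1 := w.1.mem_of_valuation_le_one _ hs1.le
  have hmemA : ∀ a : Algebra.adjoin Fq {s}, ∃ q : Polynomial Fq, Polynomial.aeval s q = (a : K) := by
    rintro ⟨a, ha⟩
    rw [Algebra.adjoin_singleton_eq_range_aeval] at ha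
    exact ha
  -- In an equation for $y$ over $\mathbb F_q[s]$ the constant term is a multiple of $y$ in the
  -- valuation ring. It therefore suffices to bound the valuation of a polynomial in $s$.
  have hle : w.1.valuation (p.coeff 0 : K) ≤ w.1.valuation y := by
    rw [← p.divX_mul_X_add, map_add, map_mul, Polynomial.aeval_X, Polynomial.aeval_C] at hp
    have h : (p.coeff 0 : K) = -(Polynomial.aeval y p.divX) * y := by
      rw [neg_mul]; exact eq_neg_of_add_eq_zero_right hp
    rw [h, map_mul]
    refine mul_le_of_le_one_left' ?_
    rw [w.1.valuation_le_one_iff]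
    refine neg_mem ?_
    rw [Polynomial.aeval_eq_sum_range]
    refine sum_mem fun i _ => ?_
    rw [Algebra.smul_def]
    refine mul_mem ?_ (pow_mem (w.1.mem_of_valuation_le_one _ h1.le) _)
    obtain ⟨q, hq⟩ := hmemA (p.divX.coeff i)
    change ((p.divX.coeff i : Algebra.adjoin Fq {s}) : K) ∈ w.1
    rw [← hq]
    exact aeval_mem Fq w.1 hsA q
  obtain ⟨P, hP⟩ := hmemA (p.coeff 0)
  have hP0 : P ≠ 0 := by
    rintro rfl
    exact hp0 (Subtype.ext (by rw [← hP, map_zero]; rfl))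
  obtain ⟨Q, hQ, hXQ⟩ := (FiniteMultiplicity.of_not_isUnit
    Polynomial.not_isUnit_X hP0).exists_eq_pow_mul_and_not_dvd
  refine ⟨multiplicity Polynomial.X P, le_trans (le_of_eq ?_) hle⟩
  rw [Polynomial.X_dvd_iff] at hXQ
  -- The constant term of `Q` is a nonzero constant, of valuation one, and all other terms are
  -- divisible by $s$.
  have hQ1 : w.1.valuation (Polynomial.aeval s Q) = 1 := by
    rw [← Q.divX_mul_X_add, map_add, map_mul, Polynomial.aeval_X, Polynomial.aeval_C]
    have hc : w.1.valuation (algebraMap Fq K (Q.coeff 0)) = 1 :=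
      valuation_eq_one_of_isAlgebraic Fq w.1 (isAlgebraic_algebraMap _) (by simpa using hXQ)
    rw [← hc]
    refine Valuation.map_add_eq_of_lt_right w.1.valuation ?_
    rw [hc, map_mul]
    exact mul_lt_one_of_nonneg_of_lt_one_right
      ((w.1.valuation_le_one_iff _).2 (aeval_mem Fq w.1 hsA Q.divX)) zero_le hs1
  have := congr_arg (fun p => w.1.valuation (Polynomial.aeval s p)) hQ
  simp only [map_mul, map_pow, Polynomial.aeval_X, hQ1, mul_one] at this
  rw [← hP, this, map_pow]

/-- A nonzero ideal contains a positive power of a transcendental $s$ of the maximal ideal, and the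
quotient by that power is finite by the fundamental inequality. -/
theorem hasFiniteQuotients_place [IsFunctionFieldOver Fq K] (w : Place K) :
    Ring.HasFiniteQuotients w.1 := by
  refine ⟨fun {I} hI => ?_⟩
  obtain ⟨s, hs, hs1⟩ := exists_transcendental_mem_nonunits Fq w
  obtain ⟨y, hyI, hy0⟩ := Submodule.exists_mem_ne_zero_of_ne_bot hI
  have hsA : s ∈ w.1 := w.1.mem_of_valuation_le_one _ hs1.le
  obtain ⟨j, hj⟩ := exists_dvd_pow Fq w hs hs1 (y := (y : K)) (by simpa using hy0)
  have hj' : w.1.valuation (s ^ (j + 1)) ≤ w.1.valuation (y : K) := by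
    refine le_trans ?_ hj
    rw [pow_succ, map_mul]
    exact mul_le_of_le_one_right' hs1.le
  -- The exponent is `j + 1` because `j` may be zero, and the power has to remain transcendental.
  have := finite_quotient_of_transcendental Fq w.1 ⟨s ^ (j + 1), pow_mem hsA _⟩
    (hs.pow (Nat.succ_pos j))
  refine Finite.of_surjective _ (Ideal.Quotient.factor_surjective
    (S := Ideal.span {(⟨s ^ (j + 1), pow_mem hsA _⟩ : w.1)}) (T := I) ?_)
  rw [Ideal.span_singleton_le_iff_mem]
  obtain ⟨a, ha⟩ := (w.1.valuation_le_iff _ _).1 hj'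
  have : (⟨s ^ (j + 1), pow_mem hsA _⟩ : w.1) = a * y := Subtype.ext ha.symm
  rw [this]
  exact I.mul_mem_left _ hyI

/-- Finite quotients make the ring Noetherian, and a Noetherian valuation ring that is not a field
is discrete. -/
theorem isDiscreteValuationRing_place [IsFunctionFieldOver Fq K] (w : Place K) :
    IsDiscreteValuationRing w.1 := by
  have := hasFiniteQuotients_place Fq w
  exact { not_a_field' := maximalIdeal_place_ne_bot w }

theorem finite_residueField_place [IsFunctionFieldOver Fq K] (w : Place K) :
    Finite (IsLocalRing.ResidueField w.1) := by
  have := hasFiniteQuotients_place Fq w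
  exact Ring.HasFiniteQuotients.finiteQuotient (maximalIdeal_place_ne_bot w)

end FunctionFields

end

end BinQuad

namespace BinQuad

noncomputable section

/-! ### Orders at discrete places -/

/-- All places of `K` are discrete, with finite residue fields. -/
class DiscretePlaces (K : Type*) [Field K] : Prop where
  dvr : ∀ w : Place K, IsDiscreteValuationRing w.1
  finite_residueField : ∀ w : Place K, Finite (IsLocalRing.ResidueField w.1)

attribute [instance] DiscretePlaces.dvr DiscretePlaces.finite_residueField

theorem IsFunctionFieldOver.discretePlaces (Fq K : Type*) [Field Fq] [Field K] [Algebra Fq K]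
    [Finite Fq] [IsFunctionFieldOver Fq K] : DiscretePlaces K :=
  ⟨isDiscreteValuationRing_place Fq, finite_residueField_place Fq⟩

namespace Place

theorem valuation_one_add_of_lt {K : Type*} [Field K] (w : Place K) {z : K}
    (h : w.1.valuation z < 1) : w.1.valuation (1 + z) = 1 :=
  Valuation.map_one_add_of_lt _ h

theorem valuation_one_add_of_gt {K : Type*} [Field K] (w : Place K) {z : K}
    (h : 1 < w.1.valuation z) : w.1.valuation (1 + z) = w.1.valuation z :=
  Valuation.map_add_eq_of_lt_right _ (by rwa [map_one])

variable {K : Type*} [Field K] [DiscretePlaces K] (w : Place K)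

/-- A uniformizer at `w`. -/
def unif : K := (IsDiscreteValuationRing.exists_irreducible w.1).choose

theorem unif_mem : w.unif ∈ w.1 := (IsDiscreteValuationRing.exists_irreducible w.1).choose.2

theorem irreducible_unif : Irreducible (⟨w.unif, w.unif_mem⟩ : w.1) :=
  (IsDiscreteValuationRing.exists_irreducible w.1).choose_spec

theorem unif_ne_zero : w.unif ≠ 0 := fun h => w.irreducible_unif.ne_zero (Subtype.ext h)

theorem valuation_unif_lt_one : w.1.valuation w.unif < 1 :=
  (w.1.valuation_lt_one_iff ⟨w.unif, w.unif_mem⟩).1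
    ((IsLocalRing.mem_maximalIdeal _).2 w.irreducible_unif.not_isUnit)

theorem valuation_unif_pos : 0 < w.1.valuation w.unif :=
  (Valuation.pos_iff _).2 w.unif_ne_zero

theorem valuation_irreducible {ϖ : w.1} (h : Irreducible ϖ) :
    w.1.valuation (ϖ : K) = w.1.valuation w.unif := by
  obtain ⟨u, hu⟩ := IsDiscreteValuationRing.associated_of_irreducible w.1 w.irreducible_unif h
  rw [← hu]
  push_cast
  rw [map_mul, w.1.valuation_unit, mul_one]

theorem exists_valuation_eq {f : K} (hf : f ≠ 0) :
    ∃ n : ℤ, w.1.valuation f = w.1.valuation w.unif ^ n := by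
  have key : ∀ f : w.1, f ≠ 0 → ∃ n : ℕ, w.1.valuation (f : K) = w.1.valuation w.unif ^ n := by
    intro f hf
    obtain ⟨n, u, hu⟩ := IsDiscreteValuationRing.eq_unit_mul_pow_irreducible hf w.irreducible_unif
    refine ⟨n, ?_⟩
    rw [hu]
    push_cast
    rw [map_mul, w.1.valuation_unit, one_mul, map_pow]
  rcases w.1.mem_or_inv_mem f with h | h
  · obtain ⟨n, hn⟩ := key ⟨f, h⟩ (fun h0 => hf (congr_arg Subtype.val h0))
    exact ⟨n, by simpa using hn⟩
  · obtain ⟨n, hn⟩ := key ⟨f⁻¹, h⟩ (fun h0 => inv_ne_zero hf (congr_arg Subtype.val h0))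
    refine ⟨-n, ?_⟩
    rw [zpow_neg, zpow_natCast, ← hn]
    simp

/-- The order of `f` at `w`. -/
def ord (f : K) : ℤ :=
  open Classical in if hf : f ≠ 0 then (w.exists_valuation_eq hf).choose else 0

theorem valuation_eq {f : K} (hf : f ≠ 0) :
    w.1.valuation f = w.1.valuation w.unif ^ w.ord f := by
  rw [ord, dif_pos hf]
  exact (w.exists_valuation_eq hf).choose_spec

theorem zpow_le_zpow_unif_iff {m n : ℤ} :
    w.1.valuation w.unif ^ m ≤ w.1.valuation w.unif ^ n ↔ n ≤ m :=
  zpow_le_zpow_iff_right_of_lt_one₀ w.valuation_unif_pos w.valuation_unif_lt_one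

theorem zpow_unif_injective : Function.Injective fun n : ℤ => w.1.valuation w.unif ^ n :=
  fun _ _ h => le_antisymm (w.zpow_le_zpow_unif_iff.1 h.ge) (w.zpow_le_zpow_unif_iff.1 h.le)

theorem valuation_le_iff_ord {f g : K} (hf : f ≠ 0) (hg : g ≠ 0) :
    w.1.valuation f ≤ w.1.valuation g ↔ w.ord g ≤ w.ord f := by
  rw [w.valuation_eq hf, w.valuation_eq hg, zpow_le_zpow_unif_iff]

theorem valuation_lt_iff_ord {f g : K} (hf : f ≠ 0) (hg : g ≠ 0) :
    w.1.valuation f < w.1.valuation g ↔ w.ord g < w.ord f := by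
  rw [← not_le, ← not_le, w.valuation_le_iff_ord hg hf]

theorem ord_eq_of_valuation_eq {f : K} (hf : f ≠ 0) {n : ℤ}
    (h : w.1.valuation f = w.1.valuation w.unif ^ n) : w.ord f = n :=
  w.zpow_unif_injective ((w.valuation_eq hf).symm.trans h)

theorem ord_mul {f g : K} (hf : f ≠ 0) (hg : g ≠ 0) : w.ord (f * g) = w.ord f + w.ord g := by
  apply w.ord_eq_of_valuation_eq (mul_ne_zero hf hg)
  rw [map_mul, w.valuation_eq hf, w.valuation_eq hg, zpow_add₀ w.valuation_unif_pos.ne']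

theorem ord_one : w.ord 1 = 0 := w.ord_eq_of_valuation_eq one_ne_zero (by simp)

theorem ord_inv {f : K} (hf : f ≠ 0) : w.ord f⁻¹ = -w.ord f := by
  apply w.ord_eq_of_valuation_eq (inv_ne_zero hf)
  rw [map_inv₀, w.valuation_eq hf, zpow_neg]

theorem ord_div {f g : K} (hf : f ≠ 0) (hg : g ≠ 0) : w.ord (f / g) = w.ord f - w.ord g := by
  rw [div_eq_mul_inv, w.ord_mul hf (inv_ne_zero hg), w.ord_inv hg, sub_eq_add_neg]

theorem ord_pow {f : K} (hf : f ≠ 0) (n : ℕ) : w.ord (f ^ n) = n * w.ord f := by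
  apply w.ord_eq_of_valuation_eq (pow_ne_zero _ hf)
  rw [map_pow, w.valuation_eq hf, ← zpow_natCast, ← zpow_mul, mul_comm]

theorem ord_zpow {f : K} (hf : f ≠ 0) (n : ℤ) : w.ord (f ^ n) = n * w.ord f := by
  apply w.ord_eq_of_valuation_eq (zpow_ne_zero _ hf)
  rw [map_zpow₀, w.valuation_eq hf, ← zpow_mul, mul_comm]

theorem ord_unif : w.ord w.unif = 1 := w.ord_eq_of_valuation_eq w.unif_ne_zero (by simp)

theorem ord_zero : w.ord 0 = 0 := by simp [ord]

theorem ord_nonneg_iff {f : K} (hf : f ≠ 0) : 0 ≤ w.ord f ↔ f ∈ w.1 := by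
  rw [← w.1.valuation_le_one_iff, ← map_one w.1.valuation, w.valuation_le_iff_ord hf one_ne_zero,
    ord_one]

theorem ord_pos_iff {f : K} (hf : f ≠ 0) : 0 < w.ord f ↔ w.1.valuation f < 1 := by
  rw [← map_one w.1.valuation, w.valuation_lt_iff_ord hf one_ne_zero, ord_one]

theorem ord_eq_zero_iff {f : K} (hf : f ≠ 0) : w.ord f = 0 ↔ w.1.valuation f = 1 := by
  rw [w.valuation_eq hf]
  exact ⟨fun h => by rw [h, zpow_zero],
    fun h => w.zpow_unif_injective (h.trans (zpow_zero _).symm)⟩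

theorem ord_neg (f : K) : w.ord (-f) = w.ord f := by
  rcases eq_or_ne f 0 with rfl | hf
  · rw [neg_zero]
  · exact w.ord_eq_of_valuation_eq (neg_ne_zero.2 hf) (by rw [Valuation.map_neg, w.valuation_eq hf])

theorem exists_pow_lt {x y : K} (hx : w.1.valuation x < 1) (hy : y ≠ 0) :
    ∃ N₀ : ℕ, ∀ N ≥ N₀, w.1.valuation x ^ N < w.1.valuation y := by
  rcases eq_or_ne x 0 with rfl | hx0
  · refine ⟨1, fun N hN => ?_⟩
    rw [map_zero, zero_pow (by omega)]
    exact (Valuation.pos_iff _).2 hy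
  · refine ⟨(w.ord y + 1).toNat, fun N hN => ?_⟩
    rw [← map_pow, w.valuation_lt_iff_ord (pow_ne_zero _ hx0) hy, w.ord_pow hx0]
    have h1 : 1 ≤ w.ord x := (w.ord_pos_iff hx0).2 hx
    have h2 : w.ord y + 1 ≤ N := by omega
    nlinarith

/-! ### Weak approximation -/

/-- A discrete valuation ring is maximal among proper subrings of its field. If $y$ lies only in the
larger ring, any $z$ is $(z y^{-N})\,y^N$ with the first factor integral for large $N$. -/
theorem le_iff_eq {w w' : Place K} : w.1 ≤ w'.1 ↔ w = w' := by
  refine ⟨fun h => ?_, fun h => h ▸ le_rfl⟩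
  refine Subtype.ext (le_antisymm h fun y hy => ?_)
  by_contra hyw
  have hy0 : y ≠ 0 := fun h0 => hyw (h0 ▸ w.1.zero_mem)
  apply w'.2
  rw [eq_top_iff]
  intro z _
  rcases eq_or_ne z 0 with rfl | hz
  · exact w'.1.zero_mem
  have hlt : w.1.valuation y⁻¹ < 1 := by
    rw [map_inv₀]
    refine inv_lt_one_of_one_lt₀ ?_
    rw [← w.1.valuation_le_one_iff] at hyw
    exact not_le.1 hyw
  obtain ⟨N, hN⟩ := w.exists_pow_lt hlt (inv_ne_zero hz)
  have h1 : z * (y⁻¹) ^ N ∈ w.1 := by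
    rw [← w.1.valuation_le_one_iff, map_mul, map_pow]
    have := (hN N le_rfl).le
    rw [map_inv₀ _ z] at this
    have hz' : 0 < w.1.valuation z := (Valuation.pos_iff _).2 hz
    calc _ ≤ w.1.valuation z * (w.1.valuation z)⁻¹ := by gcongr
      _ = 1 := mul_inv_cancel₀ hz'.ne'
  have := mul_mem (h h1) (pow_mem hy N)
  rwa [mul_assoc, ← mul_pow, inv_mul_cancel₀ hy0, one_pow, mul_one] at this

theorem exists_one_lt_lt_one {w w' : Place K} (h : w ≠ w') :
    ∃ z, 1 < w.1.valuation z ∧ w'.1.valuation z < 1 := by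
  obtain ⟨a, ha, ha'⟩ := SetLike.not_le_iff_exists.1 (mt le_iff_eq.1 h)
  obtain ⟨b, hb', hb⟩ := SetLike.not_le_iff_exists.1 (mt le_iff_eq.1 h.symm)
  rw [← ValuationSubring.valuation_le_one_iff] at ha ha' hb hb'
  have ha0 : a ≠ 0 := by rintro rfl; simp at ha'
  rw [not_le] at ha' hb
  refine ⟨b / a, ?_, ?_⟩
  · rw [map_div₀, one_lt_div₀ ((Valuation.pos_iff _).2 ha0)]
    exact ha.trans_lt hb
  · rw [map_div₀, div_lt_one₀ ((Valuation.pos_iff _).2 ha0)]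
    exact hb'.trans_lt ha'

/-- Induction of Artin and Whaples. With $z$ from the smaller set and $y$ separating $w$ from the
new place, $z^Ny$ works if $z$ is integral at the new place, and $\frac{z^N}{1+z^N}\,y$ otherwise.
-/
theorem exists_one_lt_forall_lt_one (W : Finset (Place K)) (hw : w ∉ W) :
    ∃ z, 1 < w.1.valuation z ∧ ∀ w' ∈ W, w'.1.valuation z < 1 := by
  classical
  induction W using Finset.induction_on with
  | empty =>
    refine ⟨w.unif⁻¹, ?_, by simp⟩
    rw [map_inv₀]
    exact (one_lt_inv₀ w.valuation_unif_pos).2 w.valuation_unif_lt_one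
  | insert w₁ W hw₁ ih =>
    rw [Finset.mem_insert, not_or] at hw
    obtain ⟨z, hz, hzW⟩ := ih hw.2
    obtain ⟨y, hy, hy₁⟩ := exists_one_lt_lt_one hw.1
    have hy0 : y ≠ 0 := by rintro rfl; simp at hy
    have hN : ∃ N : ℕ, 0 < N ∧ ∀ w' ∈ W, w'.1.valuation z ^ N < w'.1.valuation y⁻¹ := by
      choose! N₀ hN₀ using fun w' (hw' : w' ∈ W) => w'.exists_pow_lt (hzW w' hw') (inv_ne_zero hy0)
      refine ⟨W.sup N₀ + 1, Nat.succ_pos _, fun w' hw' => hN₀ w' hw' _ ?_⟩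
      exact (Finset.le_sup hw').trans (Nat.le_succ _)
    obtain ⟨N, hN0, hN⟩ := hN
    have hsmall : ∀ w' ∈ W, w'.1.valuation z ^ N * w'.1.valuation y < 1 := by
      intro w' hw'
      have h0 : 0 < w'.1.valuation y := (Valuation.pos_iff _).2 hy0
      have := mul_lt_mul_of_pos_right (hN w' hw') h0
      rwa [map_inv₀, inv_mul_cancel₀ h0.ne'] at this
    by_cases hz₁ : w₁.1.valuation z ≤ 1
    · refine ⟨z ^ N * y, ?_, ?_⟩
      · rw [map_mul, map_pow]
        exact one_lt_mul_of_le_of_lt (one_le_pow_of_one_le' hz.le _) hy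
      · intro w' hw'
        rw [map_mul, map_pow]
        rcases Finset.mem_insert.1 hw' with rfl | hw'
        · exact mul_lt_one_of_nonneg_of_lt_one_right (pow_le_one' hz₁ _) zero_le hy₁
        · exact hsmall w' hw'
    · rw [not_le] at hz₁
      refine ⟨z ^ N / (1 + z ^ N) * y, ?_, ?_⟩
      · have h1 : 1 < w.1.valuation (z ^ N) := by
          rw [map_pow]; exact one_lt_pow₀ hz hN0.ne'
        rw [map_mul, map_div₀, w.valuation_one_add_of_gt h1,
          div_self (zero_lt_one.trans h1).ne', one_mul]
        exact hy
      · intro w' hw'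
        rcases Finset.mem_insert.1 hw' with rfl | hw'
        · have h1 : 1 < w'.1.valuation (z ^ N) := by
            rw [map_pow]; exact one_lt_pow₀ hz₁ hN0.ne'
          rw [map_mul, map_div₀, w'.valuation_one_add_of_gt h1,
            div_self (zero_lt_one.trans h1).ne', one_mul]
          exact hy₁
        · have h1 : w'.1.valuation (z ^ N) < 1 := by
            rw [map_pow]; exact pow_lt_one₀ zero_le (hzW w' hw') hN0.ne'
          rw [map_mul, map_div₀, w'.valuation_one_add_of_lt h1, div_one, map_pow]
          exact hsmall w' hw'

/-- The elements $z^N/(1+z^N)$ tend to $1$ where $z$ is large and to $0$ where $z$ is small. -/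
theorem exists_close_to_one (W : Finset (Place K)) (hw : w ∉ W) (b : Place K → K)
    (hb : ∀ w', b w' ≠ 0) : ∃ e, w.1.valuation (e - 1) < w.1.valuation (b w) ∧
      ∀ w' ∈ W, w'.1.valuation e < w'.1.valuation (b w') := by
  obtain ⟨z, hz, hzW⟩ := w.exists_one_lt_forall_lt_one W hw
  have hz0 : z ≠ 0 := by rintro rfl; simp at hz
  have hz' : w.1.valuation z⁻¹ < 1 := by
    rw [map_inv₀]; exact inv_lt_one_of_one_lt₀ hz
  obtain ⟨N₁, hN₁⟩ := w.exists_pow_lt hz' (hb w)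
  choose! N₀ hN₀ using fun w' (hw' : w' ∈ W) => w'.exists_pow_lt (hzW w' hw') (hb w')
  set N := N₁ + W.sup N₀ + 1 with hN
  have h1 : 1 < w.1.valuation (z ^ N) := by
    rw [map_pow]; exact one_lt_pow₀ hz (by omega)
  have h1' : 1 + z ^ N ≠ 0 := by
    intro h0
    have := w.valuation_one_add_of_gt h1
    rw [h0, map_zero] at this
    exact (zero_lt_one.trans h1).ne this
  refine ⟨z ^ N / (1 + z ^ N), ?_, fun w' hw' => ?_⟩
  · have : z ^ N / (1 + z ^ N) - 1 = -(1 + z ^ N)⁻¹ := by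
      field_simp
      ring
    rw [this, Valuation.map_neg, map_inv₀, w.valuation_one_add_of_gt h1, ← map_inv₀, ← inv_pow,
      map_pow]
    exact hN₁ _ (by omega)
  · have h2 : w'.1.valuation (z ^ N) < 1 := by
      rw [map_pow]; exact pow_lt_one₀ zero_le (hzW w' hw') (by omega)
    rw [map_div₀, w'.valuation_one_add_of_lt h2, div_one, map_pow]
    refine hN₀ w' hw' _ ?_
    have := Finset.le_sup (f := N₀) hw'
    omega

theorem weak_approximation (W : Finset (Place K)) (a b : Place K → K) (hb : ∀ w, b w ≠ 0) :
    ∃ f, ∀ w ∈ W, w.1.valuation (f - a w) < w.1.valuation (b w) := by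
  classical
  have hex : ∀ w : Place K, ∃ e, w.1.valuation (a w * (e - 1)) < w.1.valuation (b w) ∧
      ∀ w' ∈ W.erase w, w'.1.valuation (a w * e) < w'.1.valuation (b w') := by
    intro w
    rcases eq_or_ne (a w) 0 with h0 | h0
    · refine ⟨0, ?_, fun w' _ => ?_⟩ <;> rw [h0, zero_mul, map_zero] <;>
        exact (Valuation.pos_iff _).2 (hb _)
    · obtain ⟨e, he, heW⟩ := w.exists_close_to_one (W.erase w) (by simp)
        (fun w' => b w' / a w) (fun w' => div_ne_zero (hb w') h0)
      refine ⟨e, ?_, fun w' hw' => ?_⟩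
      · have h1 : 0 < w.1.valuation (a w) := (Valuation.pos_iff _).2 h0
        rwa [map_div₀, lt_div_iff₀ h1, ← map_mul, mul_comm] at he
      · have h1 : 0 < w'.1.valuation (a w) := (Valuation.pos_iff _).2 h0
        have := heW w' hw'
        rwa [map_div₀, lt_div_iff₀ h1, ← map_mul, mul_comm] at this
  choose e he heW using hex
  refine ⟨∑ w ∈ W, a w * e w, fun w hw => ?_⟩
  have : ∑ w ∈ W, a w * e w - a w = a w * (e w - 1) + ∑ w' ∈ W.erase w, a w' * e w' := by
    rw [← Finset.add_sum_erase W _ hw]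
    ring
  rw [this]
  refine Valuation.map_add_lt _ (he w) ?_
  refine Valuation.map_sum_lt _ ((Valuation.ne_zero_iff _).2 (hb w)) fun w' hw' => ?_
  rw [Finset.mem_erase] at hw'
  exact heW w' w (Finset.mem_erase.2 ⟨hw'.1.symm, hw⟩)

/-- An element with prescribed orders at finitely many places. -/
theorem exists_ord_eq (W : Finset (Place K)) (n : Place K → ℤ) :
    ∃ f : K, f ≠ 0 ∧ ∀ w ∈ W, w.ord f = n w := by
  rcases W.eq_empty_or_nonempty with rfl | ⟨w₀, hw₀⟩
  · exact ⟨1, one_ne_zero, by simp⟩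
  obtain ⟨f, hf⟩ := weak_approximation W (fun w => w.unif ^ n w) (fun w => w.unif ^ n w)
    fun w => zpow_ne_zero _ w.unif_ne_zero
  have hval : ∀ w ∈ W, w.1.valuation f = w.1.valuation w.unif ^ n w := by
    intro w hw
    have := Valuation.map_add_eq_of_lt_right _ (hf w hw)
    rw [sub_add_cancel, map_zpow₀] at this
    exact this
  have hf0 : f ≠ 0 := by
    rintro rfl
    have := hval w₀ hw₀
    rw [map_zero] at this
    exact zpow_ne_zero _ w₀.valuation_unif_pos.ne' this.symm
  exact ⟨f, hf0, fun w hw => w.ord_eq_of_valuation_eq hf0 (hval w hw)⟩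

end Place

end

end BinQuad

namespace BinQuad

noncomputable section

open IntermediateField

namespace Place

variable {K : Type*} [Field K] [DiscretePlaces K] (w : Place K)

theorem one_lt_card : 1 < w.card := Finite.one_lt_card

theorem card_pos : 0 < w.card := zero_lt_one.trans w.one_lt_card

theorem natCard_quotient_span {f : w.1} (hf : f ≠ 0) {n : ℕ} (hn : w.ord (f : K) = n) :
    Nat.card (w.1 ⧸ Ideal.span {f}) = w.card ^ n := by
  have h : Ideal.span {f} = IsLocalRing.maximalIdeal w.1 ^ n := by
    rw [w.irreducible_unif.maximalIdeal_eq, Ideal.span_singleton_pow,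
      Ideal.span_singleton_eq_span_singleton]
    have hf' : (f : K) ≠ 0 := fun h => hf (Subtype.ext h)
    have hv : w.1.valuation (f : K) = w.1.valuation (w.unif ^ n) := by
      rw [w.valuation_eq hf', hn, zpow_natCast, map_pow]
    obtain ⟨u, hu⟩ := (w.1.valuation_eq_iff _ _).1 hv
    refine Associated.symm ⟨u, Subtype.ext ?_⟩
    push_cast
    rw [mul_comm]
    exact hu
  rw [h]
  exact cardQuot_pow_of_prime (P := IsLocalRing.maximalIdeal w.1)
    (maximalIdeal_place_ne_bot w)

end Place

/-! ### The fundamental inequality for zeros of an element -/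

section Zeros

variable (Fq : Type*) {K : Type*} [Field Fq] [Field K] [Algebra Fq K] [Finite Fq]
  [IsFunctionFieldOver Fq K] [DiscretePlaces K]

/-- The fundamental inequality for places of `K` above a discrete place of a subring. -/
theorem prod_card_pow_ord_le {R : Type*} [CommRing R] (φ : R →+* K) (ϖ : R)
    (hmax : (Ideal.span {ϖ}).IsMaximal) [Finite (R ⧸ Ideal.span {ϖ})] {n : ℕ}
    (hrel : HasRelations φ ϖ n) (hϖ : φ ϖ ≠ 0) (W : Finset (Place K))
    (hW : ∀ w ∈ W, ∀ r, φ r ∈ w.1) :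
    ∏ w ∈ W, w.card ^ (w.ord (φ ϖ)).toNat ≤ Nat.card (R ⧸ Ideal.span {ϖ}) ^ n := by
  have h := (card_quotients_le φ ϖ hmax hrel (fun w : W => w.1.1) (fun w r => hW w.1 w.2 r) ?_).2
  · rw [Nat.card_pi] at h
    rw [← Finset.prod_coe_sort]
    refine le_of_eq_of_le (Finset.prod_congr rfl fun w _ => ?_) h
    refine (Place.natCard_quotient_span _ (fun h => hϖ (congr_arg Subtype.val h)) ?_).symm
    exact (Int.toNat_of_nonneg ((w.1.ord_nonneg_iff hϖ).2 (hW w.1 w.2 ϖ))).symm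
  · intro a
    classical
    obtain ⟨b, hb⟩ := Place.weak_approximation W
      (fun w => if h : w ∈ W then (a ⟨w, h⟩ : K) else 0) (fun _ => φ ϖ) (fun _ => hϖ)
    refine ⟨b, fun w => ?_⟩
    have := hb w.1 w.2
    rw [dif_pos w.2] at this
    obtain ⟨c, hc⟩ := (w.1.1.valuation_le_iff _ _).1 this.le
    exact ⟨c, by rw [hc]; ring⟩

/-- The subring is $\mathbb F_q[s]$ and the element is $s$. In additive form, the degree of the
divisor of zeros of $s$ is at most $[K:\mathbb F_q(s)]$. -/
theorem prod_zeros_le {s : K} (hs : Transcendental Fq s) (W : Finset (Place K))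
    (hW : ∀ w ∈ W, w.1.valuation s < 1) :
    ∏ w ∈ W, w.card ^ (w.ord s).toNat ≤ Nat.card Fq ^ Module.finrank Fq⟮s⟯ K := by
  have hX : (Polynomial.aeval s : Polynomial Fq →ₐ[Fq] K).toRingHom Polynomial.X = s :=
    Polynomial.aeval_X s
  have h := prod_card_pow_ord_le (K := K)
    (Polynomial.aeval s : Polynomial Fq →ₐ[Fq] K).toRingHom Polynomial.X
    (isMaximal_span_X Fq) (hasRelations_of_transcendental Fq hs)
    (by rw [hX]; rintro rfl; exact hs isAlgebraic_zero) W
    (fun w hw p => aeval_mem Fq w.1 (w.1.mem_of_valuation_le_one _ (hW w hw).le) p)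
  rwa [hX, card_quotient_X] at h

end Zeros

theorem finite_zeros (Fq : Type*) {K : Type*} [Field Fq] [Field K] [Algebra Fq K]
    [Finite Fq] [IsFunctionFieldOver Fq K] [DiscretePlaces K] {s : K} (hs : s ≠ 0) : {w : Place K | w.1.valuation s < 1}.Finite := by
  by_cases halg : IsAlgebraic Fq s
  · convert Set.finite_empty
    rw [Set.eq_empty_iff_forall_notMem]
    intro w hw
    exact hw.ne (valuation_eq_one_of_isAlgebraic Fq w.1 halg hs)
  · by_contra hinf
    -- Each zero contributes at least $2$ to a product bounded by $B=q^n$, so $B$ zeros are already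
    -- too many because $2^B>B$.
    obtain ⟨W, hW, hWc⟩ := Set.Infinite.exists_subset_card_eq hinf
      (Nat.card Fq ^ Module.finrank Fq⟮s⟯ K)
    have h1 := prod_zeros_le Fq halg W fun w hw => hW hw
    have h2 : 2 ^ W.card ≤ ∏ w ∈ W, w.card ^ (w.ord s).toNat := by
      rw [← Finset.prod_const]
      refine Finset.prod_le_prod' fun w hw => ?_
      have h3 : 0 < w.ord s := (w.ord_pos_iff hs).2 (hW hw)
      calc 2 ≤ w.card := w.one_lt_card
        _ ≤ w.card ^ (w.ord s).toNat := Nat.le_self_pow (by omega) _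
    rw [hWc] at h2
    exact absurd (h2.trans h1) (not_le.2 (Nat.lt_two_pow_self))

theorem finite_ord_ne_zero (Fq : Type*) {K : Type*} [Field Fq] [Field K] [Algebra Fq K]
    [Finite Fq] [IsFunctionFieldOver Fq K] [DiscretePlaces K] (s : K) : {w : Place K | w.ord s ≠ 0}.Finite := by
  rcases eq_or_ne s 0 with rfl | hs
  · simp [Place.ord_zero]
  · refine ((finite_zeros Fq hs).union (finite_zeros Fq (inv_ne_zero hs))).subset fun w hw => ?_
    rcases lt_or_gt_of_ne hw with h | h
    · right
      rw [Set.mem_ofPred_eq, ← w.ord_pos_iff (inv_ne_zero hs), w.ord_inv hs]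
      omega
    · left
      exact (w.ord_pos_iff hs).1 h

/-- Places are discrete, and every element of `K` has finitely many zeros and poles. -/
class GlobalPlaces (K : Type*) [Field K] : Prop extends DiscretePlaces K where
  finite_ord_ne_zero : ∀ s : K, {w : Place K | w.ord s ≠ 0}.Finite

theorem IsFunctionFieldOver.globalPlaces (Fq K : Type*) [Field Fq] [Field K] [Algebra Fq K]
    [Finite Fq] [IsFunctionFieldOver Fq K] : GlobalPlaces K :=
  have := IsFunctionFieldOver.discretePlaces Fq K
  { finite_ord_ne_zero := BinQuad.finite_ord_ne_zero Fq }

/-! ### Divisors, absolute norms and Riemann–Roch spaces -/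

section Divisors

variable {K : Type*} [Field K]

/-- The absolute norm of a divisor. -/
def divNorm (D : Divisor K) : ℝ := D.prod fun w n => (w.card : ℝ) ^ n

theorem divNorm_zero : divNorm (0 : Divisor K) = 1 := Finsupp.prod_zero_index

theorem divNorm_single (w : Place K) (n : ℤ) :
    divNorm (Finsupp.single w n) = (w.card : ℝ) ^ n :=
  Finsupp.prod_single_index (zpow_zero _)

variable [GlobalPlaces K]

/-- The divisor of an element of `K` (zero for the element `0`). -/
def divisor (f : K) : Divisor K :=
  Finsupp.ofSupportFinite (fun w => w.ord f) (GlobalPlaces.finite_ord_ne_zero f)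

@[simp] theorem divisor_apply (f : K) (w : Place K) : divisor f w = w.ord f := rfl

theorem divisor_mul {f g : K} (hf : f ≠ 0) (hg : g ≠ 0) :
    divisor (f * g) = divisor f + divisor g :=
  Finsupp.ext fun w => w.ord_mul hf hg

theorem divisor_one : divisor (1 : K) = 0 := Finsupp.ext fun w => w.ord_one

theorem divisor_inv {f : K} (hf : f ≠ 0) : divisor f⁻¹ = -divisor f :=
  Finsupp.ext fun w => w.ord_inv hf

theorem divisor_div {f g : K} (hf : f ≠ 0) (hg : g ≠ 0) :
    divisor (f / g) = divisor f - divisor g :=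
  Finsupp.ext fun w => w.ord_div hf hg

theorem mem_principal_iff (D : Divisor K) : D ∈ principal K ↔ ∃ f : K, f ≠ 0 ∧ D = divisor f := by
  constructor
  · rintro ⟨f, hf⟩
    refine ⟨f, f.ne_zero, Finsupp.ext fun w => ?_⟩
    exact (w.ord_eq_of_valuation_eq f.ne_zero (hf w _ w.irreducible_unif)).symm
  · rintro ⟨f, hf, rfl⟩
    refine ⟨Units.mk0 f hf, fun w ϖ hϖ => ?_⟩
    rw [w.valuation_irreducible hϖ]
    exact w.valuation_eq hf

theorem card_cast_ne_zero (w : Place K) : (w.card : ℝ) ≠ 0 := Nat.cast_ne_zero.2 w.card_pos.ne'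

theorem divNorm_add (D E : Divisor K) : divNorm (D + E) = divNorm D * divNorm E :=
  Finsupp.prod_add_index' (fun _ => zpow_zero _) fun w _ _ => zpow_add₀ (card_cast_ne_zero w) _ _

theorem divNorm_pos (D : Divisor K) : 0 < divNorm D :=
  Finset.prod_pos fun w _ => zpow_pos (Nat.cast_pos.2 w.card_pos) _

theorem divNorm_neg (D : Divisor K) : divNorm (-D) = (divNorm D)⁻¹ := by
  refine eq_inv_of_mul_eq_one_left ?_
  rw [← divNorm_add, neg_add_cancel, divNorm_zero]

theorem divNorm_sub (D E : Divisor K) : divNorm (D - E) = divNorm D / divNorm E := by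
  rw [sub_eq_add_neg, divNorm_add, divNorm_neg, div_eq_mul_inv]

theorem divNorm_nsmul (n : ℕ) (D : Divisor K) : divNorm (n • D) = divNorm D ^ n := by
  induction n with
  | zero => rw [zero_smul, divNorm_zero, pow_zero]
  | succ n ih => rw [succ_nsmul, divNorm_add, ih, pow_succ]

theorem divNorm_zsmul (n : ℤ) (D : Divisor K) : divNorm (n • D) = divNorm D ^ n := by
  cases n with
  | ofNat n => simpa using divNorm_nsmul n D
  | negSucc n => rw [negSucc_zsmul, divNorm_neg, divNorm_nsmul, zpow_negSucc]

/-- The Riemann–Roch space `L(D)`. -/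
def rrSpace (D : Divisor K) : AddSubgroup K where
  carrier := {f | f = 0 ∨ ∀ w : Place K, -D w ≤ w.ord f}
  zero_mem' := Or.inl rfl
  add_mem' := by
    intro f g hf hg
    rcases eq_or_ne f 0 with rfl | hf0
    · rwa [zero_add]
    rcases eq_or_ne g 0 with rfl | hg0
    · rwa [add_zero]
    rcases eq_or_ne (f + g) 0 with h0 | h0
    · exact Or.inl h0
    replace hf := hf.resolve_left hf0
    replace hg := hg.resolve_left hg0
    refine Or.inr fun w => ?_
    rcases le_total (w.ord f) (w.ord g) with h | h
    · refine (hf w).trans ((w.valuation_le_iff_ord h0 hf0).1 ?_)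
      refine (Valuation.map_add _ _ _).trans (max_le le_rfl ?_)
      exact (w.valuation_le_iff_ord hg0 hf0).2 h
    · refine (hg w).trans ((w.valuation_le_iff_ord h0 hg0).1 ?_)
      refine (Valuation.map_add _ _ _).trans (max_le ?_ le_rfl)
      exact (w.valuation_le_iff_ord hf0 hg0).2 h
  neg_mem' := by
    rintro f (rfl | hf)
    · exact Or.inl neg_zero
    · exact Or.inr fun w => by rw [w.ord_neg]; exact hf w

theorem mem_rrSpace_iff {D : Divisor K} {f : K} (hf : f ≠ 0) :
    f ∈ rrSpace D ↔ ∀ w : Place K, -D w ≤ w.ord f :=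
  ⟨fun h => h.resolve_left hf, fun h => Or.inr h⟩

theorem rrSpace_mono {D E : Divisor K} (h : D ≤ E) : rrSpace D ≤ rrSpace E := by
  rintro f (rfl | hf)
  · exact zero_mem _
  · exact Or.inr fun w => (neg_le_neg (h w)).trans (hf w)

/-- Multiplication by `g` identifies `L(D)` with `L(D - div g)`. -/
def rrSpaceMulEquiv (D : Divisor K) {g : K} (hg : g ≠ 0) : rrSpace D ≃ rrSpace (D - divisor g) where
  toFun f := ⟨f * g, by
    rcases eq_or_ne (f : K) 0 with h | h
    · rw [h, zero_mul]; exact zero_mem _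
    · rw [mem_rrSpace_iff (mul_ne_zero h hg)]
      intro w
      have := (mem_rrSpace_iff h).1 f.2 w
      rw [w.ord_mul h hg, Finsupp.sub_apply, divisor_apply]
      omega⟩
  invFun f := ⟨f / g, by
    rcases eq_or_ne (f : K) 0 with h | h
    · rw [h, zero_div]; exact zero_mem _
    · rw [mem_rrSpace_iff (div_ne_zero h hg)]
      intro w
      have := (mem_rrSpace_iff h).1 f.2 w
      rw [Finsupp.sub_apply, divisor_apply] at this
      rw [w.ord_div h hg]
      omega⟩
  left_inv f := Subtype.ext (mul_div_cancel_right₀ _ hg)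
  right_inv f := Subtype.ext (div_mul_cancel₀ _ hg)

/-- Adding one place to `D` enlarges `L(D)` by at most a residue field. -/
theorem finite_rrSpace_add_single {D : Divisor K} (h : Finite (rrSpace D)) (w : Place K) :
    Finite (rrSpace (D + Finsupp.single w 1)) ∧
      Nat.card (rrSpace (D + Finsupp.single w 1)) ≤ Nat.card (rrSpace D) * w.card := by
  set D' := D + Finsupp.single w 1 with hD'
  have hDD : D ≤ D' := le_add_of_nonneg_right (Finsupp.single_nonneg.2 zero_le_one)
  have hle : rrSpace D ≤ rrSpace D' := rrSpace_mono hDD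
  have hmem : ∀ f : rrSpace D', (f : K) * w.unif ^ D' w ∈ w.1 := by
    intro f
    rcases eq_or_ne (f : K) 0 with h0 | h0
    · rw [h0, zero_mul]; exact w.1.zero_mem
    · have hu := zpow_ne_zero (D' w) w.unif_ne_zero
      rw [← w.ord_nonneg_iff (mul_ne_zero h0 hu), w.ord_mul h0 hu, w.ord_zpow w.unif_ne_zero,
        w.ord_unif]
      have := (mem_rrSpace_iff h0).1 f.2 w
      omega
  -- The leading coefficient at `w`. It vanishes exactly on $L(D)$, so the quotient embeds in the
  -- residue field.
  let φ : rrSpace D' →+ IsLocalRing.ResidueField w.1 :=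
    { toFun := fun f => IsLocalRing.residue w.1 ⟨f * w.unif ^ D' w, hmem f⟩
      map_zero' := by
        rw [← map_zero (IsLocalRing.residue w.1)]
        congr 1
        exact Subtype.ext (zero_mul _)
      map_add' := fun f g => by
        rw [← map_add]
        congr 1
        exact Subtype.ext (add_mul _ _ _) }
  have hker : φ.ker = (rrSpace D).addSubgroupOf (rrSpace D') := by
    ext f
    rw [AddMonoidHom.mem_ker, AddSubgroup.mem_addSubgroupOf]
    change IsLocalRing.residue w.1 ⟨f * w.unif ^ D' w, hmem f⟩ = 0 ↔ _
    rw [IsLocalRing.residue_eq_zero_iff, w.1.valuation_lt_one_iff]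
    rcases eq_or_ne (f : K) 0 with h0 | h0
    · simp [h0, zero_mem]
    have hu := zpow_ne_zero (D' w) w.unif_ne_zero
    rw [← w.ord_pos_iff (mul_ne_zero h0 hu), w.ord_mul h0 hu, w.ord_zpow w.unif_ne_zero,
      w.ord_unif, mem_rrSpace_iff h0]
    have h1 := (mem_rrSpace_iff h0).1 f.2
    have hw : D' w = D w + 1 := by simp [hD']
    constructor
    · intro h2 w'
      rcases eq_or_ne w' w with rfl | hne
      · omega
      · have := h1 w'
        have he : D' w' = D w' := by
          rw [hD', Finsupp.add_apply, Finsupp.single_eq_of_ne hne, add_zero]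
        rwa [he] at this
    · intro h2
      have := h2 w
      omega
  have hker_card : Nat.card φ.ker = Nat.card (rrSpace D) := by
    rw [hker]
    exact Nat.card_congr (AddSubgroup.addSubgroupOfEquivOfLe hle).toEquiv
  have hkfin : Finite φ.ker := by
    rw [hker]
    exact Finite.of_equiv _ (AddSubgroup.addSubgroupOfEquivOfLe hle).toEquiv.symm
  have hqfin : Finite (rrSpace D' ⧸ φ.ker) :=
    Finite.of_injective _ (QuotientAddGroup.kerLift_injective φ)
  refine ⟨Finite.of_equiv ((rrSpace D' ⧸ φ.ker) × φ.ker)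
    AddSubgroup.addGroupEquivQuotientProdAddSubgroup.symm, ?_⟩
  rw [AddSubgroup.card_eq_card_quotient_mul_card_addSubgroup φ.ker, hker_card, mul_comm]
  exact Nat.mul_le_mul_left _
    (Nat.card_le_card_of_injective _ (QuotientAddGroup.kerLift_injective φ))

/-- Iteration of `finite_rrSpace_add_single`. The coefficients of the added divisor are natural
numbers so that `Finsupp.induction_linear` never leaves the effective divisors. -/
theorem finite_rrSpace_add (E : Place K →₀ ℕ) : ∀ D : Divisor K, Finite (rrSpace D) →
    Finite (rrSpace (D + E.mapRange (Nat.cast : ℕ → ℤ) Nat.cast_zero)) ∧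
      (Nat.card (rrSpace (D + E.mapRange (Nat.cast : ℕ → ℤ) Nat.cast_zero)) : ℝ) ≤
        Nat.card (rrSpace D) * divNorm (E.mapRange (Nat.cast : ℕ → ℤ) Nat.cast_zero) := by
  let P : Divisor K → Prop := fun E => ∀ D : Divisor K, Finite (rrSpace D) →
    Finite (rrSpace (D + E)) ∧
      (Nat.card (rrSpace (D + E)) : ℝ) ≤ Nat.card (rrSpace D) * divNorm E
  have step : ∀ E₁ E₂, P E₁ → P E₂ → P (E₁ + E₂) := by
    intro E₁ E₂ h₁ h₂ D hD
    rw [← add_assoc, divNorm_add, ← mul_assoc]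
    obtain ⟨h3, h4⟩ := h₁ D hD
    obtain ⟨h5, h6⟩ := h₂ _ h3
    exact ⟨h5, h6.trans (mul_le_mul_of_nonneg_right h4 (divNorm_pos _).le)⟩
  have hzero : P 0 := by
    intro D hD
    rw [add_zero, divNorm_zero, mul_one]
    exact ⟨hD, le_rfl⟩
  have hsingle : ∀ (w : Place K) (n : ℕ), P (Finsupp.single w (n : ℤ)) := by
    intro w n
    induction n with
    | zero => simpa using hzero
    | succ n ih =>
      rw [Nat.cast_succ, Finsupp.single_add]
      refine step _ _ ih fun D hD => ?_
      rw [divNorm_single, zpow_one]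
      obtain ⟨h1, h2⟩ := finite_rrSpace_add_single hD w
      exact ⟨h1, by exact_mod_cast h2⟩
  change P _
  induction E using Finsupp.induction_linear with
  | zero => rwa [Finsupp.mapRange_zero]
  | add E₁ E₂ h₁ h₂ =>
    rw [Finsupp.mapRange_add (fun _ _ => Nat.cast_add _ _)]
    exact step _ _ h₁ h₂
  | single w n =>
    rw [Finsupp.mapRange_single]
    exact hsingle w n

theorem finite_rrSpace_of_le {D E : Divisor K} (h : D ≤ E) (hD : Finite (rrSpace D)) :
    Finite (rrSpace E) ∧
      (Nat.card (rrSpace E) : ℝ) ≤ Nat.card (rrSpace D) * divNorm (E - D) := by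
  have hE : E - D = (Finsupp.mapRange Int.toNat Int.toNat_zero (E - D)).mapRange
      (Nat.cast : ℕ → ℤ) Nat.cast_zero := by
    ext w
    have := h w
    simp only [Finsupp.mapRange_apply, Finsupp.sub_apply]
    omega
  have := finite_rrSpace_add (Finsupp.mapRange Int.toNat Int.toNat_zero (E - D)) D hD
  rwa [← hE, add_sub_cancel] at this

end Divisors

end

end BinQuad

namespace BinQuad

noncomputable section

/-! ### The product formula, Riemann's inequality and finiteness of the class group -/

section Riemann

open IntermediateField
open scoped IntermediateField.algebraAdjoinAdjoin

set_option linter.unusedSectionVars false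

variable (Fq : Type*) {K : Type*} [Field Fq] [Field K] [Algebra Fq K] [Finite Fq]

/-- A transcendental $s$ is not a unit of $\mathbb F_q[s]$, and a proper ideal of a subring lies in
the nonunits of some valuation ring. -/
theorem exists_place_valuation_lt_one {s : K} (hs : Transcendental Fq s) :
    ∃ w : Place K, w.1.valuation s < 1 := by
  have h0 : s ≠ 0 := by rintro rfl; exact hs isAlgebraic_zero
  let A := (Algebra.adjoin Fq {s}).toSubring
  have hsA : s ∈ A := Algebra.self_mem_adjoin_singleton Fq s
  obtain ⟨B, -, hB⟩ := Ideal.image_subset_nonunits_valuationSubring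
    (Ideal.span {(⟨s, hsA⟩ : A)}) (by
      rw [Ne, Ideal.span_singleton_eq_top, isUnit_iff_exists_inv]
      rintro ⟨⟨b, hb⟩, h⟩
      have hb' : b ∈ Algebra.adjoin Fq {s} := hb
      rw [Algebra.adjoin_singleton_eq_range_aeval] at hb'
      obtain ⟨p, hp⟩ := hb'
      have h1 : s * b = 1 := congr_arg Subtype.val h
      refine hs ⟨Polynomial.X * p - 1, fun h => ?_, ?_⟩
      · have := congr_arg (fun p => p.coeff 0) h
        simp at this
      · rw [map_sub, map_mul, Polynomial.aeval_X, map_one]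
        change s * (Polynomial.aeval s).toRingHom p - 1 = 0
        rw [← h1]
        exact sub_eq_zero.2 (congr_arg _ hp))
  have hBs : B.valuation s < 1 :=
    (B.mem_nonunits_iff).1 (hB ⟨_, Ideal.mem_span_singleton_self _, rfl⟩)
  refine ⟨⟨B, fun h => ?_⟩, hBs⟩
  have : s⁻¹ ∈ B := h ▸ ValuationSubring.mem_top _
  rw [← B.valuation_le_one_iff, map_inv₀] at this
  have h2 := mul_lt_one_of_nonneg_of_lt_one_left zero_le hBs this
  rw [mul_inv_cancel₀ ((Valuation.ne_zero_iff _).2 h0)] at h2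
  exact lt_irrefl _ h2

theorem isAlgebraic_iff_forall_mem {f : K} : IsAlgebraic Fq f ↔ ∀ w : Place K, f ∈ w.1 := by
  refine ⟨fun h w => mem_of_isAlgebraic Fq w.1 h, fun h => ?_⟩
  by_contra hf
  have h0 : f ≠ 0 := by rintro rfl; exact hf isAlgebraic_zero
  obtain ⟨w, hw⟩ := exists_place_valuation_lt_one Fq (s := f⁻¹) fun h => hf (by simpa using h.inv)
  have := h w
  rw [← w.1.valuation_le_one_iff] at this
  have h2 := mul_lt_one_of_nonneg_of_lt_one_left zero_le hw this
  rw [← map_mul, inv_mul_cancel₀ h0, map_one] at h2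
  exact lt_irrefl _ h2

/-- Fermat's theorem in the residue field. It supplies a zero at $w$ of an element that depends on
$w$ only through $q_w$ and has poles only where $t$ has. -/
theorem exists_pow_sub_self_of_mem [DiscretePlaces K] (w : Place K) {t : K} (ht : t ∈ w.1) :
    w.1.valuation (t ^ w.card - t) < 1 := by
  let _ := Fintype.ofFinite (IsLocalRing.ResidueField w.1)
  have h : IsLocalRing.residue w.1 (⟨t, ht⟩ ^ w.card - ⟨t, ht⟩) = 0 := by
    rw [map_sub, map_pow, Place.card, Nat.card_eq_fintype_card, FiniteField.pow_card, sub_self]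
  rw [IsLocalRing.residue_eq_zero_iff] at h
  exact (w.1.valuation_lt_one_iff _).1 h

theorem pow_sub_self_ne_zero {t : K} (ht : Transcendental Fq t) {m : ℕ} (hm : 1 < m) :
    t ^ m - t ≠ 0 := by
  intro h
  refine ht ⟨Polynomial.X ^ m - Polynomial.X, fun h0 => ?_, by simpa using h⟩
  exact FiniteField.X_pow_card_sub_X_ne_zero Fq hm h0

theorem mem_place_of_isIntegral (w : Place K) {R : Type*} [CommRing R] [Algebra R K]
    (hR : ∀ r : R, algebraMap R K r ∈ w.1) {y : K} (hy : IsIntegral R y) : y ∈ w.1 := by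
  have : IsIntegral w.1 y := by
    obtain ⟨p, hp, he⟩ := hy
    refine ⟨p.map ((algebraMap R K).codRestrict w.1 hR), hp.map _, ?_⟩
    rw [Polynomial.eval₂_map]
    exact he
  obtain ⟨z, hz⟩ := IsIntegrallyClosed.algebraMap_eq_of_integral this
  exact hz ▸ z.2

variable [IsFunctionFieldOver Fq K] [GlobalPlaces K]

theorem nonempty_place (Fq K : Type*) [Field Fq] [Field K] [Algebra Fq K]
    [Finite Fq] [IsFunctionFieldOver Fq K] : Nonempty (Place K) := by
  obtain ⟨t, ht, -⟩ := IsFunctionFieldOver.exists_transcendental (Fq := Fq) (K := K)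
  exact ⟨(exists_place_valuation_lt_one Fq ht).choose⟩

theorem mem_rrSpace_zero_iff {f : K} : f ∈ rrSpace (0 : Divisor K) ↔ IsAlgebraic Fq f := by
  rw [isAlgebraic_iff_forall_mem Fq]
  rcases eq_or_ne f 0 with rfl | h0
  · exact ⟨fun _ w => w.1.zero_mem, fun _ => zero_mem _⟩
  · rw [mem_rrSpace_iff h0]
    refine forall_congr' fun w => ?_
    rw [← w.ord_nonneg_iff h0, Finsupp.zero_apply, neg_zero]

theorem card_rrSpace_zero : Nat.card (rrSpace (0 : Divisor K)) = constCard K Fq :=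
  Nat.card_congr (Equiv.subtypeEquivRight fun f => by
    rw [mem_rrSpace_zero_iff Fq, mem_algebraicClosure_iff', isAlgebraic_iff_isIntegral])

theorem finite_rrSpace_zero (Fq : Type*) {K : Type*} [Field Fq] [Field K] [Algebra Fq K]
    [Finite Fq] [IsFunctionFieldOver Fq K] [GlobalPlaces K] :
    Finite (rrSpace (0 : Divisor K)) := by
  obtain ⟨w⟩ := nonempty_place Fq K
  have hmem : ∀ f : rrSpace (0 : Divisor K), (f : K) ∈ w.1 := fun f =>
    mem_of_isAlgebraic Fq w.1 ((mem_rrSpace_zero_iff Fq).1 f.2)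
  refine Finite.of_injective (fun f : rrSpace (0 : Divisor K) =>
    IsLocalRing.residue w.1 ⟨f, hmem f⟩) fun f g h => ?_
  have h' : IsLocalRing.residue w.1 (⟨f, hmem f⟩ - ⟨g, hmem g⟩) = 0 := by
    rw [map_sub]; exact sub_eq_zero.2 h
  rw [IsLocalRing.residue_eq_zero_iff, w.1.valuation_lt_one_iff] at h'
  by_contra hne
  refine h'.ne (valuation_eq_one_of_isAlgebraic Fq w.1
    ((mem_rrSpace_zero_iff Fq).1 (f - g).2) ?_)
  exact sub_ne_zero.2 fun h => hne (Subtype.ext h)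

theorem card_rrSpace_le {E : Divisor K} (hE : 0 ≤ E) :
    Finite (rrSpace E) ∧ (Nat.card (rrSpace E) : ℝ) ≤ constCard K Fq * divNorm E := by
  have := finite_rrSpace_of_le hE (finite_rrSpace_zero Fq)
  rwa [card_rrSpace_zero Fq, sub_zero] at this

end Riemann

section PoleDivisor

variable {K : Type*} [Field K] [GlobalPlaces K]

/-- The divisor of poles. -/
def poleDivisor (t : K) : Divisor K := (divisor t)⁻

theorem poleDivisor_apply (t : K) (w : Place K) : poleDivisor t w = max (-w.ord t) 0 := rfl

theorem poleDivisor_nonneg (t : K) : 0 ≤ poleDivisor t := negPart_nonneg _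

theorem mem_rrSpace_poleDivisor (t : K) : t ∈ rrSpace (poleDivisor t) := by
  rcases eq_or_ne t 0 with rfl | h0
  · exact zero_mem _
  rw [mem_rrSpace_iff h0]
  intro w
  rw [poleDivisor_apply]
  have := le_max_left (-w.ord t) 0
  omega

theorem mul_mem_rrSpace {D E : Divisor K} {f g : K} (hf : f ∈ rrSpace D) (hg : g ∈ rrSpace E) :
    f * g ∈ rrSpace (D + E) := by
  rcases eq_or_ne f 0 with rfl | hf0
  · rw [zero_mul]; exact zero_mem _
  rcases eq_or_ne g 0 with rfl | hg0
  · rw [mul_zero]; exact zero_mem _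
  rw [mem_rrSpace_iff (mul_ne_zero hf0 hg0)]
  rw [mem_rrSpace_iff hf0] at hf
  rw [mem_rrSpace_iff hg0] at hg
  intro w
  have h1 := hf w
  have h2 := hg w
  rw [w.ord_mul hf0 hg0, Finsupp.add_apply]
  omega

theorem pow_mem_rrSpace {D : Divisor K} {f : K} (hf : f ∈ rrSpace D) (n : ℕ) :
    f ^ n ∈ rrSpace (n • D) := by
  induction n with
  | zero =>
    rw [pow_zero, zero_smul, mem_rrSpace_iff one_ne_zero]
    intro w
    simp [w.ord_one]
  | succ n ih =>
    rw [pow_succ, succ_nsmul]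
    exact mul_mem_rrSpace ih hf

/-- A divisor that is positive only at poles of `t` is bounded by a multiple of the pole
divisor. -/
theorem exists_le_nsmul_poleDivisor (t : K) (D : Divisor K)
    (hD : ∀ w : Place K, t ∈ w.1 → D w ≤ 0) : ∃ m : ℕ, ∀ n ≥ m, D ≤ n • poleDivisor t := by
  refine ⟨∑ w ∈ D.support, (D w).toNat, fun n hn w => ?_⟩
  rw [Finsupp.smul_apply]
  by_cases ht : t ∈ w.1
  · exact (hD w ht).trans (nsmul_nonneg (poleDivisor_nonneg t w) _)
  by_cases hw : w ∈ D.support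
  · have h1 : (D w).toNat ≤ n := (Finset.single_le_sum (f := fun w => (D w).toNat)
      (fun _ _ => Nat.zero_le _) hw).trans hn
    have ht0 : t ≠ 0 := fun h => ht (h ▸ w.1.zero_mem)
    have h2 : 1 ≤ poleDivisor t w := by
      rw [poleDivisor_apply]
      have : ¬ 0 ≤ w.ord t := mt (w.ord_nonneg_iff ht0).1 ht
      refine le_max_of_le_left ?_
      omega
    rw [nsmul_eq_mul]
    nlinarith [Int.self_le_toNat (D w)]
  · rw [Finsupp.notMem_support_iff.1 hw]
    exact nsmul_nonneg (poleDivisor_nonneg t w) _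

theorem exists_mem_rrSpace_nsmul_poleDivisor (t : K) {y : K}
    (hy : ∀ w : Place K, t ∈ w.1 → y ∈ w.1) :
    ∃ m : ℕ, ∀ n ≥ m, y ∈ rrSpace (n • poleDivisor t) := by
  rcases eq_or_ne y 0 with rfl | h0
  · exact ⟨0, fun _ _ => zero_mem _⟩
  obtain ⟨m, hm⟩ := exists_le_nsmul_poleDivisor t (-divisor y) fun w hw => by
    rw [Finsupp.neg_apply, divisor_apply]
    have := (w.ord_nonneg_iff h0).2 (hy w hw)
    omega
  refine ⟨m, fun n hn => (mem_rrSpace_iff h0).2 fun w => ?_⟩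
  have := hm n hn w
  rw [Finsupp.neg_apply, divisor_apply] at this
  omega

end PoleDivisor

section ProductFormula

set_option linter.unusedSectionVars false

open IntermediateField
open scoped IntermediateField.algebraAdjoinAdjoin

variable (Fq : Type*) {K : Type*} [Field Fq] [Field K] [Algebra Fq K] [Finite Fq]
  [IsFunctionFieldOver Fq K] [GlobalPlaces K]

theorem aeval_mem_rrSpace {t : K} {m : ℕ} {p : Polynomial Fq} (hp : p ∈ Polynomial.degreeLT Fq m) :
    Polynomial.aeval t p ∈ rrSpace (m • poleDivisor t) := by
  rw [Polynomial.aeval_eq_sum_range]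
  refine sum_mem fun i _ => ?_
  by_cases hi : m ≤ i
  · have : p.coeff i = 0 := Polynomial.coeff_eq_zero_of_degree_lt
      ((Polynomial.mem_degreeLT.1 hp).trans_le (by exact_mod_cast hi))
    rw [this, zero_smul]
    exact zero_mem _
  · rw [Algebra.smul_def]
    have h1 : algebraMap Fq K (p.coeff i) ∈ rrSpace (0 : Divisor K) :=
      (mem_rrSpace_zero_iff Fq).2 (isAlgebraic_algebraMap _)
    have h2 := mul_mem_rrSpace h1 (pow_mem_rrSpace (mem_rrSpace_poleDivisor t) i)
    rw [zero_add] at h2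
    exact rrSpace_mono (nsmul_le_nsmul_left (poleDivisor_nonneg t) (not_le.1 hi).le) h2

theorem exists_isIntegral_mul {t : K} (ht : Transcendental Fq t) (y : K) :
    ∃ c : Fq⟮t⟯, c ≠ 0 ∧ IsIntegral (Algebra.adjoin Fq {t}) ((c : K) * y) := by
  have := finiteDimensional_of_transcendental Fq ht
  have halg : IsAlgebraic (Algebra.adjoin Fq {t}) y :=
    IntermediateField.isAlgebraic_adjoin_iff.1 (Algebra.IsAlgebraic.isAlgebraic (R := Fq⟮t⟯) y)
  obtain ⟨c, hc, h⟩ := halg.exists_integral_multiple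
  refine ⟨⟨c, algebra_adjoin_le_adjoin Fq {t} c.2⟩, fun h => hc ?_, h⟩
  exact Subtype.ext (congr_arg (fun z : Fq⟮t⟯ => (z : K)) h)

/-- A basis of $K$ over $\mathbb F_q(t)$, scaled to be integral over $\mathbb F_q[t]$, has poles
only at poles of $t$ and so lies in $L(m_0(t)_\infty)$. Its combinations with polynomials in $t$ of
degree less than $m$ are distinct elements of $L((m_0+m)(t)_\infty)$. -/
theorem card_rrSpace_nsmul_poleDivisor {t : K} (ht : Transcendental Fq t) :
    ∃ m₀ : ℕ, ∀ m : ℕ, Nat.card Fq ^ (Module.finrank Fq⟮t⟯ K * m) ≤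
      Nat.card (rrSpace ((m₀ + m) • poleDivisor t)) := by
  have := finiteDimensional_of_transcendental Fq ht
  let b := Module.finBasis Fq⟮t⟯ K
  choose c hc hInt using exists_isIntegral_mul Fq ht
  have hpole : ∀ i, ∃ m : ℕ, ∀ n ≥ m, (c (b i) : K) * b i ∈ rrSpace (n • poleDivisor t) := by
    intro i
    refine exists_mem_rrSpace_nsmul_poleDivisor t fun w hw => ?_
    refine mem_place_of_isIntegral w (fun r => ?_) (hInt (b i))
    obtain ⟨r, hr⟩ := r
    have hr' := hr
    rw [Algebra.adjoin_singleton_eq_range_aeval] at hr'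
    obtain ⟨p, hp⟩ := hr'
    change r ∈ w.1
    rw [← hp]
    exact aeval_mem Fq w.1 hw p
  choose m hm using hpole
  refine ⟨∑ i, m i, fun M => ?_⟩
  have hm' : ∀ i, (c (b i) : K) * b i ∈ rrSpace ((∑ i, m i) • poleDivisor t) := fun i =>
    hm i _ (Finset.single_le_sum (fun _ _ => Nat.zero_le _) (Finset.mem_univ i))
  let Φ : (Fin (Module.finrank Fq⟮t⟯ K) → Polynomial.degreeLT Fq M) →
      rrSpace ((∑ i, m i + M) • poleDivisor t) := fun p =>
    ⟨∑ i, ((c (b i) : K) * b i) * Polynomial.aeval t (p i : Polynomial Fq), sum_mem fun i _ => by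
      rw [add_smul]
      exact mul_mem_rrSpace (hm' i) (aeval_mem_rrSpace Fq (p i).2)⟩
  have hΦ : Function.Injective Φ := by
    intro p p' h
    have h' : ∑ i, ((c (b i) : K) * b i) * Polynomial.aeval t (p i : Polynomial Fq) =
      ∑ i, ((c (b i) : K) * b i) * Polynomial.aeval t (p' i : Polynomial Fq) :=
        congr_arg Subtype.val h
    rw [← sub_eq_zero, ← Finset.sum_sub_distrib] at h'
    have hgen : ∀ q : Polynomial Fq, ((Polynomial.aeval (AdjoinSimple.gen Fq t) q : Fq⟮t⟯) : K) =
        Polynomial.aeval t q := fun q => by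
      rw [← IntermediateField.coe_val, ← Polynomial.aeval_algHom_apply]
      simp
    have hlin := Fintype.linearIndependent_iff.1 b.linearIndependent
      (fun i => c (b i) * Polynomial.aeval (AdjoinSimple.gen Fq t)
        ((p i : Polynomial Fq) - (p' i : Polynomial Fq))) (by
      rw [← h']
      refine Finset.sum_congr rfl fun i _ => ?_
      rw [Algebra.smul_def]
      change (c (b i) : K) * ((Polynomial.aeval (AdjoinSimple.gen Fq t)
        ((p i : Polynomial Fq) - (p' i : Polynomial Fq)) : Fq⟮t⟯) : K) * b i = _
      rw [hgen, map_sub]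
      ring)
    funext i
    have h1 := (mul_eq_zero.1 (hlin i)).resolve_left (hc _)
    have h2 := congr_arg (fun z : Fq⟮t⟯ => (z : K)) h1
    simp only [hgen] at h2
    exact Subtype.ext (sub_eq_zero.1 ((transcendental_iff.1 ht) _ h2))
  have hfin := (card_rrSpace_le Fq
    (nsmul_nonneg (poleDivisor_nonneg t) (∑ i, m i + M))).1
  refine le_of_eq_of_le ?_ (Nat.card_le_card_of_injective Φ hΦ)
  rw [Nat.card_pi, Finset.prod_const, Finset.card_univ, Fintype.card_fin,
    Nat.card_congr (Polynomial.degreeLTEquiv Fq M).toEquiv, Nat.card_pi, Finset.prod_const,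
    Finset.card_univ, Fintype.card_fin, ← pow_mul, mul_comm]

theorem finrank_adjoin_inv (t : K) : Module.finrank Fq⟮t⁻¹⟯ K = Module.finrank Fq⟮t⟯ K := by
  have : Fq⟮t⁻¹⟯ = Fq⟮t⟯ := by
    apply le_antisymm
    · rw [adjoin_simple_le_iff]
      exact inv_mem (mem_adjoin_simple_self Fq t)
    · rw [adjoin_simple_le_iff]
      simpa using inv_mem (mem_adjoin_simple_self Fq t⁻¹)
  rw [this]

/-- The degree of the pole divisor. -/
theorem divNorm_poleDivisor {t : K} (ht : Transcendental Fq t) :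
    divNorm (poleDivisor t) = (Nat.card Fq : ℝ) ^ Module.finrank Fq⟮t⟯ K := by
  have ht0 : t ≠ 0 := by rintro rfl; exact ht isAlgebraic_zero
  apply le_antisymm
  -- Poles of $t$ are zeros of $t^{-1}$, and $\mathbb F_q(t^{-1})=\mathbb F_q(t)$, so the
  -- fundamental inequality is one half.
  · have hti : Transcendental Fq t⁻¹ := fun h => ht (by simpa using h.inv)
    have hpole : ∀ w ∈ (poleDivisor t).support, 0 < -w.ord t := by
      intro w hw
      rw [Finsupp.mem_support_iff, poleDivisor_apply] at hw
      by_contra! h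
      exact hw (max_eq_right h)
    have h := prod_zeros_le Fq hti (poleDivisor t).support fun w hw => by
      rw [← w.ord_pos_iff (inv_ne_zero ht0), w.ord_inv ht0]
      exact hpole w hw
    rw [finrank_adjoin_inv] at h
    refine le_of_eq_of_le ?_ (Nat.cast_le (α := ℝ).2 h) |>.trans (by push_cast; rfl)
    rw [divNorm, Finsupp.prod, Nat.cast_prod]
    refine Finset.prod_congr rfl fun w hw => ?_
    have hpos := hpole w hw
    rw [Nat.cast_pow, w.ord_inv ht0, ← zpow_natCast, Int.toNat_of_nonneg hpos.le,
      poleDivisor_apply, max_eq_left hpos.le]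
  -- For the other half, $L((m_0+m)(t)_\infty)$ has at least $b^m$ elements and at most a constant
  -- times $a^{m_0+m}$. If $a<b$, the powers of $b/a$ would be bounded.
  · obtain ⟨m₀, hm₀⟩ := card_rrSpace_nsmul_poleDivisor Fq ht
    by_contra! hlt
    set a := divNorm (poleDivisor t)
    set b := (Nat.card Fq : ℝ) ^ Module.finrank Fq⟮t⟯ K
    have ha : 0 < a := divNorm_pos _
    have hb : ∀ m : ℕ, (b / a) ^ m ≤ constCard K Fq * a ^ m₀ := by
      intro m
      have h1 := (card_rrSpace_le Fq (nsmul_nonneg (poleDivisor_nonneg t) (m₀ + m))).2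
      have h2 : b ^ m ≤ Nat.card (rrSpace ((m₀ + m) • poleDivisor t)) := by
        rw [← pow_mul]
        exact_mod_cast hm₀ m
      rw [divNorm_nsmul] at h1
      rw [div_pow, div_le_iff₀ (pow_pos ha m), mul_assoc, ← pow_add]
      exact h2.trans h1
    obtain ⟨m, hm⟩ := pow_unbounded_of_one_lt (constCard K Fq * a ^ m₀) ((one_lt_div ha).2 hlt)
    exact absurd (hb m) (not_le.2 hm)

/-- The product formula. -/
theorem divNorm_divisor (Fq : Type*) {K : Type*} [Field Fq] [Field K] [Algebra Fq K] [Finite Fq]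
    [IsFunctionFieldOver Fq K] [GlobalPlaces K] {f : K} (hf : f ≠ 0) : divNorm (divisor f) = 1 := by
  by_cases halg : IsAlgebraic Fq f
  · have : divisor f = 0 := Finsupp.ext fun w =>
      (w.ord_eq_zero_iff hf).2 (valuation_eq_one_of_isAlgebraic Fq w.1 halg hf)
    rw [this, divNorm_zero]
  · have hinv : Transcendental Fq f⁻¹ := fun h => halg (by simpa using h.inv)
    -- Zeros of $f$ are poles of $f^{-1}$, and both pole divisors have norm given by the same field
    -- degree.
    have h : divisor f = poleDivisor f⁻¹ - poleDivisor f := by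
      rw [poleDivisor, poleDivisor, divisor_inv hf, negPart_neg, posPart_sub_negPart]
    rw [h, divNorm_sub, divNorm_poleDivisor Fq hinv, divNorm_poleDivisor Fq halg,
      finrank_adjoin_inv, div_self]
    exact pow_ne_zero _ (Nat.cast_ne_zero.2 Nat.card_pos.ne')

/-- Every divisor is bounded by a multiple of the pole divisor of `t`, up to a principal one. -/
theorem exists_sub_divisor_le {t : K} (ht : Transcendental Fq t) (D : Divisor K) :
    ∃ g : K, g ≠ 0 ∧ ∃ m : ℕ, ∀ n ≥ m, D - divisor g ≤ n • poleDivisor t := by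
  classical
  let W := D.support.filter fun w => t ∈ w.1
  have hne : ∀ w : Place K, t ^ w.card - t ≠ 0 := fun w => pow_sub_self_ne_zero Fq ht w.one_lt_card
  have hp : ∀ w : Place K, (t ^ w.card - t) ^ (D w).toNat ≠ 0 := fun w => pow_ne_zero _ (hne w)
  -- The product over $w\in W$ of $(t^{q_w}-t)^{D(w)}$ vanishes at each such $w$ to order at least
  -- $D(w)$. Its poles lie at poles of $t$, so subtracting its divisor leaves positive coefficients
  -- only there.
  have hg : ∏ w ∈ W, (t ^ w.card - t) ^ (D w).toNat ≠ 0 := Finset.prod_ne_zero_iff.2 fun w _ => hp w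
  have hInt : ∀ w : Place K, t ∈ w.1 → ∀ W' : Finset (Place K),
      ∏ w ∈ W', (t ^ w.card - t) ^ (D w).toNat ∈ w.1 := fun w hw W' =>
    prod_mem fun w' _ => pow_mem (sub_mem (pow_mem hw _) hw) _
  refine ⟨_, hg, exists_le_nsmul_poleDivisor t _ fun w hw => ?_⟩
  rw [Finsupp.sub_apply, divisor_apply]
  by_cases hwD : 0 < D w
  · have hwW : w ∈ W := Finset.mem_filter.2 ⟨Finsupp.mem_support_iff.2 hwD.ne', hw⟩
    rw [← Finset.mul_prod_erase W _ hwW] at hg ⊢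
    rw [w.ord_mul (left_ne_zero_of_mul hg) (right_ne_zero_of_mul hg), w.ord_pow (hne w)]
    have h1 := (w.ord_nonneg_iff (right_ne_zero_of_mul hg)).2 (hInt w hw _)
    have h2 := (w.ord_pos_iff (hne w)).2 (exists_pow_sub_self_of_mem w hw)
    have h3 := Int.toNat_of_nonneg hwD.le
    nlinarith
  · have := (w.ord_nonneg_iff hg).2 (hInt w hw _)
    omega

/-- Riemann's inequality, in multiplicative form. -/
theorem exists_le_card_rrSpace (Fq K : Type*) [Field Fq] [Field K] [Algebra Fq K] [Finite Fq]
    [IsFunctionFieldOver Fq K] [GlobalPlaces K] :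
    ∃ c : ℝ, 0 < c ∧ ∀ D : Divisor K, Finite (rrSpace D) ∧
      c * divNorm D ≤ Nat.card (rrSpace D) := by
  obtain ⟨t, ht, -⟩ := IsFunctionFieldOver.exists_transcendental (Fq := Fq) (K := K)
  obtain ⟨m₀, hm₀⟩ := card_rrSpace_nsmul_poleDivisor Fq ht
  set b := divNorm (poleDivisor t) with hb
  have hb0 : 0 < b := divNorm_pos _
  -- Up to a principal divisor $D$ lies below $(m_0+m)(t)_\infty$, whose space has at least $b^m$
  -- elements. Passing down to $D$ costs at most the norm of the difference, which leaves the factor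
  -- $b^{-m_0}$.
  refine ⟨(b ^ m₀)⁻¹, inv_pos.2 (pow_pos hb0 _), fun D => ?_⟩
  obtain ⟨g, hg, m, hm⟩ := exists_sub_divisor_le Fq ht D
  have hle := hm (m₀ + m) (by omega)
  have hEfin := (card_rrSpace_le Fq (nsmul_nonneg (poleDivisor_nonneg t) (m₀ + m))).1
  have hfin : Finite (rrSpace (D - divisor g)) :=
    Finite.of_injective _ (AddSubgroup.inclusion_injective (rrSpace_mono hle))
  have hfinD : Finite (rrSpace D) := Finite.of_equiv _ (rrSpaceMulEquiv D hg).symm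
  refine ⟨hfinD, ?_⟩
  rw [Nat.card_congr (rrSpaceMulEquiv D hg)]
  have h1 := (finite_rrSpace_of_le hle hfin).2
  rw [divNorm_sub, divNorm_nsmul, divNorm_sub, divNorm_divisor Fq hg, div_one, ← hb] at h1
  have h2 : b ^ m ≤ Nat.card (rrSpace ((m₀ + m) • poleDivisor t)) := by
    rw [hb, divNorm_poleDivisor Fq ht, ← pow_mul]
    exact_mod_cast hm₀ m
  have h3 := h2.trans h1
  have hD := divNorm_pos D
  rw [inv_mul_eq_div, div_le_iff₀ (pow_pos hb0 _)]
  rw [mul_div_assoc', le_div_iff₀ hD, pow_add, ← mul_assoc, mul_comm] at h3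
  exact le_of_mul_le_mul_right h3 (pow_pos hb0 m)

/-- A place with $q_w=j$ is a pole of $t$ or a zero of $t^j-t$, and each of these elements has
finitely many zeros and poles. -/
theorem finite_card_le (Fq K : Type*) [Field Fq] [Field K] [Algebra Fq K] [Finite Fq]
    [IsFunctionFieldOver Fq K] [GlobalPlaces K] (M : ℕ) : {w : Place K | w.card ≤ M}.Finite := by
  obtain ⟨t, ht, -⟩ := IsFunctionFieldOver.exists_transcendental (Fq := Fq) (K := K)
  refine ((GlobalPlaces.finite_ord_ne_zero t).union (Set.Finite.biUnion
    (Set.finite_Icc 2 M) fun j _ => GlobalPlaces.finite_ord_ne_zero (t ^ j - t))).subset fun w hw => ?_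
  by_cases htw : t ∈ w.1
  · right
    refine Set.mem_biUnion (x := w.card) ⟨w.one_lt_card, hw⟩ ?_
    exact ((w.ord_pos_iff (pow_sub_self_ne_zero Fq ht w.one_lt_card)).2
      (exists_pow_sub_self_of_mem w htw)).ne'
  · left
    have ht0 : t ≠ 0 := by rintro rfl; exact ht isAlgebraic_zero
    intro h0
    exact htw ((w.ord_nonneg_iff ht0).1 h0.ge)

theorem countable_place (Fq K : Type*) [Field Fq] [Field K] [Algebra Fq K] [Finite Fq]
    [IsFunctionFieldOver Fq K] : Countable (Place K) := by
  have := IsFunctionFieldOver.globalPlaces Fq K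
  rw [← Set.countable_univ_iff]
  refine (Set.countable_iUnion fun M : ℕ => (finite_card_le Fq K M).countable).mono fun w _ => ?_
  exact Set.mem_iUnion.2 ⟨w.card, le_refl w.card⟩

theorem one_le_divNorm {D : Divisor K} (hD : 0 ≤ D) : 1 ≤ divNorm D := by
  rw [← Finset.prod_const_one (s := D.support)]
  exact Finset.prod_le_prod (fun _ _ => zero_le_one) fun w _ =>
    one_le_zpow₀ (by exact_mod_cast w.card_pos) (hD w)

theorem zpow_card_le_divNorm {D : Divisor K} (hD : 0 ≤ D) (w : Place K) :
    (w.card : ℝ) ^ D w ≤ divNorm D := by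
  have h : D = Finsupp.single w (D w) + (D - Finsupp.single w (D w)) := by abel
  have h' : 0 ≤ D - Finsupp.single w (D w) := by
    intro w'
    rw [Finsupp.sub_apply]
    rcases eq_or_ne w' w with rfl | hne
    · simp
    · rw [Finsupp.single_eq_of_ne hne, sub_zero]
      exact hD w'
  conv_rhs => rw [h, divNorm_add, divNorm_single]
  exact le_mul_of_one_le_right (by positivity) (one_le_divNorm h')

theorem finite_effective (Fq : Type*) {K : Type*} [Field Fq] [Field K] [Algebra Fq K] [Finite Fq]
    [IsFunctionFieldOver Fq K] [GlobalPlaces K] (M : ℝ) :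
    {D : Divisor K | 0 ≤ D ∧ divNorm D ≤ M}.Finite := by
  obtain ⟨N, hN⟩ := exists_nat_ge M
  classical
  -- Only places with $q_w\le N$ can occur, and the coefficient $n$ is at most $N$ because
  -- $n<q_w^n\le N$.
  let S := (finite_card_le Fq K N).toFinset
  refine (Set.finite_Icc (0 : Divisor K) (∑ w ∈ S, Finsupp.single w (N : ℤ))).subset fun D hD => ?_
  refine ⟨hD.1, fun w => ?_⟩
  have hDw := hD.1 w
  rw [Finsupp.zero_apply] at hDw
  obtain ⟨n, hn⟩ := Int.eq_ofNat_of_zero_le hDw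
  have h1 : (w.card : ℝ) ^ D w ≤ N := (zpow_card_le_divNorm hD.1 w).trans (hD.2.trans hN)
  rw [hn, zpow_natCast] at h1
  have h2 : w.card ^ n ≤ N := by exact_mod_cast h1
  rw [Finsupp.finsetSum_apply, hn]
  rcases Nat.eq_zero_or_pos n with rfl | hpos
  · exact Finset.sum_nonneg fun w' _ => (Finsupp.single_nonneg.2 (Int.natCast_nonneg N)) w
  · have hw : w ∈ S := by
      rw [Set.Finite.mem_toFinset]
      exact (Nat.le_self_pow hpos.ne' _).trans h2
    refine le_trans ?_ (Finset.single_le_sum (f := fun w' => Finsupp.single w' (N : ℤ) w)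
      (fun w' _ => (Finsupp.single_nonneg.2 (Int.natCast_nonneg N)) w) hw)
    rw [Finsupp.single_eq_same]
    exact_mod_cast (Nat.lt_pow_self w.one_lt_card).le.trans h2

/-- The divisors of norm one, that is, of degree zero. -/
def normKer (K : Type*) [Field K] [GlobalPlaces K] : AddSubgroup (Divisor K) where
  carrier := {D | divNorm D = 1}
  zero_mem' := divNorm_zero
  add_mem' := fun {D E} (hD : divNorm D = 1) (hE : divNorm E = 1) => by
    change divNorm _ = 1
    rw [divNorm_add, hD, hE, one_mul]
  neg_mem' := fun {D} (hD : divNorm D = 1) => by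
    change divNorm _ = 1
    rw [divNorm_neg, hD, inv_one]

theorem principal_le_normKer (Fq K : Type*) [Field Fq] [Field K] [Algebra Fq K] [Finite Fq]
    [IsFunctionFieldOver Fq K] [GlobalPlaces K] : principal K ≤ normKer K := by
  intro D hD
  obtain ⟨f, hf, rfl⟩ := (mem_principal_iff D).1 hD
  exact divNorm_divisor Fq hf

theorem exists_divNorm_gt (Fq K : Type*) [Field Fq] [Field K] [Algebra Fq K] [Finite Fq]
    [IsFunctionFieldOver Fq K] [GlobalPlaces K] (M : ℝ) : ∃ D : Divisor K, M < divNorm D := by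
  obtain ⟨w⟩ := nonempty_place Fq K
  obtain ⟨n, hn⟩ := pow_unbounded_of_one_lt M (y := (w.card : ℝ)) (by exact_mod_cast w.one_lt_card)
  exact ⟨Finsupp.single w n, by rwa [divNorm_single, zpow_natCast]⟩

theorem exists_effective_of_one_lt {D : Divisor K} (h : 1 < Nat.card (rrSpace D)) :
    ∃ f : K, f ≠ 0 ∧ 0 ≤ D + divisor f := by
  have : Finite (rrSpace D) := Nat.finite_of_card_ne_zero (by omega)
  have := Finite.one_lt_card_iff_nontrivial.1 h
  obtain ⟨f, hf⟩ := exists_ne (0 : rrSpace D)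
  have hf0 : (f : K) ≠ 0 := fun h => hf (Subtype.ext h)
  refine ⟨f, hf0, fun w => ?_⟩
  have := (mem_rrSpace_iff hf0).1 f.2 w
  rw [Finsupp.zero_apply, Finsupp.add_apply, divisor_apply]
  omega

/-- If the norm of $E$ exceeds $1/c$ for the constant $c$ of Riemann's inequality, then $L(D+E)\ne0$
for every $D$ of degree zero. Hence $D+E$ is equivalent to an effective divisor of the norm of $E$,
and there are finitely many of these. -/
theorem finite_classGroup (Fq K : Type*) [Field Fq] [Field K] [Algebra Fq K] [Finite Fq]
    [IsFunctionFieldOver Fq K] [GlobalPlaces K] :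
    Finite (normKer K ⧸ (principal K).addSubgroupOf (normKer K)) := by
  obtain ⟨c, hc, hcD⟩ := exists_le_card_rrSpace Fq K
  obtain ⟨E, hE⟩ := exists_divNorm_gt Fq K c⁻¹
  have key : ∀ D : normKer K, ∃ D' : {D : Divisor K | 0 ≤ D ∧ divNorm D ≤ divNorm E},
      ∃ f : K, f ≠ 0 ∧ (D' : Divisor K) = D + E + divisor f := by
    intro D
    have h1 := (hcD ((D : Divisor K) + E)).2
    have hD1 : divNorm (D : Divisor K) = 1 := D.2
    have hn : divNorm ((D : Divisor K) + E) = divNorm E := by rw [divNorm_add, hD1, one_mul]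
    rw [hn] at h1
    have h2 : (1 : ℝ) < Nat.card (rrSpace ((D : Divisor K) + E)) := by
      refine lt_of_lt_of_le ?_ h1
      rwa [inv_lt_iff_one_lt_mul₀' hc] at hE
    obtain ⟨f, hf, hnn⟩ := exists_effective_of_one_lt (by exact_mod_cast h2)
    exact ⟨⟨_, hnn, by rw [divNorm_add, hn, divNorm_divisor Fq hf, mul_one]⟩, f, hf, rfl⟩
  choose F f hf hF using key
  have := (finite_effective Fq (K := K) (divNorm E)).to_subtype
  refine Finite.of_injective (fun y : normKer K ⧸ (principal K).addSubgroupOf (normKer K) =>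
    F y.out) fun y y' h => ?_
  rw [← y.out_eq', ← y'.out_eq']
  refine QuotientAddGroup.eq.2 ?_
  rw [AddSubgroup.mem_addSubgroupOf, mem_principal_iff]
  refine ⟨f y.out / f y'.out, div_ne_zero (hf _) (hf _), ?_⟩
  have h' : ((F y.out : _) : Divisor K) = F y'.out := congr_arg Subtype.val h
  rw [hF, hF] at h'
  rw [divisor_div (hf _) (hf _)]
  push_cast
  rw [neg_add_eq_sub, sub_eq_sub_iff_add_eq_add]
  have : (y'.out : Divisor K) + divisor (f y'.out) + E = y.out + divisor (f y.out) + E := by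
    rw [add_right_comm, ← h', add_right_comm]
  rw [add_right_cancel this, add_comm]

end ProductFormula

end

end BinQuad

namespace BinQuad

noncomputable section

/-! ### Finite extensions of function fields -/

section FiniteExtension

open IntermediateField

variable (Fq K L : Type*) [Field Fq] [Field K] [Field L] [Algebra Fq K] [Algebra K L]
  [Algebra Fq L] [IsScalarTower Fq K L]

/-- `Fq(t)` does not depend on the field in which it is formed. -/
def adjoinMapEquiv (t : K) : Fq⟮t⟯ ≃ₐ[Fq] Fq⟮algebraMap K L t⟯ :=
  (Fq⟮t⟯.equivMap (IsScalarTower.toAlgHom Fq K L)).trans (IntermediateField.equivOfEq (by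
    rw [adjoin_map, Set.image_singleton]; rfl))

theorem finrank_adjoin_algebraMap (t : K) : Module.finrank Fq⟮algebraMap K L t⟯ L =
    Module.finrank Fq⟮t⟯ K * Module.finrank K L := by
  rw [Module.finrank_mul_finrank]
  refine (Algebra.finrank_eq_of_equiv_equiv (adjoinMapEquiv Fq K L t).toRingEquiv
    (RingEquiv.refl L) ?_).symm
  rfl

theorem IsFunctionFieldOver.of_finite [IsFunctionFieldOver Fq K] [FiniteDimensional K L] :
    IsFunctionFieldOver Fq L := by
  obtain ⟨t, ht, hfin⟩ := IsFunctionFieldOver.exists_transcendental (Fq := Fq) (K := K)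
  refine ⟨algebraMap K L t, ?_, ?_⟩
  · rwa [Transcendental, isAlgebraic_algebraMap_iff (algebraMap K L).injective]
  · refine Module.finite_of_finrank_pos ?_
    rw [finrank_adjoin_algebraMap]
    exact Nat.mul_pos Module.finrank_pos Module.finrank_pos

end FiniteExtension

/-! ### Places above and below, ramification and residue extensions -/

section Below

set_option linter.unusedSectionVars false

variable (K : Type*) {L : Type*} [Field K] [Field L] [Algebra K L]

/-- The place of `K` below a place of an algebraic extension. -/
def Place.below [Algebra.IsAlgebraic K L] (w : Place L) : Place K :=
  ⟨w.1.comap (algebraMap K L), fun h => w.2 (eq_top_iff.2 fun y _ =>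
    mem_place_of_isIntegral w (fun r => (ValuationSubring.mem_comap).1 (h ▸ ValuationSubring.mem_top r))
      (Algebra.IsAlgebraic.isAlgebraic (R := K) y).isIntegral)⟩

variable {K} [Algebra.IsAlgebraic K L]

theorem Place.mem_below (w : Place L) {y : K} : y ∈ (w.below K).1 ↔ algebraMap K L y ∈ w.1 :=
  Iff.rfl

theorem Place.valuation_below_lt_one (w : Place L) {y : K} :
    (w.below K).1.valuation y < 1 ↔ w.1.valuation (algebraMap K L y) < 1 := by
  rcases eq_or_ne y 0 with rfl | h0
  · simp
  have h0' : algebraMap K L y ≠ 0 := by simpa using h0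
  rw [← ValuationSubring.mem_nonunits_iff, ← ValuationSubring.mem_nonunits_iff]
  have h1 := (w.below K).1.inv_mem_nonunits_iff (x := y⁻¹)
  have h2 := w.1.inv_mem_nonunits_iff (x := algebraMap K L y⁻¹)
  rw [inv_inv] at h1
  rw [← map_inv₀, inv_inv] at h2
  rw [h1, h2, Place.mem_below]
  simp

/-- The local ring at $v$ is dominated by a valuation ring of $L$, and this restricts to exactly $v$
because discrete valuation rings are maximal subrings (`Place.le_iff_eq`). -/
theorem Place.exists_above [DiscretePlaces K] (v : Place K) : ∃ w : Place L, w.below K = v := by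
  obtain ⟨A, h, hloc⟩ := IsLocalRing.exists_factor_valuationRing
    ((algebraMap K L).comp v.1.subtype)
  have hle : v.1 ≤ A.comap (algebraMap K L) := fun y hy => h ⟨y, hy⟩
  have hA : A ≠ ⊤ := by
    rintro rfl
    refine v.irreducible_unif.not_isUnit (hloc.map_nonunit _ ?_)
    have hu : algebraMap K L v.unif ≠ 0 := by simpa using v.unif_ne_zero
    refine IsUnit.of_mul_eq_one ⟨(algebraMap K L v.unif)⁻¹, ValuationSubring.mem_top _⟩ ?_
    exact Subtype.ext (mul_inv_cancel₀ hu)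
  exact ⟨⟨A, hA⟩, (Place.le_iff_eq.1 hle).symm⟩

variable [DiscretePlaces K] [DiscretePlaces L]

/-- The ramification index. -/
def Place.ramIdx (K : Type*) {L : Type*} [Field K] [Field L] [Algebra K L]
    [Algebra.IsAlgebraic K L] [DiscretePlaces K] [DiscretePlaces L] (w : Place L) : ℤ :=
  w.ord (algebraMap K L (w.below K).unif)

theorem Place.ramIdx_pos (w : Place L) : 0 < w.ramIdx K := by
  rw [ramIdx, w.ord_pos_iff (by simpa using (w.below K).unif_ne_zero), ← valuation_below_lt_one]
  exact (w.below K).valuation_unif_lt_one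

/-- Dividing $y$ by the right power of the uniformizer below leaves a unit below, which is also a
unit at $w$. -/
theorem Place.ord_algebraMap (w : Place L) (y : K) :
    w.ord (algebraMap K L y) = w.ramIdx K * (w.below K).ord y := by
  rcases eq_or_ne y 0 with rfl | h0
  · simp [Place.ord_zero]
  set v := w.below K
  have hu := v.unif_ne_zero
  have hz := zpow_ne_zero (v.ord y) hu
  have h1 : v.ord (y / v.unif ^ v.ord y) = 0 := by
    rw [v.ord_div h0 hz, v.ord_zpow hu, v.ord_unif]; ring
  have h2 : w.ord (algebraMap K L (y / v.unif ^ v.ord y)) = 0 := by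
    have hd := div_ne_zero h0 hz
    have hd' : algebraMap K L (y / v.unif ^ v.ord y) ≠ 0 := by
      rwa [Ne, FaithfulSMul.algebraMap_eq_zero_iff]
    apply le_antisymm
    · rw [← not_lt, w.ord_pos_iff hd', ← valuation_below_lt_one, ← Place.ord_pos_iff _ hd]
      exact h1.not_gt
    · rw [w.ord_nonneg_iff hd', ← mem_below, ← Place.ord_nonneg_iff _ hd]
      exact h1.ge
  have hmap : ∀ {z : K}, z ≠ 0 → algebraMap K L z ≠ 0 := fun h => by simpa using h
  rw [map_div₀, w.ord_div (hmap h0) (hmap hz), map_zpow₀, w.ord_zpow (hmap hu)] at h2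
  rw [ramIdx, mul_comm]
  exact sub_eq_zero.1 h2

/-- The embedding of residue fields. -/
def Place.residueMap (w : Place L) :
    IsLocalRing.ResidueField (w.below K).1 →+* IsLocalRing.ResidueField w.1 :=
  Ideal.Quotient.lift _ ((IsLocalRing.residue w.1).comp
    (((algebraMap K L).comp (w.below K).1.subtype).codRestrict w.1 fun y => y.2)) fun a ha => by
      change IsLocalRing.residue w.1 _ = 0
      rw [IsLocalRing.residue_eq_zero_iff, w.1.valuation_lt_one_iff]
      exact (w.valuation_below_lt_one).1 (((w.below K).1.valuation_lt_one_iff a).1 ha)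

theorem Place.exists_card_eq_pow (w : Place L) : ∃ f > 0, w.card = (w.below K).card ^ f := by
  let _ := (w.residueMap (K := K)).toAlgebra
  refine ⟨Module.finrank (IsLocalRing.ResidueField (w.below K).1) (IsLocalRing.ResidueField w.1),
    Module.finrank_pos, ?_⟩
  exact Module.natCard_eq_pow_finrank

variable [FiniteDimensional K L]

theorem hasRelations_place (v : Place K) :
    HasRelations ((algebraMap K L).comp v.1.subtype) ⟨v.unif, v.unif_mem⟩
      (Module.finrank K L) := by
  intro f
  have hdep : ¬ LinearIndependent v.1 f := by
    rw [LinearIndependent.iff_fractionRing v.1 K]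
    intro h
    have := h.fintype_card_le_finrank
    simp at this
  rw [Fintype.not_linearIndependent_iff] at hdep
  obtain ⟨g, hg, i, hi⟩ := hdep
  refine exists_primitive_relation v.irreducible_unif.not_isUnit _ ?_ f g ⟨i, hi⟩ ?_
  · exact fun h => v.unif_ne_zero (by simpa using h)
  · rw [← hg]
    refine Finset.sum_congr rfl fun j _ => ?_
    rw [Algebra.smul_def]
    rfl

/-- The multiplicative form of $\sum ef\le[L:K]$, obtained from the fundamental inequality over the
discrete valuation ring at $v$. -/
theorem prod_card_above_le (v : Place K) (W : Finset (Place L)) (hW : ∀ w ∈ W, w.below K = v) :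
    ∏ w ∈ W, w.card ^ (w.ramIdx K).toNat ≤ v.card ^ Module.finrank K L := by
  have hmax : (Ideal.span {(⟨v.unif, v.unif_mem⟩ : v.1)}).IsMaximal := by
    rw [← v.irreducible_unif.maximalIdeal_eq]
    infer_instance
  have hcard := v.natCard_quotient_span (f := ⟨v.unif, v.unif_mem⟩) v.irreducible_unif.ne_zero
    (n := 1) v.ord_unif
  rw [pow_one] at hcard
  have : Finite (v.1 ⧸ Ideal.span {(⟨v.unif, v.unif_mem⟩ : v.1)}) :=
    Nat.finite_of_card_ne_zero (by rw [hcard]; exact v.card_pos.ne')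
  have h := prod_card_pow_ord_le (K := L) ((algebraMap K L).comp v.1.subtype)
    ⟨v.unif, v.unif_mem⟩ hmax (hasRelations_place v)
    (by simpa using v.unif_ne_zero) W (fun w hw r => by
      have : (r : K) ∈ (w.below K).1 := by rw [hW w hw]; exact r.2
      exact this)
  rw [hcard] at h
  refine le_of_eq_of_le (Finset.prod_congr rfl fun w hw => ?_) h
  rw [Place.ramIdx, hW w hw]
  rfl

end Below

/-! ### The conorm of divisors and the fundamental identity -/

section Conorm

set_option linter.unusedSectionVars false

variable {K L : Type*} [Field K] [Field L] [Algebra K L] [FiniteDimensional K L]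
  [GlobalPlaces K] [GlobalPlaces L]

theorem Place.finite_above (v : Place K) : {w : Place L | w.below K = v}.Finite := by
  refine (GlobalPlaces.finite_ord_ne_zero (algebraMap K L v.unif)).subset fun w hw => ?_
  have := w.ramIdx_pos (K := K)
  rw [Place.ramIdx, show w.below K = v from hw] at this
  exact this.ne'

variable (K L) in
/-- The conorm `Div K → Div L`. -/
def conorm : Divisor K →+ Divisor L where
  toFun D := Finsupp.ofSupportFinite (fun w => w.ramIdx K * D (w.below K))
    ((Set.Finite.biUnion D.support.finite_toSet fun v _ => v.finite_above (L := L)).subset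
      fun w hw => Set.mem_biUnion (x := w.below K)
        (Finsupp.mem_support_iff.2 fun h => hw (by
          change w.ramIdx K * _ = 0
          rw [h, mul_zero])) rfl)
  map_zero' := Finsupp.ext fun w => mul_zero _
  map_add' := fun D E => Finsupp.ext fun w => mul_add _ _ _

theorem conorm_apply (D : Divisor K) (w : Place L) :
    conorm K L D w = w.ramIdx K * D (w.below K) := rfl

theorem conorm_injective : Function.Injective (conorm K L) := by
  refine (injective_iff_map_eq_zero _).2 fun D hD => Finsupp.ext fun v => ?_
  obtain ⟨w, rfl⟩ := v.exists_above (L := L)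
  have := DFunLike.congr_fun hD w
  rw [conorm_apply] at this
  exact (mul_eq_zero.1 this).resolve_left w.ramIdx_pos.ne'

theorem conorm_divisor (f : K) : conorm K L (divisor f) = divisor (algebraMap K L f) :=
  Finsupp.ext fun w => (w.ord_algebraMap f).symm

theorem conorm_single (v : Place K) (n : ℤ) : conorm K L (Finsupp.single v n) =
    ∑ w ∈ (v.finite_above (L := L)).toFinset, Finsupp.single w (w.ramIdx K * n) := by
  classical
  ext w
  rw [conorm_apply, Finsupp.finsetSum_apply]
  by_cases hw : w.below K = v
  · have : w ∈ (v.finite_above (L := L)).toFinset := (Set.Finite.mem_toFinset _).2 hw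
    rw [Finset.sum_eq_single_of_mem w this fun w' _ hne => Finsupp.single_eq_of_ne hne.symm,
      Finsupp.single_eq_same, hw, Finsupp.single_eq_same]
  · rw [Finsupp.single_eq_of_ne hw, mul_zero]
    refine (Finset.sum_eq_zero fun w' hw' => Finsupp.single_eq_of_ne ?_).symm
    rintro rfl
    exact hw ((v.finite_above (L := L)).mem_toFinset.1 hw')

theorem divNorm_sum {K ι : Type*} [Field K] [GlobalPlaces K] (s : Finset ι) (D : ι → Divisor K) :
    divNorm (∑ i ∈ s, D i) = ∏ i ∈ s, divNorm (D i) := by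
  classical
  induction s using Finset.induction_on with
  | empty => rw [Finset.sum_empty, Finset.prod_empty, divNorm_zero]
  | insert a s ha ih => rw [Finset.sum_insert ha, Finset.prod_insert ha, divNorm_add, ih]

theorem divNorm_conorm_single_eq (v : Place K) : divNorm (conorm K L (Finsupp.single v 1)) =
    ((∏ w ∈ (v.finite_above (L := L)).toFinset, w.card ^ (w.ramIdx K).toNat : ℕ) : ℝ) := by
  rw [conorm_single, divNorm_sum, Nat.cast_prod]
  refine Finset.prod_congr rfl fun w _ => ?_
  rw [divNorm_single, mul_one, Nat.cast_pow, ← zpow_natCast, Int.toNat_of_nonneg w.ramIdx_pos.le]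

theorem divNorm_conorm_single_le (v : Place K) : divNorm (conorm K L (Finsupp.single v 1)) ≤
    divNorm (Finsupp.single v 1) ^ Module.finrank K L := by
  rw [divNorm_conorm_single_eq, divNorm_single, zpow_one]
  exact_mod_cast prod_card_above_le v _ fun w hw => (v.finite_above (L := L)).mem_toFinset.1 hw

theorem conorm_poleDivisor (t : K) :
    conorm K L (poleDivisor t) = poleDivisor (algebraMap K L t) := by
  ext w
  rw [conorm_apply, poleDivisor_apply, poleDivisor_apply, w.ord_algebraMap,
    mul_max_of_nonneg _ _ w.ramIdx_pos.le, mul_zero, mul_neg]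

theorem divNorm_eq_prod (D : Divisor K) :
    divNorm D = ∏ v ∈ D.support, divNorm (Finsupp.single v 1) ^ D v :=
  Finset.prod_congr rfl fun v _ => by rw [divNorm_single, zpow_one]

theorem divNorm_conorm_eq_prod (D : Divisor K) : divNorm (conorm K L D) =
    ∏ v ∈ D.support, divNorm (conorm K L (Finsupp.single v 1)) ^ D v := by
  conv_lhs => rw [← D.sum_single, Finsupp.sum, map_sum, divNorm_sum]
  refine Finset.prod_congr rfl fun v _ => ?_
  rw [← divNorm_zsmul, ← map_zsmul, Finsupp.smul_single, smul_eq_mul, mul_one]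

/-- The fundamental identity `∑ e f = [L : K]`. -/
theorem divNorm_conorm_single (Fq : Type*) [Field Fq] [Finite Fq] [Algebra Fq K] [Algebra Fq L]
    [IsScalarTower Fq K L] [IsFunctionFieldOver Fq K] (v : Place K) :
    divNorm (conorm K L (Finsupp.single v 1)) =
      divNorm (Finsupp.single v 1) ^ Module.finrank K L := by
  refine le_antisymm (divNorm_conorm_single_le v) ?_
  by_contra! hlt
  have := IsFunctionFieldOver.of_finite Fq K L
  -- Take $t=s^{-1}$, which has a pole at $v$. The norms of $(t)_\infty$ over $K$ and over $L$ are
  -- both known from field degrees and differ exactly by the exponent $[L:K]$. Each pole contributes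
  -- at most its share, so a strict inequality at $v$ is impossible.
  obtain ⟨s, hs, hs1⟩ := exists_transcendental_mem_nonunits Fq v
  have hs0 : s ≠ 0 := by rintro rfl; exact hs isAlgebraic_zero
  set t := s⁻¹ with ht
  have htt : Transcendental Fq t := fun h => hs (by simpa [ht] using h.inv)
  have htL : Transcendental Fq (algebraMap K L t) := by
    rwa [Transcendental, isAlgebraic_algebraMap_iff (algebraMap K L).injective]
  have hord : 0 < v.ord s := (v.ord_pos_iff hs0).2 hs1
  have hv : 0 < poleDivisor t v := by
    rw [poleDivisor_apply, ht, v.ord_inv hs0]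
    exact lt_max_of_lt_left (by omega)
  have h1 : divNorm (conorm K L (poleDivisor t)) =
      divNorm (poleDivisor t) ^ Module.finrank K L := by
    rw [conorm_poleDivisor, divNorm_poleDivisor Fq htL, divNorm_poleDivisor Fq htt,
      finrank_adjoin_algebraMap, pow_mul]
  rw [divNorm_conorm_eq_prod, divNorm_eq_prod, ← Finset.prod_pow] at h1
  refine h1.not_lt (Finset.prod_lt_prod (fun _ _ => zpow_pos (divNorm_pos _) _)
    (fun v' _ => ?_) ⟨v, Finsupp.mem_support_iff.2 hv.ne', ?_⟩)
  · rw [← zpow_natCast, zpow_comm, zpow_natCast]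
    exact zpow_le_zpow_left₀ (poleDivisor_nonneg t v') (divNorm_pos _).le
      (divNorm_conorm_single_le v')
  · rw [← zpow_natCast, zpow_comm, zpow_natCast]
    exact zpow_lt_zpow_left₀ hv (divNorm_pos _).le hlt

theorem divNorm_conorm (Fq : Type*) [Field Fq] [Finite Fq] [Algebra Fq K] [Algebra Fq L]
    [IsScalarTower Fq K L] [IsFunctionFieldOver Fq K] (D : Divisor K) :
    divNorm (conorm K L D) = divNorm D ^ Module.finrank K L := by
  rw [divNorm_conorm_eq_prod, divNorm_eq_prod, ← Finset.prod_pow]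
  refine Finset.prod_congr rfl fun v _ => ?_
  rw [divNorm_conorm_single Fq, ← zpow_natCast, zpow_comm, zpow_natCast]

end Conorm

end

end BinQuad

namespace BinQuad

noncomputable section

/-! ### Counting effective divisors -/

section Counting

set_option linter.unusedSectionVars false

/-- The effective divisors of norm `M`. -/
def effective (K : Type*) [Field K] (M : ℝ) : Set (Divisor K) := {D | 0 ≤ D ∧ divNorm D = M}

theorem finite_effective_eq (Fq K : Type*) [Field Fq] [Field K] [Algebra Fq K] [Finite Fq]
    [IsFunctionFieldOver Fq K] [GlobalPlaces K] (M : ℝ) : (effective K M).Finite :=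
  (finite_effective Fq M).subset fun _ hD => ⟨hD.1, hD.2.le⟩

theorem isAlgebraic_of_divisor_eq_zero (K : Type*) [Field K] [GlobalPlaces K] {f : K} (hf : f ≠ 0) (h : divisor f = 0) :
    f ∈ rrSpace (0 : Divisor K) := by
  rw [mem_rrSpace_iff hf]
  intro w
  have := DFunLike.congr_fun h w
  rw [divisor_apply] at this
  simp [this]

theorem add_divisor_mem_effective (Fq K : Type*) [Field Fq] [Field K] [Algebra Fq K] [Finite Fq]
    [IsFunctionFieldOver Fq K] [GlobalPlaces K] {D : Divisor K} {f : K} (hf : f ≠ 0) (h : f ∈ rrSpace D) :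
    D + divisor f ∈ effective K (divNorm D) := by
  refine ⟨fun w => ?_, by rw [divNorm_add, divNorm_divisor Fq hf, mul_one]⟩
  have := (mem_rrSpace_iff hf).1 h w
  rw [Finsupp.zero_apply, Finsupp.add_apply, divisor_apply]
  omega

/-- The map $f\mapsto D+\operatorname{div}f$ sends nonzero elements of $L(D)$ to effective divisors
of the same norm, with fibres of at most $q_K$ elements, and Riemann's inequality bounds $L(D)$ from
below. -/
theorem exists_le_ncard_effective (Fq K : Type*) [Field Fq] [Field K] [Algebra Fq K] [Finite Fq]
    [IsFunctionFieldOver Fq K] [GlobalPlaces K] : ∃ c : ℝ, 0 < c ∧ ∃ M₀ : ℝ, ∀ D : Divisor K, M₀ ≤ divNorm D →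
    c * divNorm D ≤ (effective K (divNorm D)).ncard := by
  classical
  obtain ⟨c, hc, hcD⟩ := exists_le_card_rrSpace Fq K
  have := finite_rrSpace_zero Fq (K := K)
  have hQ : 0 < constCard K Fq := by
    rw [← card_rrSpace_zero Fq]; exact Nat.card_pos
  have hQ' : (0 : ℝ) < constCard K Fq := by exact_mod_cast hQ
  -- The factor $2$ and the bound $2/c$ absorb the zero element of $L(D)$: if $cN\ge2$, then
  -- $cN-1\ge cN/2$.
  refine ⟨c / (2 * constCard K Fq), by positivity, 2 / c, fun D hD => ?_⟩
  have hfin := (finite_effective_eq Fq K (divNorm D)).to_subtype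
  obtain ⟨hfinD, hle⟩ := hcD D
  have hsec : ∀ E : effective K (divNorm D), ∃ g : K, g ≠ 0 ∧
      ((∃ f : K, f ≠ 0 ∧ (E : Divisor K) = D + divisor f) → (E : Divisor K) = D + divisor g) := by
    intro E
    by_cases h : ∃ f : K, f ≠ 0 ∧ (E : Divisor K) = D + divisor f
    · obtain ⟨f, hf, hE⟩ := h
      exact ⟨f, hf, fun _ => hE⟩
    · exact ⟨1, one_ne_zero, fun h' => absurd h' h⟩
  choose g hg hgE using hsec
  -- A nonzero `f` is recorded by its effective divisor and by its quotient with a chosen element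
  -- having the same divisor, which is a constant. The zero element goes to `none`.
  let Φ : rrSpace D → Option (effective K (divNorm D) × rrSpace (0 : Divisor K)) := fun f =>
    if hf : (f : K) = 0 then none
    else some (⟨_, add_divisor_mem_effective Fq K hf f.2⟩,
      ⟨f / g ⟨_, add_divisor_mem_effective Fq K hf f.2⟩,
        isAlgebraic_of_divisor_eq_zero K (div_ne_zero hf (hg _)) (by
          rw [divisor_div hf (hg _), sub_eq_zero]
          exact add_left_cancel (hgE ⟨_, add_divisor_mem_effective Fq K hf f.2⟩
            ⟨f, hf, rfl⟩))⟩)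
  have hΦ : Function.Injective Φ := by
    intro f f' h
    by_cases hf : (f : K) = 0
    · by_cases hf' : (f' : K) = 0
      · exact Subtype.ext (hf.trans hf'.symm)
      · simp only [Φ, dif_pos hf, dif_neg hf'] at h
        exact absurd h (by simp)
    · by_cases hf' : (f' : K) = 0
      · simp only [Φ, dif_neg hf, dif_pos hf'] at h
        exact absurd h (by simp)
      · simp only [Φ, dif_neg hf, dif_neg hf', Option.some.injEq, Prod.mk.injEq] at h
        obtain ⟨h1, h2⟩ := h
        rw [Subtype.mk.injEq, h1] at h2
        exact Subtype.ext ((div_left_inj' (hg _)).1 h2)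
  have hcard := Nat.card_le_card_of_injective Φ hΦ
  rw [Finite.card_option, Nat.card_prod, card_rrSpace_zero Fq, Nat.card_coe_set_eq] at hcard
  have hcard' : (Nat.card (rrSpace D) : ℝ) ≤
      (effective K (divNorm D)).ncard * constCard K Fq + 1 := by exact_mod_cast hcard
  have h2 : 2 ≤ c * divNorm D := by
    rwa [div_le_iff₀' hc] at hD
  rw [div_mul_eq_mul_div, div_le_iff₀ (by positivity)]
  nlinarith

/-- Effective divisors equivalent to a given one $E$ of norm $M$ are all $E+\operatorname{div}f$
with $f\in L(E)$, so a class contains at most $q_KM$ of them. The number of classes in play is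
finite. -/
theorem exists_ncard_effective_le (Fq K : Type*) [Field Fq] [Field K] [Algebra Fq K] [Finite Fq]
    [IsFunctionFieldOver Fq K] [GlobalPlaces K] : ∃ C : ℝ, ∀ M : ℝ, 0 ≤ M → (effective K M).ncard ≤ C * M := by
  classical
  have := finite_classGroup Fq K
  have := Fintype.ofFinite (normKer K ⧸ (principal K).addSubgroupOf (normKer K))
  have := finite_rrSpace_zero Fq (K := K)
  refine ⟨constCard K Fq * Fintype.card (normKer K ⧸ (principal K).addSubgroupOf (normKer K)),
    fun M hM => ?_⟩
  rcases (effective K M).eq_empty_or_nonempty with he | ⟨D₀, hD₀⟩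
  · rw [he, Set.ncard_empty, Nat.cast_zero]
    positivity
  have hfin := finite_effective_eq Fq K M
  let cls : Divisor K → normKer K ⧸ (principal K).addSubgroupOf (normKer K) := fun D =>
    if h : D - D₀ ∈ normKer K then QuotientAddGroup.mk ⟨_, h⟩ else 0
  have hn : ∀ D ∈ effective K M, D - D₀ ∈ normKer K := fun D hD => by
    change divNorm _ = 1
    rw [divNorm_sub, hD.2, hD₀.2, div_self]
    rw [← hD₀.2]
    exact (divNorm_pos D₀).ne'
  have key := Finset.card_le_mul_card_image_of_maps_to (s := hfin.toFinset) (t := Finset.univ)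
    (f := cls) (fun _ _ => Finset.mem_univ _) ⌊constCard K Fq * M⌋₊ fun y _ => by
      rcases (hfin.toFinset.filter fun D => cls D = y).eq_empty_or_nonempty with h0 | ⟨E, hE⟩
      · rw [h0, Finset.card_empty]; exact Nat.zero_le _
      rw [Finset.mem_filter, Set.Finite.mem_toFinset] at hE
      obtain ⟨hEfin, hEle⟩ := card_rrSpace_le Fq hE.1.1
      rw [hE.1.2] at hEle
      refine le_trans ?_ (Nat.le_floor hEle)
      have hex : ∀ D ∈ hfin.toFinset.filter fun D => cls D = y,
          ∃ f : rrSpace E, D = E + divisor (f : K) := by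
        intro D hD
        rw [Finset.mem_filter, Set.Finite.mem_toFinset] at hD
        have h1 := hD.2.trans hE.2.symm
        simp only [cls, dif_pos (hn D hD.1), dif_pos (hn E hE.1)] at h1
        have h2 := QuotientAddGroup.eq.1 h1.symm
        rw [AddSubgroup.mem_addSubgroupOf, mem_principal_iff] at h2
        obtain ⟨f, hf, h3⟩ := h2
        have h4 : D = E + divisor f := by
          rw [← h3]
          push_cast
          abel
        refine ⟨⟨f, (mem_rrSpace_iff hf).2 fun w => ?_⟩, h4⟩
        have h5 := hD.1.1 w
        rw [h4, Finsupp.zero_apply, Finsupp.add_apply, divisor_apply] at h5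
        omega
      have hex' : ∀ D : Divisor K, ∃ f : rrSpace E,
          D ∈ (hfin.toFinset.filter fun D => cls D = y) → D = E + divisor (f : K) := by
        intro D
        by_cases hD : D ∈ hfin.toFinset.filter fun D => cls D = y
        · exact ⟨(hex D hD).choose, fun _ => (hex D hD).choose_spec⟩
        · exact ⟨0, fun h => absurd h hD⟩
      choose F hF using hex'
      have := Fintype.ofFinite (rrSpace E)
      rw [Nat.card_eq_fintype_card, ← Finset.card_univ]
      refine Finset.card_le_card_of_injOn F (fun _ _ => Finset.mem_coe.2 (Finset.mem_univ _))
        fun D hD D' hD' h => ?_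
      rw [hF D (Finset.mem_coe.1 hD), hF D' (Finset.mem_coe.1 hD'), h]
  rw [Finset.card_univ] at key
  rw [Set.ncard_eq_toFinset_card _ hfin]
  calc (hfin.toFinset.card : ℝ) ≤ (⌊constCard K Fq * M⌋₊ : ℝ) *
        Fintype.card (normKer K ⧸ (principal K).addSubgroupOf (normKer K)) := by
          exact_mod_cast key
    _ ≤ constCard K Fq * M *
        Fintype.card (normKer K ⧸ (principal K).addSubgroupOf (normKer K)) := by
          gcongr
          exact Nat.floor_le (by positivity)
    _ = _ := by ring

end Counting

/-! ### Degrees -/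

section Degree

variable (Fq : Type*) {K : Type*} [Field Fq] [Field K] [Algebra Fq K] [Finite Fq]

set_option linter.unusedSectionVars false

/-- Constants map to the residue field. -/
def constToResidue (w : Place K) : Fq →+* IsLocalRing.ResidueField w.1 :=
  (IsLocalRing.residue w.1).comp ((algebraMap Fq K).codRestrict w.1 fun _ =>
    mem_of_isAlgebraic Fq w.1 (isAlgebraic_algebraMap _))

theorem exists_card_eq_pow [DiscretePlaces K] (w : Place K) :
    ∃ m > 0, w.card = Nat.card Fq ^ m := by
  let _ := (constToResidue Fq w).toAlgebra
  exact ⟨Module.finrank Fq (IsLocalRing.ResidueField w.1), Module.finrank_pos,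
    Module.natCard_eq_pow_finrank⟩

theorem finite_algebraicClosure (Fq K : Type*) [Field Fq] [Field K] [Algebra Fq K] [Finite Fq]
    [IsFunctionFieldOver Fq K] : Finite (algebraicClosure Fq K) := by
  have := IsFunctionFieldOver.globalPlaces Fq K
  have := finite_rrSpace_zero Fq (K := K)
  refine Nat.finite_of_card_ne_zero ?_
  change constCard K Fq ≠ 0
  rw [← card_rrSpace_zero Fq]
  exact Nat.card_pos.ne'

theorem one_lt_constCard [IsFunctionFieldOver Fq K] : 1 < constCard K Fq :=
  have := finite_algebraicClosure Fq K
  Finite.one_lt_card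

/-- The residue field is an extension of the field of constants, so $q_w$ is an exact power of $q_K$
and the logarithm in `degree` loses nothing by rounding. -/
theorem card_place_eq_pow [IsFunctionFieldOver Fq K] [DiscretePlaces K] (w : Place K) :
    w.card = constCard K Fq ^ Nat.log (constCard K Fq) w.card ∧
      0 < Nat.log (constCard K Fq) w.card := by
  have := finite_algebraicClosure Fq K
  obtain ⟨m, hm, h⟩ := exists_card_eq_pow (algebraicClosure Fq K) w
  change w.card = constCard K Fq ^ m at h
  rw [h, Nat.log_pow (one_lt_constCard Fq)]
  exact ⟨rfl, hm⟩

theorem degree_single (w : Place K) (n : ℤ) : degree K Fq (Finsupp.single w n) =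
    n * (Nat.log (constCard K Fq) w.card : ℤ) := by
  simp [degree]

theorem divNorm_eq_pow_degree [IsFunctionFieldOver Fq K] [GlobalPlaces K] (D : Divisor K) :
    divNorm D = (constCard K Fq : ℝ) ^ degree K Fq D := by
  have h0 : (constCard K Fq : ℝ) ≠ 0 :=
    Nat.cast_ne_zero.2 (zero_lt_one.trans (one_lt_constCard Fq (K := K))).ne'
  induction D using Finsupp.induction_linear with
  | zero => rw [divNorm_zero, map_zero, zpow_zero]
  | add D E hD hE => rw [divNorm_add, map_add, zpow_add₀ h0, hD, hE]
  | single w n =>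
    rw [divNorm_single, degree_single, mul_comm, zpow_mul, zpow_natCast]
    congr 1
    exact_mod_cast (card_place_eq_pow Fq w).1

theorem ker_degree_eq [IsFunctionFieldOver Fq K] [GlobalPlaces K] :
    (degree K Fq).ker = normKer K := by
  ext D
  rw [AddMonoidHom.mem_ker]
  change _ ↔ divNorm D = 1
  have h1 : (1 : ℝ) < constCard K Fq := by exact_mod_cast one_lt_constCard Fq (K := K)
  rw [divNorm_eq_pow_degree Fq, zpow_eq_one_iff_right₀ (by positivity) h1.ne']

end Degree

end

end BinQuad

namespace BinQuad

noncomputable section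

/-! ### Divisors of degree one -/

section Conjugate

set_option linter.unusedSectionVars false

variable {K L : Type*} [Field K] [Field L] [Algebra K L] [FiniteDimensional K L]

/-- The conjugate of a place by an automorphism. -/
def Place.conj (w : Place L) (τ : L ≃ₐ[K] L) : Place L :=
  ⟨w.1.comap (τ : L →+* L), fun h => w.2 (eq_top_iff.2 fun y _ => by
    have : τ.symm y ∈ w.1.comap (τ : L →+* L) := by
      rw [h]
      exact ValuationSubring.mem_top _
    rw [ValuationSubring.mem_comap] at this
    simpa using this)⟩

theorem Place.mem_conj (w : Place L) (τ : L ≃ₐ[K] L) {y : L} : y ∈ (w.conj τ).1 ↔ τ y ∈ w.1 :=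
  Iff.rfl

theorem Place.conj_mul (w : Place L) (τ τ' : L ≃ₐ[K] L) :
    w.conj (τ * τ') = (w.conj τ).conj τ' := rfl

theorem Place.conj_one (w : Place L) : w.conj (1 : L ≃ₐ[K] L) = w := rfl

theorem Place.conj_injective (τ : L ≃ₐ[K] L) :
    Function.Injective fun w : Place L => w.conj τ := by
  intro w w' h
  have := congr_arg (fun w : Place L => w.conj τ⁻¹) h
  simpa only [← Place.conj_mul, mul_inv_cancel, Place.conj_one] using this

theorem Place.below_conj (w : Place L) (τ : L ≃ₐ[K] L) : (w.conj τ).below K = w.below K := by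
  refine Subtype.ext (SetLike.ext fun y => ?_)
  change τ (algebraMap K L y) ∈ w.1 ↔ algebraMap K L y ∈ w.1
  rw [AlgEquiv.commutes]

theorem Place.valuation_conj_lt_one (w : Place L) (τ : L ≃ₐ[K] L) {y : L} :
    (w.conj τ).1.valuation y < 1 ↔ w.1.valuation (τ y) < 1 := by
  rcases eq_or_ne y 0 with rfl | h0
  · simp
  rw [← ValuationSubring.mem_nonunits_iff, ← ValuationSubring.mem_nonunits_iff]
  have h1 := (w.conj τ).1.inv_mem_nonunits_iff (x := y⁻¹)
  have h2 := w.1.inv_mem_nonunits_iff (x := τ y⁻¹)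
  rw [inv_inv] at h1
  rw [← map_inv₀, inv_inv] at h2
  rw [h1, h2, Place.mem_conj]
  simp

/-- An element of a finite extension field fixed by the Frobenius of the base is in the base. -/
theorem mem_range_of_pow_card_eq {κ κ' : Type*} [Field κ] [Field κ'] [Finite κ] (φ : κ →+* κ')
    {r : κ'} (hr : r ^ Nat.card κ = r) : ∃ a, φ a = r := by
  classical
  let _ := Fintype.ofFinite κ
  have hne := FiniteField.X_pow_card_sub_X_ne_zero κ' (Finite.one_lt_card (α := κ))
  let p : Polynomial κ' := Polynomial.X ^ Nat.card κ - Polynomial.X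
  have hroot : ∀ s : κ', s ^ Nat.card κ = s → s ∈ p.roots.toFinset := fun s hs => by
    rw [Multiset.mem_toFinset, Polynomial.mem_roots hne]
    rw [Polynomial.IsRoot, Polynomial.eval_sub, Polynomial.eval_pow, Polynomial.eval_X, hs, sub_self]
  have hsub : Finset.univ.image φ ⊆ p.roots.toFinset := by
    intro s hs
    obtain ⟨a, -, rfl⟩ := Finset.mem_image.1 hs
    refine hroot _ ?_
    rw [← map_pow, Nat.card_eq_fintype_card, FiniteField.pow_card]
  -- The polynomial $X^q-X$ has at most $q$ roots, and the image of the field with $q$ elements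
  -- already supplies that many.
  have hcard : p.roots.toFinset.card ≤ (Finset.univ.image φ).card := by
    rw [Finset.card_image_of_injective _ φ.injective, Finset.card_univ,
      ← Nat.card_eq_fintype_card]
    refine (Multiset.toFinset_card_le _).trans ((Polynomial.card_roots' p).trans ?_)
    exact (FiniteField.X_pow_card_sub_X_natDegree_eq κ' (Finite.one_lt_card (α := κ))).le
  have := hroot r hr
  rw [← Finset.eq_of_subset_of_card_le hsub hcard] at this
  obtain ⟨a, -, ha⟩ := Finset.mem_image.1 this
  exact ⟨a, ha⟩

variable (Fq : Type*) [Field Fq] [Finite Fq] [Algebra Fq K] [Algebra Fq L] [IsScalarTower Fq K L]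
  [GlobalPlaces K] [GlobalPlaces L]

/-- A place whose degree is divisible by the degree of a constant field extension splits
completely in it. -/
theorem exists_split_places {f : Polynomial Fq} (hf : Irreducible f)
    (hdeg : Module.finrank K L = f.natDegree) (h2 : 1 < f.natDegree) {α : L}
    (hα : Polynomial.aeval α f = 0) (σ : L ≃ₐ[K] L) (hσ : σ α = α ^ Nat.card Fq) (v : Place K)
    {m : ℕ} (hm : v.card = Nat.card Fq ^ m) (hdvd : f.natDegree ∣ m) :
    ∃ w w' : Place L, w ≠ w' ∧ w.below K = v ∧ w'.below K = v ∧ w.card = v.card ∧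
      w'.card = v.card := by
  classical
  obtain ⟨w, rfl⟩ := v.exists_above (L := L)
  have hαalg : IsAlgebraic Fq α := ⟨f, hf.ne_zero, hα⟩
  -- Since $\deg f$ divides $m$, the polynomial $f$ divides $X^{q^m}-X$. Thus the residue of
  -- $\alpha$ at $w$ already lies in the residue field of the place below.
  have hpow : α ^ (w.below K).card = α := by
    obtain ⟨g, hg⟩ := (hf.natDegree_dvd_iff_dvd_X_pow_card_pow_sub_X).1 hdvd
    have := congr_arg (Polynomial.aeval α) hg
    rw [map_mul, hα, zero_mul] at this
    rw [hm]
    simpa [sub_eq_zero] using this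
  have hαw : α ∈ w.1 := mem_of_isAlgebraic Fq w.1 hαalg
  obtain ⟨a, ha⟩ := mem_range_of_pow_card_eq (w.residueMap (K := K))
    (r := IsLocalRing.residue w.1 ⟨α, hαw⟩) (by
      rw [← map_pow]
      congr 1
      exact Subtype.ext hpow)
  obtain ⟨a, rfl⟩ := IsLocalRing.residue_surjective a
  have ha' : w.1.valuation (α - algebraMap K L a) < 1 := by
    have h : IsLocalRing.residue w.1 (⟨α, hαw⟩ - ⟨algebraMap K L a, a.2⟩) = 0 := by
      rw [map_sub, ← ha]
      exact sub_self _
    rw [IsLocalRing.residue_eq_zero_iff] at h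
    exact (w.1.valuation_lt_one_iff _).1 h
  have hσpow : ∀ i : ℕ, (σ ^ i) α = α ^ (Nat.card Fq ^ i) := by
    intro i
    induction i with
    | zero => simp
    | succ i ih => rw [pow_succ', AlgEquiv.mul_apply, ih, map_pow, hσ, ← pow_mul, pow_succ']
  -- If $\sigma^i$ fixed $w$, then $\alpha$ and $\alpha^{q^i}$ would have the same residue. Their
  -- difference is algebraic over $\mathbb F_q$ and hence zero, which forces $\deg f$ to divide $i$.
  have hne : ∀ i : ℕ, 0 < i → i < f.natDegree → w.conj (σ ^ i) ≠ w := by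
    intro i hi hi' h
    have h1 : ((w.conj (σ ^ i)).1).valuation (α - algebraMap K L a) < 1 := by rwa [h]
    rw [Place.valuation_conj_lt_one, map_sub, AlgEquiv.commutes, hσpow] at h1
    have h3 : w.1.valuation (α ^ (Nat.card Fq ^ i) - α) < 1 := by
      have : α ^ (Nat.card Fq ^ i) - α = (α ^ (Nat.card Fq ^ i) - algebraMap K L a) -
        (α - algebraMap K L a) := by ring
      rw [this]
      exact lt_of_le_of_lt (Valuation.map_sub _ _ _) (max_lt h1 ha')
    have h4 : α ^ (Nat.card Fq ^ i) - α = 0 := by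
      by_contra h0
      exact h3.ne (valuation_eq_one_of_isAlgebraic Fq w.1 ((hαalg.pow _).sub hαalg) h0)
    have h5 : f ∣ Polynomial.X ^ (Nat.card Fq ^ i) - Polynomial.X := by
      rw [← hf.dvd_iff_aeval_eq_zero (b := α) hα]
      simpa using h4
    have h6 := hf.natDegree_dvd_iff_dvd_X_pow_card_pow_sub_X.2 h5
    exact absurd (Nat.le_of_dvd hi h6) (not_le.2 hi')
  have hinj : Set.InjOn (fun i : ℕ => w.conj (σ ^ i)) (Finset.range f.natDegree) := by
    have key : ∀ i j : ℕ, i < j → j < f.natDegree → w.conj (σ ^ i) ≠ w.conj (σ ^ j) := by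
      intro i j hij hj h
      obtain ⟨l, rfl⟩ := Nat.exists_eq_add_of_lt hij
      rw [show i + l + 1 = (l + 1) + i by ring, pow_add, Place.conj_mul] at h
      exact hne (l + 1) (Nat.succ_pos _) (by omega) (Place.conj_injective _ h).symm
    intro i hi j hj h
    rw [Finset.mem_coe, Finset.mem_range] at hi hj
    rcases lt_trichotomy i j with h' | h' | h'
    · exact absurd h (key i j h' hj)
    · exact h'
    · exact absurd h.symm (key j i h' hi)
  set W := (Finset.range f.natDegree).image fun i : ℕ => w.conj (σ ^ i) with hW
  have hWc : W.card = f.natDegree := by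
    rw [Finset.card_image_of_injOn hinj, Finset.card_range]
  have hWv : ∀ u ∈ W, u.below K = w.below K := by
    intro u hu
    obtain ⟨i, -, rfl⟩ := Finset.mem_image.1 hu
    exact Place.below_conj _ _
  have hge : ∀ u ∈ W, (w.below K).card ≤ u.card := by
    intro u hu
    obtain ⟨e, he, h⟩ := u.exists_card_eq_pow (K := K)
    rw [h, hWv u hu]
    exact Nat.le_self_pow he.ne' _
  -- There are $[L:K]$ places in `W`, each with residue field at least as large as that below. The
  -- fundamental inequality leaves room only for equality.
  have heq : ∀ u ∈ W, u.card = (w.below K).card := by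
    intro u hu
    refine le_antisymm ?_ (hge u hu)
    by_contra! hlt
    have h1 := prod_card_above_le (w.below K) W hWv
    rw [hdeg, ← hWc] at h1
    refine absurd h1 (not_le.2 ?_)
    rw [← Finset.prod_const]
    have hle : ∀ u ∈ W, u.card ≤ u.card ^ (u.ramIdx K).toNat := fun u _ =>
      Nat.le_self_pow (by have := u.ramIdx_pos (K := K); omega) _
    exact Finset.prod_lt_prod (fun _ _ => (w.below K).card_pos)
      (fun u hu => (hge u hu).trans (hle u hu)) ⟨u, hu, hlt.trans_le (hle u hu)⟩
  have hmem : ∀ i < f.natDegree, w.conj (σ ^ i) ∈ W := fun i hi =>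
    Finset.mem_image.2 ⟨i, Finset.mem_range.2 hi, rfl⟩
  have h0 := hmem 0 (by omega)
  have h1 := hmem 1 h2
  refine ⟨_, _, fun h => ?_, hWv _ h0, hWv _ h1, heq _ h0, heq _ h1⟩
  rw [pow_zero, Place.conj_one] at h
  exact hne 1 one_pos h2 h.symm

/-- It is impossible that all places split completely in a constant field extension. -/
theorem not_forall_split [IsFunctionFieldOver Fq K]
    (h : ∀ v : Place K, ∃ w w' : Place L, w ≠ w' ∧ w.below K = v ∧ w'.below K = v ∧
      w.card = v.card ∧ w'.card = v.card) : False := by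
  classical
  have := IsFunctionFieldOver.of_finite Fq K L
  choose w w' hne hw hw' hc hc' using h
  have hinj : Function.Injective w := fun a b hab => by rw [← hw a, hab, hw]
  have hinj' : Function.Injective w' := fun a b hab => by rw [← hw' a, hab, hw']
  have hdisj : ∀ a b, w a ≠ w' b := by
    intro a b hab
    have : a = b := by rw [← hw a, hab, hw']
    subst this
    exact hne a hab
  -- Lifting one divisor along `w` and another along `w'` embeds pairs of divisors of $K$ in
  -- $\mathrm{Div}\,L$ and multiplies norms. Pairs of norms $B^{j_0+j}$ and $B^{j_0+N-j}$ for $0\le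
  -- j\le N$ then give at least $(N+1)c^2B^{2j_0+N}$ effective divisors of norm $B^{2j_0+N}$,
  -- against an upper bound $C\,B^{2j_0+N}$.
  let Φ : Divisor K × Divisor K → Divisor L := fun p =>
    p.1.mapDomain w + p.2.mapDomain w'
  have hΦ1 : ∀ p v, Φ p (w v) = p.1 v := fun p v => by
    rw [Finsupp.add_apply, Finsupp.mapDomain_apply hinj,
      Finsupp.mapDomain_of_notMem_range _ _ (by rintro ⟨b, hb⟩; exact hdisj v b hb.symm), add_zero]
  have hΦ2 : ∀ p v, Φ p (w' v) = p.2 v := fun p v => by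
    rw [Finsupp.add_apply, Finsupp.mapDomain_apply hinj',
      Finsupp.mapDomain_of_notMem_range _ _ (by rintro ⟨b, hb⟩; exact hdisj b v hb), zero_add]
  have hΦinj : Function.Injective Φ := fun p p' hp =>
    Prod.ext (Finsupp.ext fun v => by rw [← hΦ1, hp, hΦ1])
      (Finsupp.ext fun v => by rw [← hΦ2, hp, hΦ2])
  have hΦn : ∀ p, divNorm (Φ p) = divNorm p.1 * divNorm p.2 := by
    intro p
    rw [divNorm_add, divNorm, divNorm, Finsupp.prod_mapDomain_index_inj hinj,
      Finsupp.prod_mapDomain_index_inj hinj']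
    simp only [hc, hc']
    rfl
  have hΦpos : ∀ p : Divisor K × Divisor K, 0 ≤ p.1 → 0 ≤ p.2 → 0 ≤ Φ p := by
    intro p h1 h2 u
    rw [Finsupp.add_apply, Finsupp.zero_apply]
    have hnn : ∀ (g : Place K → Place L) (D : Divisor K), 0 ≤ D → 0 ≤ D.mapDomain g u := by
      intro g D hD
      rw [Finsupp.mapDomain, Finsupp.sum_apply]
      exact Finset.sum_nonneg fun v _ => (Finsupp.single_nonneg.2 (hD v)) u
    exact add_nonneg (hnn _ _ h1) (hnn _ _ h2)
  obtain ⟨c, hcpos, M₀, hlow⟩ := exists_le_ncard_effective Fq K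
  obtain ⟨C, hup⟩ := exists_ncard_effective_le Fq L
  obtain ⟨v⟩ := nonempty_place Fq K
  set B : ℝ := (v.card : ℝ) with hB
  have hB1 : 1 < B := by rw [hB]; exact_mod_cast v.one_lt_card
  have hB0 : 0 < B := zero_lt_one.trans hB1
  obtain ⟨j₀, hj₀⟩ := pow_unbounded_of_one_lt M₀ hB1
  have hlow' : ∀ j, c * B ^ (j₀ + j) ≤ (effective K (B ^ (j₀ + j))).ncard := by
    intro j
    have h1 : divNorm (Finsupp.single v ((j₀ + j : ℕ) : ℤ)) = B ^ (j₀ + j) := by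
      rw [divNorm_single, zpow_natCast]
    have := hlow (Finsupp.single v ((j₀ + j : ℕ) : ℤ))
    rw [h1] at this
    exact this (hj₀.le.trans (pow_le_pow_right₀ hB1.le (by omega)))
  -- Large enough for $Nc^2>C$, which contradicts the two bounds.
  obtain ⟨N, hN⟩ := exists_nat_gt (C / c ^ 2)
  have hfinK := fun j : ℕ => finite_effective_eq Fq K (B ^ j)
  have hfinL := finite_effective_eq Fq L (B ^ (2 * j₀ + N))
  let S := (Finset.range (N + 1)).sigma fun j =>
    (hfinK (j₀ + j)).toFinset ×ˢ (hfinK (j₀ + (N - j))).toFinset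
  have hS : ∀ s ∈ S, s.1 ≤ N ∧ s.2.1 ∈ effective K (B ^ (j₀ + s.1)) ∧
      s.2.2 ∈ effective K (B ^ (j₀ + (N - s.1))) := by
    intro s hs
    simp only [S, Finset.mem_sigma, Finset.mem_product, Finset.mem_range,
      Set.Finite.mem_toFinset] at hs
    exact ⟨by omega, hs.2.1, hs.2.2⟩
  have hcard : S.card ≤ hfinL.toFinset.card := by
    refine Finset.card_le_card_of_injOn (fun s => Φ s.2) (fun s hs => ?_) fun s hs s' hs' hss => ?_
    · obtain ⟨h1, h2, h3⟩ := hS s hs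
      rw [Finset.mem_coe, Set.Finite.mem_toFinset]
      refine ⟨hΦpos _ h2.1 h3.1, ?_⟩
      rw [hΦn, h2.2, h3.2, ← pow_add]
      congr 1
      omega
    · have h1 := hΦinj hss
      have h2 := (hS s hs).2.1.2
      have h3 := (hS s' hs').2.1.2
      rw [h1, h3] at h2
      have h4 : j₀ + s'.1 = j₀ + s.1 := pow_right_injective₀ hB0 hB1.ne' h2
      obtain ⟨i, p⟩ := s
      obtain ⟨i', p'⟩ := s'
      have h5 : i = i' := by simp only at h4; omega
      subst h5
      simp only at h1
      rw [h1]
  have hSge : ((N : ℝ) + 1) * (c ^ 2 * B ^ (2 * j₀ + N)) ≤ S.card := by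
    rw [Finset.card_sigma, Nat.cast_sum]
    have : ((N : ℝ) + 1) * (c ^ 2 * B ^ (2 * j₀ + N)) =
        ∑ _j ∈ Finset.range (N + 1), c ^ 2 * B ^ (2 * j₀ + N) := by
      rw [Finset.sum_const, Finset.card_range, nsmul_eq_mul]
      push_cast
      rfl
    rw [this]
    refine Finset.sum_le_sum fun j hj => ?_
    rw [Finset.mem_range] at hj
    rw [Finset.card_product, Nat.cast_mul, ← Set.ncard_eq_toFinset_card _ (hfinK _),
      ← Set.ncard_eq_toFinset_card _ (hfinK _)]
    calc c ^ 2 * B ^ (2 * j₀ + N) = (c * B ^ (j₀ + j)) * (c * B ^ (j₀ + (N - j))) := by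
          rw [mul_mul_mul_comm, ← pow_add, ← sq]
          congr 2
          omega
      _ ≤ _ := mul_le_mul (hlow' j) (hlow' _) (by positivity) (by positivity)
  have hle := hup (B ^ (2 * j₀ + N)) (by positivity)
  rw [Set.ncard_eq_toFinset_card _ hfinL] at hle
  have h1 : ((N : ℝ) + 1) * (c ^ 2 * B ^ (2 * j₀ + N)) ≤ C * B ^ (2 * j₀ + N) :=
    hSge.trans ((Nat.cast_le.2 hcard).trans hle)
  rw [← mul_assoc] at h1
  have h2 := le_of_mul_le_mul_right h1 (by positivity)
  rw [div_lt_iff₀ (by positivity)] at hN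
  nlinarith [sq_nonneg c]

end Conjugate

/-! ### Constant field extensions -/

section ConstantExtension

theorem exists_irreducible_natDegree (Fq : Type*) [Field Fq] [Finite Fq] (n : ℕ) (hn : n ≠ 0) :
    ∃ f : Polynomial Fq, f.Monic ∧ Irreducible f ∧ f.natDegree = n := by
  obtain ⟨p, hp⟩ := CharP.exists Fq
  have : Fact (Nat.Prime p) := ⟨CharP.char_is_prime Fq p⟩
  have : NeZero n := ⟨hn⟩
  obtain ⟨a, ha⟩ := Field.exists_primitive_element Fq (FiniteField.Extension Fq p n)
  have hInt : IsIntegral Fq a := Algebra.IsIntegral.isIntegral a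
  refine ⟨minpoly Fq a, minpoly.monic hInt, minpoly.irreducible hInt, ?_⟩
  rw [← IntermediateField.adjoin.finrank hInt, ha, IntermediateField.finrank_top',
    FiniteField.finrank_extension]

/-- The coefficients of a monic factor over $K$ are integral over $\mathbb F_q$, hence lie in
$\mathbb F_q$ when no new constants exist. So every factorization descends. -/
theorem irreducible_map_of_closed {Fq K : Type*} [Field Fq] [Field K] [Algebra Fq K]
    (hcl : ∀ a : K, IsAlgebraic Fq a → a ∈ (algebraMap Fq K).range) {f : Polynomial Fq}
    (hm : f.Monic) (hf : Irreducible f) : Irreducible (f.map (algebraMap Fq K)) := by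
  have hm1 : f.map (algebraMap Fq K) ≠ 1 := by
    intro h
    have := congr_arg Polynomial.natDegree h
    rw [Polynomial.natDegree_map, Polynomial.natDegree_one] at this
    exact hf.natDegree_pos.ne' this
  have hlift : ∀ g : Polynomial K, g.Monic → g ∣ f.map (algebraMap Fq K) →
      ∃ g₀ : Polynomial Fq, g₀.Monic ∧ g₀.map (algebraMap Fq K) = g := by
    intro g hg hd
    have h1 := integralClosure.mem_lifts_of_monic_of_dvd_map K hm hg hd
    have h2 : g ∈ Polynomial.lifts (algebraMap Fq K) := by
      rw [Polynomial.lifts_iff_coeff_lifts] at h1 ⊢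
      intro n
      obtain ⟨a, ha⟩ := h1 n
      exact hcl _ (ha ▸ IsIntegral.isAlgebraic a.2)
    obtain ⟨g₀, h3, -, h4⟩ := Polynomial.lifts_and_degree_eq_and_monic h2 hg
    exact ⟨g₀, h4, h3⟩
  rw [Polynomial.irreducible_of_monic (hm.map _) hm1]
  intro a b ha hb hab
  obtain ⟨a₀, ha₀, rfl⟩ := hlift a ha ⟨b, hab.symm⟩
  obtain ⟨b₀, hb₀, rfl⟩ := hlift b hb ⟨_, by rw [mul_comm, hab]⟩
  rw [← Polynomial.map_mul] at hab
  have h1 := Polynomial.map_injective _ (algebraMap Fq K).injective hab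
  rcases hf.isUnit_or_isUnit h1.symm with h | h
  · left
    rw [ha₀.isUnit_iff.1 h, Polynomial.map_one]
  · right
    rw [hb₀.isUnit_iff.1 h, Polynomial.map_one]

/-- The degrees of the places have no common divisor. -/
theorem not_forall_dvd_degree (Fq : Type*) {K : Type*} [Field Fq] [Field K] [Algebra Fq K]
    [Finite Fq] [IsFunctionFieldOver Fq K] [GlobalPlaces K]
    (hcl : ∀ a : K, IsAlgebraic Fq a → a ∈ (algebraMap Fq K).range) {n : ℕ} (hn : 1 < n)
    (h : ∀ v : Place K, ∃ m, n ∣ m ∧ v.card = Nat.card Fq ^ m) : False := by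
  obtain ⟨f, hm, hf, hd⟩ := exists_irreducible_natDegree Fq n (by omega)
  have hirr := irreducible_map_of_closed hcl hm hf
  let P := f.map (algebraMap Fq K)
  have : Fact (Irreducible P) := ⟨hirr⟩
  let L := AdjoinRoot P
  let α : L := AdjoinRoot.root P
  have hmP : P.Monic := hm.map _
  have : FiniteDimensional K L := (AdjoinRoot.powerBasis hirr.ne_zero).finite
  have hfr : Module.finrank K L = f.natDegree := by
    rw [(AdjoinRoot.powerBasis hirr.ne_zero).finrank, AdjoinRoot.powerBasis_dim,
      Polynomial.natDegree_map]
  have hα : Polynomial.aeval α f = 0 := by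
    have h1 : Polynomial.aeval α P = 0 := by rw [AdjoinRoot.aeval_eq, AdjoinRoot.mk_self]
    rwa [Polynomial.aeval_map_algebraMap] at h1
  -- Frobenius fixes the coefficients of `f` and permutes its roots; it provides the automorphism
  -- $\sigma$ of $L$ over $K$.
  have hα' : Polynomial.aeval (α ^ Nat.card Fq) f = 0 := by
    let _ := Fintype.ofFinite Fq
    have := FiniteField.expand_card f
    rw [← Polynomial.expand_aeval, Nat.card_eq_fintype_card, this, map_pow, hα,
      zero_pow Fintype.card_ne_zero]
  have hα'' : Polynomial.eval₂ (Algebra.ofId K L : K →+* L) (α ^ Nat.card Fq) P = 0 := by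
    change Polynomial.aeval _ P = 0
    rwa [Polynomial.aeval_map_algebraMap]
  let σ₀ : L →ₐ[K] L := AdjoinRoot.liftAlgHom P (Algebra.ofId K L) (α ^ Nat.card Fq) hα''
  let σ : L ≃ₐ[K] L := AlgEquiv.ofBijective σ₀ (Algebra.IsAlgebraic.algHom_bijective σ₀)
  have hσ : σ α = α ^ Nat.card Fq :=
    AdjoinRoot.liftAlgHom_root P (Algebra.ofId K L) (α ^ Nat.card Fq) hα''
  have := IsFunctionFieldOver.of_finite Fq K L
  have := IsFunctionFieldOver.globalPlaces Fq L
  refine not_forall_split (K := K) (L := L) Fq fun v => ?_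
  obtain ⟨m, hdvd, hcard⟩ := h v
  exact exists_split_places Fq hf hfr (by omega) hα σ hσ v hcard (hd ▸ hdvd)

end ConstantExtension

/-! ### Surjectivity of the degree -/

section DegreeSurjective

open IntermediateField

/-- A function field is also one over its field of constants. -/
theorem IsFunctionFieldOver.algebraicClosure (Fq K : Type*) [Field Fq] [Field K] [Algebra Fq K]
    [IsFunctionFieldOver Fq K] : IsFunctionFieldOver (algebraicClosure Fq K) K := by
  obtain ⟨t, ht, hfin⟩ := IsFunctionFieldOver.exists_transcendental (Fq := Fq) (K := K)
  refine ⟨t, fun h => ht ?_, ?_⟩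
  · exact IsAlgebraic.restrictScalars Fq h
  · let F := _root_.algebraicClosure Fq K
    have hle : Fq⟮t⟯ ≤ F⟮t⟯.restrictScalars Fq := by
      rw [adjoin_simple_le_iff]
      exact mem_adjoin_simple_self F t
    let _ : Algebra Fq⟮t⟯ F⟮t⟯ := (IntermediateField.inclusion hle).toAlgebra
    have : IsScalarTower Fq⟮t⟯ F⟮t⟯ K := IsScalarTower.of_algebraMap_eq fun _ => rfl
    exact Module.Finite.of_restrictScalars_finite Fq⟮t⟯ F⟮t⟯ K

variable (Fq K : Type*) [Field Fq] [Field K] [Algebra Fq K] [Finite Fq]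
  [IsFunctionFieldOver Fq K] [GlobalPlaces K]

/-- The theorem of F. K. Schmidt. The image of the degree is some $d\mathbb Z$, and $d$ divides the
degree of every place. The case $d>1$ is excluded by `not_forall_dvd_degree` over the full field of
constants, and $d=0$ because places have positive degree. -/
theorem degree_surjective : Function.Surjective (degree K Fq) := by
  have := finite_algebraicClosure Fq K
  have := IsFunctionFieldOver.algebraicClosure Fq K
  obtain ⟨d, hd⟩ := Int.subgroup_cyclic (degree K Fq).range
  rw [← AddSubgroup.zmultiples_eq_closure] at hd
  have hdvd : ∀ v : Place K, d.natAbs ∣ Nat.log (constCard K Fq) v.card := by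
    intro v
    have h1 : degree K Fq (Finsupp.single v 1) ∈ (degree K Fq).range := ⟨_, rfl⟩
    rw [hd, Int.mem_zmultiples_iff, degree_single, one_mul] at h1
    exact Int.natAbs_dvd_natAbs.2 h1
  have hcl : ∀ a : K, IsAlgebraic (_root_.algebraicClosure Fq K) a →
      a ∈ (algebraMap (_root_.algebraicClosure Fq K) K).range := fun a ha =>
    ⟨⟨a, mem_algebraicClosure_iff.2 (IsAlgebraic.restrictScalars Fq ha)⟩, rfl⟩
  have hd1 : d.natAbs = 1 := by
    have h0 : d.natAbs ≠ 0 := by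
      obtain ⟨v⟩ := nonempty_place Fq K
      intro h0
      have := hdvd v
      rw [h0, zero_dvd_iff] at this
      exact (card_place_eq_pow Fq v).2.ne' this
    by_contra h1
    exact not_forall_dvd_degree (_root_.algebraicClosure Fq K) hcl (n := d.natAbs) (by omega)
      fun v => ⟨_, hdvd v, (card_place_eq_pow Fq v).1⟩
  rw [← AddMonoidHom.range_eq_top, hd, eq_top_iff]
  intro n _
  rw [Int.mem_zmultiples_iff]
  exact Int.natAbs_dvd_natAbs.1 (by rw [hd1]; exact one_dvd _)

end DegreeSurjective

end

end BinQuad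

namespace BinQuad

noncomputable section

/-! ### Completions -/

open scoped Topology

namespace Place

section Completion

variable {K : Type*} [Field K] (v : Place K)

/-- The valuation of the completion. -/
abbrev val : Valuation v.Compl v.1.ValueGroup := Valued.v

instance : CompleteSpace v.Compl :=
  inferInstanceAs (CompleteSpace v.1.valuation.Completion)

theorem val_emb (y : K) : v.val (v.emb y) = v.1.valuation y :=
  Valued.valuedCompletion_apply (K := WithVal v.1.valuation) ((WithVal.equiv v.1.valuation).symm y)

theorem denseRange_emb : DenseRange v.emb := by
  have h : DenseRange ((↑) : WithVal v.1.valuation → v.1.valuation.Completion) :=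
    UniformSpace.Completion.denseRange_coe
  exact h.comp (WithVal.equiv v.1.valuation).symm.surjective.denseRange
    (UniformSpace.Completion.continuous_coe _)

theorem mem_nhds_zero_iff {s : Set v.Compl} :
    s ∈ 𝓝 0 ↔ ∃ y : K, y ≠ 0 ∧ {z | v.val z < v.1.valuation y} ⊆ s := by
  rw [Valued.mem_nhds_zero]
  constructor
  · rintro ⟨γ, hγ⟩
    obtain ⟨y, hy⟩ := v.1.valuation_surjective
      (MonoidWithZeroHom.ValueGroup₀.embedding γ.1)
    refine ⟨y, ?_, fun z hz => hγ ?_⟩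
    · rintro rfl
      rw [map_zero] at hy
      exact γ.ne_zero ((map_eq_zero _).1 hy.symm)
    · rw [Set.mem_ofPred_eq, Valuation.restrict_lt_iff_lt_embedding]
      exact lt_of_lt_of_eq hz hy
  · rintro ⟨y, hy, h⟩
    have h0 : v.val.restrict (v.emb y) ≠ 0 := by
      rw [Ne, Valuation.restrict_eq_zero_iff, v.val_emb]
      exact (Valuation.ne_zero_iff _).2 hy
    refine ⟨Units.mk0 _ h0, fun z hz => h ?_⟩
    have := (Valuation.restrict_lt_iff _).1 hz
    rw [Set.mem_ofPred_eq, ← v.val_emb]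
    exact this

theorem mem_nhds_iff {s : Set v.Compl} {a : v.Compl} :
    s ∈ 𝓝 a ↔ ∃ y : K, y ≠ 0 ∧ {z | v.val (z - a) < v.1.valuation y} ⊆ s := by
  rw [← map_add_left_nhds_zero, Filter.mem_map, mem_nhds_zero_iff]
  refine exists_congr fun y => and_congr_right fun _ => ⟨fun h z hz => ?_, fun h z hz => ?_⟩
  · have := h hz
    simpa using this
  · refine h ?_
    rw [Set.mem_ofPred_eq, add_sub_cancel_left]
    exact hz

theorem isOpen_val_lt {y : K} (hy : y ≠ 0) : IsOpen {z | v.val z < v.1.valuation y} := by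
  rw [isOpen_iff_mem_nhds]
  intro a ha
  rw [mem_nhds_iff]
  refine ⟨y, hy, fun z hz => ?_⟩
  rw [Set.mem_ofPred_eq, ← sub_add_cancel z a]
  exact Valuation.map_add_lt _ hz ha

/-- Sets defined by a condition on the valuation are open away from zero. -/
theorem isOpen_val_of_ne_zero (P : v.1.ValueGroup → Prop) (h0 : ¬ P 0) : IsOpen {z | P (v.val z)} := by
  rw [isOpen_iff_mem_nhds]
  intro a ha
  have hne : v.val a ≠ 0 := fun h => h0 (h ▸ ha)
  filter_upwards [Valued.locally_const hne] with z hz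
  have : v.val z = v.val a := hz
  change P (v.val z)
  rw [this]
  exact ha

theorem isOpen_integers : IsOpen (v.integers : Set v.Compl) := Valued.isOpen_integer _

theorem isClosed_integers : IsClosed (v.integers : Set v.Compl) := Valued.isClosed_integer _

theorem mem_integers {z : v.Compl} : z ∈ v.integers ↔ v.val z ≤ 1 := Iff.rfl

theorem emb_mem_integers {y : K} : v.emb y ∈ v.integers ↔ y ∈ v.1 := by
  rw [mem_integers, val_emb, v.1.valuation_le_one_iff]

theorem exists_emb_close (a : v.Compl) {y : K} (hy : y ≠ 0) :
    ∃ b : K, v.val (v.emb b - a) < v.1.valuation y := by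
  have h : {z | v.val (z - a) < v.1.valuation y} ∈ 𝓝 a := v.mem_nhds_iff.2 ⟨y, hy, le_rfl⟩
  obtain ⟨b, hb⟩ := v.denseRange_emb.mem_nhds h
  exact ⟨b, hb⟩

theorem exists_val_eq {a : v.Compl} (ha : a ≠ 0) : ∃ b : K, b ≠ 0 ∧ v.val a = v.1.valuation b := by
  obtain ⟨b, hb⟩ := v.1.valuation_surjective (v.val a)
  exact ⟨b, fun h => ha (by rw [h, map_zero] at hb; exact (map_eq_zero _).1 hb.symm), hb.symm⟩

set_option linter.unusedSectionVars false

variable [DiscretePlaces K]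

/-- Representatives of the finite ring of integers modulo the $n$-th power of a uniformizer
approximate every integer of the completion, which gives total boundedness; completeness comes from
closedness. -/
theorem isCompact_integers : IsCompact (v.integers : Set v.Compl) := by
  rw [isCompact_iff_totallyBounded_isComplete]
  refine ⟨?_, v.isClosed_integers.isComplete⟩
  rw [totallyBounded_iff_subset_finite_iUnion_nhds_zero]
  intro U hU
  obtain ⟨y, hy, hU⟩ := v.mem_nhds_zero_iff.1 hU
  obtain ⟨n, hn⟩ := v.exists_pow_lt v.valuation_unif_lt_one hy
  have hϖ : (⟨v.unif, v.unif_mem⟩ ^ n : v.1) ≠ 0 := pow_ne_zero _ v.irreducible_unif.ne_zero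
  have hord : v.ord (((⟨v.unif, v.unif_mem⟩ ^ n : v.1)) : K) = n := by
    push_cast
    rw [v.ord_pow v.unif_ne_zero, v.ord_unif, mul_one]
  have hcard := v.natCard_quotient_span hϖ hord
  have hfin : Finite (v.1 ⧸ Ideal.span {(⟨v.unif, v.unif_mem⟩ ^ n : v.1)}) :=
    Nat.finite_of_card_ne_zero (by rw [hcard]; exact (pow_pos v.card_pos _).ne')
  refine ⟨Set.range fun r : v.1 ⧸ Ideal.span {(⟨v.unif, v.unif_mem⟩ ^ n : v.1)} =>
    v.emb (r.out : v.1), Set.finite_range _, fun a ha => ?_⟩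
  obtain ⟨b, hb⟩ := v.exists_emb_close a (pow_ne_zero n v.unif_ne_zero)
  have hbv : b ∈ v.1 := by
    rw [← v.emb_mem_integers, ← sub_add_cancel (v.emb b) a]
    refine v.integers.add_mem (hb.le.trans ?_) ha
    rw [map_pow]
    exact pow_le_one' v.valuation_unif_lt_one.le n
  set r := Ideal.Quotient.mk (Ideal.span {(⟨v.unif, v.unif_mem⟩ ^ n : v.1)}) ⟨b, hbv⟩
  refine Set.mem_biUnion (x := v.emb (r.out : v.1)) ⟨r, rfl⟩ ?_
  rw [Set.mem_vadd_set_iff_neg_vadd_mem]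
  refine hU ?_
  rw [Set.mem_ofPred_eq, vadd_eq_add, neg_add_eq_sub]
  refine lt_of_le_of_lt ?_ (hn n le_rfl)
  have h1 : r.out - ⟨b, hbv⟩ ∈ Ideal.span {(⟨v.unif, v.unif_mem⟩ ^ n : v.1)} := by
    rw [← Ideal.Quotient.eq]
    exact Ideal.Quotient.mk_out _
  obtain ⟨c, hc⟩ := Ideal.mem_span_singleton.1 h1
  have h2 : v.1.valuation ((r.out : v.1) - b) ≤ v.1.valuation v.unif ^ n := by
    have h3 : ((r.out : v.1) : K) - b = v.unif ^ n * c := congr_arg Subtype.val hc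
    rw [h3, map_mul, map_pow]
    exact mul_le_of_le_one_right' ((v.1.valuation_le_one_iff _).2 c.2)
  have h4 : a - v.emb (r.out : v.1) = -(v.emb b - a) - v.emb ((r.out : v.1) - b) := by
    rw [map_sub]; ring
  rw [h4]
  refine (Valuation.map_sub _ _ _).trans (max_le ?_ ?_)
  · rw [Valuation.map_neg, ← map_pow]
    exact hb.le
  · rw [v.val_emb]
    exact h2

instance : LocallyCompactSpace v.Compl :=
  v.isCompact_integers.locallyCompactSpace_of_mem_nhds_of_addGroup
    (v.isOpen_integers.mem_nhds v.integers.zero_mem)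

theorem nhds_zero_hasBasis : (𝓝 (0 : v.Compl)).HasBasis (fun _ : ℕ => True)
    fun n => {z | v.val z < v.1.valuation v.unif ^ n} := by
  refine ⟨fun s => ?_⟩
  rw [mem_nhds_zero_iff]
  constructor
  · rintro ⟨y, hy, h⟩
    obtain ⟨n, hn⟩ := v.exists_pow_lt v.valuation_unif_lt_one hy
    exact ⟨n, trivial, fun z hz => h (lt_trans hz (hn n le_rfl))⟩
  · rintro ⟨n, -, h⟩
    exact ⟨v.unif ^ n, pow_ne_zero _ v.unif_ne_zero, by rwa [map_pow]⟩

theorem secondCountableTopology [Countable K] : SecondCountableTopology v.Compl := by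
  have h1 : (𝓝 (0 : v.Compl)).IsCountablyGenerated := v.nhds_zero_hasBasis.isCountablyGenerated
  have h2 : (uniformity v.Compl).IsCountablyGenerated :=
    IsUniformAddGroup.uniformity_countably_generated
  have h3 : TopologicalSpace.SeparableSpace v.Compl :=
    ⟨Set.range v.emb, Set.countable_range _, v.denseRange_emb⟩
  exact UniformSpace.secondCountable_of_separable v.Compl

/-- As a nonzero constant, $2$ is a unit at every place, so no place needs separate treatment. -/
theorem val_two (Fq : Type*) [Field Fq] [Finite Fq] [Algebra Fq K] (h2 : (2 : K) ≠ 0) :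
    v.val 2 = 1 := by
  have : (2 : v.Compl) = v.emb 2 := by rw [map_ofNat v.emb]
  rw [this, v.val_emb]
  refine valuation_eq_one_of_isAlgebraic Fq v.1 ?_ h2
  rw [← map_ofNat (algebraMap Fq K) 2]
  exact isAlgebraic_algebraMap _

end Completion

end Place

theorem IsFunctionFieldOver.countable (Fq K : Type*) [Field Fq] [Field K] [Algebra Fq K] [Finite Fq]
    [IsFunctionFieldOver Fq K] : Countable K := by
  obtain ⟨t, ht, hfin⟩ := IsFunctionFieldOver.exists_transcendental (Fq := Fq) (K := K)
  have : Algebra.IsAlgebraic (Algebra.adjoin Fq {t}) K :=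
    ⟨fun y => IntermediateField.isAlgebraic_adjoin_iff.1
      (Algebra.IsAlgebraic.isAlgebraic (R := IntermediateField.adjoin Fq {t}) y)⟩
  have hR : Countable (Algebra.adjoin Fq {t}) := by
    have : Countable (Polynomial Fq) := by
      rw [← Cardinal.mk_le_aleph0_iff]
      exact Polynomial.cardinalMk_le_max.trans (max_le (Cardinal.mk_le_aleph0_iff.2 inferInstance) le_rfl)
    have hsurj : Function.Surjective fun p : Polynomial Fq =>
        (⟨Polynomial.aeval t p, Polynomial.aeval_mem_adjoin_singleton Fq t⟩ : Algebra.adjoin Fq {t}) := by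
      rintro ⟨a, ha⟩
      have ha' := ha
      rw [Algebra.adjoin_singleton_eq_range_aeval] at ha'
      obtain ⟨p, hp⟩ := ha'
      exact ⟨p, Subtype.ext hp⟩
    exact hsurj.countable
  rw [← Cardinal.mk_le_aleph0_iff]
  exact (Algebra.IsAlgebraic.cardinalMk_le_max (Algebra.adjoin Fq {t}) K).trans
    (max_le (Cardinal.mk_le_aleph0_iff.2 hR) le_rfl)

end

end BinQuad

namespace BinQuad

noncomputable section

/-! ### The group of integral units of the stabilizer -/

open scoped Topology

section Eigenvectors

variable {F : Type*} [Field F] {y : V F}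

theorem poly_map_eq {E : Type*} [Field E] (f : F →+* E) (y : V F) : y.poly.map f =
    Polynomial.C (f (y 0)) * Polynomial.X ^ 2 + Polynomial.C (f (y 1)) * Polynomial.X +
      Polynomial.C (f (y 2)) := by
  simp [V.poly]

/-- Over its splitting field a binary form is a product of linear forms. -/
theorem exists_factorization (y : V F) : ∃ l l' : Fin 2 → y.field,
    ∀ i, algebraMap F y.field (y i) = ![l 0 * l' 0, l 0 * l' 1 + l 1 * l' 0, l 1 * l' 1] i := by
  by_cases h0 : y 0 = 0
  · refine ⟨![0, 1], ![algebraMap _ _ (y 1), algebraMap _ _ (y 2)], fun i => ?_⟩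
    fin_cases i <;> simp [h0]
  · have hdeg : y.poly.natDegree = 2 := Polynomial.natDegree_quadratic h0
    have hs := Polynomial.SplittingField.splits y.poly
    have hroots : ((y.poly.map (algebraMap F y.field)).roots).card = 2 := by
      rw [← hs.natDegree_eq_card_roots, Polynomial.natDegree_map, hdeg]
    obtain ⟨r, s, hrs⟩ := Multiset.card_eq_two.1 hroots
    have hp := hs.eq_prod_roots
    rw [hrs, Polynomial.leadingCoeff_map, Polynomial.leadingCoeff, hdeg] at hp
    have hlc : y.poly.coeff 2 = y 0 := by
      simp [V.poly]
    rw [hlc, Multiset.insert_eq_cons, Multiset.map_cons, Multiset.map_singleton,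
      Multiset.prod_cons, Multiset.prod_singleton] at hp
    replace hp := (poly_map_eq (algebraMap F y.field) y).symm.trans hp
    have hp' : Polynomial.C (algebraMap F y.field (y 0)) * ((Polynomial.X - Polynomial.C r) *
        (Polynomial.X - Polynomial.C s)) = Polynomial.C (algebraMap F y.field (y 0)) *
        Polynomial.X ^ 2 + Polynomial.C (-(algebraMap F y.field (y 0) * (r + s))) * Polynomial.X +
        Polynomial.C (algebraMap F y.field (y 0) * (r * s)) := by
      simp only [map_neg, map_mul, map_add]
      ring
    rw [hp'] at hp
    have h1 := congr_arg (fun p => Polynomial.coeff p 1) hp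
    have h2 := congr_arg (fun p => Polynomial.coeff p 0) hp
    simp [Polynomial.coeff_X, Polynomial.coeff_C] at h1 h2
    refine ⟨![algebraMap _ _ (y 0), -(algebraMap _ _ (y 0) * r)], ![1, -s], fun i => ?_⟩
    fin_cases i
    · simp
    · simp [h1]; ring
    · simp [h2]; ring

variable {E : Type*} [Field E] [Algebra F E] {l l' : Fin 2 → E}

/-- A linear factor is an eigenvector of $J$. Its eigenvalue $l_1l'_0-l_0l'_1$ is a square root of
the discriminant by `sq_eq_disc`, and exchanging the two factors changes its sign. -/
theorem elt_mulVec (h : ∀ i, algebraMap F E (y i) =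
      ![l 0 * l' 0, l 0 * l' 1 + l 1 * l' 0, l 1 * l' 1] i) (a b : F) :
    ((y.elt a b).map (algebraMap F E)) *ᵥ l =
      (algebraMap F E a + algebraMap F E b * (l 1 * l' 0 - l 0 * l' 1)) • l := by
  have h0 := h 0
  have h1 := h 1
  have h2 := h 2
  simp at h0 h1 h2
  ext i
  fin_cases i <;>
    simp [V.elt, Matrix.mulVec, dotProduct, Fin.sum_univ_succ, h0, h1, h2,
      map_ofNat (algebraMap F E)] <;> ring

theorem sq_eq_disc (h : ∀ i, algebraMap F E (y i) =
      ![l 0 * l' 0, l 0 * l' 1 + l 1 * l' 0, l 1 * l' 1] i) :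
    (l 1 * l' 0 - l 0 * l' 1) ^ 2 = algebraMap F E y.disc := by
  have h0 := h 0
  have h1 := h 1
  have h2 := h 2
  simp at h0 h1 h2
  simp [V.disc, h0, h1, h2, map_ofNat (algebraMap F E)]
  ring

theorem factor_ne_zero (h : ∀ i, algebraMap F E (y i) =
      ![l 0 * l' 0, l 0 * l' 1 + l 1 * l' 0, l 1 * l' 1] i) (hy : y.disc ≠ 0) : l ≠ 0 := by
  rintro rfl
  have := sq_eq_disc h
  simp at this
  exact hy ((map_eq_zero _).1 this.symm)

theorem factorization_symm (h : ∀ i, algebraMap F E (y i) =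
      ![l 0 * l' 0, l 0 * l' 1 + l 1 * l' 0, l 1 * l' 1] i) : ∀ i, algebraMap F E (y i) =
      ![l' 0 * l 0, l' 0 * l 1 + l' 1 * l 0, l' 1 * l 1] i := by
  intro i
  rw [h i]
  fin_cases i <;> simp <;> ring

theorem inv_quadratic {E : Type*} [Field E] {z r s : E} (hz : z ≠ 0) (hs : s ≠ 0)
    (h : z ^ 2 - r * z + s = 0) : z⁻¹ ^ 2 - r * s⁻¹ * z⁻¹ + s⁻¹ = 0 := by
  field_simp
  linear_combination h

theorem isIntegral_of_quadratic {R E : Type*} [CommRing R] [CommRing E] [Algebra R E] (r s : R)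
    {z : E} (h : z ^ 2 - algebraMap R E r * z + algebraMap R E s = 0) : IsIntegral R z := by
  refine ⟨Polynomial.X ^ 2 - Polynomial.C r * Polynomial.X + Polynomial.C s, ?_, ?_⟩
  · have : Polynomial.X ^ 2 - Polynomial.C r * Polynomial.X + Polynomial.C s =
        Polynomial.X ^ 2 + (Polynomial.C (-r) * Polynomial.X + Polynomial.C s) := by
      rw [map_neg]; ring
    rw [this]
    exact Polynomial.monic_X_pow_add (Polynomial.degree_linear_lt)
  · simpa using h

end Eigenvectors

/-- The standing assumptions on the form `x`. -/
class GoodForm {K : Type*} [Field K] (x : V K) : Prop where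
  val_two : ∀ v : Place K, v.val 2 = 1
  disc_ne_zero : x.disc ≠ 0

section UnitsG

variable {K : Type*} [Field K] (x : V K) [GoodForm x] (v : Place K)

theorem two_ne_zero_at {K : Type*} [Field K] (x : V K) [GoodForm x] (v : Place K) : (2 : v.Compl) ≠ 0 := by
  intro h
  have := GoodForm.val_two x v
  rw [h, map_zero] at this
  exact zero_ne_one this

theorem disc_at_ne_zero : (x.at v).disc ≠ 0 := by
  rw [V.disc_map]
  exact (map_ne_zero v.emb).2 (GoodForm.disc_ne_zero (x := x))

theorem trace_elt {R : Type*} [CommRing R] (x : V R) (a b : R) : (x.elt a b).trace = 2 * a := by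
  simp [V.elt, Matrix.trace_fin_two]
  ring

/-- The eigenvalues on the two linear factors are the roots of the characteristic polynomial. As
$\mathcal O_v$ is integrally closed, they and their inverses are integral exactly when the trace is
integral and the determinant is a unit. This criterion treats split and nonsplit places alike. -/
theorem mem_unitsG_iff (g : stabG0 (x.at v)) : g ∈ unitsG x v ↔
    (g : G v.Compl).2.1.trace ∈ v.integers ∧ v.val (g : G v.Compl).2.1.det = 1 := by
  obtain ⟨g, hg⟩ := g
  obtain ⟨a, b, h, rfl⟩ := (mem_stabG0_iff (two_ne_zero_at x v) (disc_at_ne_zero x v) g).1 hg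
  change _ ↔ (((x.at v).elt a b).trace ∈ v.integers ∧ v.val ((x.at v).elt a b).det = 1)
  rw [trace_elt, V.det_elt]
  set N := a ^ 2 - (x.at v).disc * b ^ 2 with hN
  let E := (x.at v).field
  let ι := algebraMap v.Compl E
  have hι : ∀ {z : v.Compl}, IsIntegral v.integers (ι z) → z ∈ v.integers := by
    intro z hz
    have hz' : IsIntegral v.integers z :=
      (isIntegral_algHom_iff (IsScalarTower.toAlgHom v.integers v.Compl E)
        (algebraMap v.Compl E).injective).1 hz
    exact (Valuation.integer.integers v.val).mem_of_integral hz'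
  have hprod : ∀ l l' : Fin 2 → E, (∀ i, algebraMap v.Compl (x.at v).field (x.at v i) =
      ![l 0 * l' 0, l 0 * l' 1 + l 1 * l' 0, l 1 * l' 1] i) →
      (ι a + ι b * (l 1 * l' 0 - l 0 * l' 1)) * (ι a - ι b * (l 1 * l' 0 - l 0 * l' 1)) = ι N := by
    intro l l' hl
    have := sq_eq_disc hl
    rw [hN, map_sub, map_mul, map_pow, map_pow, ← this]
    ring
  constructor
  · intro hu
    obtain ⟨l, l', hl⟩ := exists_factorization (x.at v)
    have hl' := factorization_symm hl
    obtain ⟨u, hu1, hu2, hu3⟩ := hu l l' hl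
    obtain ⟨u', hu1', hu2', hu3'⟩ := hu l' l hl'
    have hev : ∀ (l l' : Fin 2 → E), (∀ i, algebraMap v.Compl (x.at v).field (x.at v i) =
        ![l 0 * l' 0, l 0 * l' 1 + l 1 * l' 0, l 1 * l' 1] i) → ∀ u : E,
        (((x.at v).elt a b).map ι) *ᵥ l = u • l →
        u = ι a + ι b * (l 1 * l' 0 - l 0 * l' 1) := by
      intro l l' hl u hu
      rw [elt_mulVec hl] at hu
      exact (smul_left_injective E (factor_ne_zero hl (disc_at_ne_zero x v)) hu).symm
    have e1 := hev l l' hl u hu1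
    have e2 := hev l' l hl' u' hu1'
    have hsum : (u : E) + u' = ι (2 * a) := by
      rw [e1, e2, map_mul, map_ofNat ι]; ring
    have hmul : (u : E) * u' = ι N := by
      rw [← hprod l l' hl, e1, e2]; ring
    have hmul' : ((u⁻¹ : Eˣ) : E) * (u'⁻¹ : Eˣ) = ι N⁻¹ := by
      rw [map_inv₀, ← hmul, mul_inv, Units.val_inv_eq_inv_val, Units.val_inv_eq_inv_val]
    refine ⟨hι (by rw [← hsum]; exact hu2.add hu2'), le_antisymm ?_ ?_⟩
    · exact hι (by rw [← hmul]; exact hu2.mul hu2')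
    · have h1 : v.val N⁻¹ ≤ 1 := hι (by rw [← hmul']; exact hu3.mul hu3')
      rw [map_inv₀] at h1
      have hpos : 0 < v.val N := (Valuation.pos_iff _).2 h
      exact (inv_le_one₀ hpos).1 h1
  · rintro ⟨h1, h2⟩ l l' hl
    have hN0 : ι N ≠ 0 := (map_ne_zero ι).2 h
    have hp := hprod l l' hl
    set δ := l 1 * l' 0 - l 0 * l' 1 with hδ
    have hu0 : ι a + ι b * δ ≠ 0 := left_ne_zero_of_mul (hp ▸ hN0)
    have hNint : N ∈ v.integers := h2.le
    have hNinv : N⁻¹ ∈ v.integers := by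
      rw [Place.mem_integers, map_inv₀, h2, inv_one]
    have hq : (ι a + ι b * δ) ^ 2 - ι (2 * a) * (ι a + ι b * δ) + ι N = 0 := by
      rw [← hp, map_mul, map_ofNat ι]; ring
    refine ⟨Units.mk0 _ hu0, ?_, ?_, ?_⟩
    · exact elt_mulVec hl a b
    · exact isIntegral_of_quadratic (⟨2 * a, h1⟩ : v.integers) ⟨N, hNint⟩ hq
    · refine isIntegral_of_quadratic (⟨2 * a * N⁻¹, v.integers.mul_mem h1 hNinv⟩ : v.integers)
        ⟨N⁻¹, hNinv⟩ ?_
      change ((Units.mk0 _ hu0)⁻¹ : Eˣ).1 ^ 2 - ι (2 * a * N⁻¹) * ((Units.mk0 _ hu0)⁻¹ : Eˣ).1 +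
        ι N⁻¹ = 0
      rw [Units.val_inv_eq_inv_val, Units.val_mk0, map_mul ι (2 * a), map_inv₀]
      exact inv_quadratic hu0 hN0 hq

theorem mem_unitsG_eltG_iff (a b : v.Compl) (h : a ^ 2 - (x.at v).disc * b ^ 2 ≠ 0)
    (hg : (x.at v).eltG a b h ∈ stabG0 (x.at v)) : (⟨_, hg⟩ : stabG0 (x.at v)) ∈ unitsG x v ↔
      a ∈ v.integers ∧ v.val (a ^ 2 - (x.at v).disc * b ^ 2) = 1 := by
  rw [mem_unitsG_iff]
  change (((x.at v).elt a b).trace ∈ v.integers ∧ v.val ((x.at v).elt a b).det = 1) ↔ _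
  rw [trace_elt, V.det_elt, Place.mem_integers, map_mul, GoodForm.val_two x v, one_mul]
  exact Iff.rfl

end UnitsG

end

end BinQuad

namespace BinQuad

noncomputable section

/-! ### Topology of the local stabilizers -/

open scoped Topology

section General

variable {R : Type*} [CommRing R] [TopologicalSpace R] [IsTopologicalRing R]

theorem continuous_symSq : Continuous (symSq : Matrix (Fin 2) (Fin 2) R → _) := by
  have h : ∀ i j, Continuous fun m : Matrix (Fin 2) (Fin 2) R => m i j := fun i j =>
    continuous_id.matrix_elem i j
  refine continuous_matrix fun i j => ?_
  have h00 := h 0 0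
  have h01 := h 0 1
  have h10 := h 1 0
  have h11 := h 1 1
  fin_cases i <;> fin_cases j <;> simp [symSq] <;> fun_prop

theorem continuous_rho : Continuous (rho : G R → GL (Fin 3) R) := by
  have h : Continuous fun g : G R => (rho g).1 := by
    simp only [coe_rho]
    exact (Units.continuous_val.comp continuous_fst).smul
      (continuous_symSq.comp (Units.continuous_val.comp continuous_snd))
  refine Units.continuous_iff.2 ⟨h, ?_⟩
  have : (fun g : G R => ((rho g)⁻¹).1) = (fun g => (rho g).1) ∘ fun g : G R => g⁻¹ := by
    funext g
    rw [Function.comp_apply, map_inv]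
  rw [this]
  exact h.comp continuous_inv

theorem continuous_torus : Continuous (torus : Rˣ → G R) := by
  refine (continuous_pow 2).prodMk ?_
  have h : Continuous fun r : R => Matrix.scalar (Fin 2) r :=
    continuous_id.matrix_diagonal.comp (continuous_pi fun _ => continuous_id)
  exact (Continuous.units_map ((Matrix.scalar (Fin 2)).toMonoidHom : R →* _) h).comp continuous_inv

instance Units.secondCountableTopology {M : Type*} [Monoid M] [TopologicalSpace M]
    [SecondCountableTopology M] : SecondCountableTopology Mˣ := by
  have : SecondCountableTopology Mᵐᵒᵖ :=
    MulOpposite.opHomeomorph.symm.isEmbedding.secondCountableTopology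
  exact Units.isEmbedding_embedProduct.secondCountableTopology

instance Matrix.secondCountableTopology {n : ℕ} [SecondCountableTopology R] :
    SecondCountableTopology (Matrix (Fin n) (Fin n) R) :=
  inferInstanceAs (SecondCountableTopology (Fin n → Fin n → R))

instance Subgroup.secondCountableTopology {A : Type*} [Group A] [TopologicalSpace A]
    [SecondCountableTopology A] (S : Subgroup A) : SecondCountableTopology S :=
  inferInstanceAs (SecondCountableTopology (S : Set A))

end General

section Local

variable {K : Type*} [Field K] [GlobalPlaces K] (x : V K) [GoodForm x] (v : Place K)

instance [Countable K] : SecondCountableTopology v.Compl := v.secondCountableTopology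

instance : BorelSpace v.Complˣ := ⟨rfl⟩
instance : BorelSpace (G v.Compl) := ⟨rfl⟩
instance : BorelSpace (GL (Fin 3) v.Compl) := ⟨rfl⟩

set_option linter.unusedSectionVars false

theorem isClopen_val_eq_one : IsClopen {z : v.Compl | v.val z = 1} := by
  refine ⟨?_, v.isOpen_val_of_ne_zero (fun r => r = 1) zero_ne_one⟩
  have h : {z : v.Compl | v.val z = 1} = (v.integers : Set v.Compl) ∩ {z | v.val z < 1}ᶜ := by
    ext z
    simp only [Set.mem_ofPred_eq, Set.mem_inter_iff, SetLike.mem_coe, Place.mem_integers,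
      Set.mem_compl_iff, not_lt]
    exact le_antisymm_iff
  rw [h]
  refine v.isClosed_integers.inter (isClosed_compl_iff.2 ?_)
  simpa using v.isOpen_val_lt (one_ne_zero (α := K))

/-- The subgroup of integral units of `(G_x°)_{K_v}`. -/
def unitsGroup : Subgroup (stabG0 (x.at v)) where
  carrier := unitsG x v
  one_mem' := fun l l' _ => ⟨1, by simp, by simpa using isIntegral_one, by simpa using isIntegral_one⟩
  mul_mem' := by
    intro g g' hg hg' l l' hl
    obtain ⟨u, h1, h2, h3⟩ := hg l l' hl
    obtain ⟨u', h1', h2', h3'⟩ := hg' l l' hl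
    refine ⟨u * u', ?_, ?_, ?_⟩
    · have : ((g * g' : stabG0 (x.at v)) : G v.Compl).2.1 = g.1.2.1 * g'.1.2.1 := rfl
      rw [this, Matrix.map_mul, ← Matrix.mulVec_mulVec, h1', Matrix.mulVec_smul, h1, smul_smul,
        Units.val_mul, mul_comm]
    · rw [Units.val_mul]; exact h2.mul h2'
    · rw [mul_inv, Units.val_mul]; exact h3.mul h3'
  inv_mem' := by
    intro g hg l l' hl
    obtain ⟨u, h1, h2, h3⟩ := hg l l' hl
    refine ⟨u⁻¹, ?_, h3, by rwa [inv_inv]⟩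
    have h4 : (g⁻¹ : stabG0 (x.at v)).1.2.1 * g.1.2.1 = 1 := by
      have : (g⁻¹ * g : stabG0 (x.at v)).1.2.1 = 1 := by rw [inv_mul_cancel]; rfl
      exact this
    have h5 : ((g⁻¹ : stabG0 (x.at v)).1.2.1.map (algebraMap v.Compl (x.at v).field)) *ᵥ
        ((g.1.2.1.map (algebraMap v.Compl (x.at v).field)) *ᵥ l) = l := by
      rw [Matrix.mulVec_mulVec, ← Matrix.map_mul, h4, Matrix.map_one _ (map_zero _) (map_one _),
        Matrix.one_mulVec]
    rw [h1, Matrix.mulVec_smul] at h5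
    calc _ = (u⁻¹ : (x.at v).fieldˣ).1 • (u.1 • (((g⁻¹ : stabG0 (x.at v)).1.2.1.map
          (algebraMap v.Compl (x.at v).field)) *ᵥ l)) := by
          rw [smul_smul, Units.inv_mul, one_smul]
      _ = _ := by rw [h5]

theorem isOpen_unitsGroup : IsOpen (unitsGroup x v : Set (stabG0 (x.at v))) := by
  have hm : Continuous fun g : stabG0 (x.at v) => g.1.2.1 :=
    Units.continuous_val.comp (continuous_snd.comp continuous_subtype_val)
  have : (unitsGroup x v : Set (stabG0 (x.at v))) =
      (fun g : stabG0 (x.at v) => g.1.2.1.trace) ⁻¹' (v.integers : Set v.Compl) ∩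
      (fun g : stabG0 (x.at v) => g.1.2.1.det) ⁻¹' {z | v.val z = 1} := by
    ext g
    exact mem_unitsG_iff x v g
  rw [this]
  exact (v.isOpen_integers.preimage hm.matrix_trace).inter
    ((isClopen_val_eq_one v).isOpen.preimage hm.matrix_det)

theorem val_disc_mul_sq_le_one {a b : v.Compl} (ha : a ∈ v.integers)
    (h : v.val (a ^ 2 - (x.at v).disc * b ^ 2) = 1) : v.val ((x.at v).disc * b ^ 2) ≤ 1 := by
  have : (x.at v).disc * b ^ 2 = a ^ 2 - (a ^ 2 - (x.at v).disc * b ^ 2) := by ring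
  rw [this]
  exact v.val.map_sub_le (pow_mem ha 2 : a ^ 2 ∈ v.integers) h.le

/-- The pairs `(a, b)` for which `a + b √P(x)` is an integral unit. -/
def unitPairs : Set (v.Compl × v.Compl) :=
  {p | p.1 ∈ v.integers ∧ v.val (p.1 ^ 2 - (x.at v).disc * p.2 ^ 2) = 1}

/-- An integral $a$ and a norm that is a unit force $P(x)b^2$ to be integral. Then $b$ is integral
if $|P(x)|\ge1$ and $P(x)b$ is integral if $|P(x)|\le1$, so the pairs form a closed subset of a
compact set. -/
theorem isCompact_unitPairs : IsCompact (unitPairs x v) := by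
  have hd := disc_at_ne_zero x v
  have hc : IsCompact ((v.integers : Set v.Compl) ×ˢ ((v.integers : Set v.Compl) ∪
      (fun z => (x.at v).disc⁻¹ * z) '' (v.integers : Set v.Compl))) :=
    v.isCompact_integers.prod (v.isCompact_integers.union
      (v.isCompact_integers.image (continuous_const_mul _)))
  refine hc.of_isClosed_subset ?_ ?_
  · exact (v.isClosed_integers.preimage continuous_fst).inter
      ((isClopen_val_eq_one v).isClosed.preimage (by fun_prop))
  · rintro ⟨a, b⟩ ⟨ha, hN⟩
    refine ⟨ha, ?_⟩
    have hle := val_disc_mul_sq_le_one x v ha hN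
    rcases le_total (v.val (x.at v).disc) 1 with h | h
    · right
      refine ⟨(x.at v).disc * b, ?_, inv_mul_cancel_left₀ hd b⟩
      have : v.val ((x.at v).disc * b) ^ 2 ≤ 1 := by
        rw [← map_pow, show ((x.at v).disc * b) ^ 2 = (x.at v).disc * ((x.at v).disc * b ^ 2) by ring,
          map_mul]
        exact mul_le_one' h hle
      exact (pow_le_one_iff two_ne_zero).1 this
    · left
      have : v.val b ^ 2 ≤ 1 := by
        rw [map_mul, map_pow] at hle
        exact (le_mul_of_one_le_left' h).trans hle
      exact (pow_le_one_iff two_ne_zero).1 this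

theorem eltG_mem {a b : v.Compl} (h : a ^ 2 - (x.at v).disc * b ^ 2 ≠ 0) :
    (x.at v).eltG a b h ∈ stabG0 (x.at v) :=
  (mem_stabG0_iff (two_ne_zero_at x v) (disc_at_ne_zero x v) _).2 ⟨a, b, h, rfl⟩

theorem norm_ne_zero_of_val_eq_one {N : v.Compl} (h : v.val N = 1) : N ≠ 0 := by
  rintro rfl
  rw [map_zero] at h
  exact zero_ne_one h

theorem isCompact_unitsGroup : IsCompact (unitsGroup x v : Set (stabG0 (x.at v))) := by
  have : CompactSpace (unitPairs x v) := isCompact_iff_compactSpace.1 (isCompact_unitPairs x v)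
  let φ : unitPairs x v → stabG0 (x.at v) := fun p =>
    ⟨_, eltG_mem x v (norm_ne_zero_of_val_eq_one v p.2.2)⟩
  have hr : (unitsGroup x v : Set (stabG0 (x.at v))) = Set.range φ := by
    ext ⟨g, hg⟩
    constructor
    · intro h
      obtain ⟨a, b, hN, rfl⟩ := (mem_stabG0_iff (two_ne_zero_at x v) (disc_at_ne_zero x v) g).1 hg
      exact ⟨⟨(a, b), (mem_unitsG_eltG_iff x v a b hN hg).1 h⟩, rfl⟩
    · rintro ⟨⟨⟨a, b⟩, h⟩, hp⟩
      rw [← hp]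
      exact (mem_unitsG_eltG_iff x v a b _ _).2 h
  rw [hr]
  refine isCompact_range ?_
  have ha : Continuous fun p : unitPairs x v => p.1.1 := continuous_fst.comp continuous_subtype_val
  have hb : Continuous fun p : unitPairs x v => p.1.2 := continuous_snd.comp continuous_subtype_val
  have hN : Continuous fun p : unitPairs x v => p.1.1 ^ 2 - (x.at v).disc * p.1.2 ^ 2 := by
    fun_prop
  have hNi : Continuous fun p : unitPairs x v => (p.1.1 ^ 2 - (x.at v).disc * p.1.2 ^ 2)⁻¹ :=
    hN.inv₀ fun p => norm_ne_zero_of_val_eq_one v p.2.2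
  refine Continuous.subtype_mk (Continuous.prodMk ?_ ?_) _
  · refine Units.continuous_iff.2 ⟨?_, ?_⟩
    · simpa [Function.comp_def] using hNi
    · simpa using hN
  · have he : Continuous fun p : unitPairs x v => (x.at v).elt p.1.1 p.1.2 := by
      refine continuous_matrix fun i j => ?_
      fin_cases i <;> fin_cases j <;> simp [V.elt] <;> fun_prop
    refine Units.continuous_iff.2 ⟨he, ?_⟩
    -- The inverse of $a+bJ$ is $(a-bJ)/N$, so continuity of the inverse is visible on coordinates.
    have : (fun p : unitPairs x v => (((Matrix.GeneralLinearGroup.mkOfDetNeZero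
        ((x.at v).elt p.1.1 p.1.2) (by
          rw [V.det_elt]; exact norm_ne_zero_of_val_eq_one v p.2.2))⁻¹ : GL (Fin 2) v.Compl).1)) =
        fun p => (p.1.1 ^ 2 - (x.at v).disc * p.1.2 ^ 2)⁻¹ • (x.at v).elt p.1.1 (-p.1.2) := by
      funext p
      have hN0 := norm_ne_zero_of_val_eq_one v p.2.2
      refine Units.inv_eq_of_mul_eq_one_right ?_
      change (x.at v).elt p.1.1 p.1.2 * _ = 1
      rw [Matrix.mul_smul, V.elt_mul]
      have e1 : p.1.1 * p.1.1 + (x.at v).disc * p.1.2 * -p.1.2 =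
        (p.1.1 ^ 2 - (x.at v).disc * p.1.2 ^ 2) * 1 := by ring
      have e2 : p.1.1 * -p.1.2 + p.1.1 * p.1.2 =
        (p.1.1 ^ 2 - (x.at v).disc * p.1.2 ^ 2) * 0 := by ring
      rw [e1, e2, V.elt_smul, smul_smul, inv_mul_cancel₀ hN0, one_smul, V.elt_one]
    exact this ▸ hNi.smul (by
      refine continuous_matrix fun i j => ?_
      fin_cases i <;> fin_cases j <;> simp [V.elt] <;> fun_prop)

instance : LocallyCompactSpace (stabG0 (x.at v)) :=
  (isCompact_unitsGroup x v).locallyCompactSpace_of_mem_nhds_of_group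
    ((isOpen_unitsGroup x v).mem_nhds (one_mem _))

/-- The surjection `(G_x°)_{K_v} → (H_x°)_{K_v}`. -/
def rhoStab : stabG0 (x.at v) →* stabH0 (x.at v) :=
  (rho.comp (stabG0 (x.at v)).subtype).codRestrict _ fun g =>
    (mem_stabH0_iff' (two_ne_zero_at x v) (disc_at_ne_zero x v) _).2 ⟨g, g.2, rfl⟩

@[simp] theorem coe_rhoStab (g : stabG0 (x.at v)) : (rhoStab x v g : GL (Fin 3) v.Compl) = rho g.1 :=
  rfl

theorem continuous_rhoStab : Continuous (rhoStab x v) :=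
  (continuous_rho.comp continuous_subtype_val).subtype_mk _

theorem rhoStab_surjective : Function.Surjective (rhoStab x v) := by
  rintro ⟨h, hh⟩
  obtain ⟨g, hg, rfl⟩ := (mem_stabH0_iff' (two_ne_zero_at x v) (disc_at_ne_zero x v) _).1 hh
  exact ⟨⟨g, hg⟩, rfl⟩

theorem exists_rhoStab_eltG (h : stabH0 (x.at v)) : ∃ (a b : v.Compl)
    (hN : a ^ 2 - (x.at v).disc * b ^ 2 ≠ 0), h = rhoStab x v ⟨_, eltG_mem x v hN⟩ := by
  obtain ⟨⟨g, hg⟩, rfl⟩ := rhoStab_surjective x v h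
  obtain ⟨a, b, hN, rfl⟩ := (mem_stabG0_iff (two_ne_zero_at x v) (disc_at_ne_zero x v) g).1 hg
  exact ⟨a, b, hN, rfl⟩

/-- The image of the integral units in `(H_x°)_{K_v}`. -/
def unitsH : Subgroup (stabH0 (x.at v)) := (unitsGroup x v).map (rhoStab x v)

theorem isCompact_unitsH : IsCompact (unitsH x v : Set (stabH0 (x.at v))) :=
  (isCompact_unitsGroup x v).image (continuous_rhoStab x v)

theorem rhoStab_mem_unitsH {a b : v.Compl} (ha : a ∈ v.integers)
    (h : v.val (a ^ 2 - (x.at v).disc * b ^ 2) = 1) (hN) :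
    rhoStab x v ⟨(x.at v).eltG a b hN, eltG_mem x v hN⟩ ∈ unitsH x v :=
  ⟨_, (mem_unitsG_eltG_iff x v a b hN _).2 ⟨ha, h⟩, rfl⟩

theorem mem_unitsH_iff (h : stabH0 (x.at v)) : h ∈ unitsH x v ↔ ∃ (a b : v.Compl)
    (hN : a ^ 2 - (x.at v).disc * b ^ 2 ≠ 0), a ∈ v.integers ∧
      v.val (a ^ 2 - (x.at v).disc * b ^ 2) = 1 ∧ h = rhoStab x v ⟨_, eltG_mem x v hN⟩ := by
  constructor
  · rintro ⟨⟨g, hg⟩, hu, rfl⟩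
    obtain ⟨a, b, hN, rfl⟩ := (mem_stabG0_iff (two_ne_zero_at x v) (disc_at_ne_zero x v) g).1 hg
    obtain ⟨h1, h2⟩ := (mem_unitsG_eltG_iff x v a b hN hg).1 hu
    exact ⟨a, b, hN, h1, h2, rfl⟩
  · rintro ⟨a, b, hN, h1, h2, rfl⟩
    exact rhoStab_mem_unitsH x v h1 h2 hN

theorem rhoStab_smul (a b t : v.Compl) (h : a ^ 2 - (x.at v).disc * b ^ 2 ≠ 0)
    (h' : (t * a) ^ 2 - (x.at v).disc * (t * b) ^ 2 ≠ 0) :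
    rhoStab x v ⟨_, eltG_mem x v h'⟩ = rhoStab x v ⟨_, eltG_mem x v h⟩ :=
  Subtype.ext (V.rho_eltG_smul a b t h h')

/-- By the trace identity a trace close to $3$ means $|P(x)b^2|<|N|$, hence $|a^2|=|N|$, and
dividing by $a$ gives a unit. Thus the image of the units contains a neighbourhood of $1$. -/
theorem mem_unitsH_of_trace {h : stabH0 (x.at v)} (ht : v.val (h.1.1.trace - 3) < 1) :
    h ∈ unitsH x v := by
  obtain ⟨a, b, hN, rfl⟩ := exists_rhoStab_eltG x v h
  have htr := trace_rho_eltG a b hN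
  rw [coe_rhoStab] at ht
  have h4 : v.val 4 = 1 := by
    rw [show (4 : v.Compl) = 2 * 2 by norm_num, map_mul, GoodForm.val_two x v, one_mul]
  have h1 : v.val ((x.at v).disc * b ^ 2) < v.val (a ^ 2 - (x.at v).disc * b ^ 2) := by
    have h5 := congr_arg v.val htr
    rw [mul_assoc, map_mul v.val 4, h4, one_mul, map_mul] at h5
    rw [← h5]
    exact mul_lt_of_lt_one_right ((Valuation.pos_iff _).2 hN) ht
  have h2 : v.val (a ^ 2) = v.val (a ^ 2 - (x.at v).disc * b ^ 2) := by
    have := Valuation.map_add_eq_of_lt_right v.val h1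
    rw [add_sub_cancel] at this
    exact this
  have ha : a ≠ 0 := by
    rintro rfl
    rw [← h2] at h1
    simp at h1
  have hN' : (a⁻¹ * a) ^ 2 - (x.at v).disc * (a⁻¹ * b) ^ 2 ≠ 0 := by
    rw [show (a⁻¹ * a) ^ 2 - (x.at v).disc * (a⁻¹ * b) ^ 2 =
      a⁻¹ ^ 2 * (a ^ 2 - (x.at v).disc * b ^ 2) by ring]
    exact mul_ne_zero (pow_ne_zero _ (inv_ne_zero ha)) hN
  rw [← rhoStab_smul x v a b a⁻¹ hN hN']
  refine rhoStab_mem_unitsH x v ?_ ?_ hN'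
  · rw [inv_mul_cancel₀ ha]; exact one_mem _
  · rw [show (a⁻¹ * a) ^ 2 - (x.at v).disc * (a⁻¹ * b) ^ 2 =
      a⁻¹ ^ 2 * (a ^ 2 - (x.at v).disc * b ^ 2) by ring, map_mul, ← h2, ← map_mul, ← mul_pow,
      inv_mul_cancel₀ ha, one_pow, map_one]

theorem isOpen_unitsH : IsOpen (unitsH x v : Set (stabH0 (x.at v))) := by
  refine Subgroup.isOpen_of_mem_nhds (g := 1) _ ?_
  have hc : Continuous fun h : stabH0 (x.at v) => h.1.1.trace - 3 :=
    (Units.continuous_val.comp continuous_subtype_val).matrix_trace.sub continuous_const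
  have ho : IsOpen {h : stabH0 (x.at v) | v.val (h.1.1.trace - 3) < 1} := by
    have := (v.isOpen_val_lt (one_ne_zero (α := K))).preimage hc
    simpa using this
  refine Filter.mem_of_superset (ho.mem_nhds ?_) fun h hh => mem_unitsH_of_trace x v hh
  simp [Matrix.trace_one]

instance : LocallyCompactSpace (stabH0 (x.at v)) :=
  (isCompact_unitsH x v).locallyCompactSpace_of_mem_nhds_of_group
    ((isOpen_unitsH x v).mem_nhds (one_mem _))

theorem mem_integers_of_good {a b : v.Compl} (hd : v.1.valuation x.disc = 1) (ha : a ∈ v.integers)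
    (h : v.val (a ^ 2 - (x.at v).disc * b ^ 2) = 1) : b ∈ v.integers := by
  have hle := val_disc_mul_sq_le_one x v ha h
  rw [V.disc_map, map_mul, v.val_emb, hd, one_mul, map_pow] at hle
  exact (pow_le_one_iff two_ne_zero).1 hle

/-- At almost all places the integral points are the image of the integral units. -/
theorem unitsH_eq_integralH (hx : ∀ i, x i ∈ v.1) (hd : v.1.valuation x.disc = 1) :
    (unitsH x v : Set (stabH0 (x.at v))) = integralH x v := by
  have hd' : v.val (x.at v).disc = 1 := by rw [V.disc_map, v.val_emb, hd]
  have hxi : ∀ i, x.at v i ∈ v.integers := fun i => v.emb_mem_integers.2 (hx i)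
  have hInt : ∀ h ∈ unitsH x v, ∀ i j, h.1.1 i j ∈ v.integers := by
    intro h hh i j
    obtain ⟨a, b, hN, ha, h1, rfl⟩ := (mem_unitsH_iff x v h).1 hh
    have hb := mem_integers_of_good x v hd ha h1
    have := congr_arg v.val (rho_eltG_apply a b hN i j)
    rw [map_mul, h1, one_mul] at this
    change v.val ((rho ((x.at v).eltG a b hN)).1 i j) ≤ 1
    rw [this]
    change symSq _ i j ∈ v.integers
    have h2 : (2 : v.Compl) ∈ v.integers := (GoodForm.val_two x v).le
    have he : ∀ i j, (x.at v).elt a b i j ∈ v.integers := by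
      intro i j
      have e0 := hxi 0
      have e1 := hxi 1
      have e2 := hxi 2
      fin_cases i <;> fin_cases j <;> simp only [V.elt, Fin.zero_eta, Fin.mk_one,
        Matrix.of_apply, Matrix.cons_val_zero, Matrix.cons_val_one, Matrix.cons_val',
        Matrix.cons_val_fin_one, Fin.isValue]
      · exact sub_mem ha (mul_mem hb e1)
      · exact mul_mem (mul_mem h2 hb) e0
      · exact neg_mem (mul_mem (mul_mem h2 hb) e2)
      · exact add_mem ha (mul_mem hb e1)
    generalize (x.at v).elt a b = m at he
    have e00 := he 0 0
    have e01 := he 0 1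
    have e10 := he 1 0
    have e11 := he 1 1
    fin_cases i <;> fin_cases j <;> simp only [symSq, Fin.zero_eta, Fin.mk_one, Fin.reduceFinMk,
        Matrix.of_apply, Matrix.cons_val_zero, Matrix.cons_val_one, Matrix.cons_val',
        Matrix.cons_val_fin_one, Fin.isValue, Matrix.cons_val]
    · exact pow_mem e00 2
    · exact mul_mem e00 e01
    · exact pow_mem e01 2
    · exact mul_mem (mul_mem h2 e00) e10
    · exact add_mem (mul_mem e00 e11) (mul_mem e01 e10)
    · exact mul_mem (mul_mem h2 e01) e11
    · exact pow_mem e10 2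
    · exact mul_mem e10 e11
    · exact pow_mem e11 2
  ext h
  constructor
  · intro hh i j
    exact ⟨hInt h hh i j, hInt h⁻¹ (inv_mem hh) i j⟩
  · intro hh
    -- For an integral `h` the trace is integral, so the trace identity yields $|b|^2\le|N|$ and
    -- then $|a|^2\le|N|$. Dividing by the larger of $a$ and $b$ makes the norm a unit.
    have htr : h.1.1.trace - 3 ∈ v.integers := by
      refine sub_mem (sum_mem fun i _ => (hh i i).1) ?_
      exact_mod_cast natCast_mem v.integers 3
    obtain ⟨a, b, hN, rfl⟩ := exists_rhoStab_eltG x v h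
    have h4 : v.val 4 = 1 := by
      rw [show (4 : v.Compl) = 2 * 2 by norm_num, map_mul, GoodForm.val_two x v, one_mul]
    have h5 := congr_arg v.val (trace_rho_eltG a b hN)
    rw [mul_assoc, map_mul v.val 4, h4, one_mul, map_mul, map_mul, hd', one_mul, map_pow] at h5
    have hb : v.val b ^ 2 ≤ v.val (a ^ 2 - (x.at v).disc * b ^ 2) := by
      rw [← h5]
      exact mul_le_of_le_one_right' htr
    have hb' : v.val ((x.at v).disc * b ^ 2) ≤ v.val (a ^ 2 - (x.at v).disc * b ^ 2) := by
      rwa [map_mul, hd', one_mul, map_pow]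
    have ha : v.val a ^ 2 ≤ v.val (a ^ 2 - (x.at v).disc * b ^ 2) := by
      rw [← map_pow]
      have := Valuation.map_add_le v.val (le_refl (v.val (a ^ 2 - (x.at v).disc * b ^ 2))) hb'
      rwa [sub_add_cancel] at this
    obtain ⟨t, ht0, hta, hN1⟩ : ∃ t : v.Compl, t ≠ 0 ∧ v.val (t⁻¹ * a) ≤ 1 ∧
        v.val (a ^ 2 - (x.at v).disc * b ^ 2) = v.val t ^ 2 := by
      have key : ∀ t : v.Compl, v.val a ≤ v.val t → v.val b ≤ v.val t →
          v.val t ^ 2 ≤ v.val (a ^ 2 - (x.at v).disc * b ^ 2) → t ≠ 0 ∧ v.val (t⁻¹ * a) ≤ 1 ∧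
          v.val (a ^ 2 - (x.at v).disc * b ^ 2) = v.val t ^ 2 := by
        intro t h1 h2 h3
        have h6 : v.val (a ^ 2 - (x.at v).disc * b ^ 2) ≤ v.val t ^ 2 := by
          refine Valuation.map_sub_le v.val ?_ ?_
          · rw [map_pow]; exact pow_le_pow_left' h1 2
          · rw [map_mul, hd', one_mul, map_pow]; exact pow_le_pow_left' h2 2
        have ht0 : t ≠ 0 := by
          rintro rfl
          rw [map_zero, zero_pow two_ne_zero, le_zero_iff, map_eq_zero] at h6
          exact hN h6
        refine ⟨ht0, ?_, le_antisymm h6 h3⟩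
        rw [map_mul, map_inv₀]
        exact inv_mul_le_one_of_le₀ h1 zero_le
      rcases le_total (v.val a) (v.val b) with h | h
      · exact ⟨b, key b h le_rfl hb⟩
      · exact ⟨a, key a le_rfl h ha⟩
    have e : (t⁻¹ * a) ^ 2 - (x.at v).disc * (t⁻¹ * b) ^ 2 =
      t⁻¹ ^ 2 * (a ^ 2 - (x.at v).disc * b ^ 2) := by ring
    have hN' : (t⁻¹ * a) ^ 2 - (x.at v).disc * (t⁻¹ * b) ^ 2 ≠ 0 := by
      rw [e]
      exact mul_ne_zero (pow_ne_zero _ (inv_ne_zero ht0)) hN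
    rw [← rhoStab_smul x v a b t⁻¹ hN hN']
    refine rhoStab_mem_unitsH x v hta ?_ hN'
    rw [e, map_mul, hN1, ← map_pow, ← map_mul, ← mul_pow, inv_mul_cancel₀ ht0, one_pow, map_one]

theorem eventually_unitsH_eq_integralH :
    ∀ᶠ v in cofinite, (unitsH x v : Set (stabH0 (x.at v))) = integralH x v := by
  have h : ∀ f : K, f ≠ 0 → ∀ᶠ v : Place K in cofinite, v.1.valuation f = 1 := by
    intro f hf
    have := (GlobalPlaces.finite_ord_ne_zero f).compl_mem_cofinite
    filter_upwards [this] with v hv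
    exact (v.ord_eq_zero_iff hf).1 (not_not.1 hv)
  have h' : ∀ f : K, ∀ᶠ v : Place K in cofinite, f ∈ v.1 := by
    intro f
    rcases eq_or_ne f 0 with rfl | hf
    · exact Eventually.of_forall fun v => zero_mem _
    · filter_upwards [h f hf] with v hv
      exact (v.1.valuation_le_one_iff f).1 hv.le
  filter_upwards [h _ (GoodForm.disc_ne_zero (x := x)), eventually_all.2 fun i => h' (x i)]
    with v h1 h2
  exact unitsH_eq_integralH x v h2 h1

end Local

end

end BinQuad

namespace BinQuad

noncomputable section

/-! ### Local measures -/

open scoped Topology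

section General

theorem theMeasure_spec {α : Type*} [MeasurableSpace α] {Q : Measure α → Prop} (h : ∃! μ, Q μ) :
    Q (theMeasure Q) := by
  rw [theMeasure, dif_pos h]
  exact h.choose_spec.1

theorem eq_theMeasure {α : Type*} [MeasurableSpace α] {Q : Measure α → Prop} (h : ∃! μ, Q μ)
    {μ : Measure α} (hμ : Q μ) : μ = theMeasure Q :=
  h.unique hμ (theMeasure_spec h)

theorem existsUnique_haar {A : Type*} [Group A] [TopologicalSpace A] [IsTopologicalGroup A]
    [LocallyCompactSpace A] [SecondCountableTopology A] [MeasurableSpace A] [BorelSpace A]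
    {U : Set A} (hU : IsCompact U) (hi : (interior U).Nonempty) :
    ∃! μ : Measure A, μ.IsHaarMeasure ∧ μ U = 1 := by
  let P : TopologicalSpace.PositiveCompacts A := ⟨⟨U, hU⟩, hi⟩
  refine ⟨Measure.haarMeasure P, ⟨inferInstance, Measure.haarMeasure_self⟩, ?_⟩
  rintro μ ⟨hμ, h1⟩
  have := Measure.haarMeasure_unique μ P
  rw [this, show μ P = 1 from h1, one_smul]

/-- Unfolding the integral along the orbits of a central subgroup. -/
theorem setLIntegral_lintegral_mul {A T : Type*} [Group A] [MeasurableSpace A] [MeasurableMul₂ A]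
    [Group T] [MeasurableSpace T] [MeasurableInv T] (μ : Measure A) [μ.IsMulLeftInvariant] [SFinite μ]
    (l : Measure T) [SFinite l] (τ : T →* A) (hτ : Measurable τ)
    (hc : ∀ t g, g * τ t = τ t * g) {W : Set A} (hW : MeasurableSet W)
    (h1 : ∀ g, l {t | g * τ t⁻¹ ∈ W} = 1) {f : A → ℝ≥0∞} (hf : Measurable f) :
    ∫⁻ g in W, ∫⁻ t, f (g * τ t) ∂l ∂μ = ∫⁻ g, f g ∂μ := by
  have hmul : Measurable fun p : A × T => p.1 * τ p.2 :=
    measurable_fst.mul (hτ.comp measurable_snd)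
  have hmul' : Measurable fun p : A × T => p.1 * τ p.2⁻¹ :=
    measurable_fst.mul (hτ.comp measurable_snd.inv)
  have hind : Measurable (W.indicator (1 : A → ℝ≥0∞)) := measurable_one.indicator hW
  calc ∫⁻ g in W, ∫⁻ t, f (g * τ t) ∂l ∂μ
      = ∫⁻ g, ∫⁻ t, W.indicator 1 g * f (g * τ t) ∂l ∂μ := by
        rw [← lintegral_indicator hW]
        refine lintegral_congr fun g => ?_
        by_cases hg : g ∈ W <;> simp [hg]
    _ = ∫⁻ t, ∫⁻ g, W.indicator 1 g * f (g * τ t) ∂μ ∂l :=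
        lintegral_lintegral_swap ((hind.comp measurable_fst).mul (hf.comp hmul)).aemeasurable
    _ = ∫⁻ t, ∫⁻ g, W.indicator 1 (g * τ t⁻¹) * f g ∂μ ∂l := by
        refine lintegral_congr fun t => ?_
        -- Only left invariance of `μ` is assumed; centrality moves `τ t` to the other side.
        rw [← lintegral_mul_left_eq_self (fun g => W.indicator 1 (g * τ t⁻¹) * f g) (τ t)]
        refine lintegral_congr fun g => ?_
        rw [← hc t g, mul_assoc, ← map_mul, mul_inv_cancel, map_one, mul_one]
    _ = ∫⁻ g, ∫⁻ t, W.indicator 1 (g * τ t⁻¹) * f g ∂l ∂μ :=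
        (lintegral_lintegral_swap ((hind.comp hmul').mul (hf.comp measurable_fst)).aemeasurable).symm
    _ = ∫⁻ g, f g ∂μ := by
        refine lintegral_congr fun g => ?_
        have hm : Measurable fun t => g * τ t⁻¹ := hmul'.comp (measurable_const.prodMk measurable_id)
        rw [lintegral_mul_const (f g)
          (show Measurable fun t => W.indicator (1 : A → ℝ≥0∞) (g * τ t⁻¹) from hind.comp hm)]
        have : ∫⁻ t, W.indicator (1 : A → ℝ≥0∞) (g * τ t⁻¹) ∂l = l {t | g * τ t⁻¹ ∈ W} :=
          lintegral_indicator_one (hm hW)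
        rw [this, h1, one_mul]

end General

section Local

set_option linter.unusedSectionVars false

variable {K : Type*} [Field K] [GlobalPlaces K] (v : Place K)

theorem setOf_unit_eq : {u : v.Complˣ | (u : v.Compl) ∈ v.integers ∧
    ((u⁻¹ : v.Complˣ) : v.Compl) ∈ v.integers} = {u : v.Complˣ | v.val u = 1} := by
  ext u
  have h0 : 0 < v.val (u : v.Compl) := (Valuation.pos_iff _).2 u.ne_zero
  simp only [Set.mem_ofPred_eq, Place.mem_integers, Units.val_inv_eq_inv_val, map_inv₀]
  rw [inv_le_one₀ h0, ← le_antisymm_iff]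

theorem isCompact_unit : IsCompact {u : v.Complˣ | v.val u = 1} := by
  have : {u : v.Complˣ | v.val u = 1} = Units.embedProduct v.Compl ⁻¹'
      ((v.integers : Set v.Compl) ×ˢ (MulOpposite.unop ⁻¹' (v.integers : Set v.Compl))) := by
    rw [← setOf_unit_eq]
    rfl
  rw [this]
  refine Units.isClosedEmbedding_embedProduct.isCompact_preimage (v.isCompact_integers.prod ?_)
  exact MulOpposite.opHomeomorph.symm.isClosedEmbedding.isCompact_preimage v.isCompact_integers

theorem isOpen_unit : IsOpen {u : v.Complˣ | v.val u = 1} :=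
  (isClopen_val_eq_one v).isOpen.preimage Units.continuous_val

instance : LocallyCompactSpace v.Complˣ :=
  (isCompact_unit v).locallyCompactSpace_of_mem_nhds_of_group
    ((isOpen_unit v).mem_nhds (x := 1) (by simp))

theorem exists_zpow_unif {d : v.Compl} (hd : d ≠ 0) :
    ∃ n : ℤ, v.val d = v.1.valuation v.unif ^ n := by
  obtain ⟨b, hb, h⟩ := v.exists_val_eq hd
  exact ⟨v.ord b, h.trans (v.valuation_eq hb)⟩

variable [Countable K]

theorem unitMeasure_spec : (unitMeasure v).IsHaarMeasure ∧ unitMeasure v {u | v.val u = 1} = 1 := by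
  have h := existsUnique_haar (isCompact_unit v)
    (by rw [(isOpen_unit v).interior_eq]; exact ⟨1, by simp⟩)
  rw [unitMeasure, setOf_unit_eq]
  exact theMeasure_spec h

instance : (unitMeasure v).IsHaarMeasure := (unitMeasure_spec v).1

theorem unitMeasure_zpow (n : ℤ) :
    unitMeasure v {u | v.val u = v.1.valuation v.unif ^ n} = 1 := by
  have h0 : v.emb v.unif ≠ 0 := (map_ne_zero _).2 v.unif_ne_zero
  let t : v.Complˣ := Units.mk0 _ h0 ^ n
  have ht : v.val t = v.1.valuation v.unif ^ n := by
    simp [t, v.val_emb]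
  have ht0 : v.val (t : v.Compl) ≠ 0 := (Valuation.ne_zero_iff _).2 t.ne_zero
  have : {u : v.Complˣ | v.val u = v.1.valuation v.unif ^ n} =
      (fun u => t⁻¹ * u) ⁻¹' {u | v.val u = 1} := by
    ext u
    simp only [Set.mem_ofPred_eq, Set.mem_preimage, Units.val_mul, map_mul,
      Units.val_inv_eq_inv_val, map_inv₀, ← ht]
    rw [inv_mul_eq_one₀ ht0, eq_comm]
  rw [this, measure_preimage_mul]
  exact (unitMeasure_spec v).2

variable (x : V K) [GoodForm x]

theorem existsUnique_measureG :
    ∃! μ : Measure (stabG0 (x.at v)), μ.IsHaarMeasure ∧ μ (unitsG x v) = 1 :=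
  existsUnique_haar (isCompact_unitsGroup x v)
    ⟨1, (isOpen_unitsGroup x v).subset_interior_iff.2 le_rfl (one_mem (unitsGroup x v))⟩

instance : (measureG x v).IsHaarMeasure := (theMeasure_spec (existsUnique_measureG v x)).1

theorem measureG_unitsG : measureG x v (unitsG x v) = 1 :=
  (theMeasure_spec (existsUnique_measureG v x)).2

/-- A set of representatives, up to units, for the cosets of the torus. -/
def slab : Set (G v.Compl) :=
  {g | v.val g.2.1.det = 1 ∨ v.val g.2.1.det = v.1.valuation v.unif}

theorem isOpen_slab : IsOpen (slab v) := by
  refine (v.isOpen_val_of_ne_zero (fun r => r = 1 ∨ r = v.1.valuation v.unif) ?_).preimage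
    (Units.continuous_val.comp continuous_snd).matrix_det
  rintro (h | h)
  · exact zero_ne_one h
  · exact v.valuation_unif_pos.ne h

theorem det_torus (t : v.Complˣ) : (torus t).2.1.det = ((t : v.Compl) ^ 2)⁻¹ := by
  simp [torus, pow_two]

/-- A torus element of order $j$ lowers the order of the determinant by $2j$, so exactly one $j$
brings it to $0$ or $1$. Parity is why the slab has two layers, and integer division rounds down as
needed. -/
theorem mul_torus_mem_slab_iff {g : G v.Compl} {n j : ℤ} (hn : v.val g.2.1.det = v.1.valuation v.unif ^ n)
    {t : v.Complˣ} (ht : v.val t = v.1.valuation v.unif ^ j) : g * torus t ∈ slab v ↔ j = n / 2 := by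
  have h0 : v.1.valuation v.unif ≠ 0 := v.valuation_unif_pos.ne'
  have h1 : v.val (g * torus t).2.1.det = v.1.valuation v.unif ^ (n - 2 * j) := by
    have : (g * torus t).2.1 = g.2.1 * (torus t).2.1 := rfl
    rw [this, Matrix.det_mul, det_torus, map_mul, hn, map_inv₀, map_pow, ht, zpow_sub₀ h0,
      mul_comm 2 j, zpow_mul, div_eq_mul_inv]
    rfl
  have e0 : v.val (g * torus t).2.1.det = 1 ↔ n - 2 * j = 0 := by
    rw [h1]
    exact ⟨fun h => v.zpow_unif_injective (h.trans (zpow_zero _).symm),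
      fun h => by rw [h, zpow_zero]⟩
  have e1 : v.val (g * torus t).2.1.det = v.1.valuation v.unif ↔ n - 2 * j = 1 := by
    rw [h1]
    exact ⟨fun h => v.zpow_unif_injective (h.trans (zpow_one _).symm),
      fun h => by rw [h, zpow_one]⟩
  change (_ ∨ _) ↔ _
  rw [e0, e1]
  omega

theorem unitMeasure_slab (g : G v.Compl) : unitMeasure v {t | g * torus t ∈ slab v} = 1 := by
  obtain ⟨n, hn⟩ := exists_zpow_unif v ((Matrix.isUnit_iff_isUnit_det _).1 g.2.isUnit).ne_zero
  rw [← unitMeasure_zpow v (n / 2)]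
  congr 1
  ext t
  obtain ⟨j, hj⟩ := exists_zpow_unif v t.ne_zero
  simp only [Set.mem_ofPred_eq, mul_torus_mem_slab_iff v hn hj, hj]
  exact ⟨fun h => by rw [h], fun h => v.zpow_unif_injective h⟩

theorem unitMeasure_slab_inv (g : G v.Compl) : unitMeasure v {t | g * torus t⁻¹ ∈ slab v} = 1 := by
  obtain ⟨n, hn⟩ := exists_zpow_unif v ((Matrix.isUnit_iff_isUnit_det _).1 g.2.isUnit).ne_zero
  rw [← unitMeasure_zpow v (-(n / 2))]
  congr 1
  ext t
  obtain ⟨j, hj⟩ := exists_zpow_unif v t.ne_zero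
  have hj' : v.val (t⁻¹ : v.Complˣ) = v.1.valuation v.unif ^ (-j) := by
    rw [Units.val_inv_eq_inv_val, map_inv₀, hj, zpow_neg]
  simp only [Set.mem_ofPred_eq, mul_torus_mem_slab_iff v hn hj', hj]
  rw [neg_eq_iff_eq_neg]
  exact ⟨fun h => by rw [h], fun h => v.zpow_unif_injective h⟩

/-- The torus as a subgroup of `(G_x°)_{K_v}`. -/
def torusStab : v.Complˣ →* stabG0 (x.at v) where
  toFun t := ⟨torus t, torus_mem_stabG0 (two_ne_zero_at x v) (disc_at_ne_zero x v) t⟩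
  map_one' := Subtype.ext (by
    have := torus_mul (1 : v.Complˣ) 1
    rw [mul_one] at this
    exact left_eq_mul.1 this)
  map_mul' s t := Subtype.ext (torus_mul s t)

theorem measurable_torusStab : Measurable (torusStab v x) :=
  (continuous_torus.subtype_mk _).measurable

/-- The characteristic property of the measure on the quotient by the torus. -/
def IsQuotientMeasure (η : Measure (stabH0 (x.at v))) : Prop :=
  ∀ (f : G v.Compl → ℝ≥0∞) (φ : GL (Fin 3) v.Compl → ℝ≥0∞), Measurable f → Measurable φ →
    (∀ g ∈ stabG0 (x.at v), φ (rho g) = ∫⁻ t, f (g * torus t) ∂unitMeasure v) →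
    ∫⁻ g, f g ∂measureG x v = ∫⁻ h, φ h ∂η

theorem measurable_rhoStab : Measurable (rhoStab x v) := (continuous_rhoStab x v).measurable

/-- Every torus orbit meets the slab in a set of measure one. Hence the measure on $G_x^\circ$,
restricted to the slab and pushed forward, unfolds correctly. -/
theorem isQuotientMeasure_map : IsQuotientMeasure v x
    (((measureG x v).restrict (Subtype.val ⁻¹' slab v)).map (rhoStab x v)) := by
  intro f φ hf hφ h
  rw [lintegral_map (show Measurable fun h : stabH0 (x.at v) => φ h from
    hφ.comp measurable_subtype_coe) (measurable_rhoStab v x)]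
  have hW : MeasurableSet (Subtype.val ⁻¹' slab v : Set (stabG0 (x.at v))) :=
    measurable_subtype_coe (isOpen_slab v).measurableSet
  refine (setLIntegral_lintegral_mul (measureG x v) (unitMeasure v) (torusStab v x)
    (measurable_torusStab v x) (fun t g => Subtype.ext (stabG0_comm (two_ne_zero_at x v)
      (disc_at_ne_zero x v) g.2 (torusStab v x t).2)) hW
    (fun g => unitMeasure_slab_inv v g.1) (hf.comp measurable_subtype_coe)).symm.trans ?_
  exact lintegral_congr fun g => (h g.1 g.2).symm

/-- The test function is the indicator of the part of the slab above $B$. Its integrals along torus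
orbits give the indicator of $B$, so the characteristic property determines the measure. -/
theorem IsQuotientMeasure.apply {η : Measure (stabH0 (x.at v))} (hη : IsQuotientMeasure v x η)
    {B : Set (stabH0 (x.at v))} (hB : MeasurableSet B) :
    η B = measureG x v (Subtype.val ⁻¹' slab v ∩ rhoStab x v ⁻¹' B) := by
  obtain ⟨B', hB', rfl⟩ := hB
  have hr : Measurable (rho : G v.Compl → GL (Fin 3) v.Compl) := continuous_rho.measurable
  have hS : MeasurableSet (slab v ∩ rho ⁻¹' B') := (isOpen_slab v).measurableSet.inter (hr hB')
  have := hη ((slab v ∩ rho ⁻¹' B').indicator 1) (B'.indicator 1) (measurable_one.indicator hS)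
    (measurable_one.indicator hB') (by
      intro g hg
      have hm : Measurable fun t : v.Complˣ => g * torus t :=
        (continuous_const.mul continuous_torus).measurable
      have he : (fun t => (slab v ∩ rho ⁻¹' B').indicator (1 : G v.Compl → ℝ≥0∞) (g * torus t)) =
          fun t => B'.indicator 1 (rho g) * ({t | g * torus t ∈ slab v} : Set v.Complˣ).indicator 1 t := by
        funext t
        have h1 : rho (g * torus t) = rho g := by rw [map_mul, rho_torus, mul_one]
        by_cases h2 : rho g ∈ B' <;> by_cases h3 : g * torus t ∈ slab v <;>
          simp [Set.indicator, h1, h2, h3]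
      have hms : MeasurableSet {t | g * torus t ∈ slab v} := hm (isOpen_slab v).measurableSet
      rw [he, lintegral_const_mul _ (measurable_one.indicator hms), lintegral_indicator_one hms,
        unitMeasure_slab, mul_one])
  have e1 : ∫⁻ g : stabG0 (x.at v), (slab v ∩ rho ⁻¹' B').indicator (1 : G v.Compl → ℝ≥0∞) g
      ∂measureG x v = measureG x v (Subtype.val ⁻¹' slab v ∩ rhoStab x v ⁻¹' (Subtype.val ⁻¹' B')) := by
    exact lintegral_indicator_one
      (measurable_subtype_coe hS : MeasurableSet (Subtype.val ⁻¹' (slab v ∩ rho ⁻¹' B')))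
  have e2 : ∫⁻ h : stabH0 (x.at v), B'.indicator (1 : GL (Fin 3) v.Compl → ℝ≥0∞) h ∂η =
      η (Subtype.val ⁻¹' B') := by
    exact lintegral_indicator_one (measurable_subtype_coe hB')
  rw [← e1, ← e2, this]

theorem existsUnique_measureH : ∃! η, IsQuotientMeasure v x η := by
  refine ⟨_, isQuotientMeasure_map v x, fun η hη => Measure.ext fun B hB => ?_⟩
  rw [hη.apply v x hB, (isQuotientMeasure_map v x).apply v x hB]

theorem isQuotientMeasure_measureH : IsQuotientMeasure v x (measureH x v) :=
  theMeasure_spec (existsUnique_measureH v x)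

/-- In the slab the preimage of `unitsH` is just `unitsG`: such an element is a unit times a torus
element $t$, its determinant has even order, so the slab forces $|t|=1$. -/
theorem measureH_unitsH : measureH x v (unitsH x v) = 1 := by
  rw [(isQuotientMeasure_measureH v x).apply v x (isOpen_unitsH x v).measurableSet,
    ← measureG_unitsG v x]
  congr 1
  ext g
  constructor
  · rintro ⟨hg, g', hg', h⟩
    obtain ⟨t, ht⟩ := exists_torus_of_rho_eq_one (g := (g'⁻¹ * g).1) (by
      have := congr_arg Subtype.val h
      rw [coe_rhoStab, coe_rhoStab] at this
      change rho (g'.1⁻¹ * g.1) = 1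
      rw [map_mul, map_inv, this, inv_mul_cancel])
    have hgt : g.1 = g'.1 * torus t := by
      rw [← ht]
      exact (mul_inv_cancel_left g'.1 g.1).symm
    obtain ⟨h1, h2⟩ := (mem_unitsG_iff x v g').1 hg'
    obtain ⟨j, hj⟩ := exists_zpow_unif v t.ne_zero
    have hg1 : g.1 ∈ slab v := hg
    rw [hgt, mul_torus_mem_slab_iff v (n := 0) (by rw [h2, zpow_zero]) hj] at hg1
    have hj1 : v.val (t : v.Compl) = 1 := by rw [hj, hg1]; simp
    have htinv : v.val (t⁻¹ : v.Complˣ) = 1 := by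
      rw [Units.val_inv_eq_inv_val, map_inv₀, hj1, inv_one]
    refine (mem_unitsG_iff x v g).2 ⟨?_, ?_⟩
    · have : g.1.2.1 = (t⁻¹ : v.Complˣ).1 • g'.1.2.1 := by
        rw [hgt]
        change g'.1.2.1 * (torus t).2.1 = _
        simp [torus, ← Matrix.smul_one_eq_diagonal]
      rw [this, Matrix.trace_smul, smul_eq_mul]
      exact mul_mem htinv.le h1
    · have : g.1.2.1 = g'.1.2.1 * (torus t).2.1 := by rw [hgt]; rfl
      rw [this, Matrix.det_mul, det_torus, map_mul, h2, map_inv₀, map_pow, hj1]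
      simp
  · intro hg
    exact ⟨Or.inl ((mem_unitsG_iff x v g).1 hg).2, ⟨g, hg, rfl⟩⟩

/-- A translate satisfies the same characteristic property, so invariance follows from uniqueness.
-/
instance : (measureH x v).IsMulLeftInvariant := by
  refine ⟨fun h => ?_⟩
  refine eq_theMeasure (existsUnique_measureH v x) ?_
  obtain ⟨g₀, rfl⟩ := rhoStab_surjective x v h
  intro f φ hf hφ hfφ
  have hφ' : Measurable fun y : GL (Fin 3) v.Compl => φ (rho g₀.1 * y) :=
    hφ.comp (continuous_const_mul _).measurable
  have hf' : Measurable fun g : G v.Compl => f (g₀.1 * g) := hf.comp (continuous_const_mul _).measurable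
  have := isQuotientMeasure_measureH v x (fun g => f (g₀.1 * g)) (fun y => φ (rho g₀.1 * y)) hf' hφ'
    (by
      intro g hg
      rw [← map_mul, hfφ _ (mul_mem g₀.2 hg)]
      simp only [mul_assoc])
  rw [lintegral_map (show Measurable fun h : stabH0 (x.at v) => φ h from
    hφ.comp measurable_subtype_coe) (measurable_const_mul _)]
  exact (lintegral_mul_left_eq_self (fun g : stabG0 (x.at v) => f g.1) g₀).symm.trans this

instance : (measureH x v).IsHaarMeasure :=
  Measure.isHaarMeasure_of_isCompact_nonempty_interior (measureH x v) _ (isCompact_unitsH x v)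
    (by rw [(isOpen_unitsH x v).interior_eq]; exact ⟨1, one_mem _⟩)
    (by rw [measureH_unitsH]; exact one_ne_zero) (by rw [measureH_unitsH]; exact ENNReal.one_ne_top)

end Local

end

end BinQuad

namespace BinQuad

noncomputable section

/-! ### Topology of the adelic stabilizer -/

open scoped Topology

section AdelicTopology

set_option linter.unusedSectionVars false

variable {K : Type*} [Field K]

instance instFactIsOpenIntegers : Fact (∀ v : Place K, IsOpen (v.integers : Set v.Compl)) :=
  ⟨fun v => v.isOpen_integers⟩

/-- A family of adeles with continuous components that are integral outside a fixed finite set of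
places is continuous. -/
theorem continuous_adele {X : Type*} [TopologicalSpace X] {f : X → Adele K} {S : Set (Place K)}
    (hS : S.Finite) (hf : ∀ v, Continuous fun a => f a v)
    (h : ∀ a, ∀ v ∉ S, f a v ∈ v.integers) : Continuous f := by
  have hle : (cofinite : Filter (Place K)) ≤ 𝓟 Sᶜ := le_principal_iff.2 hS.compl_mem_cofinite
  let g : X → Πʳ v : Place K, [v.Compl, (v.integers : Set v.Compl)]_[𝓟 Sᶜ] := fun a =>
    ⟨fun v => f a v, eventually_principal.2 fun v hv => h a v hv⟩
  have hg : Continuous g := RestrictedProduct.continuous_rng_of_principal_iff_forall.2 hf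
  exact (RestrictedProduct.continuous_inclusion hle).comp hg

variable (x : V K)

theorem adele_ext {a b : Adele K} (h : ∀ v, a v = b v) : a = b :=
  RestrictedProduct.ext _ _ h

theorem adelicH0_ext {h h' : adelicH0 x}
    (hh : ∀ v, adelicH0.eval x v h = adelicH0.eval x v h') : h = h' := by
  refine Subtype.ext (Units.ext (Matrix.ext fun i j => adele_ext fun v => ?_))
  have := congr_arg (fun y : stabH0 (x.at v) => y.1.1 i j) (hh v)
  exact this

/-- The component at `v` as a homomorphism. -/
def evalHom (v : Place K) : adelicH0 x →* stabH0 (x.at v) where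
  toFun := adelicH0.eval x v
  map_one' := Subtype.ext (map_one (evalGL v))
  map_mul' a b := Subtype.ext (map_mul (evalGL v) a.1 b.1)

@[simp] theorem evalHom_apply (v : Place K) (h : adelicH0 x) :
    evalHom x v h = adelicH0.eval x v h := rfl

theorem continuous_evalGL (v : Place K) : Continuous (evalGL v) := by
  have h : Continuous fun m : GL (Fin 3) (Adele K) => (evalGL v m).1 :=
    continuous_matrix fun i j => (RestrictedProduct.continuous_eval v).comp
      (Units.continuous_val.matrix_elem i j)
  refine Units.continuous_iff.2 ⟨h, ?_⟩
  have : (fun m : GL (Fin 3) (Adele K) => ((evalGL v m)⁻¹).1) =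
      (fun m => (evalGL v m).1) ∘ fun m => m⁻¹ := by
    funext m
    rw [Function.comp_apply, map_inv]
  rw [this]
  exact h.comp continuous_inv

theorem continuous_eval (v : Place K) : Continuous (adelicH0.eval x v) :=
  ((continuous_evalGL v).comp continuous_subtype_val).subtype_mk _

theorem eventually_eval_mem_integralH (h : adelicH0 x) :
    ∀ᶠ v in cofinite, adelicH0.eval x v h ∈ integralH x v := by
  have h1 : ∀ p : Fin 3 × Fin 3, ∀ᶠ v in cofinite, h.1.1 p.1 p.2 v ∈ v.integers :=
    fun p => (h.1.1 p.1 p.2).2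
  have h2 : ∀ p : Fin 3 × Fin 3, ∀ᶠ v in cofinite, (h⁻¹).1.1 p.1 p.2 v ∈ v.integers :=
    fun p => ((h⁻¹).1.1 p.1 p.2).2
  filter_upwards [eventually_all.2 h1, eventually_all.2 h2] with v h1 h2 i j
  refine ⟨h1 (i, j), ?_⟩
  have : (adelicH0.eval x v h)⁻¹ = adelicH0.eval x v h⁻¹ := (map_inv (evalHom x v) h).symm
  change ((adelicH0.eval x v h)⁻¹ : stabH0 (x.at v)).1.1 i j ∈ v.integers
  rw [this]
  exact h2 (i, j)

/-- The element of the adelic group with given components. -/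
def glue (p : (v : Place K) → stabH0 (x.at v)) (hp : ∀ᶠ v in cofinite, p v ∈ integralH x v) :
    adelicH0 x :=
  ⟨{ val := Matrix.of fun i j => ⟨fun v => (p v).1.1 i j, hp.mono fun v hv => (hv i j).1⟩
     inv := Matrix.of fun i j =>
      ⟨fun v => ((p v).1⁻¹).1 i j, hp.mono fun v hv => (hv i j).2⟩
     val_inv := by
      refine Matrix.ext fun i j => adele_ext fun v => ?_
      have h := congr_arg (fun m => m i j) ((p v).1.mul_inv)
      have e : ∀ a b c d e f : Adele K, (a * b + (c * d + e * f)) v =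
        a v * b v + (c v * d v + e v * f v) := fun _ _ _ _ _ _ => rfl
      simp only [Matrix.mul_apply, Fin.sum_univ_succ, Fin.sum_univ_zero, add_zero] at h ⊢
      rw [e]
      refine h.trans ?_
      by_cases hij : i = j <;> simp [hij, Matrix.one_apply]
     inv_val := by
      refine Matrix.ext fun i j => adele_ext fun v => ?_
      have h := congr_arg (fun m => m i j) ((p v).1.inv_mul)
      have e : ∀ a b c d e f : Adele K, (a * b + (c * d + e * f)) v =
        a v * b v + (c v * d v + e v * f v) := fun _ _ _ _ _ _ => rfl
      simp only [Matrix.mul_apply, Fin.sum_univ_succ, Fin.sum_univ_zero, add_zero] at h ⊢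
      rw [e]
      refine h.trans ?_
      by_cases hij : i = j <;> simp [hij, Matrix.one_apply] },
    Subgroup.mem_iInf.2 fun v => by
      rw [Subgroup.mem_comap]
      convert (p v).2
      exact Units.ext rfl⟩

theorem eval_glue (p : (v : Place K) → stabH0 (x.at v))
    (hp : ∀ᶠ v in cofinite, p v ∈ integralH x v) (v : Place K) :
    adelicH0.eval x v (glue x p hp) = p v :=
  Subtype.ext (Units.ext rfl)

variable [GlobalPlaces K] [GoodForm x]

theorem eventually_eval_mem_unitsH (h : adelicH0 x) :
    ∀ᶠ v in cofinite, adelicH0.eval x v h ∈ unitsH x v := by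
  filter_upwards [eventually_eval_mem_integralH x h, eventually_unitsH_eq_integralH x] with v h1 h2
  rw [← h2] at h1
  exact h1

/-- The families of local points that are integral units outside `S`. -/
abbrev LocalFamily (S : Finset (Place K)) : Type _ :=
  {p : (v : Place K) → stabH0 (x.at v) // ∀ v ∉ S, p v ∈ unitsH x v}

theorem LocalFamily.eventually {S : Finset (Place K)} (p : LocalFamily x S) :
    ∀ᶠ v in cofinite, p.1 v ∈ integralH x v := by
  filter_upwards [S.finite_toSet.compl_mem_cofinite, eventually_unitsH_eq_integralH x] with v h1 h2
  rw [← h2]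
  exact p.2 v h1

/-- On families that are integral outside a fixed finite set, convergence in the restricted product
is convergence in each component. -/
theorem continuous_glue (S : Finset (Place K)) :
    Continuous fun p : LocalFamily x S => glue x p.1 (LocalFamily.eventually x p) := by
  have hfin : ((S : Set (Place K)) ∪
      {v | ¬ (unitsH x v : Set (stabH0 (x.at v))) = integralH x v}).Finite :=
    S.finite_toSet.union (eventually_unitsH_eq_integralH x)
  have hv : ∀ v, Continuous fun p : LocalFamily x S => p.1 v := fun v =>
    (continuous_apply v).comp continuous_subtype_val
  have hmem : ∀ (p : LocalFamily x S), ∀ v ∉ ((S : Set (Place K)) ∪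
      {v | ¬ (unitsH x v : Set (stabH0 (x.at v))) = integralH x v}), p.1 v ∈ integralH x v := by
    intro p v hv
    simp only [Set.mem_union, not_or, Set.mem_ofPred_eq, not_not] at hv
    rw [← hv.2]
    exact p.2 v hv.1
  refine Continuous.subtype_mk (Units.continuous_iff.2 ⟨?_, ?_⟩) _
  · exact continuous_matrix fun i j => continuous_adele hfin
      (fun v => (Units.continuous_val.comp (continuous_subtype_val.comp (hv v))).matrix_elem i j)
      fun p v h => (hmem p v h i j).1
  · exact continuous_matrix fun i j => continuous_adele hfin
      (fun v => (Units.continuous_val.comp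
        (continuous_inv.comp (continuous_subtype_val.comp (hv v)))).matrix_elem i j)
      fun p v h => (hmem p v h i j).2

/-- The subgroup of the adelic group of elements that are integral units outside `S`. -/
def boxGroup (S : Set (Place K)) : Subgroup (adelicH0 x) :=
  ⨅ v : {v // v ∉ S}, (unitsH x v.1).comap (evalHom x v)

theorem mem_boxGroup {S : Set (Place K)} {h : adelicH0 x} :
    h ∈ boxGroup x S ↔ ∀ v ∉ S, adelicH0.eval x v h ∈ unitsH x v := by
  simp [boxGroup, Subgroup.mem_iInf]

theorem isCompact_boxGroup_empty : IsCompact (boxGroup x ∅ : Set (adelicH0 x)) := by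
  have h1 : IsCompact {p : (v : Place K) → stabH0 (x.at v) |
      ∀ v ∉ (∅ : Finset (Place K)), p v ∈ unitsH x v} := by
    have := isCompact_univ_pi fun v : Place K => isCompact_unitsH x v
    convert this using 1
    ext p
    simp [Set.mem_pi]
  have : CompactSpace (LocalFamily x ∅) := isCompact_iff_compactSpace.1 h1
  convert isCompact_range (continuous_glue x ∅) using 1
  ext h
  constructor
  · intro hh
    refine ⟨⟨fun v => adelicH0.eval x v h, fun v _ => (mem_boxGroup x).1 hh v (by simp)⟩, ?_⟩
    exact adelicH0_ext x fun v => eval_glue x _ _ v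
  · rintro ⟨p, rfl⟩
    refine (mem_boxGroup x).2 fun v _ => ?_
    rw [eval_glue]
    exact p.2 v (by simp)

theorem boxGroup_mono {S T : Set (Place K)} (h : S ⊆ T) : boxGroup x S ≤ boxGroup x T :=
  fun _ hg => (mem_boxGroup x).2 fun v hv => (mem_boxGroup x).1 hg v fun hv' => hv (h hv')

/-- Having integral entries at all places, together with the inverse, is an open condition on adelic
matrices and describes the units at almost all places. At the finitely many others the open
condition `unitsH` is imposed in addition. -/
theorem isOpen_boxGroup_empty : IsOpen (boxGroup x ∅ : Set (adelicH0 x)) := by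
  refine Subgroup.isOpen_of_mem_nhds (g := 1) _ ?_
  have hO : IsOpen {a : Adele K | ∀ v, a.1 v ∈ v.integers} :=
    RestrictedProduct.isOpen_forall_mem fun v => v.isOpen_integers
  have h1 : ∀ i j, Continuous fun h : adelicH0 x => h.1.1 i j := fun i j =>
    (Units.continuous_val.comp continuous_subtype_val).matrix_elem i j
  have h2 : ∀ i j, Continuous fun h : adelicH0 x => (h⁻¹).1.1 i j := fun i j =>
    (h1 i j).comp continuous_inv
  have hone : ∀ i j, (1 : Matrix (Fin 3) (Fin 3) (Adele K)) i j ∈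
      {a : Adele K | ∀ v, a.1 v ∈ v.integers} := by
    intro i j v
    by_cases hij : i = j
    · rw [hij, Matrix.one_apply_eq]; exact one_mem v.integers
    · rw [Matrix.one_apply_ne hij]; exact zero_mem v.integers
  have e1 : ∀ᶠ h : adelicH0 x in 𝓝 1, ∀ i j, ∀ v, (h.1.1 i j).1 v ∈ v.integers :=
    eventually_all.2 fun i => eventually_all.2 fun j =>
      (h1 i j).continuousAt.eventually (hO.mem_nhds (by simpa using hone i j))
  have e2 : ∀ᶠ h : adelicH0 x in 𝓝 1, ∀ i j, ∀ v, ((h⁻¹).1.1 i j).1 v ∈ v.integers :=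
    eventually_all.2 fun i => eventually_all.2 fun j =>
      (h2 i j).continuousAt.eventually (hO.mem_nhds (by simpa using hone i j))
  have e3 : ∀ᶠ h : adelicH0 x in 𝓝 1,
      ∀ v ∈ {v | ¬ (unitsH x v : Set (stabH0 (x.at v))) = integralH x v},
      adelicH0.eval x v h ∈ unitsH x v := by
    refine (eventually_all_finite (eventually_unitsH_eq_integralH x)).2 fun v _ => ?_
    refine (continuous_eval x v).continuousAt.eventually ((isOpen_unitsH x v).mem_nhds ?_)
    have : adelicH0.eval x v 1 = 1 := map_one (evalHom x v)
    rw [this]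
    exact one_mem _
  filter_upwards [e1, e2, e3] with h h1 h2 h3
  refine (mem_boxGroup x).2 fun v _ => ?_
  by_cases hv : (unitsH x v : Set (stabH0 (x.at v))) = integralH x v
  · rw [← SetLike.mem_coe, hv]
    intro i j
    refine ⟨h1 i j v, ?_⟩
    have : (adelicH0.eval x v h)⁻¹ = adelicH0.eval x v h⁻¹ := (map_inv (evalHom x v) h).symm
    change ((adelicH0.eval x v h)⁻¹ : stabH0 (x.at v)).1.1 i j ∈ v.integers
    rw [this]
    exact h2 i j v
  · exact h3 v hv

theorem isOpen_boxGroup (S : Set (Place K)) : IsOpen (boxGroup x S : Set (adelicH0 x)) :=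
  Subgroup.isOpen_mono (boxGroup_mono x (Set.empty_subset S)) (isOpen_boxGroup_empty x)

theorem adelicH0_comm (a b : adelicH0 x) : a * b = b * a := by
  refine adelicH0_ext x fun v => ?_
  rw [← evalHom_apply, ← evalHom_apply, map_mul, map_mul]
  exact Subtype.ext (stabH0_comm (two_ne_zero_at x v) (disc_at_ne_zero x v)
    (evalHom x v a).2 (evalHom x v b).2)

end AdelicTopology

end

end BinQuad

namespace BinQuad

noncomputable section

/-! ### The adelic measure -/

open scoped Topology

section AdelicMeasure

set_option linter.unusedSectionVars false

variable {K : Type*} [Field K]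

instance : BorelSpace (GL (Fin 3) (Adele K)) := ⟨rfl⟩

variable [GlobalPlaces K] [Countable K] [Countable (Place K)] (x : V K) [GoodForm x]

/-- The set of elements with prescribed local conditions. -/
def boxSet (B : (v : Place K) → Set (stabH0 (x.at v))) : Set (adelicH0 x) :=
  {h | ∀ v, adelicH0.eval x v h ∈ B v}

theorem measurable_eval (v : Place K) : Measurable (adelicH0.eval x v) :=
  (continuous_eval x v).measurable

theorem measurableSet_boxSet {B : (v : Place K) → Set (stabH0 (x.at v))}
    (hB : ∀ v, MeasurableSet (B v)) : MeasurableSet (boxSet x B) := by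
  have : boxSet x B = ⋂ v, adelicH0.eval x v ⁻¹' B v := by
    ext h
    simp [boxSet]
  rw [this]
  exact MeasurableSet.iInter fun v => measurable_eval x v (hB v)

/-- The boxes that occur in the characterization of the adelic measure. -/
def boxes : Set (Set (adelicH0 x)) :=
  {E | ∃ B : (v : Place K) → Set (stabH0 (x.at v)), (∀ v, MeasurableSet (B v)) ∧
    (∀ᶠ v in cofinite, B v = integralH x v) ∧ E = boxSet x B}

theorem isPiSystem_boxes : IsPiSystem (boxes x) := by
  rintro _ ⟨B, hB, hB', rfl⟩ _ ⟨C, hC, hC', rfl⟩ -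
  refine ⟨fun v => B v ∩ C v, fun v => (hB v).inter (hC v), ?_, ?_⟩
  · filter_upwards [hB', hC'] with v h1 h2
    rw [h1, h2, Set.inter_self]
  · ext h
    exact forall_and.symm

theorem measurableSet_unitsH (v : Place K) : MeasurableSet (unitsH x v : Set (stabH0 (x.at v))) :=
  (isOpen_unitsH x v).measurableSet

/-- The conditions `B v` for `v ∈ S`, and integral units elsewhere. -/
def restrictedBox (S : Finset (Place K)) (B : (v : Place K) → Set (stabH0 (x.at v))) (v : Place K) :
    Set (stabH0 (x.at v)) := by
  classical exact if v ∈ S then B v else unitsH x v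

variable {x}

theorem restrictedBox_of_mem {S : Finset (Place K)} {B : (v : Place K) → Set (stabH0 (x.at v))}
    {v : Place K} (hv : v ∈ S) : restrictedBox x S B v = B v := if_pos hv

theorem restrictedBox_of_notMem {S : Finset (Place K)} {B : (v : Place K) → Set (stabH0 (x.at v))}
    {v : Place K} (hv : v ∉ S) : restrictedBox x S B v = unitsH x v := if_neg hv

theorem measurableSet_restrictedBox (S : Finset (Place K))
    {B : (v : Place K) → Set (stabH0 (x.at v))} (hB : ∀ v, MeasurableSet (B v)) (v : Place K) :
    MeasurableSet (restrictedBox x S B v) := by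
  by_cases hv : v ∈ S
  · rw [restrictedBox_of_mem hv]; exact hB v
  · rw [restrictedBox_of_notMem hv]; exact measurableSet_unitsH x v

theorem boxSet_restrictedBox_mem_boxes (S : Finset (Place K))
    {B : (v : Place K) → Set (stabH0 (x.at v))} (hB : ∀ v, MeasurableSet (B v)) :
    boxSet x (restrictedBox x S B) ∈ boxes x := by
  refine ⟨_, measurableSet_restrictedBox S hB, ?_, rfl⟩
  filter_upwards [S.finite_toSet.compl_mem_cofinite, eventually_unitsH_eq_integralH x] with v h1 h2
  rw [restrictedBox_of_notMem h1, h2]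

theorem mem_boxSet_restrictedBox {S : Finset (Place K)}
    {B : (v : Place K) → Set (stabH0 (x.at v))} {h : adelicH0 x} :
    h ∈ boxSet x (restrictedBox x S B) ↔
      (∀ v ∈ S, adelicH0.eval x v h ∈ B v) ∧ h ∈ boxGroup x (S : Set (Place K)) := by
  rw [mem_boxGroup]
  constructor
  · intro hh
    refine ⟨fun v hv => ?_, fun v hv => ?_⟩
    · have := hh v
      rwa [restrictedBox_of_mem hv] at this
    · have := hh v
      rwa [restrictedBox_of_notMem hv] at this
  · rintro ⟨h1, h2⟩ v
    by_cases hv : v ∈ S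
    · rw [restrictedBox_of_mem hv]; exact h1 v hv
    · rw [restrictedBox_of_notMem hv]; exact h2 v hv

theorem exists_mem_boxGroup (h : adelicH0 x) : ∃ S : Finset (Place K),
    h ∈ boxGroup x (S : Set (Place K)) := by
  have hf : {v | ¬ adelicH0.eval x v h ∈ unitsH x v}.Finite := eventually_eval_mem_unitsH x h
  refine ⟨hf.toFinset, (mem_boxGroup x).2 fun v hv => ?_⟩
  simpa using hv

variable (x)

/-- The adelic group is the union of the countably many subgroups `boxGroup x S`, on which the
topology comes from a countable product of second countable groups. Open sets are therefore
measurable for the components, and these are measurable for boxes. -/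
theorem generateFrom_boxes :
    (inferInstance : MeasurableSpace (adelicH0 x)) = MeasurableSpace.generateFrom (boxes x) := by
  refine le_antisymm ?_ ?_
  · have heval : ∀ v, Measurable[MeasurableSpace.generateFrom (boxes x)] (adelicH0.eval x v) := by
      classical
      intro v B hB
      have : adelicH0.eval x v ⁻¹' B = ⋃ S : Finset (Place K), boxSet x (restrictedBox x (insert v S)
          (Function.update (fun _ => Set.univ) v B)) := by
        ext h
        simp only [Set.mem_preimage, Set.mem_iUnion, mem_boxSet_restrictedBox]
        constructor
        · intro hh
          obtain ⟨S, hS⟩ := exists_mem_boxGroup h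
          refine ⟨S, fun w _ => ?_, boxGroup_mono x (by simp) hS⟩
          rcases eq_or_ne w v with rfl | hw
          · simpa using hh
          · simp [Function.update_of_ne hw]
        · rintro ⟨S, h1, -⟩
          simpa using h1 v (by simp)
      rw [this]
      refine MeasurableSet.iUnion fun S => MeasurableSpace.measurableSet_generateFrom
        (boxSet_restrictedBox_mem_boxes _ fun w => ?_)
      rcases eq_or_ne w v with rfl | hw
      · simpa using hB
      · simp [Function.update_of_ne hw]
    rw [BorelSpace.measurable_eq (α := adelicH0 x)]
    refine MeasurableSpace.generateFrom_le fun O hO => ?_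
    have hO : IsOpen O := hO
    have key : ∀ S : Finset (Place K), ∃ O' : Set ((v : Place K) → stabH0 (x.at v)),
        MeasurableSet O' ∧ O ∩ boxGroup x S = {h | (fun v => adelicH0.eval x v h) ∈ O'} ∩
          boxGroup x S := by
      intro S
      obtain ⟨O', hO', he⟩ := isOpen_induced_iff.1 (hO.preimage (continuous_glue x S))
      refine ⟨O', hO'.measurableSet, ?_⟩
      ext h
      refine and_congr_left fun hS => ?_
      let p : LocalFamily x S := ⟨fun v => adelicH0.eval x v h, (mem_boxGroup x).1 hS⟩
      have hp : glue x p.1 (LocalFamily.eventually x p) = h := adelicH0_ext x fun v => eval_glue x _ _ v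
      have h1 : p ∈ Subtype.val ⁻¹' O' ↔ glue x p.1 (LocalFamily.eventually x p) ∈ O := by
        rw [he]; rfl
      rw [hp] at h1
      exact h1.symm
    choose O' hO' he using key
    have hU : O = ⋃ S : Finset (Place K), {h | (fun v => adelicH0.eval x v h) ∈ O' S} ∩
        boxGroup x S := by
      simp only [← he, ← Set.inter_iUnion]
      refine (Set.inter_eq_left.2 fun h _ => ?_).symm
      obtain ⟨S, hS⟩ := exists_mem_boxGroup h
      exact Set.mem_iUnion.2 ⟨S, hS⟩
    rw [hU]
    refine MeasurableSet.iUnion fun S => ?_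
    refine @MeasurableSet.inter _ (MeasurableSpace.generateFrom (boxes x)) _ _ ?_ ?_
    · exact (@measurable_pi_lambda _ _ _ (MeasurableSpace.generateFrom (boxes x)) _ _ heval) (hO' S)
    · have : (boxGroup x S : Set (adelicH0 x)) =
          boxSet x (restrictedBox x S fun _ => Set.univ) := by
        ext h
        rw [mem_boxSet_restrictedBox]
        simp
      rw [this]
      exact MeasurableSpace.measurableSet_generateFrom
        (boxSet_restrictedBox_mem_boxes _ fun _ => MeasurableSet.univ)
  · refine MeasurableSpace.generateFrom_le ?_
    rintro _ ⟨B, hB, -, rfl⟩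
    exact measurableSet_boxSet x hB

/-- The product formula for the measure of boxes. -/
def IsProductMeasure (μ : Measure (adelicH0 x)) : Prop :=
  ∀ B : (v : Place K) → Set (stabH0 (x.at v)),
    (∀ v, MeasurableSet (B v)) → (∀ᶠ v in cofinite, B v = integralH x v) →
    μ {h | ∀ v, adelicH0.eval x v h ∈ B v} = ∏ᶠ v, measureH x v (B v)

variable {x}

theorem finprod_restrictedBox (S : Finset (Place K)) (B : (v : Place K) → Set (stabH0 (x.at v))) :
    ∏ᶠ v, measureH x v (restrictedBox x S B v) = ∏ v ∈ S, measureH x v (B v) := by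
  rw [finprod_eq_prod_of_mulSupport_subset (s := S)]
  · exact Finset.prod_congr rfl fun v hv => by rw [restrictedBox_of_mem hv]
  · intro v hv
    by_contra h
    rw [Finset.mem_coe] at h
    refine hv ?_
    change measureH x v (restrictedBox x S B v) = 1
    rw [restrictedBox_of_notMem h]
    exact measureH_unitsH v x

/-- The boxes form a generating $\pi$-system, and countably many boxes of finite measure cover the
group: spanning sets at finitely many places and units elsewhere. -/
theorem IsProductMeasure.unique {μ ν : Measure (adelicH0 x)} (hμ : IsProductMeasure x μ)
    (hν : IsProductMeasure x ν) : μ = ν := by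
  let T : Set (Set (adelicH0 x)) := Set.range fun p : Finset (Place K) × ℕ =>
    boxSet x (restrictedBox x p.1 fun v => spanningSets (measureH x v) p.2)
  have hspan : ∀ n v, MeasurableSet (spanningSets (measureH x v) n) := fun n v =>
    measurableSet_spanningSets _ n
  refine Measure.ext_of_generateFrom_of_cover_subset (S := boxes x) (T := T) (generateFrom_boxes x)
    (isPiSystem_boxes x) ?_ (Set.countable_range _) ?_ ?_ ?_
  · rintro _ ⟨p, rfl⟩
    exact boxSet_restrictedBox_mem_boxes _ (hspan p.2)
  · refine Set.eq_univ_of_forall fun h => ?_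
    obtain ⟨S, hS⟩ := exists_mem_boxGroup h
    have : ∀ v, ∃ n, adelicH0.eval x v h ∈ spanningSets (measureH x v) n := by
      intro v
      have : adelicH0.eval x v h ∈ ⋃ n, spanningSets (measureH x v) n := by
        rw [iUnion_spanningSets]; trivial
      exact Set.mem_iUnion.1 this
    choose n hn using this
    refine ⟨_, ⟨(S, S.sup n), rfl⟩, mem_boxSet_restrictedBox.2 ⟨fun v hv => ?_, hS⟩⟩
    exact monotone_spanningSets _ (Finset.le_sup hv) (hn v)
  · rintro _ ⟨p, rfl⟩
    have h1 := hμ (restrictedBox x p.1 fun v => spanningSets (measureH x v) p.2)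
      (measurableSet_restrictedBox _ (hspan p.2)) (by
        filter_upwards [p.1.finite_toSet.compl_mem_cofinite, eventually_unitsH_eq_integralH x]
          with v h1 h2
        rw [restrictedBox_of_notMem h1, h2])
    have h2 : μ (boxSet x (restrictedBox x p.1 fun v => spanningSets (measureH x v) p.2)) =
      ∏ v ∈ p.1, measureH x v (spanningSets (measureH x v) p.2) := by
      rw [← finprod_restrictedBox]; exact h1
    simp only [h2]
    exact ENNReal.prod_ne_top fun v _ => (measure_spanningSets_lt_top _ _).ne
  · rintro _ ⟨B, hB, hB', rfl⟩
    exact (hμ B hB hB').trans (hν B hB hB').symm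

variable (x)

/-- The integral units as a compact set with nonempty interior. -/
def unitBox : TopologicalSpace.PositiveCompacts (adelicH0 x) :=
  ⟨⟨boxGroup x ∅, isCompact_boxGroup_empty x⟩,
    ⟨1, (isOpen_boxGroup_empty x).subset_interior_iff.2 le_rfl (one_mem (boxGroup x ∅))⟩⟩

theorem exists_lift (S : Finset (Place K)) (p : (v : S) → stabH0 (x.at v.1)) :
    ∃ h ∈ boxGroup x (S : Set (Place K)), ∀ v : S, adelicH0.eval x v.1 h = p v := by
  classical
  let q : LocalFamily x S := ⟨fun v => if h : v ∈ S then p ⟨v, h⟩ else 1, fun v hv => by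
    beta_reduce; rw [dif_neg hv]; exact one_mem _⟩
  refine ⟨glue x q.1 (LocalFamily.eventually x q), (mem_boxGroup x).2 fun v hv => ?_, fun v => ?_⟩
  · rw [eval_glue]; exact q.2 v hv
  · rw [eval_glue]
    exact dif_pos v.2

/-- The projection to finitely many components. -/
def proj (S : Finset (Place K)) (h : adelicH0 x) (v : S) : stabH0 (x.at v.1) :=
  adelicH0.eval x v.1 h

theorem measurable_proj (S : Finset (Place K)) : Measurable (proj x S) :=
  measurable_pi_lambda _ fun v => measurable_eval x v.1

/-- The image of Haar measure in finitely many components is left invariant and gives the product of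
the unit groups volume one. Uniqueness of Haar measure identifies it with the product of the local
measures. -/
theorem map_proj_haar (S : Finset (Place K)) :
    ((Measure.haarMeasure (unitBox x)).restrict (boxGroup x (S : Set (Place K)))).map (proj x S) =
      Measure.pi fun v : S => measureH x v.1 := by
  set μ := Measure.haarMeasure (unitBox x)
  set ν := (μ.restrict (boxGroup x (S : Set (Place K)))).map (proj x S) with hν
  have hbox : MeasurableSet (boxGroup x (S : Set (Place K)) : Set (adelicH0 x)) :=
    (isOpen_boxGroup x S).measurableSet
  have hinv : ν.IsMulLeftInvariant := by
    refine ⟨fun p => ?_⟩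
    obtain ⟨a, ha, hap⟩ := exists_lift x S p
    rw [hν, Measure.map_map (measurable_const_mul p) (measurable_proj x S)]
    have h1 : (fun q => p * q) ∘ proj x S = proj x S ∘ fun h => a * h := by
      funext h v
      change p v * adelicH0.eval x v.1 h = adelicH0.eval x v.1 (a * h)
      rw [← hap v]
      exact (map_mul (evalHom x v.1) a h).symm
    rw [h1, ← Measure.map_map (measurable_proj x S) (measurable_const_mul a)]
    congr 1
    refine Measure.ext fun E hE => ?_
    rw [Measure.map_apply (measurable_const_mul a) hE, Measure.restrict_apply hE,
      Measure.restrict_apply (measurable_const_mul a hE), ← measure_preimage_mul μ a (E ∩ _)]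
    congr 1
    ext h
    refine and_congr_right fun _ => ?_
    exact (Subgroup.mul_mem_cancel_left _ ha).symm
  let K₀ : Set ((v : S) → stabH0 (x.at v.1)) := Set.univ.pi fun v => (unitsH x v.1 : Set _)
  have hK₀ : IsCompact K₀ := isCompact_univ_pi fun v => isCompact_unitsH x v.1
  have hK₀' : IsOpen K₀ := isOpen_set_pi Set.finite_univ fun v _ => isOpen_unitsH x v.1
  have hne : (1 : (v : S) → stabH0 (x.at v.1)) ∈ K₀ := fun v _ => one_mem (unitsH x v.1)
  let P : TopologicalSpace.PositiveCompacts ((v : S) → stabH0 (x.at v.1)) :=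
    ⟨⟨K₀, hK₀⟩, ⟨1, hK₀'.subset_interior_iff.2 le_rfl hne⟩⟩
  have hνP : ν P = 1 := by
    change ν K₀ = 1
    rw [hν, Measure.map_apply (measurable_proj x S) hK₀'.measurableSet,
      Measure.restrict_apply (measurable_proj x S hK₀'.measurableSet)]
    have : proj x S ⁻¹' K₀ ∩ boxGroup x (S : Set (Place K)) = unitBox x := by
      ext h
      change ((∀ v : S, v ∈ Set.univ → _) ∧ h ∈ boxGroup x S) ↔ h ∈ boxGroup x ∅
      rw [mem_boxGroup, mem_boxGroup]
      constructor
      · rintro ⟨h1, h2⟩ v -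
        by_cases hv : v ∈ S
        · exact h1 ⟨v, hv⟩ trivial
        · exact h2 v hv
      · intro h1
        exact ⟨fun v _ => h1 v.1 (Set.notMem_empty _), fun v _ => h1 v (Set.notMem_empty _)⟩
    rw [this]
    exact Measure.haarMeasure_self
  have hfin : IsFiniteMeasureOnCompacts ν :=
    ⟨fun C hC => measure_lt_top_of_isCompact_of_isMulLeftInvariant K₀ hK₀' ⟨1, hne⟩
      (by rw [show ν K₀ = 1 from hνP]; exact ENNReal.one_ne_top) hC⟩
  have hpi : (Measure.pi fun v : S => measureH x v.1) P = 1 := by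
    change (Measure.pi fun v : S => measureH x v.1) K₀ = 1
    rw [Measure.pi_pi]
    exact Finset.prod_eq_one fun v _ => measureH_unitsH v.1 x
  rw [Measure.haarMeasure_unique ν P, hνP,
    Measure.haarMeasure_unique (Measure.pi fun v : S => measureH x v.1) P, hpi]

theorem isProductMeasure_haar : IsProductMeasure x (Measure.haarMeasure (unitBox x)) := by
  intro B hB hB'
  have hf : {v | ¬ (B v = integralH x v ∧ (unitsH x v : Set (stabH0 (x.at v))) = integralH x v)}.Finite :=
    hB'.and (eventually_unitsH_eq_integralH x)
  set S := hf.toFinset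
  have hBS : B = restrictedBox x S B := by
    funext v
    by_cases hv : v ∈ S
    · rw [restrictedBox_of_mem hv]
    · rw [restrictedBox_of_notMem hv]
      have : B v = integralH x v ∧ (unitsH x v : Set (stabH0 (x.at v))) = integralH x v := by
        simpa [S] using hv
      rw [this.1, this.2]
  have h1 : {h | ∀ v, adelicH0.eval x v h ∈ B v} =
      proj x S ⁻¹' (Set.univ.pi fun v : S => B v.1) ∩ boxGroup x (S : Set (Place K)) := by
    ext h
    have := mem_boxSet_restrictedBox (S := S) (B := B) (h := h)
    rw [← hBS] at this
    refine this.trans (and_congr_left fun _ => ?_)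
    exact ⟨fun h1 v _ => h1 v.1 v.2, fun h1 v hv => h1 ⟨v, hv⟩ trivial⟩
  have hm : MeasurableSet (Set.univ.pi fun v : S => B v.1) :=
    MeasurableSet.univ_pi fun v => hB v.1
  have h2 : ∏ᶠ v, measureH x v (B v) = ∏ v ∈ S, measureH x v (B v) := by
    rw [← finprod_restrictedBox, ← hBS]
  rw [h1, h2, ← Measure.restrict_apply (measurable_proj x S hm),
    ← Measure.map_apply (measurable_proj x S) hm, map_proj_haar, Measure.pi_pi]
  exact Finset.prod_coe_sort S fun v => measureH x v (B v)

theorem measureAdelic_eq : measureAdelic x = Measure.haarMeasure (unitBox x) :=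
  (eq_theMeasure ⟨_, isProductMeasure_haar x, fun _ h => h.unique (isProductMeasure_haar x)⟩
    (isProductMeasure_haar x)).symm

instance : (measureAdelic x).IsHaarMeasure := by
  rw [measureAdelic_eq]
  infer_instance

theorem measureAdelic_boxGroup : measureAdelic x (boxGroup x ∅) = 1 := by
  rw [measureAdelic_eq]
  exact Measure.haarMeasure_self (K₀ := unitBox x)

end AdelicMeasure

end

end BinQuad

namespace BinQuad

noncomputable section

/-! ### The quotient measure -/

section Quotient

theorem tsum_one_eq_card (α : Type*) [Finite α] : ∑' _ : α, (1 : ℝ≥0∞) = Nat.card α := by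
  have := Fintype.ofFinite α
  rw [tsum_fintype]
  simp

set_option linter.unusedSectionVars false

variable {A : Type*} [Group A] [MeasurableSpace A] [MeasurableMul A]

/-- The unfolding property of a measure on `A ⧸ Γ`. -/
def IsUnfolding (μ : Measure A) (Γ : Subgroup A) (ν : Measure (A ⧸ Γ)) : Prop :=
  ∀ (f : A → ℝ≥0∞) (φ : A ⧸ Γ → ℝ≥0∞), Measurable f →
    (∀ h : A, φ h = ∑' γ : Γ, f (h * γ)) → ∫⁻ h, f h ∂μ = ∫⁻ y, φ y ∂ν

/-- A union of translates of `U` by representatives of the cosets of `U Γ`. -/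
def cosetUnion (U Γ : Subgroup A) : Set A :=
  ⋃ q : A ⧸ (U ⊔ Γ), {h | q.out⁻¹ * h ∈ U}

variable {U Γ : Subgroup A}

theorem mk_eq_of_mem_coset {q : A ⧸ (U ⊔ Γ)} {h : A} (hh : q.out⁻¹ * h ∈ U) : (h : A ⧸ (U ⊔ Γ)) = q := by
  conv_rhs => rw [← Quotient.out_eq q]
  exact (QuotientGroup.eq.2 (Subgroup.mem_sup_left hh)).symm

theorem mem_cosetUnion {h : A} :
    h ∈ cosetUnion U Γ ↔ ((h : A ⧸ (U ⊔ Γ)).out)⁻¹ * h ∈ U := by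
  refine Set.mem_iUnion.trans ⟨?_, fun hh => ⟨_, hh⟩⟩
  rintro ⟨q, hq⟩
  rw [mk_eq_of_mem_coset hq]
  exact hq

/-- If $h$ is the chosen representative times $u\gamma_0$, then $h\gamma$ lies in the union exactly
when $\gamma_0\gamma\in U$. The count is therefore $|U\cap\Gamma|$ for every $h$: the union is a
fundamental domain covered with constant multiplicity. -/
theorem tsum_indicator_cosetUnion (hc : ∀ a b : A, a * b = b * a) [Finite (U ⊓ Γ : Subgroup A)]
    (h : A) : ∑' γ : Γ, (cosetUnion U Γ).indicator (1 : A → ℝ≥0∞) (h * γ) =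
      Nat.card (U ⊓ Γ : Subgroup A) := by
  have hnormal : U.Normal := ⟨fun n hn g => by rwa [hc g n, mul_inv_cancel_right]⟩
  have h1 : (h : A ⧸ (U ⊔ Γ)).out⁻¹ * h ∈ U ⊔ Γ := by
    have := QuotientGroup.eq.1 (Quotient.out_eq (h : A ⧸ (U ⊔ Γ)))
    exact this
  obtain ⟨u, hu, γ₀, hγ₀, he⟩ := Subgroup.mem_sup_of_normal_left.1 h1
  have h2 : ∀ γ : Γ, h * γ ∈ cosetUnion U Γ ↔ γ₀ * γ ∈ U := by
    intro γ
    have h3 : ((h * γ : A) : A ⧸ (U ⊔ Γ)) = h :=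
      (QuotientGroup.eq.2 (by simpa using Subgroup.mem_sup_right γ.2)).symm
    rw [mem_cosetUnion, h3, ← mul_assoc, ← he, mul_assoc]
    exact Subgroup.mul_mem_cancel_left _ hu
  have h4 : ∑' γ : Γ, (cosetUnion U Γ).indicator (1 : A → ℝ≥0∞) (h * γ) =
      ∑' γ : Γ, (U : Set A).indicator (1 : A → ℝ≥0∞) γ := by
    rw [← (Equiv.mulLeft (⟨γ₀, hγ₀⟩ : Γ)).tsum_eq
      fun γ : Γ => (U : Set A).indicator (1 : A → ℝ≥0∞) γ]
    refine tsum_congr fun γ => ?_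
    by_cases h5 : γ₀ * γ ∈ U
    · rw [Set.indicator_of_mem ((h2 γ).2 h5), Set.indicator_of_mem]
      · rfl
      · exact h5
    · rw [Set.indicator_of_notMem (fun h6 => h5 ((h2 γ).1 h6)), Set.indicator_of_notMem]
      exact h5
  have h5 : ∑' γ : Γ, (U : Set A).indicator (1 : A → ℝ≥0∞) γ =
      ∑' _ : {γ : Γ | (γ : A) ∈ U}, (1 : ℝ≥0∞) :=
    (tsum_subtype {γ : Γ | (γ : A) ∈ U} fun _ => (1 : ℝ≥0∞)).symm
  let e : {γ : Γ | (γ : A) ∈ U} ≃ (U ⊓ Γ : Subgroup A) :=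
    { toFun := fun γ => ⟨γ.1.1, γ.2, γ.1.2⟩
      invFun := fun γ => ⟨⟨γ.1, γ.2.2⟩, γ.2.1⟩
      left_inv := fun _ => rfl
      right_inv := fun _ => rfl }
  rw [h4, h5, e.tsum_eq (fun _ => (1 : ℝ≥0∞)), tsum_one_eq_card]

theorem measurableSet_cosetUnion [Countable (A ⧸ (U ⊔ Γ))] (hU : MeasurableSet (U : Set A)) :
    MeasurableSet (cosetUnion U Γ) :=
  MeasurableSet.iUnion fun q => measurable_const_mul q.out⁻¹ hU

theorem measure_cosetUnion (μ : Measure A) [μ.IsMulLeftInvariant] [Finite (A ⧸ (U ⊔ Γ))]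
    (hU : MeasurableSet (U : Set A)) (h1 : μ U = 1) :
    μ (cosetUnion U Γ) = Nat.card (A ⧸ (U ⊔ Γ)) := by
  rw [cosetUnion, measure_iUnion]
  · have : ∀ q : A ⧸ (U ⊔ Γ), μ {h | q.out⁻¹ * h ∈ U} = 1 := fun q => by
      rw [← h1]
      exact measure_preimage_mul μ q.out⁻¹ U
    simp only [this]
    exact tsum_one_eq_card _
  · intro q q' hq
    refine Set.disjoint_left.2 fun h hh hh' => hq ?_
    rw [← mk_eq_of_mem_coset hh, ← mk_eq_of_mem_coset hh']
  · exact fun q => measurable_const_mul q.out⁻¹ hU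

theorem isUnfolding_map (hc : ∀ a b : A, a * b = b * a) (μ : Measure A) [μ.IsMulLeftInvariant]
    [Finite (U ⊓ Γ : Subgroup A)] [Countable (A ⧸ (U ⊔ Γ))] [Countable Γ]
    (hU : MeasurableSet (U : Set A)) : IsUnfolding μ Γ
      ((Nat.card (U ⊓ Γ : Subgroup A) : ℝ≥0∞)⁻¹ •
        (μ.restrict (cosetUnion U Γ)).map (QuotientGroup.mk : A → A ⧸ Γ)) := by
  intro f φ hf hφ
  have hn0 : (Nat.card (U ⊓ Γ : Subgroup A) : ℝ≥0∞) ≠ 0 := by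
    exact_mod_cast Nat.card_pos.ne'
  have hF := measurableSet_cosetUnion (U := U) (Γ := Γ) hU
  have hind : Measurable ((cosetUnion U Γ).indicator (1 : A → ℝ≥0∞)) := measurable_one.indicator hF
  have hφm : Measurable φ := by
    refine QuotientGroup.measurable_from_quotient.2 ?_
    have : φ ∘ (QuotientGroup.mk : A → A ⧸ Γ) = fun h => ∑' γ : Γ, f (h * γ) := funext hφ
    rw [this]
    exact Measurable.tsum fun γ => hf.comp (measurable_mul_const _)
  rw [lintegral_smul_measure, lintegral_map hφm QuotientGroup.measurable_coe]
  have h1 : ∫⁻ h in cosetUnion U Γ, φ h ∂μ = ∫⁻ h, f h * Nat.card (U ⊓ Γ : Subgroup A) ∂μ := by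
    calc ∫⁻ h in cosetUnion U Γ, φ h ∂μ
        = ∫⁻ h, ∑' γ : Γ, (cosetUnion U Γ).indicator 1 h * f (h * γ) ∂μ := by
          rw [← lintegral_indicator hF]
          refine lintegral_congr fun h => ?_
          by_cases hh : h ∈ cosetUnion U Γ <;> simp [hh, hφ]
      _ = ∑' γ : Γ, ∫⁻ h, (cosetUnion U Γ).indicator 1 h * f (h * γ) ∂μ :=
          lintegral_tsum fun γ => (hind.mul (hf.comp (measurable_mul_const _))).aemeasurable
      _ = ∑' γ : Γ, ∫⁻ h, f h * (cosetUnion U Γ).indicator 1 (h * (γ⁻¹ : Γ)) ∂μ := by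
          refine tsum_congr fun γ => ?_
          rw [← lintegral_mul_left_eq_self
            (fun h => f h * (cosetUnion U Γ).indicator 1 (h * (γ⁻¹ : Γ))) (γ : A)]
          refine lintegral_congr fun h => ?_
          rw [hc γ h, mul_comm (f _), InvMemClass.coe_inv, mul_inv_cancel_right]
      _ = ∫⁻ h, ∑' γ : Γ, f h * (cosetUnion U Γ).indicator 1 (h * (γ⁻¹ : Γ)) ∂μ :=
          (lintegral_tsum fun γ => (hf.mul (hind.comp (measurable_mul_const _))).aemeasurable).symm
      _ = ∫⁻ h, f h * Nat.card (U ⊓ Γ : Subgroup A) ∂μ := by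
          refine lintegral_congr fun h => ?_
          rw [ENNReal.tsum_mul_left, ← tsum_indicator_cosetUnion hc h,
            ← (Equiv.inv Γ).tsum_eq fun γ : Γ =>
              (cosetUnion U Γ).indicator (1 : A → ℝ≥0∞) (h * γ)]
          rfl
  rw [h1, lintegral_mul_const _ hf, smul_eq_mul, mul_comm (∫⁻ h, f h ∂μ), ← mul_assoc,
    ENNReal.inv_mul_cancel hn0 (ENNReal.natCast_ne_top _), one_mul]

/-- Testing with the indicator of `cosetUnion`, cut down to $E$ and divided by its multiplicity,
recovers the measure of $E$ and hence gives uniqueness. -/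
theorem IsUnfolding.apply (hc : ∀ a b : A, a * b = b * a) {μ : Measure A}
    [Finite (U ⊓ Γ : Subgroup A)] [Countable (A ⧸ (U ⊔ Γ))]
    (hU : MeasurableSet (U : Set A)) {ν : Measure (A ⧸ Γ)} (hν : IsUnfolding μ Γ ν)
    {E : Set (A ⧸ Γ)} (hE : MeasurableSet E) :
    ν E = ∫⁻ h, (Nat.card (U ⊓ Γ : Subgroup A) : ℝ≥0∞)⁻¹ *
      ((cosetUnion U Γ).indicator 1 h * E.indicator 1 (h : A ⧸ Γ)) ∂μ := by
  have hn0 : (Nat.card (U ⊓ Γ : Subgroup A) : ℝ≥0∞) ≠ 0 := by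
    exact_mod_cast Nat.card_pos.ne'
  have hF := measurableSet_cosetUnion (U := U) (Γ := Γ) hU
  rw [hν _ (E.indicator 1) ?_ ?_, lintegral_indicator_one hE]
  · exact measurable_const.mul ((measurable_one.indicator hF).mul
      ((measurable_one.indicator hE).comp QuotientGroup.measurable_coe))
  · intro h
    have : ∀ γ : Γ, ((h * γ : A) : A ⧸ Γ) = h := fun γ => QuotientGroup.mk_mul_of_mem h γ.2
    simp only [this]
    rw [ENNReal.tsum_mul_left, ENNReal.tsum_mul_right, tsum_indicator_cosetUnion hc, ← mul_assoc,
      ENNReal.inv_mul_cancel hn0 (ENNReal.natCast_ne_top _), one_mul]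

theorem existsUnique_isUnfolding (hc : ∀ a b : A, a * b = b * a) (μ : Measure A)
    [μ.IsMulLeftInvariant] [Finite (U ⊓ Γ : Subgroup A)] [Countable (A ⧸ (U ⊔ Γ))] [Countable Γ]
    (hU : MeasurableSet (U : Set A)) : ∃! ν, IsUnfolding μ Γ ν := by
  refine ⟨_, isUnfolding_map hc μ hU, fun ν hν => Measure.ext fun E hE => ?_⟩
  rw [hν.apply hc hU hE, (isUnfolding_map hc μ hU).apply hc hU hE]

theorem IsUnfolding.measure_univ (hc : ∀ a b : A, a * b = b * a) {μ : Measure A}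
    [μ.IsMulLeftInvariant] [Finite (U ⊓ Γ : Subgroup A)] [Finite (A ⧸ (U ⊔ Γ))] [Countable Γ]
    (hU : MeasurableSet (U : Set A)) (h1 : μ U = 1) {ν : Measure (A ⧸ Γ)} (hν : IsUnfolding μ Γ ν) :
    ν Set.univ = Nat.card (A ⧸ (U ⊔ Γ)) / Nat.card (U ⊓ Γ : Subgroup A) := by
  rw [(existsUnique_isUnfolding hc μ hU).unique hν (isUnfolding_map hc μ hU), Measure.smul_apply,
    Measure.map_apply QuotientGroup.measurable_coe MeasurableSet.univ, Set.preimage_univ,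
    Measure.restrict_apply_univ, measure_cosetUnion μ hU h1, smul_eq_mul, ENNReal.div_eq_inv_mul]

end Quotient

section Volume

variable {K : Type*} [Field K] [GlobalPlaces K] [Countable K] [Countable (Place K)] (x : V K)
  [GoodForm x]

theorem countable_rationalH0 {K : Type*} [Field K] [Countable K] (x : V K) :
    Countable (rationalH0 x) := by
  have : Countable (GL (Fin 3) K) := by
    have : Countable (Matrix (Fin 3) (Fin 3) K) :=
      inferInstanceAs (Countable (Fin 3 → Fin 3 → K))
    exact Units.val_injective.countable
  choose γ hγ h using fun h : rationalH0 x => h.2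
  have hinj : Function.Injective γ := by
    intro a b hab
    refine Subtype.ext (adelicH0_ext x fun v => Subtype.ext ?_)
    have h1 := h a v
    rw [hab, ← h b v] at h1
    exact h1
  exact hinj.countable

/-- The volume in terms of the group of integral units and the rational points. -/
theorem volume_eq [Finite (boxGroup x ∅ ⊓ rationalH0 x : Subgroup (adelicH0 x))]
    [Finite (adelicH0 x ⧸ (boxGroup x ∅ ⊔ rationalH0 x))] :
    volume x = Nat.card (adelicH0 x ⧸ (boxGroup x ∅ ⊔ rationalH0 x)) /
      Nat.card (boxGroup x ∅ ⊓ rationalH0 x : Subgroup (adelicH0 x)) := by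
  have := countable_rationalH0 x
  have hU : MeasurableSet (boxGroup x ∅ : Set (adelicH0 x)) := (isOpen_boxGroup x ∅).measurableSet
  have hspec : IsUnfolding (measureAdelic x) (rationalH0 x) (measureQuotient x) :=
    theMeasure_spec (existsUnique_isUnfolding (adelicH0_comm x) (measureAdelic x) hU)
  exact hspec.measure_univ (adelicH0_comm x) hU (measureAdelic_boxGroup x)

end Volume

end

end BinQuad

namespace BinQuad

noncomputable section

/-! ### The stabilizer and the quadratic extension -/

open scoped Topology

/-- A square root of the discriminant that generates the quadratic extension `L`. -/
structure QuadGen {k : Type*} [Field k] (x : V k) (L : Type*) [Field L] [Algebra k L] where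
  root : L
  sq : root ^ 2 = algebraMap k L x.disc
  ne : ∀ c : k, algebraMap k L c ≠ root
  span : ∀ z : L, ∃ a b : k, z = algebraMap k L a + algebraMap k L b * root

namespace QuadGen

set_option linter.unusedSectionVars false

section Algebra

variable {k L : Type*} [Field k] [Field L] [Algebra k L] {x : V k} (d : QuadGen x L)

/-- The element `a + b √P(x)`. -/
def elt (a b : k) : L := algebraMap k L a + algebraMap k L b * d.root

/-- The rational part. -/
def re (z : L) : k := (d.span z).choose

/-- The coefficient of the square root. -/
def im (z : L) : k := (d.span z).choose_spec.choose

/-- The norm. -/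
def nrm (z : L) : k := d.re z ^ 2 - x.disc * d.im z ^ 2

theorem elt_re_im (z : L) : d.elt (d.re z) (d.im z) = z :=
  (d.span z).choose_spec.choose_spec.symm

theorem elt_injective {a b a' b' : k} (h : d.elt a b = d.elt a' b') : a = a' ∧ b = b' := by
  have hb : b = b' := by
    by_contra hb
    have h0 : algebraMap k L (b - b') ≠ 0 := (map_ne_zero _).2 (sub_ne_zero.2 hb)
    refine d.ne ((a' - a) / (b - b')) ?_
    rw [map_div₀, div_eq_iff h0, map_sub, map_sub]
    simp only [elt] at h
    linear_combination -h
  subst hb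
  exact ⟨(algebraMap k L).injective (add_right_cancel h), rfl⟩

@[simp] theorem re_elt (a b : k) : d.re (d.elt a b) = a := (d.elt_injective (d.elt_re_im _)).1

@[simp] theorem im_elt (a b : k) : d.im (d.elt a b) = b := (d.elt_injective (d.elt_re_im _)).2

theorem elt_mul (a b a' b' : k) :
    d.elt a b * d.elt a' b' = d.elt (a * a' + x.disc * b * b') (a * b' + a' * b) := by
  simp only [elt, map_add, map_mul]
  linear_combination (algebraMap k L b * algebraMap k L b') * d.sq

theorem elt_add (a b a' b' : k) : d.elt a b + d.elt a' b' = d.elt (a + a') (b + b') := by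
  simp only [elt, map_add]
  ring

theorem algebraMap_eq_elt (a : k) : algebraMap k L a = d.elt a 0 := by simp [elt]

/-- The conjugation `a + b √P(x) ↦ a - b √P(x)`. -/
def conjHom : L →ₐ[k] L where
  toFun z := d.elt (d.re z) (-d.im z)
  map_one' := by
    have h : (1 : L) = d.elt 1 0 := by simp [elt]
    rw [h]
    simp
  map_zero' := by
    have h : (0 : L) = d.elt 0 0 := by simp [elt]
    rw [h]
    simp
  map_mul' z z' := by
    rw [← d.elt_re_im z, ← d.elt_re_im z', elt_mul]
    simp only [re_elt, im_elt, elt_mul]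
    congr 1 <;> ring
  map_add' z z' := by
    rw [← d.elt_re_im z, ← d.elt_re_im z', elt_add]
    simp only [re_elt, im_elt, elt_add]
    congr 1; ring
  commutes' a := by
    rw [algebraMap_eq_elt d]
    simp

theorem conjHom_elt (a b : k) : d.conjHom (d.elt a b) = d.elt a (-b) := by
  change d.elt (d.re (d.elt a b)) (-d.im (d.elt a b)) = _
  rw [re_elt, im_elt]

/-- The conjugation as an automorphism. -/
def conj : L ≃ₐ[k] L :=
  have h : d.conjHom.comp d.conjHom = AlgHom.id k L := by
    ext z
    rw [← d.elt_re_im z]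
    simp [conjHom_elt]
  AlgEquiv.ofAlgHom d.conjHom d.conjHom h h

theorem conj_elt (a b : k) : d.conj (d.elt a b) = d.elt a (-b) := d.conjHom_elt a b

theorem mul_conj (z : L) : z * d.conj z = algebraMap k L (d.nrm z) := by
  conv_lhs => rw [← d.elt_re_im z]
  rw [conj_elt, elt_mul, algebraMap_eq_elt d, nrm]
  congr 1 <;> ring

theorem add_conj (z : L) : z + d.conj z = algebraMap k L (2 * d.re z) := by
  conv_lhs => rw [← d.elt_re_im z]
  rw [conj_elt, elt_add, algebraMap_eq_elt d]
  congr 1 <;> ring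

theorem nrm_ne_zero {z : L} (hz : z ≠ 0) : d.nrm z ≠ 0 := by
  intro h
  have := d.mul_conj z
  rw [h, map_zero] at this
  rcases mul_eq_zero.1 this with h | h
  · exact hz h
  · exact hz ((map_eq_zero d.conj).1 h)

theorem quadratic (z : L) : z ^ 2 - algebraMap k L (2 * d.re z) * z + algebraMap k L (d.nrm z) = 0 := by
  rw [← d.mul_conj z, ← d.add_conj z]
  ring

theorem ne_zero_of_nrm {a b : k} (h : a ^ 2 - x.disc * b ^ 2 ≠ 0) : d.elt a b ≠ 0 := by
  intro h0
  have h1 : d.elt a b = d.elt 0 0 := by rw [h0]; simp [elt]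
  obtain ⟨rfl, rfl⟩ := d.elt_injective h1
  simp at h

theorem re_smul (t : k) (z : L) : d.re (algebraMap k L t * z) = t * d.re z := by
  conv_lhs => rw [← d.elt_re_im z, algebraMap_eq_elt d, elt_mul, re_elt]
  ring

theorem im_smul (t : k) (z : L) : d.im (algebraMap k L t * z) = t * d.im z := by
  conv_lhs => rw [← d.elt_re_im z, algebraMap_eq_elt d, elt_mul, im_elt]
  ring

theorem nrm_smul (t : k) (z : L) : d.nrm (algebraMap k L t * z) = t ^ 2 * d.nrm z := by
  rw [nrm, re_smul, im_smul, nrm]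
  ring

end Algebra

theorem valuation_eq_one_iff_mem {F : Type*} [Field F] (A : ValuationSubring F) {z : F} (hz : z ≠ 0) :
    A.valuation z = 1 ↔ z ∈ A ∧ z⁻¹ ∈ A := by
  have h0 : 0 < A.valuation z := (Valuation.pos_iff _).2 hz
  rw [← A.valuation_le_one_iff, ← A.valuation_le_one_iff, map_inv₀, inv_le_one₀ h0,
    le_antisymm_iff]

section Local

variable {k L : Type*} [Field k] [Field L] [Algebra k L] [FiniteDimensional k L] {x : V k}
  [GlobalPlaces k] [GlobalPlaces L] [GoodForm x] (d : QuadGen x L) (v : Place k)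

theorem two_mem_and_inv_mem (x : V k) [GoodForm x] : (2 : k) ∈ v.1 ∧ (2 : k)⁻¹ ∈ v.1 := by
  have h2 : v.1.valuation 2 = 1 := by
    rw [← v.val_emb, map_ofNat v.emb]
    exact GoodForm.val_two x v
  refine (valuation_eq_one_iff_mem v.1 ?_).1 h2
  intro h
  rw [h, map_zero] at h2
  exact zero_ne_one h2

/-- In one direction $z$ and $z^{-1}$ are roots of monic quadratics with coefficients integral at
$v$. In the other, trace and norm combine $z$ with its conjugate, and a unit at all places above $v$
is one at $w$ and at its conjugate; halving the trace is harmless since $2$ is a unit. -/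
theorem unit_iff {z : L} (hz : z ≠ 0) : (d.re z ∈ v.1 ∧ v.1.valuation (d.nrm z) = 1) ↔
    ∀ w : Place L, w.below k = v → w.1.valuation z = 1 := by
  have hN := d.nrm_ne_zero hz
  constructor
  · rintro ⟨h1, h2⟩ w rfl
    obtain ⟨h3, h4⟩ := (valuation_eq_one_iff_mem _ hN).1 h2
    have h5 : 2 * d.re z ∈ (w.below k).1 := mul_mem (two_mem_and_inv_mem _ x).1 h1
    rw [valuation_eq_one_iff_mem _ hz]
    constructor
    · exact mem_place_of_isIntegral w (R := w.1) (fun r => r.2)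
        (isIntegral_of_quadratic (⟨_, w.mem_below.1 h5⟩ : w.1) ⟨_, w.mem_below.1 h3⟩ (d.quadratic z))
    · have := inv_quadratic hz ((map_ne_zero (algebraMap k L)).2 hN) (d.quadratic z)
      rw [← map_inv₀, ← map_mul] at this
      exact mem_place_of_isIntegral w (R := w.1) (fun r => r.2)
        (isIntegral_of_quadratic (⟨_, w.mem_below.1 (mul_mem h5 h4)⟩ : w.1)
          ⟨_, w.mem_below.1 h4⟩ this)
  · intro h
    obtain ⟨w, rfl⟩ := v.exists_above (L := L)
    obtain ⟨h1, h2⟩ := (valuation_eq_one_iff_mem _ hz).1 (h w rfl)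
    obtain ⟨h3, h4⟩ := (valuation_eq_one_iff_mem _ hz).1 (h (w.conj d.conj) (w.below_conj _))
    rw [Place.mem_conj] at h3 h4
    rw [map_inv₀] at h4
    constructor
    · have h5 : 2 * d.re z ∈ (w.below k).1 := by
        rw [w.mem_below, ← d.add_conj]
        exact add_mem h1 h3
      obtain ⟨-, h6⟩ := two_mem_and_inv_mem (w.below k) x
      have h20 : (2 : k) ≠ 0 := by
        intro h0
        have := two_ne_zero_at x (w.below k)
        rw [← map_ofNat (w.below k).emb 2, h0, map_zero] at this
        exact this rfl
      have := mul_mem h6 h5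
      rwa [inv_mul_cancel_left₀ h20] at this
    · rw [valuation_eq_one_iff_mem _ hN, w.mem_below, w.mem_below, map_inv₀, ← d.mul_conj, mul_inv]
      exact ⟨mul_mem h1 h3, mul_mem h2 h4⟩

theorem norm_at (a b : k) : v.emb a ^ 2 - (x.at v).disc * v.emb b ^ 2 =
    v.emb (a ^ 2 - x.disc * b ^ 2) := by
  rw [V.disc_map]
  simp

theorem norm_at_ne_zero {z : L} (hz : z ≠ 0) :
    v.emb (d.re z) ^ 2 - (x.at v).disc * v.emb (d.im z) ^ 2 ≠ 0 := by
  rw [norm_at]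
  exact (map_ne_zero _).2 (d.nrm_ne_zero hz)

theorem re_mul (z z' : L) : d.re (z * z') = d.re z * d.re z' + x.disc * d.im z * d.im z' := by
  conv_lhs => rw [← d.elt_re_im z, ← d.elt_re_im z', elt_mul, re_elt]

theorem im_mul (z z' : L) : d.im (z * z') = d.re z * d.im z' + d.re z' * d.im z := by
  conv_lhs => rw [← d.elt_re_im z, ← d.elt_re_im z', elt_mul, im_elt]

theorem _root_.BinQuad.V.eltG_congr {F : Type*} [Field F] {y : V F} {a b a' b' : F} (ha : a = a')
    (hb : b = b') (h h') : y.eltG a b h = y.eltG a' b' h' := by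
  subst ha hb
  rfl

/-- The multiplicative group of `L` as a subgroup of the local stabilizer. -/
def locG : Lˣ →* stabG0 (x.at v) where
  toFun z := ⟨_, eltG_mem x v (d.norm_at_ne_zero v z.ne_zero)⟩
  map_one' := by
    refine Subtype.ext ?_
    have h1 : (1 : L) = d.elt 1 0 := by simp [elt]
    have hr : d.re (1 : L) = 1 := by rw [h1, re_elt]
    have hi : d.im (1 : L) = 0 := by rw [h1, im_elt]
    have h : (1 : v.Compl) ^ 2 - (x.at v).disc * 0 ^ 2 ≠ 0 := by simp
    refine (V.eltG_congr ?_ ?_ _ h).trans (V.eltG_one h)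
    · rw [Units.val_one, hr, map_one]
    · rw [Units.val_one, hi, map_zero]
  map_mul' z z' := by
    refine Subtype.ext ?_
    have h := mul_ne_zero (d.norm_at_ne_zero v z.ne_zero) (d.norm_at_ne_zero v z'.ne_zero)
    rw [← V.norm_mul] at h
    refine Eq.trans ?_ (V.eltG_mul _ _ _ _ (d.norm_at_ne_zero v z.ne_zero)
      (d.norm_at_ne_zero v z'.ne_zero) h).symm
    refine V.eltG_congr ?_ ?_ _ h
    · rw [Units.val_mul, re_mul, V.disc_map]; simp
    · rw [Units.val_mul, im_mul]; simp

/-- The multiplicative group of `L` acting through the local stabilizer. -/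
def loc : Lˣ →* stabH0 (x.at v) := (rhoStab x v).comp (d.locG v)

theorem coe_loc (z : Lˣ) : (d.loc v z : GL (Fin 3) v.Compl) =
    rho ((x.at v).eltG _ _ (d.norm_at_ne_zero v z.ne_zero)) := rfl

/-- Being in the image of the units means that some multiple of $z$ by a scalar of $k_v$ is a unit.
Only the absolute value of the scalar matters, so it may be taken in $k$. -/
theorem loc_mem_unitsH_iff_exists (z : Lˣ) : d.loc v z ∈ unitsH x v ↔
    ∃ t : k, t ≠ 0 ∧ t * d.re z ∈ v.1 ∧ v.1.valuation (t ^ 2 * d.nrm z) = 1 := by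
  constructor
  · rintro ⟨g', hg', h⟩
    obtain ⟨s, hs⟩ := exists_torus_of_rho_eq_one (g := g'.1⁻¹ * (d.locG v z).1) (by
      have h1 : rho g'.1 = rho (d.locG v z).1 := congr_arg Subtype.val h
      rw [map_mul, map_inv, h1, inv_mul_cancel])
    have hgt : (d.locG v z).1 = g'.1 * torus s := by
      rw [← hs, mul_inv_cancel_left]
    obtain ⟨h1, h2⟩ := (mem_unitsG_iff x v g').1 hg'
    have e1 : (d.locG v z).1.2.1 = (s⁻¹ : v.Complˣ).1 • g'.1.2.1 := by
      rw [hgt]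
      change g'.1.2.1 * (torus s).2.1 = _
      simp [torus, ← Matrix.smul_one_eq_diagonal]
    have e2 : (d.locG v z).1.2.1.trace = 2 * v.emb (d.re z) := trace_elt _ _ _
    have e3 : (d.locG v z).1.2.1.det = v.emb (d.nrm z) :=
      (V.det_elt _ _ _).trans (norm_at v _ _)
    rw [e1, Matrix.trace_smul, smul_eq_mul] at e2
    rw [e1, Matrix.det_smul, Fintype.card_fin] at e3
    obtain ⟨t, ht0, ht⟩ := v.exists_val_eq s.ne_zero
    have hs0 : v.val (s : v.Compl) ≠ 0 := (Valuation.ne_zero_iff _).2 s.ne_zero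
    refine ⟨t, ht0, ?_, ?_⟩
    · have e4 := congr_arg v.val e2
      rw [map_mul, map_mul v.val 2, GoodForm.val_two x v, one_mul] at e4
      rw [← v.1.valuation_le_one_iff, map_mul, ← ht, ← v.val_emb, ← e4, Units.val_inv_eq_inv_val,
        map_inv₀, mul_inv_cancel_left₀ hs0]
      exact h1
    · rw [map_mul, map_pow, ← ht, ← v.val_emb, ← e3, map_mul, map_pow, Units.val_inv_eq_inv_val,
        map_inv₀, h2, mul_one, ← mul_pow, mul_inv_cancel₀ hs0, one_pow]
  · rintro ⟨t, ht0, h1, h2⟩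
    have hN := d.norm_at_ne_zero v z.ne_zero
    have e : (v.emb t * v.emb (d.re z)) ^ 2 - (x.at v).disc * (v.emb t * v.emb (d.im z)) ^ 2 =
        v.emb (t ^ 2 * d.nrm z) := by
      rw [← map_mul, ← map_mul, norm_at, nrm]
      congr 1
      ring
    have hv : v.val ((v.emb t * v.emb (d.re z)) ^ 2 - (x.at v).disc * (v.emb t * v.emb (d.im z)) ^ 2) = 1 := by
      rw [e, v.val_emb, h2]
    have h' := norm_ne_zero_of_val_eq_one v hv
    have := rhoStab_smul x v (v.emb (d.re z)) (v.emb (d.im z)) (v.emb t) hN h'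
    change rhoStab x v ⟨_, eltG_mem x v hN⟩ ∈ unitsH x v
    rw [← this]
    refine rhoStab_mem_unitsH x v ?_ hv h'
    rw [← map_mul]
    exact v.emb_mem_integers.2 h1

/-- An element of `L` acts as an integral unit if and only if its divisor above `v` comes
from `k`. -/
theorem loc_mem_unitsH_iff (z : Lˣ) : d.loc v z ∈ unitsH x v ↔
    ∃ n : ℤ, ∀ w : Place L, w.below k = v → w.ord (z : L) = w.ramIdx k * n := by
  rw [loc_mem_unitsH_iff_exists]
  have key : ∀ t : k, t ≠ 0 → ((t * d.re z ∈ v.1 ∧ v.1.valuation (t ^ 2 * d.nrm z) = 1) ↔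
      ∀ w : Place L, w.below k = v → w.ord (z : L) = w.ramIdx k * (-v.ord t)) := by
    intro t ht
    have ht' : algebraMap k L t ≠ 0 := (map_ne_zero _).2 ht
    rw [← re_smul, ← nrm_smul, d.unit_iff v (mul_ne_zero ht' z.ne_zero)]
    refine forall_congr' fun w => forall_congr' fun hw => ?_
    rw [← w.ord_eq_zero_iff (mul_ne_zero ht' z.ne_zero), w.ord_mul ht' z.ne_zero,
      w.ord_algebraMap, hw]
    constructor <;> intro h <;> linarith
  constructor
  · rintro ⟨t, ht, h⟩
    exact ⟨_, (key t ht).1 h⟩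
  · rintro ⟨n, h⟩
    have hu : v.unif ^ (-n) ≠ 0 := zpow_ne_zero _ v.unif_ne_zero
    refine ⟨v.unif ^ (-n), hu, (key _ hu).2 ?_⟩
    have : v.ord (v.unif ^ (-n)) = -n :=
      v.ord_eq_of_valuation_eq hu (map_zpow₀ _ _ _)
    rwa [this, neg_neg]

/-- Weak approximation at one place: pairs from $k$ are dense among the coordinates $(a,b)$ over
$k_v$, and being a unit times a given element is an open condition. -/
theorem exists_loc_inv_mul_mem (h : stabH0 (x.at v)) : ∃ z : Lˣ, (d.loc v z)⁻¹ * h ∈ unitsH x v := by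
  obtain ⟨a, b, hN, rfl⟩ := exists_rhoStab_eltG x v h
  set N := a ^ 2 - (x.at v).disc * b ^ 2 with hNdef
  -- `P p` and `Q p` are the coordinates of the quotient of $p_1+p_2\sqrt{P(x)}$ by
  -- $a+b\sqrt{P(x)}$.
  let P : v.Compl × v.Compl → v.Compl := fun p => (a * p.1 - (x.at v).disc * b * p.2) / N
  let Q : v.Compl × v.Compl → v.Compl := fun p => (a * p.2 - p.1 * b) / N
  have hP : Continuous P := by
    have : Continuous fun p : v.Compl × v.Compl => a * p.1 - (x.at v).disc * b * p.2 := by fun_prop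
    exact this.div_const N
  have hQ : Continuous Q := by
    have : Continuous fun p : v.Compl × v.Compl => a * p.2 - p.1 * b := by fun_prop
    exact this.div_const N
  have hO : IsOpen {p : v.Compl × v.Compl | P p ∈ v.integers ∧
      v.val (P p ^ 2 - (x.at v).disc * Q p ^ 2) = 1} :=
    (v.isOpen_integers.preimage hP).inter
      ((isClopen_val_eq_one v).isOpen.preimage ((hP.pow 2).sub (continuous_const.mul (hQ.pow 2))))
  have hPa : P (a, b) = 1 := by
    simp only [P]
    rw [div_eq_one_iff_eq hN, hNdef]
    ring
  have hQa : Q (a, b) = 0 := by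
    simp only [Q]
    rw [sub_self, zero_div]
  have hmem : (a, b) ∈ {p : v.Compl × v.Compl | P p ∈ v.integers ∧
      v.val (P p ^ 2 - (x.at v).disc * Q p ^ 2) = 1} := by
    refine ⟨?_, ?_⟩
    · rw [hPa]; exact one_mem _
    · rw [hPa, hQa]; simp
  obtain ⟨⟨a₀, b₀⟩, h1, h2⟩ := (v.denseRange_emb.prodMap v.denseRange_emb).exists_mem_open hO ⟨_, hmem⟩
  simp only [Prod.map_apply] at h1 h2
  set A := P (v.emb a₀, v.emb b₀) with hA
  set B := Q (v.emb a₀, v.emb b₀) with hB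
  have hAB := norm_ne_zero_of_val_eq_one v h2
  have ea : a * A + (x.at v).disc * b * B = v.emb a₀ := by
    rw [hA, hB]
    simp only [P, Q]
    field_simp
    rw [hNdef]
    ring
  have eb : a * B + A * b = v.emb b₀ := by
    rw [hA, hB]
    simp only [P, Q]
    field_simp
    rw [hNdef]
    ring
  have hN₀ : v.emb a₀ ^ 2 - (x.at v).disc * v.emb b₀ ^ 2 ≠ 0 := by
    rw [← ea, ← eb, V.norm_mul]
    exact mul_ne_zero hN hAB
  have hz : d.elt a₀ b₀ ≠ 0 := by
    rw [norm_at] at hN₀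
    exact d.ne_zero_of_nrm fun h0 => hN₀ (by rw [h0, map_zero])
  refine ⟨Units.mk0 _ hz, ?_⟩
  have h3 : d.loc v (Units.mk0 _ hz) = rhoStab x v ⟨_, eltG_mem x v hN⟩ *
      rhoStab x v ⟨_, eltG_mem x v hAB⟩ := by
    refine Subtype.ext ?_
    rw [coe_loc, Subgroup.coe_mul, coe_rhoStab, coe_rhoStab, ← map_mul]
    congr 1
    have h4 := hN₀
    rw [← ea, ← eb] at h4
    refine Eq.trans ?_ (V.eltG_mul a b A B hN hAB h4).symm
    refine V.eltG_congr ?_ ?_ _ _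
    · rw [ea, Units.val_mk0, re_elt]
    · rw [eb, Units.val_mk0, im_elt]
  rw [h3, mul_inv_rev, inv_mul_cancel_right]
  exact inv_mem (rhoStab_mem_unitsH x v h1 h2 hAB)

end Local

end QuadGen

end

end BinQuad

namespace BinQuad

noncomputable section

/-! ### Adelic classes and divisor classes -/

namespace QuadGen

set_option linter.unusedSectionVars false

variable {k L : Type*} [Field k] [Field L] [Algebra k L] [FiniteDimensional k L] {x : V k}
  [GlobalPlaces k] [GlobalPlaces L] [GoodForm x] (d : QuadGen x L)

theorem mem_range_conorm_iff (E : Divisor L) : E ∈ (conorm k L).range ↔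
    ∀ v : Place k, ∃ n : ℤ, ∀ w : Place L, w.below k = v → E w = w.ramIdx k * n := by
  constructor
  · rintro ⟨D, rfl⟩ v
    refine ⟨D v, ?_⟩
    rintro w rfl
    exact conorm_apply D w
  · intro h
    choose n hn using h
    have hfin : (Function.support n).Finite := by
      refine (E.hasFiniteSupport.image fun w : Place L => w.below k).subset fun v hv => ?_
      obtain ⟨w, rfl⟩ := v.exists_above (L := L)
      refine ⟨w, ?_, rfl⟩
      rw [Function.mem_support, hn _ w rfl]
      exact mul_ne_zero w.ramIdx_pos.ne' hv
    refine ⟨Finsupp.ofSupportFinite n hfin, Finsupp.ext fun w => ?_⟩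
    rw [conorm_apply, hn _ w rfl]
    rfl

theorem eventually_loc_mem (E : Divisor L) (z : Place k → Lˣ)
    (h : ∀ w : Place L, w.ord (z (w.below k) : L) = E w) :
    ∀ᶠ v in cofinite, d.loc v (z v) ∈ integralH x v := by
  have hfin := (E.hasFiniteSupport.image fun w : Place L => w.below k).compl_mem_cofinite
  filter_upwards [hfin, eventually_unitsH_eq_integralH x] with v h1 h2
  rw [← h2]
  refine (d.loc_mem_unitsH_iff v (z v)).2 ⟨0, ?_⟩
  rintro w rfl
  rw [h w, mul_zero]
  by_contra h3
  exact h1 ⟨w, h3, rfl⟩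

/-- The multiplicative group of `L` in the adelic group. -/
def glob : Lˣ →* adelicH0 x where
  toFun z := glue x (fun v => d.loc v z)
    (d.eventually_loc_mem (divisor (z : L)) (fun _ => z) fun _ => rfl)
  map_one' := adelicH0_ext x fun v => by
    rw [eval_glue, map_one]
    exact (map_one (evalHom x v)).symm
  map_mul' z z' := adelicH0_ext x fun v => by
    rw [eval_glue, map_mul, ← evalHom_apply, map_mul, evalHom_apply, evalHom_apply, eval_glue,
      eval_glue]

theorem eval_glob (z : Lˣ) (v : Place k) : adelicH0.eval x v (d.glob z) = d.loc v z :=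
  eval_glue x (fun v => d.loc v z)
    (d.eventually_loc_mem (divisor (z : L)) (fun _ => z) fun _ => rfl) v

theorem two_ne_zero_of_place (x : V k) [GoodForm x] (v : Place k) : (2 : k) ≠ 0 := by
  intro h
  have := two_ne_zero_at x v
  rw [← map_ofNat v.emb 2, h, map_zero] at this
  exact this rfl

variable [hne : Nonempty (Place k)]

/-- Rational points of $H_x^\circ$ lift to $G_x^\circ$ over $k$ itself, by `mem_stabH0_iff'`, and
the points there are the nonzero elements of $L$. -/
theorem range_glob : d.glob.range = rationalH0 x := by
  have h2 := two_ne_zero_of_place x hne.some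
  have hx := GoodForm.disc_ne_zero (x := x)
  have key : ∀ (v : Place k) (a b : k) (hN : a ^ 2 - x.disc * b ^ 2 ≠ 0)
      (hN' : v.emb a ^ 2 - (x.at v).disc * v.emb b ^ 2 ≠ 0),
      rho ((x.at v).eltG _ _ hN') = Matrix.GeneralLinearGroup.map v.emb (rho (x.eltG a b hN)) := by
    intro v a b hN hN'
    rw [rho_map, V.eltG_map]
  ext h
  constructor
  · rintro ⟨z, rfl⟩
    refine ⟨rho (x.eltG _ _ (d.nrm_ne_zero z.ne_zero)), ?_, fun v => ?_⟩
    · exact (mem_stabH0_iff' h2 hx _).2 ⟨_, (mem_stabG0_iff h2 hx _).2 ⟨_, _, _, rfl⟩, rfl⟩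
    · exact (congr_arg Subtype.val (d.eval_glob z v)).trans
        (key v _ _ (d.nrm_ne_zero z.ne_zero) (d.norm_at_ne_zero v z.ne_zero))
  · rintro ⟨γ, hγ, h⟩
    obtain ⟨g, hg, rfl⟩ := (mem_stabH0_iff' h2 hx _).1 hγ
    obtain ⟨a, b, hN, rfl⟩ := (mem_stabG0_iff h2 hx _).1 hg
    refine ⟨Units.mk0 _ (d.ne_zero_of_nrm hN), adelicH0_ext x fun v => Subtype.ext ?_⟩
    rw [eval_glob, coe_loc]
    refine Eq.trans ?_ (h v).symm
    have hN' : v.emb a ^ 2 - (x.at v).disc * v.emb b ^ 2 ≠ 0 := by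
      rw [norm_at]; exact (map_ne_zero _).2 hN
    rw [← key v a b hN hN']
    congr 1
    exact V.eltG_congr (by simp) (by simp) _ _

theorem glob_mem_boxGroup_iff (z : Lˣ) :
    d.glob z ∈ boxGroup x ∅ ↔ divisor (z : L) ∈ (conorm k L).range := by
  rw [mem_boxGroup, mem_range_conorm_iff]
  refine forall_congr' fun v => ?_
  rw [eval_glob, d.loc_mem_unitsH_iff]
  simp

theorem ker_glob : d.glob.ker = (Units.map (algebraMap k L : k →* L)).range := by
  ext z
  rw [MonoidHom.mem_ker]
  constructor
  · intro h
    obtain ⟨v⟩ := hne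
    have h1 : (d.loc v z : GL (Fin 3) v.Compl) = 1 := by
      rw [← eval_glob, h]
      exact congr_arg Subtype.val (map_one (evalHom x v))
    -- At a single place, trace $3$ already forces the coefficient of the square root to vanish.
    have h2 := trace_rho_eltG _ _ (d.norm_at_ne_zero v z.ne_zero)
    rw [← coe_loc, h1, Units.val_one, Matrix.trace_one, Fintype.card_fin, Nat.cast_ofNat, sub_self,
      mul_zero] at h2
    have h4 : (4 : v.Compl) ≠ 0 := by
      rw [show (4 : v.Compl) = 2 * 2 by norm_num]
      exact mul_ne_zero (two_ne_zero_at x v) (two_ne_zero_at x v)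
    have h3 : d.im (z : L) = 0 := by
      have := (mul_eq_zero.1 h2.symm).resolve_left (mul_ne_zero h4 (disc_at_ne_zero x v))
      exact (map_eq_zero v.emb).1 (pow_eq_zero_iff two_ne_zero |>.1 this)
    have h5 : algebraMap k L (d.re (z : L)) = z := by
      conv_rhs => rw [← d.elt_re_im (z : L), h3]
      exact d.algebraMap_eq_elt _
    have h6 : d.re (z : L) ≠ 0 := fun h0 => z.ne_zero (by rw [← h5, h0, map_zero])
    exact ⟨Units.mk0 _ h6, Units.ext h5⟩
  · rintro ⟨a, rfl⟩
    refine adelicH0_ext x fun v => Subtype.ext ?_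
    rw [eval_glob, coe_loc]
    refine Eq.trans ?_ (congr_arg Subtype.val (map_one (evalHom x v))).symm
    have h : (v.emb (a : k)) ^ 2 - (x.at v).disc * 0 ^ 2 ≠ 0 := by simp
    rw [Subgroup.coe_one, ← rho_eltG_zero _ h]
    congr 1
    have : ((Units.map (algebraMap k L : k →* L) a : Lˣ) : L) = d.elt a 0 := d.algebraMap_eq_elt _
    refine V.eltG_congr ?_ ?_ _ _
    · rw [this, re_elt]
    · rw [this, im_elt, map_zero]

/-- The integral rational points are the elements of `L` with divisor from `k`, modulo `k`. -/
theorem card_boxGroup_inf_rationalH0 :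
    Nat.card (boxGroup x ∅ ⊓ rationalH0 x : Subgroup (adelicH0 x)) =
      d.glob.ker.relIndex ((boxGroup x ∅).comap d.glob) := by
  rw [Subgroup.relIndex_ker, Subgroup.map_comap_eq, range_glob, inf_comm]

theorem exists_units_ord_eq (E : Divisor L) (v : Place k) :
    ∃ z : Lˣ, ∀ w : Place L, w.below k = v → w.ord (z : L) = E w := by
  obtain ⟨f, hf, h⟩ := Place.exists_ord_eq (v.finite_above (L := L)).toFinset E
  exact ⟨Units.mk0 f hf, fun w hw => h w (by simpa using hw)⟩

/-- Local elements with the given divisor. -/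
def pick (E : Divisor L) (v : Place k) : Lˣ := (exists_units_ord_eq E v).choose

theorem ord_pick (E : Divisor L) (w : Place L) : w.ord (pick E (w.below k) : L) = E w :=
  (exists_units_ord_eq E (w.below k)).choose_spec w rfl

/-- An adelic element with the given divisor. -/
def ofDivisor (E : Divisor L) : adelicH0 x :=
  glue x (fun v => d.loc v (pick E v)) (d.eventually_loc_mem E _ (ord_pick E))

theorem eval_ofDivisor (E : Divisor L) (v : Place k) :
    adelicH0.eval x v (d.ofDivisor E) = d.loc v (pick E v) := eval_glue x _ _ v

theorem boxGroup_normal : (boxGroup x ∅).Normal :=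
  ⟨fun n hn g => by rwa [adelicH0_comm x g n, mul_inv_cancel_right]⟩

theorem mem_sup_rationalH0_iff (h : adelicH0 x) : h ∈ boxGroup x ∅ ⊔ rationalH0 x ↔
    ∃ z : Lˣ, h * (d.glob z)⁻¹ ∈ boxGroup x ∅ := by
  have := boxGroup_normal (x := x)
  rw [Subgroup.mem_sup_of_normal_left, ← range_glob d]
  constructor
  · rintro ⟨u, hu, _, ⟨z, rfl⟩, rfl⟩
    exact ⟨z, by rwa [mul_inv_cancel_right]⟩
  · rintro ⟨z, hz⟩
    exact ⟨_, hz, _, ⟨z, rfl⟩, inv_mul_cancel_right _ _⟩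

/-- Modulo local units a component depends only on its orders up to conorms, by
`loc_mem_unitsH_iff`, while a rational point changes the divisor by a principal one. -/
theorem ofDivisor_rel_iff (E E' : Divisor L) :
    (d.ofDivisor E)⁻¹ * d.ofDivisor E' ∈ boxGroup x ∅ ⊔ rationalH0 x ↔
      -E + E' ∈ (conorm k L).range ⊔ principal L := by
  have key : ∀ z : Lˣ, (d.ofDivisor E)⁻¹ * d.ofDivisor E' * (d.glob z)⁻¹ ∈ boxGroup x ∅ ↔
      -E + E' - divisor (z : L) ∈ (conorm k L).range := by
    intro z
    rw [mem_boxGroup, mem_range_conorm_iff]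
    refine forall_congr' fun v => ?_
    have h1 : adelicH0.eval x v ((d.ofDivisor E)⁻¹ * d.ofDivisor E' * (d.glob z)⁻¹) =
        d.loc v ((pick E v)⁻¹ * pick E' v * z⁻¹) := by
      rw [← evalHom_apply, map_mul, map_mul, map_inv, map_inv, evalHom_apply, evalHom_apply,
        evalHom_apply, eval_ofDivisor, eval_ofDivisor, eval_glob, map_mul, map_mul, map_inv, map_inv]
    rw [h1, d.loc_mem_unitsH_iff]
    simp only [Set.mem_empty_iff_false, not_false_eq_true, forall_true_left]
    refine exists_congr fun n => forall_congr' fun w => ?_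
    refine forall_congr' fun hw => ?_
    subst hw
    have e : w.ord (((pick E (w.below k))⁻¹ * pick E' (w.below k) * z⁻¹ : Lˣ) : L) =
        (-E + E' - divisor (z : L)) w := by
      rw [Units.val_mul, Units.val_mul, Units.val_inv_eq_inv_val, Units.val_inv_eq_inv_val,
        w.ord_mul (mul_ne_zero (inv_ne_zero (Units.ne_zero _)) (Units.ne_zero _))
          (inv_ne_zero (Units.ne_zero _)), w.ord_mul (inv_ne_zero (Units.ne_zero _)) (Units.ne_zero _),
        w.ord_inv (Units.ne_zero _), w.ord_inv (Units.ne_zero _), ord_pick, ord_pick]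
      rfl
    rw [e]
  rw [d.mem_sup_rationalH0_iff, AddSubgroup.mem_sup]
  constructor
  · rintro ⟨z, hz⟩
    exact ⟨_, (key z).1 hz, divisor (z : L), (mem_principal_iff _).2 ⟨z, z.ne_zero, rfl⟩,
      sub_add_cancel _ _⟩
  · rintro ⟨C, hC, P, hP, h⟩
    obtain ⟨f, hf, rfl⟩ := (mem_principal_iff P).1 hP
    refine ⟨Units.mk0 f hf, (key _).2 ?_⟩
    rw [← h, Units.val_mk0, add_sub_cancel_right]
    exact hC

/-- Each component is an element of $L^\times$ times a unit, and its orders above that place are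
prescribed. Where the component is already a unit, order zero is prescribed instead, so that only
finitely many coefficients are nonzero. -/
theorem exists_ofDivisor (h : adelicH0 x) :
    ∃ E : Divisor L, (d.ofDivisor E)⁻¹ * h ∈ boxGroup x ∅ := by
  classical
  choose z hz using fun v => d.exists_loc_inv_mul_mem v (adelicH0.eval x v h)
  have hfin : {v : Place k | ¬ adelicH0.eval x v h ∈ unitsH x v}.Finite :=
    eventually_eval_mem_unitsH x h
  let e : Place L → ℤ := fun w =>
    if adelicH0.eval x (w.below k) h ∈ unitsH x (w.below k) then 0 else w.ord (z (w.below k) : L)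
  have he : (Function.support e).Finite := by
    refine (hfin.biUnion fun v _ => v.finite_above (L := L)).subset fun w hw => ?_
    refine Set.mem_biUnion (x := w.below k) ?_ rfl
    intro h1
    exact hw (if_pos h1)
  refine ⟨Finsupp.ofSupportFinite e he, (mem_boxGroup x).2 fun v _ => ?_⟩
  set E := Finsupp.ofSupportFinite e he with hE
  have h1 : adelicH0.eval x v ((d.ofDivisor E)⁻¹ * h) = (d.loc v (pick E v))⁻¹ *
      adelicH0.eval x v h := by
    rw [← evalHom_apply, map_mul, map_inv, evalHom_apply, evalHom_apply, eval_ofDivisor]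
  rw [h1]
  by_cases hv : adelicH0.eval x v h ∈ unitsH x v
  · refine mul_mem (inv_mem ((d.loc_mem_unitsH_iff v _).2 ⟨0, ?_⟩)) hv
    rintro w rfl
    rw [ord_pick, mul_zero]
    exact if_pos hv
  · have h2 : d.loc v ((pick E v)⁻¹ * z v) ∈ unitsH x v := by
      refine (d.loc_mem_unitsH_iff v _).2 ⟨0, ?_⟩
      rintro w rfl
      rw [Units.val_mul, Units.val_inv_eq_inv_val,
        w.ord_mul (inv_ne_zero (Units.ne_zero _)) (Units.ne_zero _),
        w.ord_inv (Units.ne_zero _), ord_pick, mul_zero]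
      have : E w = w.ord (z (w.below k) : L) := if_neg hv
      rw [this, neg_add_cancel]
    have h3 := mul_mem h2 (hz v)
    rwa [map_mul, map_inv, mul_assoc, mul_inv_cancel_left] at h3

/-- The adelic classes are the divisor classes of `L` modulo the divisors of `k`. -/
theorem card_adelic_quotient (d : QuadGen x L) : Nat.card (adelicH0 x ⧸ (boxGroup x ∅ ⊔ rationalH0 x)) =
    ((conorm k L).range ⊔ principal L).index := by
  let f : Divisor L ⧸ ((conorm k L).range ⊔ principal L) →
      adelicH0 x ⧸ (boxGroup x ∅ ⊔ rationalH0 x) :=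
    Quotient.map' d.ofDivisor fun E E' h => by
      rw [QuotientAddGroup.leftRel_apply] at h
      rw [QuotientGroup.leftRel_apply]
      exact (d.ofDivisor_rel_iff E E').2 h
  have hf : Function.Bijective f := by
    constructor
    · intro a b
      induction a using QuotientAddGroup.induction_on with | _ E =>
      induction b using QuotientAddGroup.induction_on with | _ E' =>
      intro h
      exact QuotientAddGroup.eq.2 ((d.ofDivisor_rel_iff E E').1 (QuotientGroup.eq.1 h))
    · intro a
      induction a using QuotientGroup.induction_on with | _ h =>
      obtain ⟨E, hE⟩ := d.exists_ofDivisor h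
      refine ⟨QuotientAddGroup.mk E, ?_⟩
      exact QuotientGroup.eq.2 (Subgroup.mem_sup_left hE)
  exact (Nat.card_congr (Equiv.ofBijective f hf)).symm

end QuadGen

end

end BinQuad

namespace BinQuad

noncomputable section

/-! ### Index computations -/

section Index

variable {D : Type*} [AddCommGroup D] (C P D₀ Q : AddSubgroup D)

/-- The modular law gives $(C+P)\cap D_0=P+(C\cap D_0)$. With $D_0$ the divisors of degree zero this
splits off the contribution of degrees. -/
theorem index_sup_eq (hP : P ≤ D₀) :
    (C ⊔ P).index = (P ⊔ C ⊓ D₀).relIndex D₀ * (C ⊔ D₀).index := by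
  rw [← AddSubgroup.relIndex_mul_index (sup_le_sup_left hP C)]
  congr 1
  have h1 : C ⊔ D₀ = C ⊔ P ⊔ D₀ := by rw [sup_assoc, sup_eq_right.2 hP]
  have h2 : (C ⊔ P) ⊓ D₀ = P ⊔ C ⊓ D₀ := by
    rw [sup_comm C P, sup_inf_assoc_of_le C hP]
  rw [h1, AddSubgroup.relIndex_sup_left, ← AddSubgroup.inf_relIndex_right, h2]

/-- By the second isomorphism theorem $[P+(C\cap D_0):P]=[C\cap D_0:C\cap P]$. The identity compares
the class numbers of $L$ and $k$ once $Q$ is the group of conorms of principal divisors of $k$. -/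
theorem relIndex_mul_relIndex_eq (hP : P ≤ D₀) (hQ : Q ≤ C ⊓ P) :
    P.relIndex D₀ * Q.relIndex (C ⊓ P) =
      Q.relIndex (C ⊓ D₀) * (P ⊔ C ⊓ D₀).relIndex D₀ := by
  have h1 := AddSubgroup.relIndex_mul_relIndex P (P ⊔ C ⊓ D₀) D₀ le_sup_left
    (sup_le hP inf_le_right)
  have h2 := AddSubgroup.relIndex_mul_relIndex Q (C ⊓ P) (C ⊓ D₀) hQ (inf_le_inf_left C hP)
  rw [AddSubgroup.relIndex_sup_left] at h1
  have h3 : P ⊓ (C ⊓ D₀) = C ⊓ P := by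
    rw [← inf_assoc, inf_comm P C, inf_assoc, inf_eq_left.2 hP]
  have h4 := AddSubgroup.inf_relIndex_right P (C ⊓ D₀)
  rw [h3] at h4
  rw [← h1, ← h2, h4]
  ring

/-- The index of a subgroup computed through a homomorphism. -/
theorem relIndex_mul_card_inf_ker {E : Type*} [AddCommGroup E] (f : E →+ D) (R M : AddSubgroup E)
    (hM : f.ker ≤ M) (hR : R ≤ M) :
    R.relIndex M * Nat.card (R ⊓ f.ker : AddSubgroup E) =
      Nat.card f.ker * (R.map f).relIndex (M.map f) := by
  have h1 := AddSubgroup.relIndex_mul_relIndex R (R ⊔ f.ker) M le_sup_left (sup_le hR hM)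
  rw [AddSubgroup.relIndex_sup_left] at h1
  have h2 := AddSubgroup.relIndex_map_map f R M
  rw [sup_eq_left.2 hM] at h2
  have h3 := AddSubgroup.relIndex_mul_relIndex ⊥ (R ⊓ f.ker) f.ker bot_le inf_le_right
  rw [AddSubgroup.relIndex_bot_left, AddSubgroup.relIndex_bot_left,
    AddSubgroup.inf_relIndex_right] at h3
  rw [← h1, h2, ← h3]
  ring

end Index

/-! ### The divisor homomorphism, constants and class numbers -/

section DivisorHom

/-- The divisor homomorphism. -/
def divHom (K : Type*) [Field K] [GlobalPlaces K] : Additive Kˣ →+ Divisor K where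
  toFun f := divisor (f.toMul : K)
  map_zero' := divisor_one
  map_add' f g := divisor_mul f.toMul.ne_zero g.toMul.ne_zero

theorem divHom_apply {K : Type*} [Field K] [GlobalPlaces K] (f : Kˣ) :
    divHom K (Additive.ofMul f) = divisor (f : K) := rfl

theorem range_divHom (K : Type*) [Field K] [GlobalPlaces K] : (divHom K).range = principal K := by
  ext D
  rw [mem_principal_iff]
  constructor
  · rintro ⟨f, rfl⟩
    exact ⟨_, f.toMul.ne_zero, rfl⟩
  · rintro ⟨f, hf, rfl⟩
    exact ⟨Additive.ofMul (Units.mk0 f hf), rfl⟩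

theorem card_ker_divHom (Fq K : Type*) [Field Fq] [Field K] [Algebra Fq K] [Finite Fq]
    [IsFunctionFieldOver Fq K] [GlobalPlaces K] :
    Nat.card (divHom K).ker = constCard K Fq - 1 := by
  have := finite_algebraicClosure Fq K
  rw [constCard, ← Nat.card_units]
  let g : (algebraicClosure Fq K)ˣ → (divHom K).ker := fun u =>
    ⟨Additive.ofMul (Units.map (algebraMap (algebraicClosure Fq K) K).toMonoidHom u), by
      rw [AddMonoidHom.mem_ker, divHom_apply]
      refine Finsupp.ext fun w => ?_
      refine (w.ord_eq_zero_iff (Units.ne_zero _)).2 (valuation_eq_one_of_isAlgebraic Fq _ ?_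
        (Units.ne_zero _))
      exact mem_algebraicClosure_iff.1 u.1.2⟩
  refine (Nat.card_congr (Equiv.ofBijective g ⟨fun u u' h => ?_, ?_⟩)).symm
  · have h1 := congr_arg (fun a : (divHom K).ker => (a.1.toMul : K)) h
    exact Units.ext (Subtype.ext h1)
  · rintro ⟨f, hf⟩
    have h1 := (mem_rrSpace_zero_iff Fq).1
      (isAlgebraic_of_divisor_eq_zero K f.toMul.ne_zero (AddMonoidHom.mem_ker.1 hf))
    have h2 : (⟨_, mem_algebraicClosure_iff.2 h1⟩ : algebraicClosure Fq K) ≠ 0 := by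
      intro h
      exact f.toMul.ne_zero (congr_arg Subtype.val h)
    exact ⟨Units.mk0 _ h2, Subtype.ext (Units.ext rfl)⟩

theorem classNumber_eq_relIndex (Fq K : Type*) [Field Fq] [Field K] [Algebra Fq K] [Finite Fq]
    [IsFunctionFieldOver Fq K] [GlobalPlaces K] :
    classNumber K Fq = (principal K).relIndex (normKer K) := by
  rw [← ker_degree_eq Fq]
  rfl

theorem classNumber_ne_zero (Fq K : Type*) [Field Fq] [Field K] [Algebra Fq K] [Finite Fq]
    [IsFunctionFieldOver Fq K] [GlobalPlaces K] : classNumber K Fq ≠ 0 := by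
  rw [classNumber_eq_relIndex]
  have := finite_classGroup Fq K
  exact Nat.card_pos.ne'

end DivisorHom

/-! ### Class numbers, constants and degrees in a quadratic extension -/

section Extension

set_option linter.unusedSectionVars false

variable (Fq : Type*) {k L : Type*} [Field Fq] [Finite Fq] [Field k] [Field L] [Algebra k L]
  [Algebra Fq k] [Algebra Fq L] [IsScalarTower Fq k L]
  [FiniteDimensional k L] [GlobalPlaces k] [GlobalPlaces L] [IsFunctionFieldOver Fq k]
  [IsFunctionFieldOver Fq L]

/-- The conorm raises the absolute norm to the power $[L:k]$, so norm one upstairs already means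
norm one downstairs. -/
theorem range_conorm_inf_normKer (Fq : Type*) {k L : Type*} [Field Fq] [Finite Fq] [Field k]
    [Field L] [Algebra k L] [Algebra Fq k] [Algebra Fq L] [IsScalarTower Fq k L]
    [FiniteDimensional k L] [GlobalPlaces k] [GlobalPlaces L] [IsFunctionFieldOver Fq k] :
    (conorm k L).range ⊓ normKer L = (normKer k).map (conorm k L) := by
  ext E
  have key : ∀ D : Divisor k, conorm k L D ∈ normKer L ↔ D ∈ normKer k := by
    intro D
    change divNorm _ = 1 ↔ divNorm _ = 1
    rw [divNorm_conorm Fq, pow_eq_one_iff_of_nonneg (divNorm_pos D).le Module.finrank_pos.ne']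
  constructor
  · rintro ⟨⟨D, rfl⟩, h⟩
    exact ⟨D, (key D).1 h, rfl⟩
  · rintro ⟨D, h, rfl⟩
    exact ⟨⟨D, rfl⟩, (key D).2 h⟩

/-- The field extension on multiplicative groups. -/
def unitsIncl (k L : Type*) [Field k] [Field L] [Algebra k L] : Additive kˣ →+ Additive Lˣ :=
  MonoidHom.toAdditive (Units.map (algebraMap k L : k →* L))

theorem divHom_unitsIncl (f : Additive kˣ) :
    divHom L (unitsIncl k L f) = conorm k L (divHom k f) :=
  (conorm_divisor (f.toMul : k)).symm

theorem unitsIncl_injective (k L : Type*) [Field k] [Field L] [Algebra k L] :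
    Function.Injective (unitsIncl k L) := by
  intro a b h
  have h1 := congr_arg (fun a : Additive Lˣ => (a.toMul : L)) h
  exact Units.ext ((algebraMap k L).injective h1)

theorem card_range_unitsIncl_inf_ker :
    Nat.card ((unitsIncl k L).range ⊓ (divHom L).ker : AddSubgroup (Additive Lˣ)) =
      constCard k Fq - 1 := by
  rw [← card_ker_divHom Fq k]
  have h : (unitsIncl k L).range ⊓ (divHom L).ker = ((divHom k).ker).map (unitsIncl k L) := by
    ext z
    have key : ∀ f : Additive kˣ, unitsIncl k L f ∈ (divHom L).ker ↔ f ∈ (divHom k).ker := by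
      intro f
      rw [AddMonoidHom.mem_ker, AddMonoidHom.mem_ker, divHom_unitsIncl,
        map_eq_zero_iff _ conorm_injective]
    constructor
    · rintro ⟨⟨f, rfl⟩, h⟩
      exact ⟨f, (key f).1 h, rfl⟩
    · rintro ⟨f, h, rfl⟩
      exact ⟨⟨f, rfl⟩, (key f).2 h⟩
  rw [h]
  exact (Nat.card_congr ((divHom k).ker.equivMapOfInjective _ (unitsIncl_injective k L)).toEquiv).symm

theorem map_range_unitsIncl :
    ((unitsIncl k L).range).map (divHom L) = (principal k).map (conorm k L) := by
  rw [← range_divHom k]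
  ext D
  constructor
  · rintro ⟨_, ⟨f, rfl⟩, rfl⟩
    exact ⟨_, ⟨f, rfl⟩, (divHom_unitsIncl f).symm⟩
  · rintro ⟨_, ⟨f, rfl⟩, rfl⟩
    exact ⟨_, ⟨f, rfl⟩, divHom_unitsIncl f⟩

theorem constCard_eq_pow (Fq L : Type*) [Field Fq] [Finite Fq] [Field L] [Algebra Fq L]
    [IsFunctionFieldOver Fq L] :
    constCard L Fq = Nat.card Fq ^ Module.finrank Fq (algebraicClosure Fq L) := by
  have := finite_algebraicClosure Fq L
  exact Module.natCard_eq_pow_finrank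

/-- The degree of a conorm. -/
theorem finrank_mul_degree_conorm (hconst : algebraicClosure Fq k = ⊥)
    (h2 : Module.finrank k L = 2) (D : Divisor k) :
    (Module.finrank Fq (algebraicClosure Fq L) : ℤ) * degree L Fq (conorm k L D) =
      2 * degree k Fq D := by
  have h := divNorm_conorm (L := L) Fq D
  have hk : constCard k Fq = Nat.card Fq := by
    rw [constCard_eq_pow, hconst, IntermediateField.finrank_bot, pow_one]
  rw [divNorm_eq_pow_degree Fq, divNorm_eq_pow_degree Fq, constCard_eq_pow Fq L, hk, h2,
    Nat.cast_pow, ← zpow_natCast, ← zpow_mul, ← zpow_natCast, ← zpow_mul] at h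
  have hq : 1 < (Nat.card Fq : ℝ) := by exact_mod_cast Finite.one_lt_card
  have := zpow_right_injective₀ (zero_lt_one.trans hq) hq.ne' h
  rw [this]
  push_cast
  ring

/-- The degree of $L$ is surjective onto $\mathbb Z$ and its kernel is `normKer L`, so the index can
be computed in $\mathbb Z$. -/
theorem index_range_conorm_sup_normKer :
    ((conorm k L).range ⊔ normKer L).index = (((degree L Fq).comp (conorm k L)).range).index := by
  rw [← ker_degree_eq Fq, ← AddSubgroup.index_map_eq _ (degree_surjective Fq L) le_sup_right,
    AddSubgroup.map_sup, (AddSubgroup.map_eq_bot_iff _).2 le_rfl, sup_bot_eq]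
  congr 1
  rw [AddMonoidHom.range_comp]

/-- The index of the degrees of divisors from `k`: two, or one for a constant field extension. -/
theorem index_degree_range (hconst : algebraicClosure Fq k = ⊥) (h2 : Module.finrank k L = 2) :
    (algebraicClosure Fq L = ⊥ → ((conorm k L).range ⊔ normKer L).index = 2) ∧
    (algebraicClosure Fq L ≠ ⊥ → ((conorm k L).range ⊔ normKer L).index = 1) := by
  rw [index_range_conorm_sup_normKer Fq]
  have hd := finrank_mul_degree_conorm (L := L) Fq hconst h2
  have hfin := finite_algebraicClosure Fq L
  constructor
  · intro h
    rw [h, IntermediateField.finrank_bot] at hd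
    have : ((degree L Fq).comp (conorm k L)).range = AddSubgroup.zmultiples 2 := by
      ext n
      rw [Int.mem_zmultiples_iff]
      constructor
      · rintro ⟨D, rfl⟩
        have := hd D
        exact ⟨_, by simpa using this⟩
      · rintro ⟨m, rfl⟩
        obtain ⟨D, hD⟩ := degree_surjective Fq k m
        refine ⟨D, ?_⟩
        have := hd D
        rw [hD] at this
        simpa using this
    rw [this, Int.index_zmultiples]
    rfl
  · intro h
    -- Applying `finrank_mul_degree_conorm` to a divisor of degree one shows that the degree of the
    -- constant extension divides $2$. If it is not $1$, the conorm preserves degrees.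
    have h1 : Module.finrank Fq (algebraicClosure Fq L) ≠ 1 := fun h' =>
      h (IntermediateField.finrank_eq_one_iff.1 h')
    obtain ⟨D, hD⟩ := degree_surjective Fq k 1
    have h3 : Module.finrank Fq (algebraicClosure Fq L) = 2 := by
      have h4 := hd D
      rw [hD, mul_one] at h4
      have h5 : Module.finrank Fq (algebraicClosure Fq L) ∣ 2 := by
        exact_mod_cast Dvd.intro _ h4
      exact ((Nat.dvd_prime Nat.prime_two).1 h5).resolve_left h1
    rw [h3] at hd
    have : ((degree L Fq).comp (conorm k L)).range = ⊤ := by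
      refine AddMonoidHom.range_eq_top.2 fun n => ?_
      obtain ⟨D, hD⟩ := degree_surjective Fq k n
      refine ⟨D, ?_⟩
      have := hd D
      rw [hD] at this
      exact mul_left_cancel₀ two_ne_zero this
    rw [this, AddSubgroup.index_top]

variable {x : V k} [GoodForm x] [Countable k] [Countable (Place k)]

/-- The volume in terms of divisor class numbers. -/
theorem volume_eq_index_mul (d : QuadGen x L) (hidx : ((conorm k L).range ⊔ normKer L).index ≠ 0) :
    volume x = ENNReal.ofReal (((conorm k L).range ⊔ normKer L).index *
      (constC L Fq / constC k Fq)) := by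
  have hne : Nonempty (Place k) := nonempty_place Fq k
  set C := (conorm k L).range with hC
  set P := principal L with hP
  set Q := (principal k).map (conorm k L) with hQ
  set m := (C ⊔ normKer L).index
  have hP0 : P ≤ normKer L := principal_le_normKer Fq L
  have hQ0 : Q ≤ C ⊓ P := by
    rw [hQ, ← map_range_unitsIncl (L := L), hC, hP, ← range_divHom L]
    refine le_inf ?_ (AddSubgroup.map_le_range _ _)
    rw [map_range_unitsIncl]
    exact AddSubgroup.map_le_range _ _
  -- The indices satisfy $h_L\,i=h_k\,g$ (`hh`), and the number of adelic classes is $gm$ (`hI`).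
  set g := (P ⊔ C ⊓ normKer L).relIndex (normKer L)
  set i := Q.relIndex (C ⊓ P)
  have hI := index_sup_eq C P (normKer L) hP0
  have hh := relIndex_mul_relIndex_eq C P (normKer L) Q hP0 hQ0
  have hhk : Q.relIndex (C ⊓ normKer L) = classNumber k Fq := by
    rw [hC, range_conorm_inf_normKer Fq, hQ,
      AddSubgroup.relIndex_map_map_of_injective _ _ conorm_injective, ← classNumber_eq_relIndex Fq k]
  rw [hhk, ← classNumber_eq_relIndex Fq L] at hh
  -- The integral rational points are the $z\in L^\times$ with divisor in $C$, modulo $k^\times$.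
  -- Passing to divisors loses the constants of $L$ and of $k$, which gives $n(q_k-1)=(q_L-1)\,i$.
  have hn : Nat.card (boxGroup x ∅ ⊓ rationalH0 x : Subgroup (adelicH0 x)) * (constCard k Fq - 1) =
      (constCard L Fq - 1) * i := by
    rw [d.card_boxGroup_inf_rationalH0, ← Subgroup.relIndex_toAddSubgroup,
      ← card_range_unitsIncl_inf_ker Fq (k := k) (L := L), ← card_ker_divHom Fq L]
    have hR : Subgroup.toAddSubgroup d.glob.ker = (unitsIncl k L).range := by
      rw [d.ker_glob]
      rfl
    have hM : Subgroup.toAddSubgroup ((boxGroup x ∅).comap d.glob) = C.comap (divHom L) := by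
      ext z
      exact d.glob_mem_boxGroup_iff z.toMul
    have hRM : (unitsIncl k L).range ≤ C.comap (divHom L) := by
      rintro _ ⟨f, rfl⟩
      exact ⟨_, (divHom_unitsIncl f).symm⟩
    rw [hR, hM, relIndex_mul_card_inf_ker (divHom L) _ _
      (fun z hz => by
        rw [AddSubgroup.mem_comap, AddMonoidHom.mem_ker.1 hz]; exact zero_mem _) hRM,
      map_range_unitsIncl, AddSubgroup.map_comap_eq, range_divHom, inf_comm P C]
  have hA := d.card_adelic_quotient
  rw [hI] at hA
  have hhk0 := classNumber_ne_zero Fq k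
  have hhL0 := classNumber_ne_zero Fq L
  have hi0 : i ≠ 0 := by
    intro h0
    have h1 := AddSubgroup.relIndex_mul_relIndex Q (C ⊓ P) (C ⊓ normKer L) hQ0 (inf_le_inf_left C hP0)
    rw [hhk, show Q.relIndex (C ⊓ P) = 0 from h0, zero_mul] at h1
    exact hhk0 h1.symm
  have hg0 : g ≠ 0 := by
    intro h0
    rw [show (P ⊔ C ⊓ normKer L).relIndex (normKer L) = 0 from h0, mul_zero] at hh
    exact (mul_ne_zero hhL0 hi0) hh
  have hqk := one_lt_constCard Fq (K := k)
  have hqL := one_lt_constCard Fq (K := L)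
  set n := Nat.card (boxGroup x ∅ ⊓ rationalH0 x : Subgroup (adelicH0 x))
  have hn0 : n ≠ 0 := by
    intro h0
    rw [h0, zero_mul] at hn
    exact (mul_ne_zero (Nat.sub_ne_zero_of_lt hqL) hi0) hn.symm
  have : Finite (boxGroup x ∅ ⊓ rationalH0 x : Subgroup (adelicH0 x)) :=
    Nat.finite_of_card_ne_zero hn0
  have : Finite (adelicH0 x ⧸ (boxGroup x ∅ ⊔ rationalH0 x)) :=
    Nat.finite_of_card_ne_zero (by rw [hA]; exact mul_ne_zero hg0 hidx)
  rw [volume_eq x, hA]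
  -- Dividing $h_Li=h_kg$ by $n(q_k-1)=(q_L-1)i$ eliminates the unknown index $i$ and leaves
  -- $g/n=\mathfrak C_L/\mathfrak C_k$.
  have hreal : (m : ℝ) * (constC L Fq / constC k Fq) = ((g * m : ℕ) : ℝ) / (n : ℝ) := by
    have hh' : (classNumber L Fq : ℝ) * i = classNumber k Fq * g := by exact_mod_cast hh
    have hn' : (n : ℝ) * (constCard k Fq - 1) = (constCard L Fq - 1) * i := by
      have := congr_arg (fun a : ℕ => (a : ℝ)) hn
      simpa [Nat.cast_sub hqk.le, Nat.cast_sub hqL.le] using this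
    have e1 : (constCard k Fq : ℝ) - 1 ≠ 0 := by
      have : (1 : ℝ) < constCard k Fq := by exact_mod_cast hqk
      linarith
    have e2 : (constCard L Fq : ℝ) - 1 ≠ 0 := by
      have : (1 : ℝ) < constCard L Fq := by exact_mod_cast hqL
      linarith
    have e3 : (n : ℝ) ≠ 0 := by exact_mod_cast hn0
    have e4 : (classNumber k Fq : ℝ) ≠ 0 := by exact_mod_cast hhk0
    have e5 : (i : ℝ) ≠ 0 := by exact_mod_cast hi0
    rw [constC, constC, Nat.cast_mul]
    field_simp
    refine mul_right_cancel₀ e5 ?_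
    linear_combination (n : ℝ) * ((constCard k Fq : ℝ) - 1) * hh' + (classNumber k Fq : ℝ) * g * hn'
  rw [hreal, ENNReal.ofReal_div_of_pos (by exact_mod_cast Nat.pos_of_ne_zero hn0),
    ENNReal.ofReal_natCast, ENNReal.ofReal_natCast]

end Extension

/-! ### The quadratic extension attached to the form -/

section Existence

/-- The splitting field of a nonsingular form is generated by a root of the discriminant. -/
theorem nonempty_quadGen {k : Type*} [Field k] (h2 : (2 : k) ≠ 0) {x : V k} (hx : x ∈ V'' k) :
    Nonempty (QuadGen x x.field) := by
  obtain ⟨hd, hfin⟩ := hx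
  obtain ⟨l, l', hl⟩ := exists_factorization x
  have hsq := sq_eq_disc hl
  set δ := l 1 * l' 0 - l 0 * l' 1
  -- A square root of the discriminant in $k$ would split the form by the quadratic formula, or
  -- $x_0=0$ would do so at once, and the splitting field would have degree one.
  have hne : ∀ c : k, algebraMap k x.field c ≠ δ := by
    intro c hc
    rw [← hc, ← map_pow] at hsq
    have hc2 : c ^ 2 = x.disc := (algebraMap k x.field).injective hsq
    have hs : x.poly.Splits := by
      by_cases h0 : x 0 = 0
      · refine Polynomial.Splits.of_natDegree_le_one ?_
        have : x.poly = Polynomial.C (x 1) * Polynomial.X + Polynomial.C (x 2) := by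
          simp [V.poly, h0]
        rw [this]
        exact Polynomial.natDegree_linear_le
      · have : x.poly = Polynomial.C (x 0) * ((Polynomial.X - Polynomial.C ((-x 1 + c) / (2 * x 0))) *
            (Polynomial.X - Polynomial.C ((-x 1 - c) / (2 * x 0)))) := by
          have e1 : x 0 * ((-x 1 + c) / (2 * x 0) + (-x 1 - c) / (2 * x 0)) = -x 1 := by
            field_simp
            ring
          have e2 : x 0 * ((-x 1 + c) / (2 * x 0) * ((-x 1 - c) / (2 * x 0))) = x 2 := by
            rw [V.disc] at hc2
            field_simp
            linear_combination -hc2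
          generalize (-x 1 + c) / (2 * x 0) = r at e1 e2 ⊢
          generalize (-x 1 - c) / (2 * x 0) = s at e1 e2 ⊢
          have e3 : x 1 = -(x 0 * (r + s)) := by rw [e1, neg_neg]
          rw [V.poly, ← e2, e3]
          simp only [map_mul, map_neg, map_add]
          ring
        rw [this]
        exact (Polynomial.Splits.C _).mul ((Polynomial.Splits.X_sub_C _).mul
          (Polynomial.Splits.X_sub_C _))
    have h1 := (Polynomial.IsSplittingField.splits_iff (L := x.field) x.poly).1 hs
    have h3 : Module.finrank k x.field = 1 := by
      rw [← Subalgebra.bot_eq_top_iff_finrank_eq_one, h1]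
    omega
  have hli : LinearIndependent k ![(1 : x.field), δ] := by
    rw [LinearIndependent.pair_iff]
    intro s t hst
    have ht : t = 0 := by
      by_contra ht
      refine hne (-s / t) ?_
      have ht' : algebraMap k x.field t ≠ 0 := (map_ne_zero _).2 ht
      rw [map_div₀, div_eq_iff ht', map_neg]
      rw [Algebra.smul_def, Algebra.smul_def] at hst
      linear_combination -hst
    subst ht
    simpa using hst
  have hspan := hli.span_eq_top_of_card_eq_finrank (by rw [Fintype.card_fin, hfin])
  refine ⟨⟨δ, hsq, hne, fun z => ?_⟩⟩
  have hz : z ∈ Submodule.span k (Set.range ![(1 : x.field), δ]) := by rw [hspan]; trivial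
  rw [Matrix.range_cons, Matrix.range_cons, Matrix.range_empty, Set.union_empty,
    Set.singleton_union, Submodule.mem_span_pair] at hz
  obtain ⟨a, b, h⟩ := hz
  exact ⟨a, b, by rw [← h, Algebra.smul_def, Algebra.smul_def, mul_one]⟩

theorem isFunctionFieldOver_ratFunc (Fq : Type*) [Field Fq] : IsFunctionFieldOver Fq (RatFunc Fq) := by
  refine ⟨RatFunc.X, RatFunc.transcendental_X, ?_⟩
  rw [RatFunc.adjoin_X]
  exact Module.finite_of_finrank_pos (by rw [IntermediateField.finrank_top]; exact one_pos)

end Existence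

end

end BinQuad

theorem mainTheorem10 (Fq k : Type*) [Field Fq] [Finite Fq] [Field k] [Algebra Fq k]
    [Algebra (RatFunc Fq) k] [IsScalarTower Fq (RatFunc Fq) k] [FunctionField Fq k]
    (hconst : algebraicClosure Fq k = ⊥) (hchar : ringChar k ≠ 2)
    (x : BinQuad.V k) (hx : x ∈ BinQuad.V'' k) :
    (algebraicClosure Fq x.field = ⊥ → BinQuad.volume x =
      ENNReal.ofReal (2 * (BinQuad.constC x.field Fq / BinQuad.constC k Fq))) ∧
    (algebraicClosure Fq x.field ≠ ⊥ → BinQuad.volume x =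
      ENNReal.ofReal (BinQuad.constC x.field Fq / BinQuad.constC k Fq)) := by
  have := BinQuad.isFunctionFieldOver_ratFunc Fq
  have : BinQuad.IsFunctionFieldOver Fq k := BinQuad.IsFunctionFieldOver.of_finite Fq (RatFunc Fq) k
  have : BinQuad.IsFunctionFieldOver Fq x.field := BinQuad.IsFunctionFieldOver.of_finite Fq k x.field
  have := BinQuad.IsFunctionFieldOver.globalPlaces Fq k
  have := BinQuad.IsFunctionFieldOver.globalPlaces Fq x.field
  have := BinQuad.IsFunctionFieldOver.countable Fq k
  have := BinQuad.countable_place Fq k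
  have h2 : (2 : k) ≠ 0 := Ring.two_ne_zero hchar
  have : BinQuad.GoodForm x := ⟨fun v => v.val_two Fq h2, hx.1⟩
  obtain ⟨d⟩ := BinQuad.nonempty_quadGen h2 hx
  obtain ⟨hi, hi'⟩ := BinQuad.index_degree_range (L := x.field) Fq hconst hx.2
  constructor
  · intro h
    rw [BinQuad.volume_eq_index_mul Fq d (by rw [hi h]; exact two_ne_zero), hi h, Nat.cast_ofNat]
  · intro h
    rw [BinQuad.volume_eq_index_mul Fq d (by rw [hi' h]; exact one_ne_zero), hi' h, Nat.cast_one,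
      one_mul]
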